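/- Let $\mathbb G$ be a compact (Hausdorff) group and $\mathbb U$ a real or complex Banach Lie group with Lie algebra $\mathfrak u$ and adjoint representation $\mathrm{Ad}:\mathbb U\to GL(\mathfrak u)$. Let $B\subset GL(\mathfrak u)$ be open and bounded in the operator norm. For a map $\rho:\mathbb G\to\mathbb U$ put $\delta\rho(s,t):=\rho(s)\rho(t)\rho(st)^{-1}$. Give $C(\mathbb G,\mathbb U)$ and $C(\mathbb G^2,\mathbb U)$ the topology of uniform convergence; recall that $C(\mathbb G,\mathbb U)$ is a Banach Lie group modelled on $C(\mathbb G,\mathfrak u)$. For a set $W$ of maps $\mathbb G^2\to\mathbb U$ let $(\delta^{-1}W)_{\mathrm{Ad}\subset B}$ be the set of $\rho$ with $\delta\rho\in W$ and $\mathrm{Ad}(\rho(s))\in B$ for all $s\in\mathbb G$. (1) For every neighborhood $V$ of $1$ in $C(\mathbb G,\mathbb U)$ there are a neighborhood $W$ of $1$ in $C(\mathbb G^2,\mathbb U)$ and a map $\rho\mapsto\rho'$ from $(\delta^{-1}W)_{\mathrm{Ad}\subset B}\subset C(\mathbb G,\mathbb U)$ to the set of continuous group morphisms $\mathbb G\to\mathbb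 U$ such that $\rho'\cdot\rho^{-1}\in V$ for all $\rho$, and such that $\rho\mapsto\rho'$ is analytic (as a map to $C(\mathbb G,\mathbb U)$) and uniformly continuous, both for the uniformity of uniform convergence attached to the right uniformity of $\mathbb U$ and for the one attached to its left uniformity. (2) Suppose that $\mathbb G$ is a Lie group and let $1\le r\le\omega$ ($r$ a positive integer, $\infty$ or $\omega$, where $C^\omega$ means real analytic). Give $C^r(\mathbb G,\mathbb U)$ and $C^r(\mathbb G^2,\mathbb U)$ the $C^r$ topology, i.e. the topology of uniform convergence of the maps and of all their derivatives of finite order $\le r$; the corresponding uniformity is that of uniform convergence of the maps (for the right, or for the left, uniformity of $\mathbb U$) and of the derivatives of order $<r$ (of any finite order if $r\in\{\infty,\omega\}$), along left-invariant vector fields, of their left logarithmic derivatives $\rho^{-1}d\rho$. Then for every neighborhood $V$ of $1$ in $C^r(\mathbb G,\mathbb U)$ there are a neighborhood $W$ of $1$ in $C^r(\mathbb G^2,\mathbb U)$ and a map $\rho\mapsto\rho'$ from $(\delta^{-1}W)_{\mathrm{Ad}\subset B}\subset C^r(\mathbb G,\mathbb U)$ to the set of $C^r$ group morphisms $\mathbb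 G\to\mathbb U$ such that $\rho'\cdot\rho^{-1}\in V$ for all $\rho$, and such that $\rho\mapsto\rho'$ is analytic (for the Lie group structure of $C^r(\mathbb G,\mathbb U)$ modelled on $C^r(\mathbb G,\mathfrak u)$) and uniformly continuous for both of these uniformities. Here a map between locally convex spaces is called analytic if it is continuous and, near each point, the sum of a series of continuous homogeneous polynomials. -/

import Mathlib

open scoped Manifold ContDiff Topology
open Filter

noncomputable section

namespace AlmostMorphism

/-! ### Banach Lie groups

`𝕜` is `ℝ` or `ℂ`, and `U` is an analytic Lie group over `𝕜` modelled on the Banach space `E`. The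
Lie algebra (tangent space at `1`) is identified with `E` through the preferred chart at `1`, as
everywhere in Mathlib. When `U` is complex it is regarded as a real Lie group as far as `C^r` maps
from a (real) compact Lie group to it are concerned. -/

section Lie

variable (𝕜 : Type*) [RCLike 𝕜] {E : Type*} [NormedAddCommGroup E] [NormedSpace 𝕜 E]
  {U : Type*} [Group U] [TopologicalSpace U] [ChartedSpace E U]

/-- The adjoint representation: `Ad u` is the derivative at `1` of conjugation by `u`. -/
def Ad (u : U) : E →L[𝕜] E :=
  mfderiv 𝓘(𝕜, E) 𝓘(𝕜, E) (fun x : U => u * x * u⁻¹) 1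

/-- A manifold over `𝕜` is a real manifold. -/
theorem isManifold_real [NormedSpace ℝ E] [IsScalarTower ℝ 𝕜 E] {M : Type*} [TopologicalSpace M]
    [ChartedSpace E M] {n : WithTop ℕ∞} [h : IsManifold 𝓘(𝕜, E) n M] : IsManifold 𝓘(ℝ, E) n M := by
  apply isManifold_of_contDiffOn
  intro e e' he he'
  have h1 := h.compatible he he'
  rw [contDiffGroupoid, mem_groupoid_of_pregroupoid] at h1
  exact ContDiffOn.restrict_scalars ℝ h1.1

/-- A Lie group over `𝕜` is a real Lie group. -/
theorem lieGroup_real [NormedSpace ℝ E] [IsScalarTower ℝ 𝕜 E] {n : WithTop ℕ∞}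
    [h : LieGroup 𝓘(𝕜, E) n U] : LieGroup 𝓘(ℝ, E) n U := by
  have := isManifold_real 𝕜 (E := E) (M := U) (n := n)
  refine { contMDiff_mul := fun x => ?_, contMDiff_inv := fun x => ?_ }
  · have h1 := h.contMDiff_mul x
    exact ⟨h1.1, ContDiffWithinAt.restrict_scalars ℝ h1.2⟩
  · have h1 := h.contMDiff_inv x
    exact ⟨h1.1, ContDiffWithinAt.restrict_scalars ℝ h1.2⟩

end Lie

/-! ### The continuous setting -/

/-- The uniformity of uniform convergence on `X → Y`, for a given uniformity on `Y`. -/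
@[reducible]
def unifConv (X : Type*) {Y : Type*} (𝒰 : UniformSpace Y) : UniformSpace (X → Y) :=
  (UniformFun.uniformSpace X Y).comap UniformFun.ofFun

section Continuous

variable {G : Type*} [Group G] [TopologicalSpace G] [IsTopologicalGroup G]
  {U : Type*} [Group U] [TopologicalSpace U] [IsTopologicalGroup U]

/-- The coboundary `(s, t) ↦ ρ(s) ρ(t) ρ(st)⁻¹` of a continuous map `ρ`. -/
def coboundary (ρ : C(G, U)) : C(G × G, U) where
  toFun p := ρ p.1 * ρ p.2 * (ρ (p.1 * p.2))⁻¹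
  continuous_toFun := by fun_prop

variable (𝕜 : Type*) [RCLike 𝕜] {E : Type*} [NormedAddCommGroup E] [NormedSpace 𝕜 E]
  [ChartedSpace E U]

/-- The continuous almost-morphisms `G → U`: the maps whose coboundary lies in `W`, and which take
values in `B` after composition with `Ad`. -/
def almostMorphisms (B : Set (E →L[𝕜] E)) (W : Set C(G × G, U)) : Set C(G, U) :=
  {ρ | coboundary ρ ∈ W ∧ ∀ g, Ad 𝕜 (ρ g) ∈ B}

/-- `ξ : X → E` is the expression of `ρ : X → U` in the right translate by `ρ₀` of the chart of a
group of maps `X → U` at the constant map `1`, that is: `ρ ρ₀⁻¹` takes values in the domain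
of the chart of `U` at `1`, and its expression in this chart is `ξ`. -/
def IsCoord {X : Type*} (ρ₀ ρ : X → U) (ξ : X → E) : Prop :=
  ∀ x, ρ x * (ρ₀ x)⁻¹ ∈ (chartAt E (1 : U)).source ∧ chartAt E (1 : U) (ρ x * (ρ₀ x)⁻¹) = ξ x

/-- Analyticity, for the Banach Lie group structure on `C(G, U)` (modelled on `C(G, E)`), of a map
from a set `D` of continuous maps to the set of continuous morphisms. -/
def IsAnalytic [CompactSpace G] {D : Set C(G, U)} (F : D → (G →ₜ* U)) : Prop :=
  ∀ ρ₀ : D, ∃ f : C(G, E) → C(G, E),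
    AnalyticAt 𝕜 f (ContinuousMap.const G (chartAt E (1 : U) 1)) ∧
    ∀ᶠ ξ : C(G, E) in 𝓝 (ContinuousMap.const G (chartAt E (1 : U) 1)), ∀ ρ : D,
      IsCoord ρ₀.1 ρ.1 ξ → IsCoord (F ρ₀) (F ρ) (f ξ)

end Continuous

/-! ### The `C^r` setting -/

section Cr

variable {EG : Type*} [NormedAddCommGroup EG] [NormedSpace ℝ EG] {H : Type*} [TopologicalSpace H]
  (I : ModelWithCorners ℝ EG H) {G : Type*} [Group G] [TopologicalSpace G] [ChartedSpace H G]
  {E : Type*} [NormedAddCommGroup E] [NormedSpace ℝ E]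
  {U : Type*} [Group U] [TopologicalSpace U] [ChartedSpace E U]

/-- The derivative of `f : G → E` along the left-invariant vector field on `G` given by the tangent
vector `X` at `1`. -/
def invDeriv (X : EG) (f : G → E) (g : G) : E :=
  mfderiv I 𝓘(ℝ, E) (fun h : G => f (g * h)) 1 X

/-- Iterated derivatives of `f : G → E` along left-invariant vector fields. -/
def invDerivs (L : List EG) (f : G → E) : G → E :=
  L.foldr (invDeriv I) f

/-- The derivative of `f : G → U` along the left-invariant vector field on `G` given by `X`, moved
to the tangent space of `U` at `1` by a left translation (the left logarithmic derivative). -/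
def logDeriv (X : EG) (f : G → U) (g : G) : E :=
  mfderiv I 𝓘(ℝ, E) (fun h : G => (f g)⁻¹ * f (g * h)) 1 X

variable (r : WithTop ℕ∞)

/-- The `C^r` uniformity on `C^r(G, U)`: uniform convergence of the maps (for the given
uniformity on `U`) and of all their derivatives up to order `r`, where the tangent bundles are
trivialized by left translations. -/
@[reducible]
def crUniformSpace (𝒰 : UniformSpace U) : UniformSpace C^r⟮I, G; 𝓘(ℝ, E), U⟯ :=
  (unifConv G 𝒰).comap (fun f => ⇑f) ⊓
    ⨅ (X : EG) (L : List EG) (_ : ((L.length + 1 : ℕ) : WithTop ℕ∞) ≤ r),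
      (unifConv G (inferInstance : UniformSpace E)).comap
        (fun f : C^r⟮I, G; 𝓘(ℝ, E), U⟯ => invDerivs I L (logDeriv I X f))

/-- The `C^r` topology on `C^r(G, U)`. -/
instance crTopology [IsTopologicalGroup U] : TopologicalSpace C^r⟮I, G; 𝓘(ℝ, E), U⟯ :=
  (crUniformSpace I r (IsTopologicalGroup.rightUniformSpace U)).toTopologicalSpace

variable (𝕜 : Type*) [RCLike 𝕜] [NormedSpace 𝕜 E] [IsScalarTower ℝ 𝕜 E]

/-- The quotient `x ↦ f(x) g(x)⁻¹` of two `C^r` maps. -/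
def crDiv [LieGroup 𝓘(𝕜, E) ω U] (f g : C^r⟮I, G; 𝓘(ℝ, E), U⟯) : C^r⟮I, G; 𝓘(ℝ, E), U⟯ :=
  haveI : LieGroup 𝓘(ℝ, E) r U := lieGroup_real 𝕜
  ⟨fun x => f x * (g x)⁻¹, f.contMDiff.mul g.contMDiff.inv⟩

/-- The coboundary `(s, t) ↦ ρ(s) ρ(t) ρ(st)⁻¹` of a `C^r` map `ρ`. -/
def crCoboundary [LieGroup I ω G] [LieGroup 𝓘(𝕜, E) ω U] (ρ : C^r⟮I, G; 𝓘(ℝ, E), U⟯) :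
    C^r⟮I.prod I, G × G; 𝓘(ℝ, E), U⟯ :=
  haveI : LieGroup 𝓘(ℝ, E) r U := lieGroup_real 𝕜
  ⟨fun p => ρ p.1 * ρ p.2 * (ρ (p.1 * p.2))⁻¹,
    ((ρ.contMDiff.comp contMDiff_fst).mul (ρ.contMDiff.comp contMDiff_snd)).mul
      (ρ.contMDiff.comp (contMDiff_mul I r)).inv⟩

/-- The `C^r` almost-morphisms `G → U`: the maps whose coboundary lies in `W`, and which take
values in `B` after composition with `Ad`. -/
def crAlmostMorphisms [LieGroup I ω G] [LieGroup 𝓘(𝕜, E) ω U] (B : Set (E →L[𝕜] E))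
    (W : Set C^r⟮I.prod I, G × G; 𝓘(ℝ, E), U⟯) : Set C^r⟮I, G; 𝓘(ℝ, E), U⟯ :=
  {ρ | crCoboundary I r 𝕜 ρ ∈ W ∧ ∀ g, Ad 𝕜 (ρ g) ∈ B}

/-- The `C^r` maps `G → U` that are group morphisms. -/
def crMorphisms : Set C^r⟮I, G; 𝓘(ℝ, E), U⟯ :=
  {π | ∀ s t, π (s * t) = π s * π t}

variable (G E) in
/-- The `C^r` maps `G → E`, as a subspace of the `𝕜`-vector space of all maps. -/
def crSubmodule : Submodule 𝕜 (G → E) where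
  carrier := {f | ContMDiff I 𝓘(ℝ, E) r f}
  add_mem' hf hg := ContMDiff.add hf hg
  zero_mem' := contMDiff_const
  smul_mem' c _ hf :=
    ((c • ContinuousLinearMap.id ℝ E : E →L[ℝ] E).contMDiff (n := r)).comp hf

variable (G E) in
/-- The vector space `C^r(G, E)`, which carries its own topology. -/
def CrVec : Type _ := crSubmodule I G E r 𝕜

instance : AddCommGroup (CrVec I G E r 𝕜) := inferInstanceAs (AddCommGroup (crSubmodule I G E r 𝕜))

instance : Module 𝕜 (CrVec I G E r 𝕜) := inferInstanceAs (Module 𝕜 (crSubmodule I G E r 𝕜))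

instance : CoeFun (CrVec I G E r 𝕜) (fun _ => G → E) := ⟨fun f => f.1⟩

/-- The `C^r` topology on `C^r(G, E)`: uniform convergence of all derivatives up to order `r`. -/
instance : TopologicalSpace (CrVec I G E r 𝕜) :=
  (⨅ (L : List EG) (_ : ((L.length : ℕ) : WithTop ℕ∞) ≤ r),
    (unifConv G (inferInstance : UniformSpace E)).comap
      (fun f : CrVec I G E r 𝕜 => invDerivs I L f)).toTopologicalSpace

variable (G) in
/-- A constant map, as an element of `C^r(G, E)`. -/
def crConst (e : E) : CrVec I G E r 𝕜 := ⟨fun _ => e, contMDiff_const⟩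

/-- Analyticity at a point of a map between topological vector spaces, not necessarily normable:
the map is continuous near the point, and it is there the sum of a series of continuous homogeneous
polynomials in the increment. -/
def AnalyticNear {X Y : Type*} [AddCommGroup X] [Module 𝕜 X] [TopologicalSpace X]
    [AddCommGroup Y] [Module 𝕜 Y] [TopologicalSpace Y] (f : X → Y) (x : X) : Prop :=
  (∀ᶠ y in 𝓝 x, ContinuousAt f y) ∧
    ∃ p : (k : ℕ) → ContinuousMultilinearMap 𝕜 (fun _ : Fin k => X) Y,
      ∀ᶠ h in 𝓝 (0 : X), HasSum (fun k => p k fun _ => h) (f (x + h))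

/-- Analyticity, for the Lie group structure on `C^r(G, U)` (modelled on `C^r(G, E)`), of a
map from a set `D` of `C^r` maps to the set of `C^r` morphisms. -/
def CrIsAnalytic {D : Set C^r⟮I, G; 𝓘(ℝ, E), U⟯}
    (F : D → (crMorphisms I r : Set C^r⟮I, G; 𝓘(ℝ, E), U⟯)) : Prop :=
  ∀ ρ₀ : D, ∃ f : CrVec I G E r 𝕜 → CrVec I G E r 𝕜,
    AnalyticNear 𝕜 f (crConst I G r 𝕜 (chartAt E (1 : U) 1)) ∧
    ∀ᶠ ξ : CrVec I G E r 𝕜 in 𝓝 (crConst I G r 𝕜 (chartAt E (1 : U) 1)), ∀ ρ : D,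
      IsCoord ρ₀.1 ρ.1 ξ → IsCoord (F ρ₀).1 (F ρ).1 (f ξ)

end Cr

end AlmostMorphism

end

open AlmostMorphism

/-! Let `ρ` be an almost morphism and look for a correction `σ(t) = ρ(t) exp β(t)` with `β` small in
`C(G, E)`. The defect `d(s, t) = log(σ(st)⁻¹ σ(s) σ(t))` is, to first order, `-β(st) + γ(s, t) +
Ad(ρ(t)⁻¹) β(s) + β(t)`, where `γ(s, t) = log(ρ(st)⁻¹ ρ(s) ρ(t))`. Average over `s` with Haar
measure and let `m` be the mean of `β`: besides `β(t)` there remain the terms `Ad(ρ(t)⁻¹) m - m`,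
which are not small compared with `β`. So the average of `d` is not required to vanish, but to equal
`Ad(σ(t)⁻¹) m - m`. The linear terms in `β` then cancel, and `β` is a fixed point of `gaugeMap`,
which is analytic and contracts by `1/4` (`exists_gaugeMap_bounds`). One application of the fixed
point theorem gives `β` as an analytic and Lipschitz function of the data `(γ, Ad ρ⁻¹)`
(`exists_correction`). A bound on `Ad ρ⁻¹` is all that the size of the domain depends on, and it
follows from the boundedness of `B` (`exists_isAlmost`).

The corrected map is exactly multiplicative (`exists_defect_eq_zero`): `d` satisfies a nonabelian
cocycle identity; averaging it in one variable, where all means of `d` are coboundaries of `m`,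
gives `‖d‖ ≤ ‖d‖ / 2`, hence `d = 0`. The gauge equation then says that `m` is fixed by `Ad` of the
morphism.

Analyticity and uniform continuity in the continuous setting follow by expressing the data of
`exp(h) ρ₀` through `h` (`toData_eq_shift`) and comparing the two morphisms (`exp_compareQuad`). The
left uniformity is reduced to the right one, since conjugation by elements with bounded `Ad` is
equicontinuous at `1` (`exists_conj_mem`).

In the `C^r` setting the same morphism `π` is used; it is analytic because it is continuous
(`contMDiff_morphism`). Three separate ideas give the estimates. Closeness: `α = log(π ρ⁻¹)`
satisfies an identity (`mean_superpose_gaugeQuad`) that determines `α(y)` analytically from the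
logarithm of the coboundary at the points `(x, x⁻¹y)`, from `α` as a fixed element of `C(G, E)`, and
from `m`. Differentiation in `y` touches only the first of these, so the derivatives of `π ρ⁻¹` are
controlled by those of the coboundary (`Corrector.exists_logDeriv_quotient`,
`Corrector.exists_tendsto_crDiv`). Uniform continuity: the logarithmic derivatives of a morphism are
constant, so only its tangent map matters (`Corrector.exists_logDeriv_close`). Analyticity: nearby
morphisms are conjugate by some `exp y`, with `y` analytic in their sup-norm distance
(`exists_conjugator`), so that `π π₀⁻¹ = exp(y) exp(-Ad(π₀) y)` lies in the image of a Banach space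
of weighted jets (`AnalyticAction.exists_jet_series`).

The exponential coordinates that all this rests on (`LogChart.nonempty`) are constructed from the
chart at `1`, by solving the integral equation of the left-invariant fields with the same analytic
fixed point theorem. -/

noncomputable section

namespace AlmostMorphism

set_option linter.unusedSectionVars false

/-! ### Analytic fixed points and superposition operators. -/

section FixedPoint

variable {𝕜 : Type*} [RCLike 𝕜] {X P : Type*} [NormedAddCommGroup X] [NormedSpace 𝕜 X]
  [CompleteSpace X] [NormedAddCommGroup P] [NormedSpace 𝕜 P] [CompleteSpace P]

/-- An analytic family of maps, contracting to first order at a fixed point, has a locally unique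
fixed point depending analytically on the parameter. -/
theorem exists_analyticAt_fixedPoint {Φ : P × X → X} {p₀ : P} {x₀ : X}
    (hΦ : AnalyticAt 𝕜 Φ (p₀, x₀)) (hfix : Φ (p₀, x₀) = x₀)
    (hlt : ‖fderiv 𝕜 Φ (p₀, x₀) ∘L ContinuousLinearMap.inr 𝕜 P X‖ < 1) :
    ∃ ψ : P → X, AnalyticAt 𝕜 ψ p₀ ∧ ψ p₀ = x₀ ∧ (∀ᶠ p in 𝓝 p₀, Φ (p, ψ p) = ψ p) ∧
      ∀ᶠ v in 𝓝 (p₀, x₀), Φ v = v.2 → ψ v.1 = v.2 := by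
  have hf : AnalyticAt 𝕜 (fun v : P × X => v.2 - Φ v) (p₀, x₀) := analyticAt_snd.sub hΦ
  have hcd : ContDiffAt 𝕜 ω (fun v : P × X => v.2 - Φ v) (p₀, x₀) := hf.contDiffAt
  have hd : fderiv 𝕜 (fun v : P × X => v.2 - Φ v) (p₀, x₀) ∘L ContinuousLinearMap.inr 𝕜 P X
      = 1 - fderiv 𝕜 Φ (p₀, x₀) ∘L ContinuousLinearMap.inr 𝕜 P X := by
    have h2 : HasFDerivAt (fun v : P × X => v.2 - Φ v)
        (ContinuousLinearMap.snd 𝕜 P X - fderiv 𝕜 Φ (p₀, x₀)) (p₀, x₀) :=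
      hasFDerivAt_snd.sub hΦ.differentiableAt.hasFDerivAt
    rw [h2.fderiv]
    ext x
    simp
  -- The partial derivative of `v.2 - Φ v` is `1` minus an operator of norm `< 1`, invertible by the
  -- Neumann series, so the implicit function theorem applies.
  have hinv : (fderiv 𝕜 (fun v : P × X => v.2 - Φ v) (p₀, x₀) ∘L
      ContinuousLinearMap.inr 𝕜 P X).IsInvertible := by
    rw [hd]
    have hu := isUnit_one_sub_of_norm_lt_one hlt
    exact ⟨ContinuousLinearEquiv.ofUnit hu.unit, by ext; rfl⟩
  have hz : (fun v : P × X => v.2 - Φ v) (p₀, x₀) = 0 := by simp [hfix]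
  refine ⟨hcd.implicitFunction (by simp) hinv,
    (hcd.contDiffAt_implicitFunction (by simp) hinv).analyticAt,
    hcd.implicitFunction_apply_self (by simp) hinv, ?_, ?_⟩
  · filter_upwards [hcd.eventually_apply_implicitFunction (by simp) hinv] with p hp
    exact (sub_eq_zero.1 (hp.trans hz)).symm
  · filter_upwards [hcd.eventually_apply_eq_iff_implicitFunction (by simp) hinv] with v hv hv2
    exact hv.1 (Eq.trans (by simp [hv2]) hz.symm)

end FixedPoint

section Superposition

variable {𝕜 : Type*} [RCLike 𝕜] {E F : Type*} [NormedAddCommGroup E] [NormedSpace 𝕜 E]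
  [NormedAddCommGroup F] [NormedSpace 𝕜 F] {K : Type*} [TopologicalSpace K] [CompactSpace K]

open Classical in
/-- Composition of a continuous map on `K` with `f`, when the result is continuous. -/
def superpose (f : E → F) (u : C(K, E)) : C(K, F) :=
  if h : Continuous (fun k => f (u k)) then ⟨fun k => f (u k), h⟩ else 0

/-- Agreement with a continuous `g` already supplies the continuity required by the definition, so
that values can be computed without checking it. -/
theorem superpose_eq {f : E → F} {u : C(K, E)} {g : C(K, F)} (h : ∀ k, f (u k) = g k) :
    superpose f u = g := by
  have h' : (fun k => f (u k)) = g := funext h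
  have hc : Continuous (fun k => f (u k)) := h' ▸ g.continuous
  rw [superpose, dif_pos hc]
  ext k
  exact h k

theorem superpose_apply {f : E → F} {u : C(K, E)} (h : Continuous (fun k => f (u k))) (k : K) :
    superpose f u k = f (u k) := by
  rw [superpose, dif_pos h]
  rfl

variable (K) in
/-- A continuous multilinear map acts pointwise on continuous maps. -/
def pointwiseMultilinear {n : ℕ} (p : ContinuousMultilinearMap 𝕜 (fun _ : Fin n => E) F) :
    ContinuousMultilinearMap 𝕜 (fun _ : Fin n => C(K, E)) C(K, F) :=
  MultilinearMap.mkContinuous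
    { toFun := fun h => ⟨fun k => p fun i => h i k, by fun_prop⟩
      map_update_add' := by
        intro _ h i x y
        ext k
        have e : ∀ z : C(K, E), (fun j => Function.update h i z j k) =
            Function.update (fun j => h j k) i (z k) := by
          intro z
          ext j
          by_cases hj : j = i
          · subst hj; simp
          · simp [hj]
        simp [e]
      map_update_smul' := by
        intro _ h i c x
        ext k
        have e : ∀ z : C(K, E), (fun j => Function.update h i z j k) =
            Function.update (fun j => h j k) i (z k) := by
          intro z
          ext j
          by_cases hj : j = i
          · subst hj; simp
          · simp [hj]
        simp [e] } ‖p‖ (by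
    intro h
    rw [ContinuousMap.norm_le _ (by positivity)]
    intro k
    refine (p.le_opNorm _).trans ?_
    gcongr with i
    exact (h i).norm_coe_le_norm k)

theorem norm_pointwiseMultilinear_le {n : ℕ}
    (p : ContinuousMultilinearMap 𝕜 (fun _ : Fin n => E) F) : ‖pointwiseMultilinear K p‖ ≤ ‖p‖ :=
  MultilinearMap.mkContinuous_norm_le _ (by positivity) _

/-- The pointwise coefficients have norms at most `‖p n‖`, so the radius does not shrink and the
series converges absolutely in `C(K, F)`; evaluation at each `k` identifies its sum with the
original series at `y k`. Expansion around a constant map is enough for later use, since an analytic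
map is analytic in the whole ball. -/
theorem HasFPowerSeriesOnBall.superpose [CompleteSpace F] {f : E → F}
    {p : FormalMultilinearSeries 𝕜 E F} {x : E} {r : ENNReal} (h : HasFPowerSeriesOnBall f p x r) :
    HasFPowerSeriesOnBall (superpose (K := K) f) (fun n => pointwiseMultilinear K (p n))
      (ContinuousMap.const K x) r where
  r_le := by
    refine h.r_le.trans ?_
    refine FormalMultilinearSeries.radius_le_of_le (fun n => ?_)
    exact norm_pointwiseMultilinear_le _
  r_pos := h.r_pos
  hasSum := by
    intro y hy
    have hy' : ENNReal.ofReal ‖y‖ < p.radius := by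
      refine lt_of_lt_of_le ?_ h.r_le
      simpa [Metric.mem_eball, edist_zero_right] using hy
    have hs : Summable fun n => ‖p n‖ * ‖y‖ ^ n := by
      have := p.summable_norm_mul_pow (r := ‖y‖₊) (by simpa [enorm_eq_nnnorm] using hy')
      simpa using this
    have hs2 : Summable fun n => pointwiseMultilinear K (p n) fun _ => y := by
      refine Summable.of_norm_bounded hs (fun n => ?_)
      refine (ContinuousMultilinearMap.le_opNorm _ _).trans ?_
      simp only [Finset.prod_const, Finset.card_univ, Fintype.card_fin]
      gcongr
      exact norm_pointwiseMultilinear_le _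
    have key := hs2.hasSum
    rw [superpose_eq (g := ∑' n, pointwiseMultilinear K (p n) fun _ => y)]
    · exact key
    · intro k
      have h1 : HasSum (fun n => p n fun _ => y k)
          ((∑' n, pointwiseMultilinear K (p n) fun _ => y) k) :=
        key.mapL (ContinuousMap.evalCLM 𝕜 k)
      have h2 : HasSum (fun n => p n fun _ => y k) (f (x + y k)) := by
        refine h.hasSum ?_
        have h3 : ‖y k‖ₑ ≤ ‖y‖ₑ := by
          rw [enorm_le_iff_norm_le]
          exact y.norm_coe_le_norm k
        have h4 : ‖y‖ₑ < r := by simpa using hy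
        simpa using h3.trans_lt h4
      exact h2.unique h1

/-- The superposition operator of a map analytic at `x` is analytic at all continuous maps with
values in a fixed ball around `x`. -/
theorem exists_superpose_analyticAt [CompleteSpace F] {f : E → F} {x : E}
    (hf : AnalyticAt 𝕜 f x) :
    ∃ r > 0, ContinuousOn f (Metric.ball x r) ∧
      ∀ u : C(K, E), (∀ k, ‖u k - x‖ < r) → AnalyticAt 𝕜 (superpose f) u ∧
        ∀ k, superpose f u k = f (u k) := by
  obtain ⟨p, R, hp⟩ := hf
  obtain ⟨r, hr0, hr⟩ := ENNReal.lt_iff_exists_nnreal_btwn.1 hp.r_pos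
  have hr0' : (0 : ℝ) < r := by exact_mod_cast hr0
  have hcont : ContinuousOn f (Metric.ball x r) := by
    refine hp.continuousOn.mono ?_
    intro y hy
    rw [Metric.mem_ball, dist_eq_norm] at hy
    rw [Metric.mem_eball, edist_eq_enorm_sub]
    refine lt_trans ?_ hr
    rw [← ofReal_norm]
    rw [ENNReal.ofReal_lt_coe_iff (by positivity)]
    exact hy
  refine ⟨r, hr0', hcont, fun u hu => ⟨?_, ?_⟩⟩
  · refine (HasFPowerSeriesOnBall.superpose (K := K) hp).analyticAt_of_mem ?_
    rw [Metric.mem_eball, edist_eq_enorm_sub]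
    refine lt_trans ?_ hr
    rw [← ofReal_norm, ENNReal.ofReal_lt_coe_iff (by positivity)]
    rw [ContinuousMap.norm_lt_iff _ hr0']
    exact fun k => hu k
  · refine superpose_apply ?_
    refine hcont.comp_continuous u.continuous fun k => ?_
    rw [Metric.mem_ball, dist_eq_norm]
    exact hu k

end Superposition

end AlmostMorphism

end

/-! ### Haar averaging of vector-valued continuous maps. -/

noncomputable section

namespace AlmostMorphism

set_option linter.unusedSectionVars false

section Mean

/-- An invariant mean for continuous vector-valued maps on a group. -/
structure InvariantMean (𝕜 G E : Type*) [RCLike 𝕜] [NormedAddCommGroup E] [NormedSpace 𝕜 E]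
    [Group G] [TopologicalSpace G] [IsTopologicalGroup G] [CompactSpace G] where
  /-- The mean as a continuous linear map. -/
  mean : C(G, E) →L[𝕜] E
  norm_le : ∀ f, ‖mean f‖ ≤ ‖f‖
  const : ∀ e, mean (ContinuousMap.const G e) = e
  congr_mul_right : ∀ (f g : C(G, E)) (t : G), (∀ s, g s = f (s * t)) → mean g = mean f
  congr_inv : ∀ f g : C(G, E), (∀ s, g s = f s⁻¹) → mean g = mean f
  comp_clm : ∀ (T : E →L[𝕜] E) (f g : C(G, E)), (∀ s, g s = T (f s)) → mean g = T (mean f)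

-- The mean is integration against the normalized Haar measure. Its images under right translations
-- and under inversion are again Haar probability measures; uniqueness of these makes it
-- bi-invariant and inversion-invariant.
open MeasureTheory in
theorem InvariantMean.nonempty (𝕜 G E : Type*) [RCLike 𝕜] [NormedAddCommGroup E]
    [NormedSpace 𝕜 E] [NormedSpace ℝ E] [IsScalarTower ℝ 𝕜 E] [CompleteSpace E] [Group G]
    [TopologicalSpace G] [IsTopologicalGroup G] [CompactSpace G] :
    Nonempty (InvariantMean 𝕜 G E) := by
  let _ : MeasurableSpace G := borel G
  have : BorelSpace G := ⟨rfl⟩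
  let μ : Measure G := Measure.haarMeasure ⊤
  have hp : IsProbabilityMeasure μ := ⟨by
    have := Measure.haarMeasure_self (K₀ := (⊤ : TopologicalSpace.PositiveCompacts G))
    simpa using this⟩
  have hr : ∀ g : G, Measure.map (· * g) μ = μ := fun g => by
    have : IsProbabilityMeasure (Measure.map (· * g) μ) :=
      Measure.isProbabilityMeasure_map (by fun_prop)
    have := Measure.isHaarMeasure_map_mul_right μ g
    exact Measure.isHaarMeasure_eq_of_isProbabilityMeasure _ _
  have : μ.IsMulRightInvariant := ⟨hr⟩
  have : μ.inv.IsHaarMeasure :=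
    Measure.isHaarMeasure_of_isCompact_nonempty_interior μ.inv Set.univ isCompact_univ
      (by simp) (by simp [Measure.inv_apply]) (by simp [Measure.inv_apply])
  have : IsProbabilityMeasure μ.inv := Measure.isProbabilityMeasure_map (by fun_prop)
  have : μ.IsInvInvariant := ⟨Measure.isHaarMeasure_eq_of_isProbabilityMeasure _ _⟩
  have hint : ∀ f : C(G, E), Integrable f μ := fun f =>
    f.continuous.integrable_of_hasCompactSupport
      (HasCompactSupport.of_compactSpace _)
  have hbd : ∀ f : C(G, E), ‖∫ s, f s ∂μ‖ ≤ ‖f‖ := fun f => by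
    refine (norm_integral_le_of_norm_le_const (C := ‖f‖)
      (Eventually.of_forall f.norm_coe_le_norm)).trans ?_
    simp
  refine ⟨⟨LinearMap.mkContinuous
    { toFun := fun f => ∫ s, f s ∂μ
      map_add' := fun f g => integral_add (hint f) (hint g)
      map_smul' := fun c f => by simp [integral_smul] } 1
      (fun f => by simpa using hbd f), fun f => hbd f, fun e => ?_, fun f g t h => ?_,
      fun f g h => ?_, fun T f g h => ?_⟩⟩
  · simp [LinearMap.mkContinuous]
  · change ∫ s, g s ∂μ = ∫ s, f s ∂μ
    simp_rw [h]
    exact integral_mul_right_eq_self (fun s => f s) t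
  · change ∫ s, g s ∂μ = ∫ s, f s ∂μ
    simp_rw [h]
    exact integral_inv_eq_self (fun s => f s) μ
  · change ∫ s, g s ∂μ = T (∫ s, f s ∂μ)
    simp_rw [h]
    exact T.integral_comp_comm (hint f)

variable {𝕜 G E : Type*} [RCLike 𝕜] [NormedAddCommGroup E] [NormedSpace 𝕜 E]
  [Group G] [TopologicalSpace G] [IsTopologicalGroup G] [CompactSpace G]

namespace InvariantMean

variable (M : InvariantMean 𝕜 G E)

theorem norm_le_of_forall {f : C(G, E)} {C : ℝ} (hC : 0 ≤ C) (h : ∀ s, ‖f s‖ ≤ C) :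
    ‖M.mean f‖ ≤ C :=
  (M.norm_le f).trans ((ContinuousMap.norm_le _ hC).2 h)

theorem congr_inv_mul (f g : C(G, E)) (y : G) (h : ∀ s, g s = f (s⁻¹ * y)) :
    M.mean g = M.mean f := by
  have h1 := M.congr_mul_right f (f.comp ⟨fun s => s * y, by fun_prop⟩) y (fun s => rfl)
  rw [← h1]
  exact M.congr_inv _ _ (fun s => by simp [h])

/-- The section `s ↦ f (s, t)`. -/
def sectionFst (f : C(G × G, E)) (t : G) : C(G, E) := ⟨fun s => f (s, t), by fun_prop⟩

@[simp]
theorem sectionFst_apply (f : C(G × G, E)) (t s : G) : sectionFst f t s = f (s, t) := rfl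

/-- Averaging over the first variable. -/
def avgFst : C(G × G, E) →L[𝕜] C(G, E) :=
  LinearMap.mkContinuous
    -- Currying after the swap shows that `t ↦ f (·, t)` is continuous into `C(G, E)`.
    { toFun := fun f => ⟨fun t => M.mean (sectionFst f t), M.mean.continuous.comp
        (f.comp ⟨Prod.swap, continuous_swap⟩).curry.continuous⟩
      map_add' := fun f g => by
        ext t
        exact M.mean.map_add (sectionFst f t) (sectionFst g t)
      map_smul' := fun c f => by
        ext t
        exact M.mean.map_smul c (sectionFst f t) } 1 (fun f => by
    rw [one_mul, ContinuousMap.norm_le _ (norm_nonneg _)]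
    exact fun t => M.norm_le_of_forall (norm_nonneg _) fun s => f.norm_coe_le_norm _)

theorem avgFst_apply (f : C(G × G, E)) (t : G) : M.avgFst f t = M.mean (sectionFst f t) := rfl

end InvariantMean

end Mean

end AlmostMorphism

end

/-! ### Integral curves of the left-invariant fields of a local group. -/

noncomputable section

namespace AlmostMorphism

set_option linter.unusedSectionVars false

section Primitive

variable (𝕜 : Type*) [RCLike 𝕜] {E : Type*} [NormedAddCommGroup E] [NormedSpace 𝕜 E]
  [NormedSpace ℝ E] [IsScalarTower ℝ 𝕜 E] [CompleteSpace E]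

/-- The primitive of a continuous map on the unit interval, extended by constants. -/
def primitive (f : C(unitInterval, E)) (t : ℝ) : E :=
  ∫ τ in (0 : ℝ)..t, f (Set.projIcc 0 1 zero_le_one τ)

theorem hasDerivAt_primitive (f : C(unitInterval, E)) (t : ℝ) :
    HasDerivAt (primitive f) (f (Set.projIcc 0 1 zero_le_one t)) t := by
  have hc : Continuous fun τ : ℝ => f (Set.projIcc 0 1 zero_le_one τ) :=
    f.continuous.comp continuous_projIcc
  exact hc.integral_hasStrictDerivAt 0 t |>.hasDerivAt

/-- The operator of integration from `0`. -/
def primitiveCLM : C(unitInterval, E) →L[𝕜] C(unitInterval, E) :=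
  LinearMap.mkContinuous
    { toFun := fun f => ⟨fun t => primitive f t,
        (continuous_iff_continuousAt.2 fun t => (hasDerivAt_primitive f t).continuousAt).comp
          continuous_subtype_val⟩
      map_add' := fun f g => by
        ext t
        have hc : ∀ f : C(unitInterval, E), Continuous fun τ : ℝ =>
          f (Set.projIcc 0 1 zero_le_one τ) := fun f => f.continuous.comp continuous_projIcc
        exact intervalIntegral.integral_add ((hc f).intervalIntegrable _ _)
          ((hc g).intervalIntegrable _ _)
      map_smul' := fun c f => by
        ext t
        exact intervalIntegral.integral_smul c _ } 1 (fun f => by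
    rw [one_mul, ContinuousMap.norm_le _ (norm_nonneg _)]
    intro t
    have h1 := intervalIntegral.norm_integral_le_of_norm_le_const (a := (0 : ℝ)) (b := t)
      (C := ‖f‖) (f := fun τ : ℝ => f (Set.projIcc 0 1 zero_le_one τ))
      (fun τ _ => f.norm_coe_le_norm _)
    refine h1.trans ?_
    rw [sub_zero, abs_of_nonneg t.2.1]
    exact mul_le_of_le_one_right (norm_nonneg _) t.2.2)

end Primitive

theorem analyticAt_clm_apply {𝕜 : Type*} [RCLike 𝕜] {X E F : Type*} [NormedAddCommGroup X]
    [NormedSpace 𝕜 X] [NormedAddCommGroup E] [NormedSpace 𝕜 E] [NormedAddCommGroup F]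
    [NormedSpace 𝕜 F] {T : X → E →L[𝕜] F} {f : X → E} {x : X} (hT : AnalyticAt 𝕜 T x)
    (hf : AnalyticAt 𝕜 f x) : AnalyticAt 𝕜 (fun x => T x (f x)) x :=
  AnalyticAt.fun_comp (g := fun p : (E →L[𝕜] F) × E => p.1 p.2)
    ((ContinuousLinearMap.id 𝕜 (E →L[𝕜] F)).analyticAt_bilinear _) (AnalyticAt.prod hT hf)

section LocalGroup

variable {𝕜 : Type*} [RCLike 𝕜] {E : Type*} [NormedAddCommGroup E] [NormedSpace 𝕜 E]
  [NormedSpace ℝ E] [IsScalarTower ℝ 𝕜 E] [CompleteSpace E]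

/-- An analytic local group law on a Banach space, with neutral element `0`. -/
structure IsLocalGroup (𝕜 : Type*) [RCLike 𝕜] {E : Type*} [NormedAddCommGroup E] [NormedSpace 𝕜 E]
    (m : E × E → E) : Prop where
  analyticAt : AnalyticAt 𝕜 m 0
  mul_zero : ∀ᶠ y in 𝓝 (0 : E), m (y, 0) = y
  zero_mul : ∀ᶠ y in 𝓝 (0 : E), m (0, y) = y
  assoc : ∀ᶠ p in 𝓝 (0 : E × E × E), m (m (p.1, p.2.1), p.2.2) = m (p.1, m (p.2.1, p.2.2))

variable (𝕜) in
/-- The left-invariant vector field of a local group law given by `x`, at the point `y`. -/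
def invField (m : E × E → E) (p : E × E) : E := fderiv 𝕜 m (p.1, 0) (0, p.2)

namespace IsLocalGroup

variable {m : E × E → E} (hm : IsLocalGroup 𝕜 m)
include hm

theorem map_zero : m 0 = 0 := hm.mul_zero.self_of_nhds

theorem analyticAt_fderiv : AnalyticAt 𝕜 (fun y : E => fderiv 𝕜 m (y, 0)) 0 := by
  have h1 : AnalyticAt 𝕜 (fun y : E => ((y, 0) : E × E)) 0 := AnalyticAt.prod analyticAt_id analyticAt_const
  exact AnalyticAt.fun_comp (f := fun y : E => ((y, 0) : E × E)) (g := fderiv 𝕜 m)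
    (AnalyticAt.fderiv hm.analyticAt) h1

theorem analyticAt_invField : AnalyticAt 𝕜 (invField 𝕜 m) 0 := by
  have h1 : AnalyticAt 𝕜 (fun p : E × E => fderiv 𝕜 m (p.1, 0)) 0 :=
    AnalyticAt.fun_comp (f := fun p : E × E => p.1) (g := fun y : E => fderiv 𝕜 m (y, 0))
      hm.analyticAt_fderiv analyticAt_fst
  have h2 : AnalyticAt 𝕜 (fun p : E × E => ((0, p.2) : E × E)) 0 :=
    AnalyticAt.prod analyticAt_const analyticAt_snd
  exact analyticAt_clm_apply h1 h2

theorem eventually_differentiableAt : ∀ᶠ p in 𝓝 (0 : E × E), DifferentiableAt 𝕜 m p :=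
  hm.analyticAt.eventually_analyticAt.mono fun _ h => h.differentiableAt

theorem invField_zero_left (x : E) : invField 𝕜 m (0, x) = x := by
  have h1 : HasFDerivAt (fun z : E => m (0, z)) (fderiv 𝕜 m (0, 0) ∘L
      ContinuousLinearMap.inr 𝕜 E E) 0 :=
    HasFDerivAt.comp (f := fun z : E => ((0, z) : E × E)) (g := m) (0 : E)
      hm.analyticAt.differentiableAt.hasFDerivAt (ContinuousLinearMap.inr 𝕜 E E).hasFDerivAt
  have h2 : HasFDerivAt (fun z : E => m (0, z)) (ContinuousLinearMap.id 𝕜 E) 0 :=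
    (hasFDerivAt_id (𝕜 := 𝕜) (0 : E)).congr_of_eventuallyEq hm.zero_mul
  have := DFunLike.congr_fun (h1.unique h2) x
  simpa [invField] using this

/-- Left invariance of the fields, obtained by differentiating the associativity law `m (m p, z) = m
(p.1, m (p.2, z))` in `z` at `0`. -/
theorem invField_mul : ∀ᶠ p in 𝓝 (0 : E × E), ∀ x,
    fderiv 𝕜 m p (0, invField 𝕜 m (p.2, x)) = invField 𝕜 m (m p, x) := by
  have hc : Tendsto (fun p : E × E => ((m p, 0) : E × E)) (𝓝 0) (𝓝 0) := by
    have := hm.analyticAt.continuousAt.prodMk (continuousAt_const (y := (0 : E)))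
    rw [ContinuousAt, hm.map_zero] at this
    exact this
  have hc2 : Tendsto (fun p : E × E => ((p.2, 0) : E × E)) (𝓝 0) (𝓝 0) := by
    have : Continuous (fun p : E × E => ((p.2, 0) : E × E)) := by fun_prop
    exact this.tendsto' _ _ (by simp)
  have ha : ∀ᶠ p in 𝓝 (0 : E × E), ∀ᶠ z in 𝓝 (0 : E),
      m (m p, z) = m (p.1, m (p.2, z)) := by
    have h1 : Tendsto (fun q : (E × E) × E => ((q.1.1, q.1.2, q.2) : E × E × E)) (𝓝 0) (𝓝 0) := by
      have : Continuous (fun q : (E × E) × E => ((q.1.1, q.1.2, q.2) : E × E × E)) := by fun_prop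
      exact this.tendsto' _ _ (by simp)
    have h2 := h1.eventually hm.assoc
    exact Eventually.curry_nhds (x := (0 : E × E)) (y := (0 : E)) h2
  have hz : ∀ᶠ p in 𝓝 (0 : E × E), m (p.2, 0) = p.2 := by
    have : Tendsto (fun p : E × E => p.2) (𝓝 0) (𝓝 0) := continuous_snd.tendsto' _ _ rfl
    exact this.eventually hm.mul_zero
  filter_upwards [ha, hc.eventually hm.eventually_differentiableAt,
    hc2.eventually hm.eventually_differentiableAt, hm.eventually_differentiableAt, hz]
    with p hp h1 h2 h3 h4 x
  have d1 : HasFDerivAt (fun z : E => m (m p, z)) (fderiv 𝕜 m (m p, 0) ∘L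
      ContinuousLinearMap.inr 𝕜 E E) 0 :=
    HasFDerivAt.comp (f := fun z : E => ((m p, z) : E × E)) (g := m) (0 : E)
      h1.hasFDerivAt (hasFDerivAt_prodMk_right _ _)
  have d2 : HasFDerivAt (fun z : E => m (p.2, z)) (fderiv 𝕜 m (p.2, 0) ∘L
      ContinuousLinearMap.inr 𝕜 E E) 0 :=
    HasFDerivAt.comp (f := fun z : E => ((p.2, z) : E × E)) (g := m) (0 : E)
      h2.hasFDerivAt (hasFDerivAt_prodMk_right _ _)
  have d3 : HasFDerivAt (fun z : E => m (p.1, z)) (fderiv 𝕜 m p ∘L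
      ContinuousLinearMap.inr 𝕜 E E) p.2 :=
    HasFDerivAt.comp (f := fun z : E => ((p.1, z) : E × E)) (g := m) p.2
      h3.hasFDerivAt (hasFDerivAt_prodMk_right _ _)
  have d4 := HasFDerivAt.comp (f := fun z : E => m (p.2, z)) (g := fun z : E => m (p.1, z))
    (0 : E) (by rw [h4]; exact d3) d2
  have d5 := d4.congr_of_eventuallyEq (f₁ := fun z : E => m (m p, z)) hp
  have := DFunLike.congr_fun (d1.unique d5) x
  simpa [invField] using this.symm

/-- Uniform Lipschitz bounds for the left-invariant vector fields. -/
theorem exists_lipschitzOnWith : ∃ K : NNReal, ∃ s ∈ 𝓝 (0 : E), ∀ x,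
    LipschitzOnWith (K * ‖x‖₊) (fun y => invField 𝕜 m (y, x)) s := by
  obtain ⟨K, s, hs, hK⟩ := (hm.analyticAt_fderiv.contDiffAt (n := 1)).exists_lipschitzOnWith
  refine ⟨K, s, hs, fun x => ?_⟩
  refine LipschitzOnWith.of_dist_le_mul fun y hy z hz => ?_
  have h1 := hK.dist_le_mul y hy z hz
  rw [dist_eq_norm] at h1 ⊢
  have h2 := (fderiv 𝕜 m (y, 0) - fderiv 𝕜 m (z, 0)).le_opNorm ((0, x) : E × E)
  have h3 : ‖((0, x) : E × E)‖ = ‖x‖ := by simp [Prod.norm_def]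
  rw [h3] at h2
  refine h2.trans ?_
  push_cast
  calc _ ≤ (K * dist y z) * ‖x‖ := by gcongr
    _ = _ := by ring

/-- The flow of the left-invariant vector fields at the origin depends analytically on the field. -/
theorem exists_flow : ∃ ψ : E → C(unitInterval, E), AnalyticAt 𝕜 ψ 0 ∧ ψ 0 = 0 ∧
    ∃ r > 0, (∀ x, ‖x‖ < r → ∀ t, ψ x t = ∫ τ in (0 : ℝ)..t,
        invField 𝕜 m (ψ x (Set.projIcc 0 1 zero_le_one τ), x)) ∧
      (∀ x, ‖x‖ < r → Continuous fun t => invField 𝕜 m (ψ x t, x)) ∧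
      ∀ x, ‖x‖ < r → ∀ τ : unitInterval, ∀ t : unitInterval, ψ x (τ * t) = ψ ((τ : ℝ) • x) t := by
  obtain ⟨ρ, hρ, -, hsup⟩ :=
    exists_superpose_analyticAt (K := unitInterval) hm.analyticAt_invField
  let pair : E × C(unitInterval, E) →L[𝕜] C(unitInterval, E × E) :=
    LinearMap.mkContinuous
      { toFun := fun p => p.2.prodMk (ContinuousMap.const _ p.1)
        map_add' := fun p q => by ext <;> simp
        map_smul' := fun c p => by ext <;> simp } 1 (fun p => by
      rw [one_mul, ContinuousMap.norm_le _ (norm_nonneg _)]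
      intro t
      change ‖((p.2 t, p.1) : E × E)‖ ≤ ‖p‖
      rw [Prod.norm_def, Prod.norm_def, max_comm]
      exact max_le_max le_rfl (p.2.norm_coe_le_norm t))
  have pair_apply : ∀ x γ t, pair (x, γ) t = (γ t, x) := fun x γ t => rfl
  have hpair : ∀ x γ t, ‖(x, γ)‖ < ρ → ‖pair (x, γ) t - 0‖ < ρ := fun x γ t h => by
    rw [sub_zero, pair_apply, Prod.norm_def]
    rw [Prod.norm_def, max_lt_iff] at h
    exact max_lt ((γ.norm_coe_le_norm t).trans_lt h.2) h.1
  -- Fixed points of `Φ (x, ·)` are the solutions of the integral equation on all of `[0, 1]`. The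
  -- field is linear in `x`, so `Φ (0, ·) = 0`: the partial derivative in the curve vanishes at `(0,
  -- 0)`, and the fixed point theorem applies with no further smallness.
  let Φ : E × C(unitInterval, E) → C(unitInterval, E) := fun p =>
    primitiveCLM 𝕜 (superpose (invField 𝕜 m) (pair p))
  have hΦ : AnalyticAt 𝕜 Φ (0, 0) := by
    refine AnalyticAt.fun_comp (g := primitiveCLM 𝕜) (ContinuousLinearMap.analyticAt _ _) ?_
    refine AnalyticAt.fun_comp (g := superpose (invField 𝕜 m)) (hsup _ ?_).1
      (ContinuousLinearMap.analyticAt _ _)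
    exact fun t => hpair _ _ _ (by simpa using hρ)
  have hΦ0 : ∀ γ, Φ (0, γ) = 0 := fun γ => by
    have : superpose (invField 𝕜 m) (pair (0, γ)) = 0 :=
      superpose_eq fun t => by
        rw [pair_apply]
        exact ContinuousLinearMap.map_zero _
    simp only [Φ, this, _root_.map_zero]
  have hder : fderiv 𝕜 Φ (0, 0) ∘L ContinuousLinearMap.inr 𝕜 E C(unitInterval, E) = 0 := by
    have h1 : HasFDerivAt (fun γ => Φ (0, γ)) (fderiv 𝕜 Φ (0, 0) ∘L
        ContinuousLinearMap.inr 𝕜 E C(unitInterval, E)) 0 :=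
      HasFDerivAt.comp (f := fun γ => ((0, γ) : E × C(unitInterval, E))) (g := Φ) 0
        hΦ.differentiableAt.hasFDerivAt (hasFDerivAt_prodMk_right _ _)
    have h2 : (fun γ => Φ (0, γ)) = fun _ => 0 := funext hΦ0
    rw [h2] at h1
    exact h1.unique (hasFDerivAt_const _ _)
  obtain ⟨ψ, hψ, hψ0, hfix, huniq⟩ := exists_analyticAt_fixedPoint hΦ (hΦ0 0)
    (by rw [hder]; simp)
  obtain ⟨η, hη, hη'⟩ := Metric.eventually_nhds_iff_ball.1 huniq
  have hsmall : ∀ᶠ x in 𝓝 (0 : E), ‖(x, ψ x)‖ < min ρ η := by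
    have hc : ContinuousAt (fun x => (x, ψ x)) 0 := continuousAt_id.prodMk hψ.continuousAt
    have : Tendsto (fun x => ‖(x, ψ x)‖) (𝓝 0) (𝓝 0) := by
      have := hc.norm
      rw [ContinuousAt, hψ0] at this
      simpa using this
    exact this.eventually (gt_mem_nhds (lt_min hρ hη))
  obtain ⟨r, hr, hr'⟩ := Metric.eventually_nhds_iff_ball.1 (hfix.and hsmall)
  have hball : ∀ x, ‖x‖ < r → Φ (x, ψ x) = ψ x ∧ ‖(x, ψ x)‖ < min ρ η := fun x hx =>
    hr' x (by simpa using hx)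
  have hval : ∀ x γ t, ‖(x, γ)‖ < ρ → superpose (invField 𝕜 m) (pair (x, γ)) t =
      invField 𝕜 m (γ t, x) := fun x γ t h => by
    rw [(hsup _ fun t => hpair x γ t h).2, pair_apply]
  have hint : ∀ x γ t, ‖(x, γ)‖ < ρ → Φ (x, γ) t = ∫ τ in (0 : ℝ)..t,
        invField 𝕜 m (γ (Set.projIcc 0 1 zero_le_one τ), x) := fun x γ t h => by
    change primitive _ _ = _
    rw [primitive]
    simp only [hval x γ _ h]
  refine ⟨ψ, hψ, hψ0, r, hr, fun x hx t => ?_, fun x hx => ?_, fun x hx τ => ?_⟩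
  · obtain ⟨h1, h2⟩ := hball x hx
    rw [← hint x (ψ x) t (h2.trans_le (min_le_left _ _)), h1]
  · obtain ⟨h1, h2⟩ := hball x hx
    have := (superpose (invField 𝕜 m) (pair (x, ψ x))).continuous
    refine this.congr fun t => ?_
    exact hval x (ψ x) t (h2.trans_le (min_le_left _ _))
  · obtain ⟨h1, h2⟩ := hball x hx
    -- The slowed-down curve solves the equation with field parameter `τ x`, and the pair has not
    -- grown in norm, so it is still in the ball where fixed points are unique.
    let δ : C(unitInterval, E) := (ψ x).comp ⟨fun t => τ * t, by fun_prop⟩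
    have hδn : ‖((τ : ℝ) • x, δ)‖ ≤ ‖(x, ψ x)‖ := by
      rw [Prod.norm_def, Prod.norm_def]
      refine max_le_max ?_ ?_
      · rw [norm_smul, Real.norm_of_nonneg τ.2.1]
        exact mul_le_of_le_one_left (norm_nonneg _) τ.2.2
      · rw [ContinuousMap.norm_le _ (norm_nonneg _)]
        exact fun t => (ψ x).norm_coe_le_norm _
    have hδ : Φ ((τ : ℝ) • x, δ) = δ := by
      ext t
      rw [hint _ _ _ (hδn.trans_lt (h2.trans_le (min_le_left _ _)))]
      change _ = ψ x (τ * t)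
      have e1 : ∀ y, invField 𝕜 m (y, (τ : ℝ) • x) = (τ : ℝ) • invField 𝕜 m (y, x) := fun y => by
        have : ((0 : E), (τ : ℝ) • x) = (τ : ℝ) • ((0 : E), x) := by simp
        rw [invField, this]
        exact ((fderiv 𝕜 m (y, 0)).restrictScalars ℝ).map_smul _ _
      simp_rw [e1]
      rw [intervalIntegral.integral_smul]
      conv_rhs => rw [← h1, hint x (ψ x) _ (h2.trans_le (min_le_left _ _))]
      have e2 : ∀ s ∈ Set.uIcc (0 : ℝ) t, invField 𝕜 m (δ (Set.projIcc 0 1 zero_le_one s), x) =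
          (fun u : ℝ => invField 𝕜 m (ψ x (Set.projIcc 0 1 zero_le_one u), x)) (τ * s) := by
        intro s hs
        rw [Set.uIcc_of_le t.2.1] at hs
        have hs1 : s ∈ Set.Icc (0 : ℝ) 1 := ⟨hs.1, hs.2.trans t.2.2⟩
        have hs2 : (τ : ℝ) * s ∈ Set.Icc (0 : ℝ) 1 := unitInterval.mul_mem τ.2 hs1
        simp only [δ, ContinuousMap.comp_apply, ContinuousMap.coe_mk,
          Set.projIcc_of_mem zero_le_one hs1, Set.projIcc_of_mem zero_le_one hs2]
        rfl
      rw [intervalIntegral.integral_congr e2]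
      refine (intervalIntegral.smul_integral_comp_mul_left
        (fun u : ℝ => invField 𝕜 m (ψ x (Set.projIcc 0 1 zero_le_one u), x)) (τ : ℝ)).trans ?_
      simp
    have := hη' ((τ : ℝ) • x, δ) (by
      rw [Metric.mem_ball, dist_eq_norm, ← Prod.zero_eq_mk, sub_zero]
      exact hδn.trans_lt (h2.trans_le (min_le_right _ _))) hδ
    intro t
    simp only at this
    rw [this]
    rfl

end IsLocalGroup

end LocalGroup

end AlmostMorphism

end

/-! ### The exponential map of a local group. -/

noncomputable section

namespace AlmostMorphism

set_option linter.unusedSectionVars false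

section LocalGroup

variable {𝕜 : Type*} [RCLike 𝕜] {E : Type*} [NormedAddCommGroup E] [NormedSpace 𝕜 E]
  [NormedSpace ℝ E] [IsScalarTower ℝ 𝕜 E] [CompleteSpace E]

theorem invField_real_smul (m : E × E → E) (y x : E) (t : ℝ) :
    invField 𝕜 m (y, t • x) = t • invField 𝕜 m (y, x) := by
  have : ((0 : E), t • x) = t • ((0 : E), x) := by simp
  rw [invField, this]
  exact ((fderiv 𝕜 m (y, 0)).restrictScalars ℝ).map_smul _ _

theorem hasDerivAt_comp_smul {f : E → E} {x : E} {t : ℝ} (hf : DifferentiableAt 𝕜 f (t • x)) :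
    HasDerivAt (fun s : ℝ => f (s • x)) (fderiv 𝕜 f (t • x) x) t := by
  have h1 : HasDerivAt (fun s : ℝ => s • x) x t := by
    simpa using (hasDerivAt_id t).smul_const x
  exact (hf.hasFDerivAt.restrictScalars ℝ).comp_hasDerivAt t h1

namespace IsLocalGroup

variable {m : E × E → E} (hm : IsLocalGroup 𝕜 m)
include hm

/-- The exponential map of a local group, with its differential equation. -/
theorem exists_exp_hasDerivAt : ∃ ε : E → E, AnalyticAt 𝕜 ε 0 ∧ ε 0 = 0 ∧
    HasFDerivAt ε (ContinuousLinearMap.id 𝕜 E) 0 ∧ ∃ r > 0, ∀ (x : E) (t : ℝ), ‖t • x‖ < r →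
      HasDerivAt (fun s : ℝ => ε (s • x)) (invField 𝕜 m (ε (t • x), x)) t := by
  obtain ⟨ψ, hψ, hψ0, r, hr, hode, hcont, hscale⟩ := hm.exists_flow
  let ε : E → E := fun x => ψ x 1
  have hε : AnalyticAt 𝕜 ε 0 := AnalyticAt.fun_comp (g := ContinuousMap.evalCLM 𝕜 1)
    (ContinuousLinearMap.analyticAt _ _) hψ
  have hε0 : ε 0 = 0 := by simp [ε, hψ0]
  have hscale' : ∀ x, ‖x‖ < r → ∀ τ : unitInterval, ψ x τ = ε ((τ : ℝ) • x) := fun x hx τ => by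
    have := hscale x hx τ 1
    rwa [mul_one] at this
  have hflow : ∀ x, ‖x‖ < r → ∀ t ∈ Set.Ioo (0 : ℝ) 1,
      HasDerivAt (fun s : ℝ => ε (s • x)) (invField 𝕜 m (ε (t • x), x)) t := by
    intro x hx t ht
    have h1 := hasDerivAt_primitive ⟨fun t => invField 𝕜 m (ψ x t, x), hcont x hx⟩ t
    have ht' : t ∈ Set.Icc (0 : ℝ) 1 := ⟨ht.1.le, ht.2.le⟩
    have e : ∀ s ∈ Set.Icc (0 : ℝ) 1,
        primitive ⟨fun t => invField 𝕜 m (ψ x t, x), hcont x hx⟩ s = ε (s • x) := by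
      intro s hs
      have := hode x hx ⟨s, hs⟩
      rw [hscale' x hx] at this
      exact this.symm
    have h2 : invField 𝕜 m (ε (t • x), x) =
        (⟨fun t => invField 𝕜 m (ψ x t, x), hcont x hx⟩ : C(unitInterval, E))
          (Set.projIcc 0 1 zero_le_one t) := by
      rw [Set.projIcc_of_mem zero_le_one ht']
      change _ = invField 𝕜 m (ψ x ⟨t, ht'⟩, x)
      rw [hscale' x hx]
    rw [h2]
    refine h1.congr_of_eventuallyEq ?_
    filter_upwards [Ioo_mem_nhds ht.1 ht.2] with s hs
    exact (e s ⟨hs.1.le, hs.2.le⟩).symm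
  have hdiff : ∀ᶠ z in 𝓝 (0 : E), DifferentiableAt 𝕜 ε z :=
    hε.eventually_analyticAt.mono fun _ h => h.differentiableAt
  -- So far the differential equation is known only for `t` in the open interval `(0, 1)`. At time
  -- `1/2` of the curve of `2z` it gives the radial derivative at every small `z`. Dividing by `t`
  -- then covers times of both signs, and `t = 0` is reached by letting `t` tend to `0`, which also
  -- identifies the derivative of `ε` at `0`.
  have hrad : ∀ᶠ z in 𝓝 (0 : E), fderiv 𝕜 ε z z = invField 𝕜 m (ε z, z) := by
    have h2 : ∀ᶠ z in 𝓝 (0 : E), ‖(2 : ℝ) • z‖ < r := by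
      have : Continuous fun z : E => ‖(2 : ℝ) • z‖ := by fun_prop
      exact this.continuousAt.eventually_lt continuousAt_const (by simpa using hr)
    filter_upwards [h2, hdiff] with z hz hd
    have e2 : (1 / 2 : ℝ) • (2 : ℝ) • z = z := by rw [smul_smul]; norm_num
    have h3 := hflow _ hz (1 / 2) ⟨by norm_num, by norm_num⟩
    rw [e2] at h3
    have h4 : HasDerivAt (fun s : ℝ => ε (s • (2 : ℝ) • z)) (fderiv 𝕜 ε z ((2 : ℝ) • z))
        (1 / 2) := by
      have := hasDerivAt_comp_smul (𝕜 := 𝕜) (f := ε) (x := (2 : ℝ) • z) (t := 1 / 2)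
        (by rw [e2]; exact hd)
      rwa [e2] at this
    have h5 := h4.unique h3
    rw [invField_real_smul, (fderiv 𝕜 ε z).map_smul_of_tower (2 : ℝ)] at h5
    exact smul_right_injective E (two_ne_zero' ℝ) h5
  obtain ⟨r', hr', hball⟩ := Metric.eventually_nhds_iff_ball.1 (hdiff.and hrad)
  have hpos : ∀ (x : E) (t : ℝ), t ≠ 0 → ‖t • x‖ < r' →
      fderiv 𝕜 ε (t • x) x = invField 𝕜 m (ε (t • x), x) := by
    intro x t ht hx
    have h := (hball (t • x) (by simpa using hx)).2
    rw [invField_real_smul, (fderiv 𝕜 ε (t • x)).map_smul_of_tower t] at h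
    exact smul_right_injective E ht h
  have hzero : fderiv 𝕜 ε 0 = ContinuousLinearMap.id 𝕜 E := by
    ext x
    have hc : Tendsto (fun t : ℝ => t • x) (𝓝[≠] 0) (𝓝 0) := by
      have : Continuous fun t : ℝ => t • x := by fun_prop
      exact (this.tendsto' 0 0 (by simp)).mono_left nhdsWithin_le_nhds
    have l1 : Tendsto (fun t : ℝ => fderiv 𝕜 ε (t • x) x) (𝓝[≠] 0) (𝓝 (fderiv 𝕜 ε 0 x)) := by
      have h1 : ContinuousAt (fun z => fderiv 𝕜 ε z x) 0 :=
        hε.fderiv.continuousAt.clm_apply continuousAt_const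
      exact h1.tendsto.comp hc
    have l2 : Tendsto (fun t : ℝ => invField 𝕜 m (ε (t • x), x)) (𝓝[≠] 0) (𝓝 x) := by
      have h1 : ContinuousAt (fun y : E => invField 𝕜 m (y, x)) 0 :=
        hm.analyticAt_fderiv.continuousAt.clm_apply continuousAt_const
      have h2 : Tendsto (fun t : ℝ => ε (t • x)) (𝓝[≠] 0) (𝓝 0) := by
        have := hε.continuousAt.tendsto.comp hc
        rwa [hε0] at this
      have := h1.tendsto.comp h2
      rwa [hm.invField_zero_left] at this
    refine tendsto_nhds_unique (l1.congr' ?_) l2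
    have : ∀ᶠ t : ℝ in 𝓝[≠] 0, ‖t • x‖ < r' := by
      have := hc.norm
      rw [norm_zero] at this
      exact this.eventually (gt_mem_nhds hr')
    filter_upwards [this, self_mem_nhdsWithin] with t ht ht0
    exact hpos x t ht0 ht
  refine ⟨ε, hε, hε0, hzero ▸ hε.differentiableAt.hasFDerivAt, r', hr', fun x t htx => ?_⟩
  have h := hasDerivAt_comp_smul (𝕜 := 𝕜) (hball (t • x) (by simpa using htx)).1
  by_cases ht : t = 0
  · subst ht
    rw [zero_smul] at h ⊢
    rw [hε0, hm.invField_zero_left]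
    rw [hzero] at h
    exact h
  · rw [← hpos x t ht htx]
    exact h

/-- The exponential map of a local group. -/
theorem exists_exp : ∃ ε : E → E, AnalyticAt 𝕜 ε 0 ∧ ε 0 = 0 ∧
    HasFDerivAt ε (ContinuousLinearMap.id 𝕜 E) 0 ∧
    (∃ r > 0, ∀ x, ‖x‖ < r → ∀ s ∈ Set.Icc (-1 : ℝ) 1, ∀ t ∈ Set.Icc (-1 : ℝ) 1,
      m (ε (s • x), ε (t • x)) = ε ((s + t) • x)) ∧
    ∀ (y : ℝ → E) (v : E), y 0 = 0 → HasDerivAt y v 0 →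
      (∀ᶠ p in 𝓝 (0 : ℝ × ℝ), y (p.1 + p.2) = m (y p.1, y p.2)) → ∀ᶠ t in 𝓝 0, y t = ε (t • v) := by
  obtain ⟨ε, hε, hε0, hε', r, hr, hode⟩ := hm.exists_exp_hasDerivAt
  obtain ⟨K, s₀, hs₀, hK⟩ := hm.exists_lipschitzOnWith
  refine ⟨ε, hε, hε0, hε', ?_, ?_⟩
  · have hz : ∀ᶠ z in 𝓝 (0 : E), m (ε z, 0) = ε z := by
      have : Tendsto ε (𝓝 0) (𝓝 0) := by simpa [ContinuousAt, hε0] using hε.continuousAt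
      exact this.eventually hm.mul_zero
    have hp : ∀ᶠ p in 𝓝 (0 : E × E), DifferentiableAt 𝕜 m (ε p.1, ε p.2) ∧
        (∀ x, fderiv 𝕜 m (ε p.1, ε p.2) (0, invField 𝕜 m (ε p.2, x)) =
          invField 𝕜 m (m (ε p.1, ε p.2), x)) ∧ m (ε p.1, ε p.2) ∈ s₀ ∧ ε p.2 ∈ s₀ := by
      have c1 : Tendsto (fun p : E × E => (ε p.1, ε p.2)) (𝓝 0) (𝓝 0) := by
        have h1 : ContinuousAt (fun p : E × E => ε p.1) 0 :=
          ContinuousAt.comp (f := Prod.fst) (x := (0 : E × E)) (g := ε) hε.continuousAt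
            continuousAt_fst
        have h2 : ContinuousAt (fun p : E × E => ε p.2) 0 :=
          ContinuousAt.comp (f := Prod.snd) (x := (0 : E × E)) (g := ε) hε.continuousAt
            continuousAt_snd
        have := (h1.prodMk h2).tendsto
        simp only [Prod.fst_zero, Prod.snd_zero, hε0] at this
        exact this
      have c2 : Tendsto m (𝓝 0) (𝓝 0) := by
        simpa [ContinuousAt, hm.map_zero] using hm.analyticAt.continuousAt
      have c3 : Tendsto (fun p : E × E => ε p.2) (𝓝 0) (𝓝 0) :=
        (continuous_snd.tendsto' (0 : E × E) 0 rfl).comp c1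
      filter_upwards [c1.eventually hm.eventually_differentiableAt, c1.eventually hm.invField_mul,
        (c2.comp c1).eventually hs₀, c3.eventually hs₀] with p h1 h2 h3 h4
      exact ⟨h1, h2, h3, h4⟩
    obtain ⟨r₁, hr₁, hb₁⟩ := Metric.eventually_nhds_iff_ball.1 hz
    obtain ⟨r₂, hr₂, hb₂⟩ := Metric.eventually_nhds_iff_ball.1 hp
    -- The division by `3` leaves room for `s + t` with `|s| ≤ 1` and `|t| < 2`; the open interval
    -- for `t` has to contain `[-1, 1]`.
    have hpos : 0 < min r (min r₁ r₂) / 3 := by positivity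
    refine ⟨_, hpos, fun x hx s hs t ht => ?_⟩
    have hsm : ∀ t : ℝ, |t| ≤ 3 → ‖t • x‖ < min r (min r₁ r₂) := fun t ht => by
      rw [norm_smul, Real.norm_eq_abs]
      calc |t| * ‖x‖ ≤ 3 * ‖x‖ := by gcongr
        _ < 3 * (min r (min r₁ r₂) / 3) := by gcongr
        _ = _ := by ring
    have hss : |s| ≤ 1 := abs_le.2 hs
    -- As functions of `t`, both sides are integral curves of the field of `x`: the first because
    -- left translations preserve the field, the second by a shift of time. They agree at `t = 0`,
    -- and the field is Lipschitz on `s₀`.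
    have key : Set.EqOn (fun t : ℝ => m (ε (s • x), ε (t • x))) (fun t => ε ((s + t) • x))
        (Set.Ioo (-2) 2) := by
      refine ODE_solution_unique_of_mem_Ioo (v := fun _ y => invField 𝕜 m (y, x))
        (s := fun _ => s₀) (K := K * ‖x‖₊) (t₀ := 0) (fun t _ => hK x) (by norm_num) ?_ ?_ ?_
      · intro t ht
        have ht3 : |t| ≤ 3 := abs_le.2 ⟨by linarith [ht.1], by linarith [ht.2]⟩
        obtain ⟨h1, h2, h3, -⟩ := hb₂ (s • x, t • x) (by
          rw [mem_ball_zero_iff, Prod.norm_def, max_lt_iff]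
          exact ⟨(hsm s (by linarith)).trans_le ((min_le_right _ _).trans (min_le_right _ _)),
            (hsm t ht3).trans_le ((min_le_right _ _).trans (min_le_right _ _))⟩)
        refine ⟨?_, h3⟩
        have d1 := hode x t ((hsm t ht3).trans_le (min_le_left _ _))
        have d2 : HasDerivAt (fun t : ℝ => ((ε (s • x), ε (t • x)) : E × E))
            (0, invField 𝕜 m (ε (t • x), x)) t := (hasDerivAt_const t _).prodMk d1
        have d3 := (h1.hasFDerivAt.restrictScalars ℝ).comp_hasDerivAt t d2
        rw [← h2 x]
        exact d3
      · intro t ht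
        have ht3 : |s + t| ≤ 3 := (abs_add_le _ _).trans (by
          have : |t| ≤ 2 := abs_le.2 ⟨by linarith [ht.1], by linarith [ht.2]⟩
          linarith)
        obtain ⟨-, -, -, h4⟩ := hb₂ (0, (s + t) • x) (by
          rw [mem_ball_zero_iff, Prod.norm_def, max_lt_iff]
          refine ⟨by simpa using hr₂, ?_⟩
          exact (hsm _ ht3).trans_le ((min_le_right _ _).trans (min_le_right _ _)))
        refine ⟨?_, h4⟩
        have d1 := hode x (s + t) ((hsm _ ht3).trans_le (min_le_left _ _))
        exact d1.comp_const_add s t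
      · simp only [zero_smul, hε0, add_zero]
        exact hb₁ _ (by
          rw [mem_ball_zero_iff]
          exact (hsm s (by linarith)).trans_le ((min_le_right _ _).trans (min_le_left _ _)))
    exact key (x := t) ⟨by linarith [ht.1], by linarith [ht.2]⟩
  · intro y v hy0 hyd hy
    have hyc : Tendsto y (𝓝 0) (𝓝 0) := by
      simpa [ContinuousAt, hy0] using hyd.continuousAt
    have hsv : Tendsto (fun t : ℝ => t • v) (𝓝 0) (𝓝 0) := by
      have : Continuous fun t : ℝ => t • v := by fun_prop
      exact this.tendsto' 0 0 (by simp)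
    -- Differentiating `y (t + h) = m (y t, y h)` at `h = 0` shows that a local one-parameter group
    -- is an integral curve of the field of its velocity `v`.
    refine ODE_solution_unique_of_eventually (v := fun _ y => invField 𝕜 m (y, v))
        (s := fun _ => s₀) (K := K * ‖v‖₊) (Eventually.of_forall fun t => hK v) ?_ ?_ ?_
    · have hcur : ∀ᶠ t in 𝓝 (0 : ℝ), ∀ᶠ h in 𝓝 (0 : ℝ), y (t + h) = m (y t, y h) :=
        Eventually.curry_nhds (x := (0 : ℝ)) (y := (0 : ℝ)) hy
      have hdif : ∀ᶠ t in 𝓝 (0 : ℝ), DifferentiableAt 𝕜 m (y t, 0) := by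
        have : Tendsto (fun t => ((y t, 0) : E × E)) (𝓝 0) (𝓝 0) :=
          Tendsto.prodMk_nhds hyc tendsto_const_nhds
        exact this.eventually hm.eventually_differentiableAt
      filter_upwards [hcur, hdif, hyc.eventually hs₀] with t h1 h2 h3
      refine ⟨?_, h3⟩
      have d1 : HasDerivAt (fun h : ℝ => ((y t, y h) : E × E)) (0, v) 0 :=
        (hasDerivAt_const _ _).prodMk hyd
      have d2 := HasFDerivAt.comp_hasDerivAt (0 : ℝ) (l := m) (f := fun h : ℝ => (y t, y h))
        (by rw [hy0]; exact h2.hasFDerivAt.restrictScalars ℝ) d1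
      have d3 : HasDerivAt (fun h => y (t + h)) (invField 𝕜 m (y t, v)) 0 :=
        d2.congr_of_eventuallyEq h1
      have d4 := HasDerivAt.comp_add_const (x := t) (a := -t) (f := fun h => y (t + h))
        (by simpa using d3)
      simpa using d4
    · have hsm : ∀ᶠ t : ℝ in 𝓝 0, ‖t • v‖ < r := by
        have := hsv.norm
        rw [norm_zero] at this
        exact this.eventually (gt_mem_nhds hr)
      have hεs : ∀ᶠ t : ℝ in 𝓝 0, ε (t • v) ∈ s₀ := by
        have h1 : Tendsto ε (𝓝 0) (𝓝 0) := by simpa [ContinuousAt, hε0] using hε.continuousAt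
        exact (h1.comp hsv).eventually hs₀
      filter_upwards [hsm, hεs] with t h1 h2
      exact ⟨hode v t h1, h2⟩
    · simp [hy0, hε0]

end IsLocalGroup

end LocalGroup

end AlmostMorphism

end

/-! ### Exponential coordinates on a Banach Lie group. -/

noncomputable section

namespace AlmostMorphism

set_option linter.unusedSectionVars false

section Chart

variable (𝕜 : Type*) [RCLike 𝕜] {E : Type*} [NormedAddCommGroup E] [NormedSpace 𝕜 E]
  {U : Type*} [Group U] [TopologicalSpace U] [ChartedSpace E U]

theorem hasFDerivAt_Ad [LieGroup 𝓘(𝕜, E) ω U] (u : U) :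
    HasFDerivAt (fun y => chartAt E (1 : U) (u * (chartAt E (1 : U)).symm y * u⁻¹)) (Ad 𝕜 u)
      (chartAt E (1 : U) 1) := by
  have h1 : ContMDiff 𝓘(𝕜, E) 𝓘(𝕜, E) ω (fun x : U => u * x * u⁻¹) :=
    (contMDiff_mul_right (a := u⁻¹)).comp (contMDiff_mul_left (a := u))
  have h2 := (h1.mdifferentiable (by simp) 1).hasMFDerivAt.2
  have e : u * 1 * u⁻¹ = 1 := by simp
  simp only [writtenInExtChartAt, e, mfld_simps] at h2
  exact hasFDerivWithinAt_univ.1 h2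

theorem analyticAt_chart_mul [CompleteSpace E] [LieGroup 𝓘(𝕜, E) ω U] :
    AnalyticAt 𝕜 (fun p : E × E => chartAt E (1 : U)
      ((chartAt E (1 : U)).symm p.1 * (chartAt E (1 : U)).symm p.2))
      (chartAt E (1 : U) 1, chartAt E (1 : U) 1) := by
  have h1 := (contMDiff_mul 𝓘(𝕜, E) ω (G := U)).contMDiffAt (x := (1, 1))
  rw [contMDiffAt_iff] at h1
  have h2 := h1.2
  have h3 : ContDiffAt 𝕜 ω (fun p : E × E => chartAt E (1 : U)
      ((chartAt E (1 : U)).symm p.1 * (chartAt E (1 : U)).symm p.2))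
      (chartAt E (1 : U) 1, chartAt E (1 : U) 1) := by
    rw [← contDiffWithinAt_univ]
    simp only [mul_one, mfld_simps] at h2
    convert! h2 using 1
    simp
  exact h3.analyticAt

end Chart

/-- Exponential coordinates near the identity of a Banach Lie group. -/
structure LogChart (𝕜 E U : Type*) [RCLike 𝕜] [NormedAddCommGroup E] [NormedSpace 𝕜 E]
    [NormedSpace ℝ E] [Group U] [TopologicalSpace U] [ChartedSpace E U] where
  /-- The exponential map. -/
  exp : E → U
  /-- The logarithm. -/
  log : U → E
  /-- A radius of validity. -/
  radius : ℝ
  radius_pos : 0 < radius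
  exp_zero : exp 0 = 1
  log_exp : ∀ x, ‖x‖ < radius → log (exp x) = x
  exp_log : ∀ᶠ u in 𝓝 1, exp (log u) = u
  continuousOn_exp : ContinuousOn exp (Metric.ball 0 radius)
  continuousAt_log : ∀ᶠ u in 𝓝 1, ContinuousAt log u
  analyticAt_mul : AnalyticAt 𝕜 (fun p : E × E => log (exp p.1 * exp p.2)) 0
  exp_add : ∀ x, ‖x‖ < radius → ∀ s ∈ Set.Icc (-1 : ℝ) 1, ∀ t ∈ Set.Icc (-1 : ℝ) 1,
    exp (s • x) * exp (t • x) = exp ((s + t) • x)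
  exp_Ad : ∀ (u : U) (x : E), ‖x‖ < radius → ‖Ad 𝕜 u x‖ < radius →
    exp (Ad 𝕜 u x) = u * exp x * u⁻¹
  analyticAt_chart_exp : AnalyticAt 𝕜 (fun x => chartAt E (1 : U) (exp x)) 0
  hasFDerivAt_chart_exp : HasFDerivAt (fun x => chartAt E (1 : U) (exp x))
    (ContinuousLinearMap.id 𝕜 E) 0
  analyticAt_log_chart : AnalyticAt 𝕜 (fun y => log ((chartAt E (1 : U)).symm y))
    (chartAt E (1 : U) 1)

/-- Additivity is available only for times in `[-1, 1]`, and the multiples `k/n` with `k ≤ n` stay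
there. This is what carries identities known at time `1/n` to time `1`. -/
theorem exp_pow_of_exp_add {E U : Type*} [NormedAddCommGroup E] [NormedSpace ℝ E] [Group U]
    {exp : E → U} (h0 : exp 0 = 1) {x : E}
    (h : ∀ s ∈ Set.Icc (-1 : ℝ) 1, ∀ t ∈ Set.Icc (-1 : ℝ) 1,
      exp (s • x) * exp (t • x) = exp ((s + t) • x)) (n : ℕ) (hn : 0 < n) (k : ℕ) (hk : k ≤ n) :
    exp (((1 : ℝ) / n) • x) ^ k = exp (((k : ℝ) / n) • x) := by
  have hn' : (0 : ℝ) < n := by exact_mod_cast hn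
  induction k with
  | zero => simp [h0]
  | succ k ih =>
    rw [pow_succ, ih (by omega), h]
    · congr 2
      push_cast
      ring
    · have : (k : ℝ) ≤ n := by exact_mod_cast (by omega : k ≤ n)
      refine ⟨by linarith [show (0 : ℝ) ≤ k / n by positivity], ?_⟩
      rw [div_le_one hn']
      exact this
    · have : (1 : ℝ) ≤ n := by exact_mod_cast hn
      refine ⟨by linarith [show (0 : ℝ) ≤ 1 / n by positivity], ?_⟩
      rw [div_le_one hn']
      exact this

/-- The chart at `1`, translated so that `1` goes to `0`, turns a neighbourhood of `1` into a local
group. Its exponential `ε` has derivative the identity at `0`, hence an analytic local inverse;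
`exp` and `log` are `ε` and this inverse composed with the translated chart. -/
theorem LogChart.nonempty (𝕜 E U : Type*) [RCLike 𝕜] [NormedAddCommGroup E] [NormedSpace 𝕜 E]
    [NormedSpace ℝ E] [IsScalarTower ℝ 𝕜 E] [CompleteSpace E] [Group U] [TopologicalSpace U]
    [IsTopologicalGroup U] [ChartedSpace E U] [LieGroup 𝓘(𝕜, E) ω U] :
    Nonempty (LogChart 𝕜 E U) := by
  set φ := chartAt E (1 : U) with hφ
  set e : E := φ 1 with he
  have h1s : (1 : U) ∈ φ.source := mem_chart_source E 1
  have het : e ∈ φ.target := φ.map_source h1s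
  let a : E → U := fun y => φ.symm (e + y)
  let b : U → E := fun u => φ u - e
  have ha0 : a 0 = 1 := by simp [a, he, φ.left_inv h1s]
  have hb1 : b 1 = 0 := by simp [b, he]
  have hac : ∀ᶠ y in 𝓝 (0 : E), ContinuousAt a y := by
    have : Tendsto (fun y : E => e + y) (𝓝 0) (𝓝 e) :=
      (continuous_const.add continuous_id).tendsto' _ _ (add_zero e)
    filter_upwards [this.eventually (φ.open_target.mem_nhds het)] with y hy
    exact ContinuousAt.comp (g := φ.symm) (φ.continuousAt_symm hy) (by fun_prop)
  have hac0 : Tendsto a (𝓝 0) (𝓝 1) := by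
    have := hac.self_of_nhds
    rwa [ContinuousAt, ha0] at this
  have hbc : ∀ᶠ u in 𝓝 (1 : U), ContinuousAt b u := by
    filter_upwards [φ.open_source.mem_nhds h1s] with u hu
    exact (φ.continuousAt hu).sub continuousAt_const
  have hbc0 : Tendsto b (𝓝 1) (𝓝 0) := by
    have := hbc.self_of_nhds
    rwa [ContinuousAt, hb1] at this
  have hab : ∀ᶠ u in 𝓝 (1 : U), a (b u) = u := by
    filter_upwards [φ.open_source.mem_nhds h1s] with u hu
    simp [a, b, φ.left_inv hu]
  have hba : ∀ᶠ y in 𝓝 (0 : E), b (a y) = y := by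
    have : Tendsto (fun y : E => e + y) (𝓝 0) (𝓝 e) :=
      (continuous_const.add continuous_id).tendsto' _ _ (add_zero e)
    filter_upwards [this.eventually (φ.open_target.mem_nhds het)] with y hy
    simp [a, b, φ.right_inv hy]
  let m : E × E → E := fun p => b (a p.1 * a p.2)
  have hmul0 : Tendsto (fun p : E × E => a p.1 * a p.2) (𝓝 0) (𝓝 1) := by
    have h1 : Tendsto (fun p : E × E => a p.1) (𝓝 0) (𝓝 1) :=
      hac0.comp (continuous_fst.tendsto' (0 : E × E) 0 rfl)
    have h2 : Tendsto (fun p : E × E => a p.2) (𝓝 0) (𝓝 1) :=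
      hac0.comp (continuous_snd.tendsto' (0 : E × E) 0 rfl)
    simpa using h1.mul h2
  have ham : ∀ᶠ p in 𝓝 (0 : E × E), a (m p) = a p.1 * a p.2 := hmul0.eventually hab
  have hm0 : Tendsto m (𝓝 0) (𝓝 0) := hbc0.comp hmul0
  have hm : IsLocalGroup 𝕜 m := by
    refine ⟨?_, ?_, ?_, ?_⟩
    · have h1 : AnalyticAt 𝕜 (fun p : E × E => φ (φ.symm p.1 * φ.symm p.2)) (e, e) :=
        analyticAt_chart_mul 𝕜 (U := U)
      have h2 : AnalyticAt 𝕜 (fun p : E × E => (e + p.1, e + p.2)) 0 :=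
        AnalyticAt.prod (analyticAt_const.add analyticAt_fst) (analyticAt_const.add analyticAt_snd)
      have h3 := AnalyticAt.fun_comp (g := fun p : E × E => φ (φ.symm p.1 * φ.symm p.2))
        (f := fun p : E × E => (e + p.1, e + p.2)) (x := 0) (by simpa using h1) h2
      exact h3.sub analyticAt_const
    · filter_upwards [hba] with y hy
      simp [m, ha0, hy]
    · filter_upwards [hba] with y hy
      simp [m, ha0, hy]
    · have c1 : Tendsto (fun p : E × E × E => (p.1, p.2.1)) (𝓝 0) (𝓝 0) := by
        have : Continuous (fun p : E × E × E => (p.1, p.2.1)) := by fun_prop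
        exact this.tendsto' _ _ rfl
      have c2 : Tendsto (fun p : E × E × E => p.2) (𝓝 0) (𝓝 0) := continuous_snd.tendsto' _ _ rfl
      filter_upwards [c1.eventually ham, c2.eventually ham] with p h1 h2
      simp only [m] at h1 h2 ⊢
      rw [h1, h2, mul_assoc]
  obtain ⟨ε, hε, hε0, hε', ⟨r₀, hr₀, hadd⟩, huniq⟩ := hm.exists_exp
  have hεc : Tendsto ε (𝓝 0) (𝓝 0) := by simpa [ContinuousAt, hε0] using hε.continuousAt
  have hstrict : HasFDerivAt ε ((ContinuousLinearEquiv.refl 𝕜 E : E ≃L[𝕜] E) : E →L[𝕜] E) 0 := hε'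
  let Λ := (hε.contDiffAt (n := ω)).toOpenPartialHomeomorph ε hstrict (by simp)
  have hΛ : (Λ : E → E) = ε := rfl
  have h0s : (0 : E) ∈ Λ.source :=
    (hε.contDiffAt (n := ω)).mem_toOpenPartialHomeomorph_source hstrict (by simp)
  have h0t : (0 : E) ∈ Λ.target := by
    have := Λ.map_source h0s
    rwa [hΛ, hε0] at this
  have hΛ0 : Λ.symm 0 = 0 := by
    have := Λ.left_inv h0s
    rwa [hΛ, hε0] at this
  have hΛan : AnalyticAt 𝕜 Λ.symm 0 := by
    have := (hε.contDiffAt (n := ω)).to_localInverse hstrict (by simp)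
    rw [hε0] at this
    exact this.analyticAt
  have hΛc0 : Tendsto Λ.symm (𝓝 0) (𝓝 0) := by
    simpa [ContinuousAt, hΛ0] using hΛan.continuousAt
  let exp : E → U := fun x => a (ε x)
  let log : U → E := fun u => Λ.symm (b u)
  have hexp0 : exp 0 = 1 := by simp [exp, hε0, ha0]
  have hle : ∀ᶠ x in 𝓝 (0 : E), log (exp x) = x := by
    filter_upwards [hεc.eventually hba, Λ.open_source.mem_nhds h0s] with x h1 h2
    simp only [log, exp, h1]
    exact Λ.left_inv h2
  have hel : ∀ᶠ u in 𝓝 (1 : U), exp (log u) = u := by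
    filter_upwards [hab, hbc0.eventually (Λ.open_target.mem_nhds h0t)] with u h1 h2
    have : ε (Λ.symm (b u)) = b u := Λ.right_inv h2
    simp only [log, exp, this, h1]
  have hexpc : ∀ᶠ x in 𝓝 (0 : E), ContinuousAt exp x := by
    filter_upwards [hεc.eventually hac, hε.eventually_analyticAt] with x h1 h2
    exact ContinuousAt.comp (g := a) (f := ε) h1 h2.continuousAt
  have hlogc : ∀ᶠ u in 𝓝 (1 : U), ContinuousAt log u := by
    filter_upwards [hbc, hbc0.eventually hΛan.eventually_analyticAt] with u h1 h2
    exact ContinuousAt.comp (g := Λ.symm) (f := b) h2.continuousAt h1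
  have hexpt : Tendsto exp (𝓝 0) (𝓝 1) := hac0.comp hεc
  have hpair : Tendsto (fun p : E × E => (ε p.1, ε p.2)) (𝓝 0) (𝓝 0) := by
    have h1 : Tendsto (fun p : E × E => ε p.1) (𝓝 0) (𝓝 0) :=
      hεc.comp (continuous_fst.tendsto' (0 : E × E) 0 rfl)
    have h2 : Tendsto (fun p : E × E => ε p.2) (𝓝 0) (𝓝 0) :=
      hεc.comp (continuous_snd.tendsto' (0 : E × E) 0 rfl)
    exact h1.prodMk_nhds h2
  obtain ⟨r₁, hr₁, hb₁⟩ := Metric.eventually_nhds_iff_ball.1 (hle.and hexpc)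
  obtain ⟨r₂, hr₂, hb₂⟩ := Metric.eventually_nhds_iff_ball.1 (hpair.eventually ham)
  let r := min r₀ (min r₁ r₂)
  have hr : 0 < r := by positivity
  have hexpadd : ∀ x, ‖x‖ < r → ∀ s ∈ Set.Icc (-1 : ℝ) 1, ∀ t ∈ Set.Icc (-1 : ℝ) 1,
      exp (s • x) * exp (t • x) = exp ((s + t) • x) := by
    intro x hx s hs t ht
    have h1 := hadd x (hx.trans_le (min_le_left _ _)) s hs t ht
    have hsm : ∀ s ∈ Set.Icc (-1 : ℝ) 1, ‖s • x‖ < r₂ := fun s hs => by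
      rw [norm_smul, Real.norm_eq_abs]
      refine (mul_le_of_le_one_left (norm_nonneg _) (abs_le.2 hs)).trans_lt ?_
      exact hx.trans_le ((min_le_right _ _).trans (min_le_right _ _))
    have h2 := hb₂ (s • x, t • x) (by
      rw [mem_ball_zero_iff, Prod.norm_def, max_lt_iff]
      exact ⟨hsm s hs, hsm t ht⟩)
    simp only [exp]
    rw [← h1, h2]
  refine ⟨⟨exp, log, r, hr, hexp0, fun x hx => ?_, hel, fun x hx => ?_, hlogc, ?_, hexpadd, ?_,
    ?_, ?_, ?_⟩⟩
  · exact (hb₁ x (by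
      rw [mem_ball_zero_iff]
      exact hx.trans_le ((min_le_right _ _).trans (min_le_left _ _)))).1
  · rw [mem_ball_zero_iff] at hx
    exact (hb₁ x (by
      rw [mem_ball_zero_iff]
      exact hx.trans_le ((min_le_right _ _).trans (min_le_left _ _)))).2.continuousWithinAt
  · have h1 : AnalyticAt 𝕜 (fun p : E × E => (ε p.1, ε p.2)) 0 :=
      AnalyticAt.prod (AnalyticAt.fun_comp (g := ε) (f := fun p : E × E => p.1) (x := 0) hε
        analyticAt_fst) (AnalyticAt.fun_comp (g := ε) (f := fun p : E × E => p.2) (x := 0) hε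
        analyticAt_snd)
    have h2 : AnalyticAt 𝕜 (fun p : E × E => m (ε p.1, ε p.2)) 0 :=
      AnalyticAt.fun_comp (g := m) (f := fun p : E × E => (ε p.1, ε p.2)) (x := 0)
        (by simp only [Prod.fst_zero, Prod.snd_zero, hε0]; exact hm.analyticAt) h1
    exact AnalyticAt.fun_comp (g := Λ.symm) (f := fun p : E × E => m (ε p.1, ε p.2)) (x := 0)
      (by simp only [Prod.fst_zero, Prod.snd_zero, hε0]
          rw [show m (0, 0) = 0 from hm.map_zero]
          exact hΛan) h2
  -- The curve `t ↦ u exp(tx) u⁻¹` is a local one-parameter group of velocity `Ad u x`, hence equals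
  -- `exp(t Ad u x)` for small `t`, but how small depends on `u`. Taking `t = 1/n` and `n`-th powers
  -- reaches `t = 1` with a radius that does not depend on `u`; every later estimate that is uniform
  -- over elements with bounded `Ad` uses this.
  · intro u x hx hux
    let y : ℝ → E := fun t => b (u * exp (t • x) * u⁻¹)
    have hsx : Tendsto (fun t : ℝ => t • x) (𝓝 0) (𝓝 0) := by
      have : Continuous fun t : ℝ => t • x := by fun_prop
      exact this.tendsto' 0 0 (by simp)
    have hconj : Tendsto (fun w : U => u * w * u⁻¹) (𝓝 1) (𝓝 1) := by
      have : Continuous fun w : U => u * w * u⁻¹ := by fun_prop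
      exact this.tendsto' _ _ (by simp)
    have hct : Tendsto (fun t : ℝ => u * exp (t • x) * u⁻¹) (𝓝 0) (𝓝 1) :=
      hconj.comp (hexpt.comp hsx)
    have hyb : ∀ᶠ t in 𝓝 (0 : ℝ), a (y t) = u * exp (t • x) * u⁻¹ := hct.eventually hab
    have hy0 : y 0 = 0 := by simp [y, hexp0, hb1]
    have hyd : HasDerivAt y (Ad 𝕜 u x) 0 := by
      have d1 : HasDerivAt (fun t : ℝ => e + ε (t • x)) x 0 := by
        have := hasDerivAt_comp_smul (𝕜 := 𝕜) (f := ε) (x := x) (t := 0)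
          (by rw [zero_smul]; exact hε'.differentiableAt)
        rw [zero_smul, hε'.fderiv] at this
        exact this.const_add e
      have d2 := (hasFDerivAt_Ad 𝕜 (E := E) u).restrictScalars ℝ
      have d3 := HasFDerivAt.comp_hasDerivAt (0 : ℝ) (f := fun t : ℝ => e + ε (t • x))
        (l := fun y => φ (u * φ.symm y * u⁻¹)) (l' := (Ad 𝕜 u).restrictScalars ℝ)
        (by simpa [hε0] using d2) d1
      exact d3.sub_const e
    have hyloc : ∀ᶠ p in 𝓝 (0 : ℝ × ℝ), y (p.1 + p.2) = m (y p.1, y p.2) := by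
      have c1 : Tendsto (fun p : ℝ × ℝ => p.1) (𝓝 0) (𝓝 0) := continuous_fst.tendsto' _ _ rfl
      have c2 : Tendsto (fun p : ℝ × ℝ => p.2) (𝓝 0) (𝓝 0) := continuous_snd.tendsto' _ _ rfl
      have hI : Set.Icc (-1 : ℝ) 1 ∈ 𝓝 (0 : ℝ) := Icc_mem_nhds (by norm_num) (by norm_num)
      filter_upwards [c1.eventually hyb, c2.eventually hyb, c1.eventually hI, c2.eventually hI]
        with p h1 h2 h3 h4
      simp only [m, h1, h2]
      simp only [y]
      rw [← hexpadd x hx _ h3 _ h4]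
      congr 1
      group
    have hfin := (huniq y (Ad 𝕜 u x) hy0 hyd hyloc).and hyb
    have hlim : Tendsto (fun n : ℕ => (1 : ℝ) / n) atTop (𝓝 0) := tendsto_one_div_atTop_nhds_zero_nat
    obtain ⟨n, hn, hn0⟩ := ((hlim.eventually hfin).and (eventually_gt_atTop 0)).exists
    have hn' : (n : ℝ) ≠ 0 := by exact_mod_cast hn0.ne'
    have e1 : exp (((1 : ℝ) / n) • Ad 𝕜 u x) = u * exp (((1 : ℝ) / n) • x) * u⁻¹ := by
      rw [← hn.2, hn.1]
    have p1 := exp_pow_of_exp_add hexp0 (hexpadd x hx) n hn0 n le_rfl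
    have p2 := exp_pow_of_exp_add hexp0 (hexpadd _ hux) n hn0 n le_rfl
    rw [div_self hn', one_smul] at p1 p2
    rw [← p2, e1, conj_pow, p1]
  · have h1 : AnalyticAt 𝕜 (fun x => e + ε x) 0 := analyticAt_const.add hε
    refine h1.congr ?_
    filter_upwards [hεc.eventually hba] with x hx
    have : φ (a (ε x)) - e = ε x := hx
    exact (eq_add_of_sub_eq' this).symm
  · have h1 : HasFDerivAt (fun x => e + ε x) (ContinuousLinearMap.id 𝕜 E) 0 := hε'.const_add e
    refine h1.congr_of_eventuallyEq ?_
    filter_upwards [hεc.eventually hba] with x hx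
    have : φ (a (ε x)) - e = ε x := hx
    exact eq_add_of_sub_eq' this
  · have h1 : AnalyticAt 𝕜 (fun y => Λ.symm (y - e)) e :=
      AnalyticAt.fun_comp (g := Λ.symm) (f := fun y => y - e) (by simpa using hΛan)
        (by fun_prop)
    refine h1.congr ?_
    filter_upwards [φ.open_target.mem_nhds het] with y hy
    change Λ.symm (y - e) = Λ.symm (φ (φ.symm y) - e)
    rw [φ.right_inv hy]

end AlmostMorphism

end

/-! ### The adjoint representation and products in exponential coordinates. -/

noncomputable section

namespace AlmostMorphism

set_option linter.unusedSectionVars false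

section AdRep

variable (𝕜 : Type*) [RCLike 𝕜] {E : Type*} [NormedAddCommGroup E] [NormedSpace 𝕜 E]
  {U : Type*} [Group U] [TopologicalSpace U] [IsTopologicalGroup U] [ChartedSpace E U]
  [LieGroup 𝓘(𝕜, E) ω U]

theorem Ad_one : Ad 𝕜 (1 : U) = ContinuousLinearMap.id 𝕜 E := by
  have h1 := hasFDerivAt_Ad 𝕜 (E := E) (1 : U)
  have h2 : HasFDerivAt (fun y => chartAt E (1 : U) (1 * (chartAt E (1 : U)).symm y * 1⁻¹))
      (ContinuousLinearMap.id 𝕜 E) (chartAt E (1 : U) 1) := by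
    refine (hasFDerivAt_id _).congr_of_eventuallyEq ?_
    filter_upwards [(chartAt E (1 : U)).open_target.mem_nhds (mem_chart_target E (1 : U))]
      with y hy
    simp [(chartAt E (1 : U)).right_inv hy]
  exact h1.unique h2

theorem Ad_mul (u v : U) : Ad 𝕜 (u * v) = (Ad 𝕜 u).comp (Ad 𝕜 v : E →L[𝕜] E) := by
  set φ := chartAt E (1 : U) with hφ
  have h1 := hasFDerivAt_Ad 𝕜 (E := E) (u * v)
  have hu := hasFDerivAt_Ad 𝕜 (E := E) u
  have hv := hasFDerivAt_Ad 𝕜 (E := E) v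
  have e0 : φ (v * φ.symm (φ 1) * v⁻¹) = φ 1 := by
    rw [φ.left_inv (mem_chart_source E (1 : U))]
    simp
  have h2 := HasFDerivAt.comp (φ 1) (g := fun y => φ (u * φ.symm y * u⁻¹))
    (f := fun y => φ (v * φ.symm y * v⁻¹)) (by rw [e0]; exact hu) hv
  refine h1.unique (h2.congr_of_eventuallyEq ?_)
  have hc : Tendsto (fun y => v * φ.symm y * v⁻¹) (𝓝 (φ 1)) (𝓝 1) := by
    have h3 : Tendsto φ.symm (𝓝 (φ 1)) (𝓝 1) := by
      have := φ.continuousAt_symm (mem_chart_target E (1 : U))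
      rwa [ContinuousAt, φ.left_inv (mem_chart_source E (1 : U))] at this
    have h4 : Continuous fun w : U => v * w * v⁻¹ := by fun_prop
    exact (h4.tendsto' 1 1 (by simp)).comp h3
  filter_upwards [hc.eventually (φ.open_source.mem_nhds (mem_chart_source E (1 : U)))] with y hy
  change φ (u * v * φ.symm y * (u * v)⁻¹) = φ (u * φ.symm (φ (v * φ.symm y * v⁻¹)) * u⁻¹)
  rw [φ.left_inv hy]
  congr 1
  group

theorem Ad_mul_apply (u v : U) (x : E) : Ad 𝕜 (u * v) x = Ad 𝕜 u (Ad 𝕜 v x) := by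
  rw [Ad_mul]; rfl

@[simp]
theorem Ad_inv_Ad (u : U) (x : E) : Ad 𝕜 u⁻¹ (Ad 𝕜 u x) = x := by
  rw [← Ad_mul_apply, inv_mul_cancel, Ad_one]; rfl

@[simp]
theorem Ad_Ad_inv (u : U) (x : E) : Ad 𝕜 u (Ad 𝕜 u⁻¹ x) = x := by
  rw [← Ad_mul_apply, mul_inv_cancel, Ad_one]; rfl

end AdRep

/-- Differentiability is assumed, so the derivative is determined by its restrictions to the two
axes. -/
theorem hasFDerivAt_of_partial {𝕜 : Type*} [RCLike 𝕜] {X Y F : Type*} [NormedAddCommGroup X]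
    [NormedSpace 𝕜 X] [NormedAddCommGroup Y] [NormedSpace 𝕜 Y] [NormedAddCommGroup F]
    [NormedSpace 𝕜 F] {f : X × Y → F} {A : X →L[𝕜] F} {B : Y →L[𝕜] F}
    (hf : DifferentiableAt 𝕜 f 0) (hA : HasFDerivAt (fun x => f (x, 0)) A 0)
    (hB : HasFDerivAt (fun y => f (0, y)) B 0) :
    HasFDerivAt f (A.coprod B) 0 := by
  have h := hf.hasFDerivAt
  have h1 : HasFDerivAt (fun x => f (x, 0)) (fderiv 𝕜 f 0 ∘L ContinuousLinearMap.inl 𝕜 X Y) 0 :=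
    HasFDerivAt.comp (f := fun x : X => ((x, 0) : X × Y)) (g := f) (0 : X) h
      (hasFDerivAt_prodMk_left _ _)
  have h2 : HasFDerivAt (fun y => f (0, y)) (fderiv 𝕜 f 0 ∘L ContinuousLinearMap.inr 𝕜 X Y) 0 :=
    HasFDerivAt.comp (f := fun y : Y => ((0, y) : X × Y)) (g := f) (0 : Y) h
      (hasFDerivAt_prodMk_right _ _)
  have e : fderiv 𝕜 f 0 = A.coprod B := by
    rw [← h1.unique hA, ← h2.unique hB]
    ext p <;> simp
  exact e ▸ h

namespace LogChart

variable {𝕜 : Type*} [RCLike 𝕜] {E : Type*} [NormedAddCommGroup E] [NormedSpace 𝕜 E]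
  [NormedSpace ℝ E] {U : Type*} [Group U] [TopologicalSpace U] [IsTopologicalGroup U]
  [ChartedSpace E U] (L : LogChart 𝕜 E U)

theorem log_one : L.log 1 = 0 := by
  rw [← L.exp_zero]
  exact L.log_exp 0 (by simpa using L.radius_pos)

theorem exp_neg {x : E} (hx : ‖x‖ < L.radius) : L.exp (-x) = (L.exp x)⁻¹ := by
  have := L.exp_add x hx 1 (by norm_num) (-1) (by norm_num)
  simp only [one_smul, neg_smul, add_neg_cancel, zero_smul, L.exp_zero] at this
  exact (inv_eq_of_mul_eq_one_right this).symm

theorem tendsto_exp : Tendsto L.exp (𝓝 0) (𝓝 1) := by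
  have := L.continuousOn_exp.continuousAt (Metric.ball_mem_nhds 0 L.radius_pos)
  rwa [ContinuousAt, L.exp_zero] at this

theorem tendsto_log : Tendsto L.log (𝓝 1) (𝓝 0) := by
  have := L.continuousAt_log.self_of_nhds
  rwa [ContinuousAt, L.log_one] at this

theorem continuous_exp_comp {X : Type*} [TopologicalSpace X] {f : X → E} (hf : Continuous f)
    (h : ∀ x, ‖f x‖ < L.radius) : Continuous fun x => L.exp (f x) :=
  L.continuousOn_exp.comp_continuous hf fun x => by simpa using h x

theorem eventually_log_lt {δ : ℝ} (hδ : 0 < δ) :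
    ∀ᶠ u in 𝓝 (1 : U), ‖L.log u‖ < δ ∧ L.exp (L.log u) = u ∧ ContinuousAt L.log u := by
  have := L.tendsto_log.norm
  rw [norm_zero] at this
  filter_upwards [this.eventually (gt_mem_nhds hδ), L.exp_log, L.continuousAt_log]
    with u h1 h2 h3
  exact ⟨h1, h2, h3⟩

theorem eq_of_exp_eq {x y : E} (hx : ‖x‖ < L.radius) (hy : ‖y‖ < L.radius)
    (h : L.exp x = L.exp y) : x = y := by
  rw [← L.log_exp x hx, h, L.log_exp y hy]

/-- The product of four elements in exponential coordinates. -/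
def mul4 (p : E × E × E × E) : E :=
  L.log (L.exp p.1 * L.exp p.2.1 * L.exp p.2.2.1 * L.exp p.2.2.2)

/-- Products of analytic expressions in exponential coordinates are analytic. -/
theorem analyticAt_log_mul {X : Type*} [NormedAddCommGroup X] [NormedSpace 𝕜 X] {f g : X → U}
    {x : X} (hf : AnalyticAt 𝕜 (fun x => L.log (f x)) x) (hf1 : Tendsto f (𝓝 x) (𝓝 1))
    (hfx : f x = 1) (hg : AnalyticAt 𝕜 (fun x => L.log (g x)) x) (hg1 : Tendsto g (𝓝 x) (𝓝 1))
    (hgx : g x = 1) : AnalyticAt 𝕜 (fun x => L.log (f x * g x)) x := by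
  have h1 := AnalyticAt.fun_comp (g := fun p : E × E => L.log (L.exp p.1 * L.exp p.2))
    (f := fun x => (L.log (f x), L.log (g x))) (x := x)
    (by rw [hfx, hgx, L.log_one]; exact L.analyticAt_mul) (AnalyticAt.prod hf hg)
  refine h1.congr ?_
  filter_upwards [hf1.eventually L.exp_log, hg1.eventually L.exp_log] with y h2 h3
  simp only [h2, h3]

theorem analyticAt_log_exp {X : Type*} [NormedAddCommGroup X] [NormedSpace 𝕜 X] {f : X → E}
    {x : X} (hf : AnalyticAt 𝕜 f x) (hx : f x = 0) :
    AnalyticAt 𝕜 (fun x => L.log (L.exp (f x))) x := by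
  refine hf.congr ?_
  have h1 : Tendsto (fun y => ‖f y‖) (𝓝 x) (𝓝 0) := by
    have := hf.continuousAt.norm
    rw [ContinuousAt, hx] at this
    simpa using this
  filter_upwards [h1.eventually (gt_mem_nhds L.radius_pos)] with y hy
  exact (L.log_exp _ hy).symm

theorem tendsto_exp_comp {X : Type*} [TopologicalSpace X] {f : X → E} {x : X}
    (hf : ContinuousAt f x) (hx : f x = 0) : Tendsto (fun x => L.exp (f x)) (𝓝 x) (𝓝 1) := by
  refine L.tendsto_exp.comp ?_
  rwa [ContinuousAt, hx] at hf

theorem analyticAt_mul4 : AnalyticAt 𝕜 L.mul4 0 := by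
  have a1 : AnalyticAt 𝕜 (fun p : E × E × E × E => p.1) 0 := analyticAt_fst
  have b1 : AnalyticAt 𝕜 (fun p : E × E × E × E => p.2) 0 := analyticAt_snd
  have a2 : AnalyticAt 𝕜 (fun p : E × E × E × E => p.2.1) 0 :=
    AnalyticAt.fun_comp (g := Prod.fst) analyticAt_fst b1
  have b2 : AnalyticAt 𝕜 (fun p : E × E × E × E => p.2.2) 0 :=
    AnalyticAt.fun_comp (g := Prod.snd) analyticAt_snd b1
  have a3 : AnalyticAt 𝕜 (fun p : E × E × E × E => p.2.2.1) 0 :=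
    AnalyticAt.fun_comp (g := Prod.fst) analyticAt_fst b2
  have a4 : AnalyticAt 𝕜 (fun p : E × E × E × E => p.2.2.2) 0 :=
    AnalyticAt.fun_comp (g := Prod.snd) analyticAt_snd b2
  have t1 := L.tendsto_exp_comp a1.continuousAt rfl
  have t2 := L.tendsto_exp_comp a2.continuousAt rfl
  have t3 := L.tendsto_exp_comp a3.continuousAt rfl
  have t4 := L.tendsto_exp_comp a4.continuousAt rfl
  have e1 := L.analyticAt_log_mul (L.analyticAt_log_exp a1 rfl) t1 (by simp [L.exp_zero])
    (L.analyticAt_log_exp a2 rfl) t2 (by simp [L.exp_zero])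
  have t12 := t1.mul t2
  rw [mul_one] at t12
  have e2 := L.analyticAt_log_mul e1 t12 (by simp [L.exp_zero])
    (L.analyticAt_log_exp a3 rfl) t3 (by simp [L.exp_zero])
  have t123 := t12.mul t3
  rw [mul_one] at t123
  exact L.analyticAt_log_mul e2 t123 (by simp [L.exp_zero])
    (L.analyticAt_log_exp a4 rfl) t4 (by simp [L.exp_zero])

theorem mul4_zero : L.mul4 0 = 0 := by simp [mul4, L.exp_zero, L.log_one]

/-- The sum of the four components. -/
def sum4 (𝕜 E : Type*) [RCLike 𝕜] [NormedAddCommGroup E] [NormedSpace 𝕜 E] :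
    E × E × E × E →L[𝕜] E :=
  (ContinuousLinearMap.id 𝕜 E).coprod ((ContinuousLinearMap.id 𝕜 E).coprod
    ((ContinuousLinearMap.id 𝕜 E).coprod (ContinuousLinearMap.id 𝕜 E)))

@[simp]
theorem sum4_apply (p : E × E × E × E) :
    sum4 𝕜 E p = p.1 + (p.2.1 + (p.2.2.1 + p.2.2.2)) := by
  simp [sum4]

/-- When three of the arguments are `0` the product is a single `exp x`, whose logarithm is `x`;
hence every partial derivative is the identity. -/
theorem hasFDerivAt_mul4 : HasFDerivAt L.mul4 (sum4 𝕜 E) 0 := by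
  have hid : ∀ f : E → E, (∀ x, ‖x‖ < L.radius → f x = x) →
      HasFDerivAt f (ContinuousLinearMap.id 𝕜 E) 0 := fun f hf => by
    refine (hasFDerivAt_id (𝕜 := 𝕜) (0 : E)).congr_of_eventuallyEq ?_
    filter_upwards [Metric.ball_mem_nhds 0 L.radius_pos] with x hx
    exact hf x (by simpa using hx)
  have hd := L.analyticAt_mul4.differentiableAt
  have c1 : DifferentiableAt 𝕜 (fun q : E × E × E => L.mul4 (0, q)) 0 :=
    DifferentiableAt.comp (g := L.mul4) (f := fun q : E × E × E => ((0, q) : E × E × E × E)) 0 hd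
      (hasFDerivAt_prodMk_right _ _).differentiableAt
  have c2 : DifferentiableAt 𝕜 (fun q : E × E => L.mul4 (0, 0, q)) 0 :=
    DifferentiableAt.comp (g := fun q : E × E × E => L.mul4 (0, q))
      (f := fun q : E × E => ((0, q) : E × E × E)) 0 c1
      (hasFDerivAt_prodMk_right _ _).differentiableAt
  refine hasFDerivAt_of_partial hd (hid _ fun x hx => ?_) (hasFDerivAt_of_partial c1
    (hid _ fun x hx => ?_) (hasFDerivAt_of_partial c2 (hid _ fun x hx => ?_)
    (hid _ fun x hx => ?_))) <;>
  simp [mul4, L.exp_zero, L.log_exp x hx]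

/-- The deviation of the product from the sum is Lipschitz with small constant. -/
theorem eventually_mul4_lipschitz {κ : ℝ} (hκ : 0 < κ) :
    ∃ δ > 0, ∀ p q : E × E × E × E, ‖p‖ < δ → ‖q‖ < δ →
      ‖(L.mul4 p - sum4 𝕜 E p) - (L.mul4 q - sum4 𝕜 E q)‖ ≤ κ * ‖p - q‖ := by
  -- Strict differentiability at `0` is exactly an estimate for pairs of points near `0`, with an
  -- arbitrarily small Lipschitz constant.
  have hs : HasStrictFDerivAt L.mul4 (sum4 𝕜 E) 0 := by
    have := L.analyticAt_mul4.hasStrictFDerivAt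
    rwa [L.hasFDerivAt_mul4.fderiv] at this
  have h1 := hs.isLittleO.def hκ
  obtain ⟨δ, hδ, hb⟩ := Metric.eventually_nhds_iff_ball.1 h1
  refine ⟨δ, hδ, fun p q hp hq => ?_⟩
  have := hb (p, q) (by
    rw [Metric.mem_ball, dist_eq_norm]
    rw [show ((p, q) - ((0, 0) : (E × E × E × E) × (E × E × E × E))) = (p, q) by simp]
    rw [Prod.norm_def]
    exact max_lt hp hq)
  refine le_trans (le_of_eq ?_) this
  congr 1
  rw [map_sub]
  abel

theorem eventually_exp_mul4 {η : ℝ} (hη : 0 < η) : ∃ δ > 0, ∀ p : E × E × E × E, ‖p‖ < δ →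
    L.exp (L.mul4 p) = L.exp p.1 * L.exp p.2.1 * L.exp p.2.2.1 * L.exp p.2.2.2 ∧
      ‖L.mul4 p‖ < η := by
  have t : Tendsto (fun p : E × E × E × E =>
      L.exp p.1 * L.exp p.2.1 * L.exp p.2.2.1 * L.exp p.2.2.2) (𝓝 0) (𝓝 1) := by
    have h := ((((L.tendsto_exp_comp (x := (0 : E × E × E × E)) (f := fun p => p.1)
      (by fun_prop) rfl)).mul (L.tendsto_exp_comp (x := (0 : E × E × E × E)) (f := fun p => p.2.1)
      (by fun_prop) rfl)).mul (L.tendsto_exp_comp (x := (0 : E × E × E × E))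
      (f := fun p => p.2.2.1) (by fun_prop) rfl)).mul (L.tendsto_exp_comp
      (x := (0 : E × E × E × E)) (f := fun p => p.2.2.2) (by fun_prop) rfl)
    simpa using h
  obtain ⟨δ, hδ, hb⟩ := Metric.eventually_nhds_iff_ball.1
    (t.eventually (L.eventually_log_lt hη))
  refine ⟨δ, hδ, fun p hp => ?_⟩
  obtain ⟨h1, h2, -⟩ := hb p (by simpa using hp)
  exact ⟨h2, h1⟩

section

variable [LieGroup 𝓘(𝕜, E) ω U]

/-- By `exp_Ad`, `Ad (exp x)` is the derivative at `z = 0` of `log(exp x exp z exp(-x))`, which is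
jointly analytic in `(x, z)`. Analyticity is thus obtained for the operator norm, not only
pointwise. -/
theorem analyticAt_Ad_exp [CompleteSpace E] : 
    AnalyticAt 𝕜 (fun x => (Ad 𝕜 (L.exp x) : E →L[𝕜] E)) 0 := by
  let A : E × E → E := fun p => L.mul4 (p.1, p.2, -p.1, 0)
  have hA : AnalyticAt 𝕜 A 0 := by
    refine AnalyticAt.fun_comp (g := L.mul4) (f := fun p : E × E => (p.1, p.2, -p.1, (0 : E)))
      (by
        simp only [Prod.fst_zero, Prod.snd_zero, neg_zero]
        exact L.analyticAt_mul4) ?_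
    exact AnalyticAt.prod analyticAt_fst (AnalyticAt.prod analyticAt_snd
      (AnalyticAt.prod analyticAt_fst.neg analyticAt_const))
  have h1 : AnalyticAt 𝕜 (fun x : E => fderiv 𝕜 A (x, 0)) 0 :=
    AnalyticAt.fun_comp (f := fun x : E => ((x, 0) : E × E)) (g := fderiv 𝕜 A)
      (AnalyticAt.fderiv hA) (AnalyticAt.prod analyticAt_id analyticAt_const)
  have h2 : AnalyticAt 𝕜 (fun x : E => fderiv 𝕜 A (x, 0) ∘L ContinuousLinearMap.inr 𝕜 E E) 0 :=
    AnalyticAt.fun_comp (g := fun T : E × E →L[𝕜] E => T ∘L ContinuousLinearMap.inr 𝕜 E E)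
      (((ContinuousLinearMap.compL 𝕜 E (E × E) E).flip
        (ContinuousLinearMap.inr 𝕜 E E)).analyticAt _) h1
  refine h2.congr ?_
  have hd : ∀ᶠ x in 𝓝 (0 : E), DifferentiableAt 𝕜 A (x, 0) := by
    have : Tendsto (fun x : E => ((x, 0) : E × E)) (𝓝 0) (𝓝 0) := by
      have : Continuous fun x : E => ((x, 0) : E × E) := by fun_prop
      exact this.tendsto' _ _ rfl
    exact this.eventually (hA.eventually_analyticAt.mono fun _ h => h.differentiableAt)
  filter_upwards [hd, Metric.ball_mem_nhds 0 L.radius_pos] with x hx hxr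
  have hxr' : ‖x‖ < L.radius := by simpa using hxr
  have d1 : HasFDerivAt (fun z : E => A (x, z)) (fderiv 𝕜 A (x, 0) ∘L
      ContinuousLinearMap.inr 𝕜 E E) 0 :=
    HasFDerivAt.comp (f := fun z : E => ((x, z) : E × E)) (g := A) (0 : E) hx.hasFDerivAt
      (hasFDerivAt_prodMk_right _ _)
  have d2 : HasFDerivAt (fun z : E => A (x, z)) (Ad 𝕜 (L.exp x)) 0 := by
    refine (Ad 𝕜 (L.exp x)).hasFDerivAt.congr_of_eventuallyEq ?_
    have hs : ∀ᶠ z in 𝓝 (0 : E), ‖Ad 𝕜 (L.exp x) z‖ < L.radius := by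
      have : Continuous fun z : E => ‖Ad 𝕜 (L.exp x) z‖ := by fun_prop
      exact this.continuousAt.eventually_lt continuousAt_const (by simpa using L.radius_pos)
    filter_upwards [hs, Metric.ball_mem_nhds 0 L.radius_pos] with z h1 h2
    have h3 := L.exp_Ad (L.exp x) z (by simpa using h2) h1
    simp only [A, mul4, L.exp_zero, mul_one, L.exp_neg hxr']
    rw [← h3, L.log_exp _ h1]
  exact d1.unique d2

/-- Norm continuity at `1` comes from exponential coordinates, and multiplicativity transports it to
every `u`. -/
theorem continuous_Ad [CompleteSpace E] (L : LogChart 𝕜 E U) :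
    Continuous fun u : U => (Ad 𝕜 u : E →L[𝕜] E) := by
  have h1 : Tendsto (fun u : U => (Ad 𝕜 u : E →L[𝕜] E)) (𝓝 1)
      (𝓝 (ContinuousLinearMap.id 𝕜 E)) := by
    have h2 := L.analyticAt_Ad_exp.continuousAt.tendsto.comp L.tendsto_log
    rw [L.exp_zero, Ad_one] at h2
    refine h2.congr' ?_
    filter_upwards [L.exp_log] with u hu
    simp [hu]
  refine continuous_iff_continuousAt.2 fun u => ?_
  have h3 : Tendsto (fun v : U => u⁻¹ * v) (𝓝 u) (𝓝 1) := by
    have : Continuous fun v : U => u⁻¹ * v := by fun_prop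
    exact this.tendsto' _ _ (by simp)
  have h4 : Tendsto (fun v : U => (Ad 𝕜 u).comp (Ad 𝕜 (u⁻¹ * v) : E →L[𝕜] E)) (𝓝 u)
      (𝓝 ((Ad 𝕜 u).comp (ContinuousLinearMap.id 𝕜 E))) := by
    exact ((ContinuousLinearMap.compL 𝕜 E E E (Ad 𝕜 u)).continuous.tendsto _).comp (h1.comp h3)
  rw [ContinuousAt]
  convert! h4 using 1
  ext v : 1
  rw [← Ad_mul, mul_inv_cancel_left]

/-- `Ad ∘ exp` is Lipschitz near `0`. -/
theorem exists_lipschitz_Ad_exp [CompleteSpace E] : ∃ C > 0, ∃ δ > 0, ∀ x y : E, ‖x‖ < δ →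
    ‖y‖ < δ → ‖(Ad 𝕜 (L.exp x) : E →L[𝕜] E) - Ad 𝕜 (L.exp y)‖ ≤ C * ‖x - y‖ := by
  obtain ⟨K, s, hs, hK⟩ := (L.analyticAt_Ad_exp.contDiffAt (n := 1)).exists_lipschitzOnWith
  obtain ⟨δ, hδ, hb⟩ := Metric.mem_nhds_iff.1 hs
  refine ⟨K + 1, by positivity, δ, hδ, fun x y hx hy => ?_⟩
  have := hK.dist_le_mul x (hb (by simpa using hx)) y (hb (by simpa using hy))
  rw [dist_eq_norm, dist_eq_norm] at this
  refine this.trans ?_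
  gcongr
  linarith

end

end LogChart

end AlmostMorphism

end

/-! ### Pointwise operations on continuous maps and the gauge map. -/

noncomputable section

namespace AlmostMorphism

set_option linter.unusedSectionVars false

section Pointwise

variable (𝕜 : Type*) [RCLike 𝕜] {E F : Type*} [NormedAddCommGroup E] [NormedSpace 𝕜 E]
  [NormedAddCommGroup F] [NormedSpace 𝕜 F] {K K' : Type*} [TopologicalSpace K] [CompactSpace K]
  [TopologicalSpace K'] [CompactSpace K']

/-- Precomposition with a continuous map, as a continuous linear map. -/
def precompCLM (E : Type*) [NormedAddCommGroup E] [NormedSpace 𝕜 E] (a : C(K', K)) :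
    C(K, E) →L[𝕜] C(K', E) :=
  LinearMap.mkContinuous
    { toFun := fun f => f.comp a
      map_add' := fun _ _ => rfl
      map_smul' := fun _ _ => rfl } 1 (fun f => by
    rw [one_mul, ContinuousMap.norm_le _ (norm_nonneg _)]
    exact fun t => f.norm_coe_le_norm _)

@[simp]
theorem precompCLM_apply (a : C(K', K)) (f : C(K, E)) (k : K') :
    precompCLM 𝕜 E a f k = f (a k) := rfl

/-- Postcomposition with a continuous linear map, as a continuous linear map. -/
def postcompCLM (K : Type*) [TopologicalSpace K] [CompactSpace K] (T : E →L[𝕜] F) :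
    C(K, E) →L[𝕜] C(K, F) :=
  LinearMap.mkContinuous
    { toFun := fun f => ⟨fun k => T (f k), by fun_prop⟩
      map_add' := fun f g => by ext; simp
      map_smul' := fun c f => by ext; simp } ‖T‖ (fun f => by
    rw [ContinuousMap.norm_le _ (by positivity)]
    exact fun t => (T.le_opNorm _).trans (by gcongr; exact f.norm_coe_le_norm _))

@[simp]
theorem postcompCLM_apply (T : E →L[𝕜] F) (f : C(K, E)) (k : K) :
    postcompCLM 𝕜 K T f k = T (f k) := rfl

/-- Constant maps. -/
def constCLM (K : Type*) [TopologicalSpace K] [CompactSpace K] (E : Type*) [NormedAddCommGroup E]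
    [NormedSpace 𝕜 E] : E →L[𝕜] C(K, E) :=
  LinearMap.mkContinuous
    { toFun := fun e => ContinuousMap.const K e
      map_add' := fun _ _ => rfl
      map_smul' := fun _ _ => rfl } 1 (fun f => by
    rw [one_mul, ContinuousMap.norm_le _ (norm_nonneg _)]
    exact fun t => le_rfl)

@[simp]
theorem constCLM_apply (e : E) (k : K) : constCLM 𝕜 K E e k = e := rfl

/-- A pair of continuous maps as a continuous map to the product. -/
def pairCLM (K E F : Type*) [TopologicalSpace K] [CompactSpace K] [NormedAddCommGroup E]
    [NormedSpace 𝕜 E] [NormedAddCommGroup F] [NormedSpace 𝕜 F] :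
    C(K, E) × C(K, F) →L[𝕜] C(K, E × F) :=
  LinearMap.mkContinuous
    { toFun := fun p => p.1.prodMk p.2
      map_add' := fun _ _ => rfl
      map_smul' := fun _ _ => rfl } 1 (fun p => by
    rw [one_mul, ContinuousMap.norm_le _ (norm_nonneg _)]
    exact fun t => max_le_max (p.1.norm_coe_le_norm _) (p.2.norm_coe_le_norm _))

@[simp]
theorem pairCLM_apply (p : C(K, E) × C(K, F)) (k : K) : pairCLM 𝕜 K E F p k = (p.1 k, p.2 k) := rfl

/-- Pointwise application of a continuous bilinear map. -/
def bilinCLM {E' : Type*} [NormedAddCommGroup E'] [NormedSpace 𝕜 E'] (K : Type*)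
    [TopologicalSpace K] [CompactSpace K] (T : E →L[𝕜] F →L[𝕜] E') :
    C(K, E) →L[𝕜] C(K, F) →L[𝕜] C(K, E') :=
  LinearMap.mkContinuous₂
    (LinearMap.mk₂ 𝕜 (fun f g => (⟨fun k => T (f k) (g k), by fun_prop⟩ : C(K, E')))
      (fun _ _ _ => by ext; simp) (fun _ _ _ => by ext; simp) (fun _ _ _ => by ext; simp)
      (fun _ _ _ => by ext; simp)) ‖T‖ (fun f g => by
    refine (ContinuousMap.norm_le _ (by positivity)).2 fun k => ?_
    refine (T.le_opNorm₂ _ _).trans ?_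
    gcongr
    · exact f.norm_coe_le_norm k
    · exact g.norm_coe_le_norm k)

@[simp]
theorem bilinCLM_apply {E' : Type*} [NormedAddCommGroup E'] [NormedSpace 𝕜 E']
    (T : E →L[𝕜] F →L[𝕜] E') (f : C(K, E)) (g : C(K, F)) (k : K) :
    bilinCLM 𝕜 K T f g k = T (f k) (g k) := rfl

variable {𝕜} {X : Type*} [NormedAddCommGroup X] [NormedSpace 𝕜 X]

theorem analyticAt_pair {f : X → C(K, E)} {g : X → C(K, F)} {x : X} (hf : AnalyticAt 𝕜 f x)
    (hg : AnalyticAt 𝕜 g x) : AnalyticAt 𝕜 (fun x => pairCLM 𝕜 K E F (f x, g x)) x :=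
  AnalyticAt.fun_comp ((pairCLM 𝕜 K E F).analyticAt _) (AnalyticAt.prod hf hg)

theorem analyticAt_bilin {E' : Type*} [NormedAddCommGroup E'] [NormedSpace 𝕜 E']
    (T : E →L[𝕜] F →L[𝕜] E') {f : X → C(K, E)} {g : X → C(K, F)} {x : X} (hf : AnalyticAt 𝕜 f x)
    (hg : AnalyticAt 𝕜 g x) : AnalyticAt 𝕜 (fun x => bilinCLM 𝕜 K T (f x) (g x)) x :=
  AnalyticAt.fun_comp ((bilinCLM 𝕜 K T).analyticAt_bilinear _) (AnalyticAt.prod hf hg)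

theorem analyticAt_clm_comp (T : E →L[𝕜] F) {f : X → E} {x : X} (hf : AnalyticAt 𝕜 f x) :
    AnalyticAt 𝕜 (fun x => T (f x)) x :=
  AnalyticAt.fun_comp (T.analyticAt _) hf

end Pointwise

section Gauge

variable {𝕜 : Type*} [RCLike 𝕜] {E : Type*} [NormedAddCommGroup E] [NormedSpace 𝕜 E]
  [CompleteSpace E] [NormedSpace ℝ E] [IsScalarTower ℝ 𝕜 E]
  {U : Type*} [Group U] [TopologicalSpace U] [IsTopologicalGroup U]
  [ChartedSpace E U] [LieGroup 𝓘(𝕜, E) ω U]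
  {G : Type*} [Group G] [TopologicalSpace G] [IsTopologicalGroup G] [CompactSpace G]

variable (𝕜 E G) in
/-- The data attached to an almost morphism: the logarithm of its defect, and its adjoint action. -/
abbrev Data : Type _ := C(G × G, E) × C(G, E →L[𝕜] E)

/-- The quadruple of logarithms whose product is the defect of the corrected map. -/
def quad (p : Data 𝕜 E G) (β : C(G, E)) : C(G × G, E × E × E × E) :=
  -- For `σ = ρ exp β`, the element `σ(st)⁻¹ σ(s) σ(t)` factors as `exp(-β(st))`, then `ρ(st)⁻¹ ρ(s)
  -- ρ(t)`, then `ρ(t)⁻¹ exp(β(s)) ρ(t)`, then `exp(β(t))`.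
  pairCLM 𝕜 (G × G) E (E × E × E) (-precompCLM 𝕜 E ⟨fun q : G × G => q.1 * q.2, by fun_prop⟩ β,
    pairCLM 𝕜 (G × G) E (E × E) (p.1, pairCLM 𝕜 (G × G) E E
      (bilinCLM 𝕜 (G × G) (.id 𝕜 (E →L[𝕜] E)) (precompCLM 𝕜 (E →L[𝕜] E) ⟨Prod.snd, by fun_prop⟩ p.2)
        (precompCLM 𝕜 E ⟨Prod.fst, by fun_prop⟩ β),
      precompCLM 𝕜 E ⟨Prod.snd, by fun_prop⟩ β)))

@[simp]
theorem quad_apply (p : Data 𝕜 E G) (β : C(G, E)) (s t : G) :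
    quad p β (s, t) = (-β (s * t), p.1 (s, t), p.2 t (β s), β t) := rfl

variable (L : LogChart 𝕜 E U) (M : InvariantMean 𝕜 G E)

/-- The logarithm of the defect of the corrected map. -/
def defect (p : Data 𝕜 E G) (β : C(G, E)) : C(G × G, E) := superpose L.mul4 (quad p β)

/-- The map whose fixed points are the corrections. -/
def gaugeMap (v : Data 𝕜 E G × C(G, E)) : C(G, E) :=
  -- With `m` the mean of `β`, the last terms add `Ad(σ(t)⁻¹) m - m`. The averaged defect contains
  -- `-m + Ad(ρ(t)⁻¹) m + β(t)`; after subtraction only `(Ad(exp(-β(t))) - 1) Ad(ρ(t)⁻¹) m` is left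
  -- of these, which is of second order in `β`.
  v.2 - M.avgFst (defect L v.1 v.2) + bilinCLM 𝕜 G (.id 𝕜 (E →L[𝕜] E))
    (superpose (fun x => (Ad 𝕜 (L.exp x) : E →L[𝕜] E)) (-v.2))
    (bilinCLM 𝕜 G (.id 𝕜 (E →L[𝕜] E)) v.1.2 (constCLM 𝕜 G E (M.mean v.2)))
    - constCLM 𝕜 G E (M.mean v.2)

theorem analyticAt_quad (v : Data 𝕜 E G × C(G, E)) :
    AnalyticAt 𝕜 (fun v : Data 𝕜 E G × C(G, E) => quad v.1 v.2) v := by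
  have h1 : AnalyticAt 𝕜 (fun v : Data 𝕜 E G × C(G, E) => v.1.1) v :=
    AnalyticAt.fun_comp (g := Prod.fst) analyticAt_fst analyticAt_fst
  have h2 : AnalyticAt 𝕜 (fun v : Data 𝕜 E G × C(G, E) => v.1.2) v :=
    AnalyticAt.fun_comp (g := Prod.snd) analyticAt_snd analyticAt_fst
  have h3 : AnalyticAt 𝕜 (fun v : Data 𝕜 E G × C(G, E) => v.2) v := analyticAt_snd
  exact analyticAt_pair (analyticAt_clm_comp _ h3).neg (analyticAt_pair h1 (analyticAt_pair
    (analyticAt_bilin _ (analyticAt_clm_comp _ h2) (analyticAt_clm_comp _ h3))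
    (analyticAt_clm_comp _ h3)))

theorem norm_quad_apply_lt {δ C : ℝ} (hδ : 0 < δ) (hC : 1 ≤ C) {p : Data 𝕜 E G} {β : C(G, E)}
    (h1 : ‖p.1‖ < C * δ) (h2 : ‖p.2‖ < C) (h3 : ‖β‖ < δ) (k : G × G) :
    ‖quad p β k‖ < C * δ := by
  obtain ⟨s, t⟩ := k
  have hβ := fun s => (β.norm_coe_le_norm s).trans_lt h3
  have hd : δ ≤ C * δ := by nlinarith
  rw [quad_apply, Prod.norm_mk, Prod.norm_mk, Prod.norm_mk, norm_neg]
  refine max_lt ((hβ _).trans_le hd) (max_lt ((p.1.norm_coe_le_norm _).trans_lt h1)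
    (max_lt ?_ ((hβ _).trans_le hd)))
  calc ‖p.2 t (β s)‖ ≤ ‖p.2 t‖ * ‖β s‖ := (p.2 t).le_opNorm _
    _ ≤ C * ‖β s‖ := by gcongr; exact ((p.2.norm_coe_le_norm _).trans_lt h2).le
    _ < C * δ := by gcongr; exact hβ s

/-- The part of the averaged defect which is not linear in the logarithms. -/
theorem mean_defect (p : Data 𝕜 E G) (β : C(G, E)) (N : C(G × G, E))
    (hN : ∀ s t, N (s, t) = defect L p β (s, t) - LogChart.sum4 𝕜 E (quad p β (s, t))) (t : G) :
    M.mean (InvariantMean.sectionFst (defect L p β) t) =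
      M.mean (InvariantMean.sectionFst N t) - M.mean β + M.mean (InvariantMean.sectionFst p.1 t) +
        p.2 t (M.mean β) + β t := by
  have h1 : InvariantMean.sectionFst (defect L p β) t = InvariantMean.sectionFst N t
      - precompCLM 𝕜 E ⟨fun s => s * t, by fun_prop⟩ β + InvariantMean.sectionFst p.1 t
      + postcompCLM 𝕜 G (p.2 t) β + ContinuousMap.const G (β t) := by
    ext s
    simp [hN]
    abel
  -- Right invariance of the mean removes the dependence of `β(st)` on `t`.
  have h2 : M.mean (precompCLM 𝕜 E ⟨fun s => s * t, by fun_prop⟩ β) = M.mean β :=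
    M.congr_mul_right _ _ t fun s => rfl
  have h3 : M.mean (postcompCLM 𝕜 G (p.2 t) β) = p.2 t (M.mean β) :=
    M.comp_clm _ _ _ fun s => rfl
  rw [h1, map_add, map_add, map_add, map_sub, h2, h3, M.const]

theorem norm_quad_sub_le {δ C : ℝ} (hC : 1 ≤ C) {p p' : Data 𝕜 E G} {β β' : C(G, E)}
    (h2 : ‖p.2‖ < C) (h3 : ‖β'‖ < δ) (k : G × G) :
    ‖quad p β k - quad p' β' k‖ ≤ C * ‖β - β'‖ + ‖p.1 - p'.1‖ + δ * ‖p.2 - p'.2‖ := by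
  obtain ⟨s, t⟩ := k
  have hδ : 0 < δ := (norm_nonneg _).trans_lt h3
  have hβ := fun s => (β - β').norm_coe_le_norm s
  have hp := (p.1 - p'.1).norm_coe_le_norm (s, t)
  have hS := (p.2 - p'.2).norm_coe_le_norm t
  simp only [ContinuousMap.coe_sub, Pi.sub_apply] at hβ hp hS
  have hd : ∀ s, ‖β s - β' s‖ ≤ C * ‖β - β'‖ := fun s => by
    have := hβ s
    nlinarith [norm_nonneg (β - β')]
  have n1 : 0 ≤ ‖p.1 - p'.1‖ := norm_nonneg _
  have n2 : 0 ≤ C * ‖β - β'‖ := by positivity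
  have n3 : 0 ≤ δ * ‖p.2 - p'.2‖ := by positivity
  simp only [quad_apply, Prod.mk_sub_mk, Prod.norm_mk]
  refine max_le ?_ (max_le ?_ (max_le ?_ ?_))
  · rw [neg_sub_neg, norm_sub_rev]
    linarith [hd (s * t)]
  · linarith
  · have e : p.2 t (β s) - p'.2 t (β' s) = p.2 t (β s - β' s) + (p.2 t - p'.2 t) (β' s) := by
      simp
    rw [e]
    have a1 : ‖p.2 t (β s - β' s)‖ ≤ C * ‖β - β'‖ :=
      ((p.2 t).le_opNorm _).trans (by
        gcongr
        · exact ((p.2.norm_coe_le_norm _).trans_lt h2).le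
        · exact hβ s)
    have a2 : ‖(p.2 t - p'.2 t) (β' s)‖ ≤ δ * ‖p.2 - p'.2‖ :=
      ((p.2 t - p'.2 t).le_opNorm _).trans (by
        rw [mul_comm]
        gcongr
        exact ((β'.norm_coe_le_norm _).trans_lt h3).le)
    exact (norm_add_le _ _).trans (by linarith)
  · linarith [hd t]

/-- The residual `(A - 1) S m` is a product in which `A - 1` and `m` are both of order `δ` while `S`
is merely bounded, so its variation has small constants. To be applied with `A = Ad(exp(-β(t)))`, `S
= Ad(ρ(t)⁻¹)` and `m` the mean of `β`. -/
theorem norm_correction_sub_le {A A' S S' : E →L[𝕜] E} {m m' : E} {D δ C b e : ℝ} (hD : 0 ≤ D)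
    (hC : 0 ≤ C) (hδ : 0 ≤ δ) (hb : 0 ≤ b) (he : 0 ≤ e) (A1 : ‖A - A'‖ ≤ D * b)
    (A2 : ∀ x, ‖A' x - x‖ ≤ D * δ * ‖x‖) (S1 : ‖S‖ ≤ C) (S2 : ‖S - S'‖ ≤ e) (hm : ‖m‖ ≤ δ)
    (hm' : ‖m'‖ ≤ δ) (hmm : ‖m - m'‖ ≤ b) (hδ1 : δ * (16 * D * C) ≤ 1) (hδC : δ ≤ C) :
    ‖(A (S m) - S m) - (A' (S' m') - S' m')‖ ≤ 1 / 8 * b + 1 / 16 * e := by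
  have t3 : ‖(A - A') (S m)‖ ≤ 1 / 16 * b := by
    have h1 : ‖S m‖ ≤ C * δ := S.le_of_opNorm_le_of_le S1 hm
    refine ((A - A').le_of_opNorm_le_of_le A1 h1).trans ?_
    nlinarith
  have t4 : ‖A' (S (m - m') + (S - S') m') - (S (m - m') + (S - S') m')‖ ≤ 1 / 16 * b + 1 / 16 * e := by
    have h1 : ‖S (m - m')‖ ≤ C * b := S.le_of_opNorm_le_of_le S1 hmm
    have h2 : ‖(S - S') m'‖ ≤ e * δ := (S - S').le_of_opNorm_le_of_le S2 hm'
    have h3 : e * δ ≤ C * e := by nlinarith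
    refine (A2 _).trans ?_
    have h4 := norm_add_le_of_le h1 (h2.trans h3)
    have h5 : D * δ * ‖S (m - m') + (S - S') m'‖ ≤ D * δ * (C * b + C * e) := by gcongr
    nlinarith
  have e1 : (A (S m) - S m) - (A' (S' m') - S' m') =
      (A - A') (S m) + (A' (S (m - m') + (S - S') m') - (S (m - m') + (S - S') m')) := by
    simp only [ContinuousLinearMap.sub_apply, map_sub, map_add]
    abel
  rw [e1]
  exact (norm_add_le_of_le t3 t4).trans (by linarith)

set_option maxHeartbeats 800000 in
/-- Regularity and contraction properties of the gauge map. -/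
theorem exists_gaugeMap_bounds {C : ℝ} (hC : 1 ≤ C) : ∃ δ > 0,
    (∀ v : Data 𝕜 E G × C(G, E), ‖v.1.1‖ < C * δ → ‖v.1.2‖ < C → ‖v.2‖ < δ →
      AnalyticAt 𝕜 (gaugeMap L M) v ∧
      (∀ s t, defect L v.1 v.2 (s, t) = L.mul4 (quad v.1 v.2 (s, t))) ∧
      ∀ t, gaugeMap L M v t = v.2 t - M.mean (InvariantMean.sectionFst (defect L v.1 v.2) t) +
        Ad 𝕜 (L.exp (-v.2 t)) (v.1.2 t (M.mean v.2)) - M.mean v.2) ∧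
    ∀ v w : Data 𝕜 E G × C(G, E), ‖v.1.1‖ < C * δ → ‖v.1.2‖ < C → ‖v.2‖ < δ →
      ‖w.1.1‖ < C * δ → ‖w.1.2‖ < C → ‖w.2‖ < δ →
      ‖gaugeMap L M v - gaugeMap L M w‖ ≤
        1 / 4 * ‖v.2 - w.2‖ + 2 * ‖v.1.1 - w.1.1‖ + ‖v.1.2 - w.1.2‖ := by
  have hC0 : 0 < C := by linarith
  -- The quadruple varies by at most `C` times the variation of `β`, so this `κ` makes the nonlinear
  -- part of the defect contribute `1/8`; the residual of the correction contributes another `1/8`,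
  -- whence the constant `1/4`.
  obtain ⟨δ₁, hδ₁, hlip⟩ := L.eventually_mul4_lipschitz (κ := 1 / (8 * C)) (by positivity)
  obtain ⟨D, hD, δ₂, hδ₂, hAd⟩ := L.exists_lipschitz_Ad_exp
  obtain ⟨r₁, hr₁, -, hsup₁⟩ := exists_superpose_analyticAt (K := G × G) L.analyticAt_mul4
  obtain ⟨r₂, hr₂, -, hsup₂⟩ := exists_superpose_analyticAt (K := G) L.analyticAt_Ad_exp
  obtain ⟨δ, hδ, hδ'⟩ : ∃ δ > 0, δ ≤ δ₁ / C ∧ δ ≤ δ₂ ∧ δ ≤ r₁ / C ∧ δ ≤ r₂ ∧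
      δ ≤ 1 / (16 * D * C) ∧ δ ≤ 1 :=
    ⟨min (δ₁ / C) (min δ₂ (min (r₁ / C) (min r₂ (min (1 / (16 * D * C)) 1)))), by positivity,
      by simp, by simp, by simp, by simp, by simp, by simp⟩
  obtain ⟨l1, l2, l3, l4, l5, l6⟩ := hδ'
  rw [le_div_iff₀ (by positivity), mul_comm] at l1 l3
  rw [le_div_iff₀ (by positivity)] at l5
  have main : ∀ v : Data 𝕜 E G × C(G, E), ‖v.1.1‖ < C * δ → ‖v.1.2‖ < C → ‖v.2‖ < δ →
      AnalyticAt 𝕜 (gaugeMap L M) v ∧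
      (∀ s t, defect L v.1 v.2 (s, t) = L.mul4 (quad v.1 v.2 (s, t))) ∧
      ∀ t, gaugeMap L M v t = v.2 t - M.mean (InvariantMean.sectionFst (defect L v.1 v.2) t) +
        Ad 𝕜 (L.exp (-v.2 t)) (v.1.2 t (M.mean v.2)) - M.mean v.2 := by
    intro v h1 h2 h3
    have q := fun k => norm_quad_apply_lt hδ hC h1 h2 h3 k
    obtain ⟨s1, s2⟩ := hsup₁ (quad v.1 v.2) fun k => by
      rw [sub_zero]; exact (q k).trans_le l3
    obtain ⟨s3, s4⟩ := hsup₂ (-v.2) fun k => by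
      rw [sub_zero, ContinuousMap.neg_apply, norm_neg]
      exact ((v.2.norm_coe_le_norm k).trans_lt h3).trans_le l4
    refine ⟨?_, fun s t => s2 (s, t), fun t => ?_⟩
    · have k2 : AnalyticAt 𝕜 (fun v : Data 𝕜 E G × C(G, E) => v.2) v := analyticAt_snd
      have k12 : AnalyticAt 𝕜 (fun v : Data 𝕜 E G × C(G, E) => v.1.2) v :=
        AnalyticAt.fun_comp (g := Prod.snd) analyticAt_snd analyticAt_fst
      have km := analyticAt_clm_comp (constCLM 𝕜 G E) (analyticAt_clm_comp M.mean k2)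
      refine ((k2.sub (analyticAt_clm_comp _ ?_)).add (analyticAt_bilin _ ?_
        (analyticAt_bilin _ k12 km))).sub km
      · exact AnalyticAt.fun_comp (g := superpose L.mul4)
          (f := fun v : Data 𝕜 E G × C(G, E) => quad v.1 v.2) s1 (analyticAt_quad v)
      · exact AnalyticAt.fun_comp (g := superpose fun x => (Ad 𝕜 (L.exp x) : E →L[𝕜] E))
          (f := fun v : Data 𝕜 E G × C(G, E) => -v.2) s3 k2.neg
    · simp only [gaugeMap, ContinuousMap.sub_apply, ContinuousMap.add_apply, bilinCLM_apply,
        ContinuousLinearMap.id_apply, s4, constCLM_apply, InvariantMean.avgFst_apply,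
        ContinuousMap.neg_apply]
  refine ⟨δ, hδ, main, fun v w hv1 hv2 hv3 hw1 hw2 hw3 => ?_⟩
  let N : Data 𝕜 E G × C(G, E) → C(G × G, E) := fun v =>
    defect L v.1 v.2 - postcompCLM 𝕜 (G × G) (LogChart.sum4 𝕜 E) (quad v.1 v.2)
  have hN : ∀ v s t, N v (s, t) =
      defect L v.1 v.2 (s, t) - LogChart.sum4 𝕜 E (quad v.1 v.2 (s, t)) := fun v s t => rfl
  obtain ⟨-, dv, gv⟩ := main v hv1 hv2 hv3
  obtain ⟨-, dw, gw⟩ := main w hw1 hw2 hw3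
  rw [ContinuousMap.norm_le _ (by positivity)]
  intro t
  rw [ContinuousMap.sub_apply, gv, gw, mean_defect L M _ _ (N v) (hN v),
    mean_defect L M _ _ (N w) (hN w)]
  set b := ‖v.2 - w.2‖ with hb
  set c := ‖v.1.1 - w.1.1‖ with hc
  set e := ‖v.1.2 - w.1.2‖ with he
  have b0 : 0 ≤ b := norm_nonneg _
  have c0 : 0 ≤ c := norm_nonneg _
  have e0 : 0 ≤ e := norm_nonneg (v.1.2 - w.1.2)
  have t1 : ‖M.mean (InvariantMean.sectionFst (N v) t) - M.mean (InvariantMean.sectionFst (N w) t)‖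
      ≤ 1 / 8 * b + 1 / 8 * c + 1 / 8 * e := by
    rw [← map_sub]
    refine M.norm_le_of_forall (by positivity) fun s => ?_
    rw [ContinuousMap.sub_apply, InvariantMean.sectionFst_apply, InvariantMean.sectionFst_apply,
      hN, hN, dv, dw]
    refine (hlip _ _ ((norm_quad_apply_lt hδ hC hv1 hv2 hv3 _).trans_le l1)
      ((norm_quad_apply_lt hδ hC hw1 hw2 hw3 _).trans_le l1)).trans ?_
    calc 1 / (8 * C) * ‖quad v.1 v.2 (s, t) - quad w.1 w.2 (s, t)‖
        ≤ 1 / (8 * C) * (C * b + c + δ * e) := by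
          gcongr; exact norm_quad_sub_le hC hv2 hw3 _
      _ ≤ 1 / (8 * C) * (C * b + C * c + C * e) := by
          have : δ ≤ C := l6.trans hC
          gcongr
          nlinarith
      _ = _ := by field_simp
  have t2 : ‖M.mean (InvariantMean.sectionFst v.1.1 t) - M.mean (InvariantMean.sectionFst w.1.1 t)‖
      ≤ c := by
    rw [← map_sub]
    exact M.norm_le_of_forall (by positivity) fun s => (v.1.1 - w.1.1).norm_coe_le_norm _
  have mv : ‖M.mean v.2‖ < δ := (M.norm_le _).trans_lt hv3
  have mw : ‖M.mean w.2‖ < δ := (M.norm_le _).trans_lt hw3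
  have mvw : ‖M.mean v.2 - M.mean w.2‖ ≤ b := by
    rw [← map_sub]; exact M.norm_le _
  have Sv : ‖v.1.2 t‖ ≤ C := ((v.1.2.norm_coe_le_norm t).trans_lt hv2).le
  have Svw : ‖v.1.2 t - w.1.2 t‖ ≤ e := (v.1.2 - w.1.2).norm_coe_le_norm t
  have bv : ‖-v.2 t‖ < δ := by rw [norm_neg]; exact (v.2.norm_coe_le_norm t).trans_lt hv3
  have bw : ‖-w.2 t‖ < δ := by rw [norm_neg]; exact (w.2.norm_coe_le_norm t).trans_lt hw3
  have bvw : ‖-v.2 t - -w.2 t‖ ≤ b := by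
    rw [neg_sub_neg, norm_sub_rev]; exact (v.2 - w.2).norm_coe_le_norm t
  set Av : E →L[𝕜] E := Ad 𝕜 (L.exp (-v.2 t)) with hAv
  set Aw : E →L[𝕜] E := Ad 𝕜 (L.exp (-w.2 t)) with hAw
  have A1 : ‖Av - Aw‖ ≤ D * b :=
    (hAd _ _ (bv.trans_le l2) (bw.trans_le l2)).trans (by gcongr)
  have A2 : ∀ x, ‖Aw x - x‖ ≤ D * δ * ‖x‖ := fun x => by
    have := hAd (-w.2 t) 0 (bw.trans_le l2) (by simpa using hδ₂)
    rw [L.exp_zero, Ad_one, sub_zero] at this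
    have h2 : D * ‖-w.2 t‖ ≤ D * δ := by gcongr
    exact ContinuousLinearMap.le_of_opNorm_le _ (this.trans h2) x
  have t3 := norm_correction_sub_le hD.le (by linarith) hδ.le b0 e0 A1 A2 Sv Svw mv.le mw.le mvw
    (by linarith) (l6.trans hC)
  -- Here the linear terms in `β` cancel: what survives is the nonlinear part of the defect, the
  -- mean of the datum, and the residual of the correction.
  have split : v.2 t - (M.mean (InvariantMean.sectionFst (N v) t) - M.mean v.2 +
      M.mean (InvariantMean.sectionFst v.1.1 t) + v.1.2 t (M.mean v.2) + v.2 t) +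
      Av (v.1.2 t (M.mean v.2)) - M.mean v.2 -
      (w.2 t - (M.mean (InvariantMean.sectionFst (N w) t) - M.mean w.2 +
      M.mean (InvariantMean.sectionFst w.1.1 t) + w.1.2 t (M.mean w.2) + w.2 t) +
      Aw (w.1.2 t (M.mean w.2)) - M.mean w.2) =
      -(M.mean (InvariantMean.sectionFst (N v) t) - M.mean (InvariantMean.sectionFst (N w) t))
      - (M.mean (InvariantMean.sectionFst v.1.1 t) - M.mean (InvariantMean.sectionFst w.1.1 t))
      + ((Av (v.1.2 t (M.mean v.2)) - v.1.2 t (M.mean v.2)) -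
        (Aw (w.1.2 t (M.mean w.2)) - w.1.2 t (M.mean w.2))) := by
    abel
  rw [split]
  refine (norm_add_le_of_le (norm_sub_le_of_le ((norm_neg _).trans_le t1) t2) t3).trans ?_
  linarith

end Gauge

end AlmostMorphism

end

/-! ### Existence of the correction and vanishing of the defect. -/

noncomputable section

namespace AlmostMorphism

set_option linter.unusedSectionVars false

variable {𝕜 : Type*} [RCLike 𝕜] {E : Type*} [NormedAddCommGroup E] [NormedSpace 𝕜 E]
  [CompleteSpace E] [NormedSpace ℝ E] [IsScalarTower ℝ 𝕜 E]
  {U : Type*} [Group U] [TopologicalSpace U] [IsTopologicalGroup U]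
  [ChartedSpace E U] [LieGroup 𝓘(𝕜, E) ω U]
  {G : Type*} [Group G] [TopologicalSpace G] [IsTopologicalGroup G] [CompactSpace G]
  (L : LogChart 𝕜 E U) (M : InvariantMean 𝕜 G E)

/-- When the defect is trivial no correction is needed, whatever the adjoint action. This is the
reference point for all size estimates on fixed points. -/
theorem gaugeMap_zero (S : C(G, E →L[𝕜] E)) : gaugeMap L M ((0, S), 0) = 0 := by
  have h : defect L ((0, S) : Data 𝕜 E G) (0 : C(G, E)) = 0 :=
    superpose_eq fun k => by
      obtain ⟨s, t⟩ := k
      simp only [quad_apply, ContinuousMap.zero_apply, neg_zero, map_zero]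
      exact L.mul4_zero
  ext t
  simp [gaugeMap, h]

section

variable {P₁ P₂ X : Type*} [NormedAddCommGroup P₁] [NormedSpace 𝕜 P₁] [CompleteSpace P₁]
  [NormedAddCommGroup P₂] [NormedSpace 𝕜 P₂] [CompleteSpace P₂]
  [NormedAddCommGroup X] [NormedSpace 𝕜 X] [CompleteSpace X]

/-- Fixed points of an analytic family of contractions. -/
theorem exists_fixedPoint_family {Φ : (P₁ × P₂) × X → X} {δ C : ℝ} (hδ : 0 < δ) (hC : 1 ≤ C)
    (h1 : ∀ v, ‖v.1.1‖ < C * δ → ‖v.1.2‖ < C → ‖v.2‖ < δ → AnalyticAt 𝕜 Φ v)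
    (h2 : ∀ v w, ‖v.1.1‖ < C * δ → ‖v.1.2‖ < C → ‖v.2‖ < δ →
      ‖w.1.1‖ < C * δ → ‖w.1.2‖ < C → ‖w.2‖ < δ →
      ‖Φ v - Φ w‖ ≤ 1 / 4 * ‖v.2 - w.2‖ + 2 * ‖v.1.1 - w.1.1‖ + ‖v.1.2 - w.1.2‖)
    (h3 : ∀ S, Φ ((0, S), 0) = 0) : ∃ ε > 0, ∃ β : P₁ × P₂ → X, ε ≤ δ / 8 ∧
    ∀ p : P₁ × P₂, ‖p.1‖ < ε → ‖p.2‖ < C → ‖β p‖ < δ ∧ ‖β p‖ ≤ 3 * ‖p.1‖ ∧ AnalyticAt 𝕜 β p ∧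
      Φ (p, β p) = β p ∧ ∀ p' : P₁ × P₂, ‖p'.1‖ < ε → ‖p'.2‖ < C →
        ‖β p - β p'‖ ≤ 3 * ‖p.1 - p'.1‖ + 2 * ‖p.2 - p'.2‖ := by
  have hex : ∀ p : P₁ × P₂, ‖p.1‖ < δ / 8 → ‖p.2‖ < C →
      ∃ β : X, ‖β‖ < δ ∧ Φ (p, β) = β := by
    intro p hp1 hp2
    have hp1' : ‖p.1‖ < C * δ := by nlinarith
    -- Comparison with the fixed point at `p.1 = 0` shows that this ball is preserved: at most `δ/8`
    -- comes from `β` and `2 · δ/8` from `p.1`, in total less than `δ/2`.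
    let s : Set X := Metric.closedBall 0 (δ / 2)
    have hs : IsComplete s := Metric.isClosed_closedBall.isComplete
    have hsm : ∀ β ∈ s, ‖β‖ < δ := fun β hβ => by
      have : ‖β‖ ≤ δ / 2 := by simpa [s] using hβ
      linarith
    have hmaps : Set.MapsTo (fun β => Φ (p, β)) s s := fun β hβ => by
      have hβ' : ‖β‖ ≤ δ / 2 := by simpa [s] using hβ
      have := h2 (p, β) ((0, p.2), 0) hp1' hp2 (hsm β hβ) (by simpa using by positivity) hp2
        (by simpa using hδ)
      rw [h3] at this
      simp only [sub_zero, sub_self, norm_zero, add_zero] at this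
      rw [mem_closedBall_zero_iff]
      linarith
    have hcon : ContractingWith (1 / 4) (hmaps.restrict (fun β => Φ (p, β)) s s) := by
      refine ⟨by rw [← NNReal.coe_lt_coe]; norm_num, LipschitzWith.of_dist_le_mul fun β β' => ?_⟩
      have := h2 (p, β.1) (p, β'.1) hp1' hp2 (hsm _ β.2) hp1' hp2 (hsm _ β'.2)
      rw [Subtype.dist_eq, Subtype.dist_eq, dist_eq_norm, dist_eq_norm]
      simpa using this
    obtain ⟨y, hy, hfix, -⟩ := hcon.exists_fixedPoint' hs hmaps (x := 0) (by simp [s]; positivity)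
      (edist_ne_top _ _)
    exact ⟨y, hsm y hy, hfix⟩
  have huniq : ∀ (p p' : P₁ × P₂) (β β' : X), ‖p.1‖ < δ / 8 → ‖p.2‖ < C →
      ‖p'.1‖ < δ / 8 → ‖p'.2‖ < C → ‖β‖ < δ → ‖β'‖ < δ → Φ (p, β) = β →
      Φ (p', β') = β' →
      ‖β - β'‖ ≤ 4 / 3 * (2 * ‖p.1 - p'.1‖ + ‖p.2 - p'.2‖) := by
    intro p p' β β' a1 a2 a3 a4 a5 a6 a7 a8
    have := h2 (p, β) (p', β') (by change ‖p.1‖ < _; nlinarith) a2 a5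
      (by change ‖p'.1‖ < _; nlinarith) a4 a6
    rw [a7, a8] at this
    dsimp only at this
    linarith
  choose! β hβ1 hβ2 using hex
  refine ⟨δ / 8, by positivity, β, le_rfl, fun p hp1 hp2 => ?_⟩
  have hp1' : ‖p.1‖ < C * δ := by nlinarith
  have k1 := h1 (p, β p) hp1' hp2 (hβ1 p hp1 hp2)
  refine ⟨hβ1 p hp1 hp2, ?_, ?_, hβ2 p hp1 hp2, fun p' hp1' hp2' => ?_⟩
  · have := huniq p (0, p.2) (β p) 0 hp1 hp2 (by simpa using hδ) hp2 (hβ1 p hp1 hp2)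
      (by simpa using hδ) (hβ2 p hp1 hp2) (h3 _)
    simp only [sub_zero, sub_self, norm_zero, add_zero] at this
    linarith [norm_nonneg p.1]
  · have hder : ‖fderiv 𝕜 (Φ) (p, β p) ∘L
        ContinuousLinearMap.inr 𝕜 (P₁ × P₂) X‖ < 1 := by
      have hd : HasFDerivAt (fun b => Φ (p, b)) (fderiv 𝕜 (Φ) (p, β p) ∘L
          ContinuousLinearMap.inr 𝕜 (P₁ × P₂) X) (β p) :=
        HasFDerivAt.comp (f := fun b : X => (p, b)) (g := Φ) (β p)
          k1.differentiableAt.hasFDerivAt (hasFDerivAt_prodMk_right _ _)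
      have hl : LipschitzOnWith (1 / 4) (fun b => Φ (p, b)) (Metric.ball 0 δ) := by
        refine LipschitzOnWith.of_dist_le_mul fun b hb b' hb' => ?_
        have := h2 (p, b) (p, b') hp1' hp2 (by simpa using hb) hp1' hp2 (by simpa using hb')
        rw [dist_eq_norm, dist_eq_norm]
        simpa using this
      have := hd.le_of_lipschitzOn (Metric.isOpen_ball.mem_nhds
        (by simpa using hβ1 p hp1 hp2)) hl
      refine this.trans_lt ?_
      norm_num
    -- `β` was obtained point by point. Near `p` it coincides with the analytic family `ψ`, because
    -- both are fixed points in the ball of radius `δ`, where they are unique.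
    obtain ⟨ψ, ψ1, ψ2, ψ3, -⟩ := exists_analyticAt_fixedPoint k1 (hβ2 p hp1 hp2) hder
    refine ψ1.congr ?_
    have c1 : ∀ᶠ q in 𝓝 p, ‖q.1‖ < δ / 8 :=
      continuous_fst.norm.continuousAt.eventually_lt continuousAt_const hp1
    have c2 : ∀ᶠ q in 𝓝 p, ‖q.2‖ < C :=
      continuous_snd.norm.continuousAt.eventually_lt continuousAt_const hp2
    have c3 : ∀ᶠ q in 𝓝 p, ‖ψ q‖ < δ :=
      ψ1.continuousAt.norm.eventually_lt continuousAt_const (by rw [ψ2]; exact hβ1 p hp1 hp2)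
    filter_upwards [c1, c2, c3, ψ3] with q q1 q2 q3 q4
    have := huniq q q (ψ q) (β q) q1 q2 q1 q2 q3 (hβ1 q q1 q2) q4 (hβ2 q q1 q2)
    simp only [sub_self, norm_zero, add_zero, mul_zero] at this
    exact sub_eq_zero.1 (norm_le_zero_iff.1 this)
  · have := huniq p p' (β p) (β p') hp1 hp2 hp1' hp2' (hβ1 p hp1 hp2) (hβ1 p' hp1' hp2')
      (hβ2 p hp1 hp2) (hβ2 p' hp1' hp2')
    linarith [norm_nonneg (p.1 - p'.1), norm_nonneg (p.2 - p'.2)]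

end

/-- The correction of an almost morphism as a function of its data. -/
theorem exists_correction {C : ℝ} (hC : 1 ≤ C) : ∃ ε > 0, ∃ β : Data 𝕜 E G → C(G, E),
    ∀ p : Data 𝕜 E G, ‖p.1‖ < ε → ‖p.2‖ < C → ‖β p‖ ≤ 3 * ‖p.1‖ ∧ AnalyticAt 𝕜 β p ∧
      (∀ s t, defect L p (β p) (s, t) = L.mul4 (quad p (β p) (s, t))) ∧
      (∀ t, M.mean (InvariantMean.sectionFst (defect L p (β p)) t) =
        Ad 𝕜 (L.exp (-β p t)) (p.2 t (M.mean (β p))) - M.mean (β p)) ∧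
      ∀ p' : Data 𝕜 E G, ‖p'.1‖ < ε → ‖p'.2‖ < C →
        ‖β p - β p'‖ ≤ 3 * ‖p.1 - p'.1‖ + 2 * ‖p.2 - p'.2‖ := by
  obtain ⟨δ, hδ, h1, h2⟩ := exists_gaugeMap_bounds L M hC
  obtain ⟨ε, hε, β, hεδ, h⟩ := exists_fixedPoint_family hδ hC (fun v a b c => (h1 v a b c).1) h2
    (gaugeMap_zero L M)
  refine ⟨ε, hε, β, fun p hp1 hp2 => ?_⟩
  obtain ⟨a1, a2, a3, a4, a5⟩ := h p hp1 hp2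
  obtain ⟨-, k2, k3⟩ := h1 (p, β p) (by change ‖p.1‖ < _; nlinarith) hp2 a1
  refine ⟨a2, a3, k2, fun t => ?_, a5⟩
  have := k3 t
  rw [a4] at this
  dsimp only at this
  rw [← sub_eq_zero] at this ⊢
  rw [← this]
  abel

/-- A map whose defect is small, and a coboundary on average, is a morphism. -/
theorem exists_defect_eq_zero {C : ℝ} (hC : 1 ≤ C) : ∃ ε > 0, ∀ (σ : G → U) (d : C(G × G, E)) (m : E),
    ‖d‖ < ε → ‖m‖ < ε → (∀ t, ‖(Ad 𝕜 (σ t)⁻¹ : E →L[𝕜] E)‖ ≤ C) →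
    (∀ s t, L.exp (d (s, t)) = (σ (s * t))⁻¹ * σ s * σ t) →
    (∀ t, M.mean (InvariantMean.sectionFst d t) = Ad 𝕜 (σ t)⁻¹ m - m) → d = 0 := by
  have hC0 : 0 < C := by linarith
  obtain ⟨δ₁, hδ₁, hlip⟩ := L.eventually_mul4_lipschitz (κ := 1 / 4) (by positivity)
  obtain ⟨D, hD, δ₂, hδ₂, hAd⟩ := L.exists_lipschitz_Ad_exp
  obtain ⟨ε, hε, l1, l2, l3, l4⟩ : ∃ ε > 0, ε ≤ δ₁ ∧ ε ≤ δ₂ ∧ ε ≤ L.radius / C ∧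
      ε ≤ 1 / (4 * D * C) :=
    ⟨min δ₁ (min δ₂ (min (L.radius / C) (1 / (4 * D * C)))), by have := L.radius_pos; positivity,
      by simp, by simp, by simp, by simp⟩
  rw [le_div_iff₀ (by positivity)] at l3 l4
  have l5 : ε ≤ L.radius := by nlinarith
  refine ⟨ε, hε, fun σ d m hd hm hS hexp hmean => ?_⟩
  have hd' := fun k => (d.norm_coe_le_norm k).trans_lt hd
  let T : G → E →L[𝕜] E := fun t => Ad 𝕜 (σ t)⁻¹
  -- With `e(s, t) = σ(st)⁻¹ σ(s) σ(t)`, the cocycle identity is `e(st, u)⁻¹ e(s, tu) e(t, u) =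
  -- σ(u)⁻¹ e(s, t) σ(u)`. The fourth slot of `mul4` is idle.
  have hcoc : ∀ s t u, L.mul4 (-d (s * t, u), d (s, t * u), d (t, u), 0) = T u (d (s, t)) := by
    intro s t u
    have a1 : ‖T u (d (s, t))‖ < L.radius := by
      calc _ ≤ C * ‖d (s, t)‖ := (T u).le_of_opNorm_le (hS u) _
        _ < C * ε := by gcongr; exact hd' _
        _ ≤ L.radius := by linarith
    have a2 := L.exp_Ad (σ u)⁻¹ (d (s, t)) ((hd' _).trans_le l5) a1
    rw [LogChart.mul4, ← L.log_exp _ a1]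
    congr 1
    simp only [L.exp_zero, mul_one, L.exp_neg ((hd' _).trans_le l5), hexp]
    change _ = L.exp (Ad 𝕜 (σ u)⁻¹ (d (s, t)))
    rw [a2, hexp, mul_assoc s t u]
    group
  -- Average the cocycle identity over `s`. All means of `d` are coboundaries of `m`, and their
  -- terms cancel except for `T u (T t m) - T (t * u) m`; so `d (t, u)` is this difference minus the
  -- mean of the nonlinear part `N`. The latter is at most `‖d‖ / 4` by the choice of `κ`. The
  -- former is `(Ad(exp(-d(t, u))) - 1) T (t * u) m`, because `T` is multiplicative up to the
  -- defect, and is at most `‖d‖ / 4` since `m` is small.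
  have key : ∀ t u, ‖d (t, u)‖ ≤ 1 / 2 * ‖d‖ := by
    intro t u
    let f1 : C(G, E) := -precompCLM 𝕜 E ⟨fun s => s * t, by fun_prop⟩ (InvariantMean.sectionFst d u)
    let f2 : C(G, E) := InvariantMean.sectionFst d (t * u)
    let N : C(G, E) := postcompCLM 𝕜 G (T u) (InvariantMean.sectionFst d t) - f1 - f2
      - ContinuousMap.const G (d (t, u))
    have hN : ‖M.mean N‖ ≤ 1 / 4 * ‖d‖ := by
      refine M.norm_le_of_forall (by positivity) fun s => ?_
      have hq : ‖((-d (s * t, u), d (s, t * u), d (t, u), 0) : E × E × E × E)‖ ≤ ‖d‖ := by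
        simp only [Prod.norm_mk, norm_neg, norm_zero]
        exact max_le (d.norm_coe_le_norm _) (max_le (d.norm_coe_le_norm _)
          (max_le (d.norm_coe_le_norm _) (norm_nonneg _)))
      have := hlip _ 0 (hq.trans_lt (hd.trans_le l1)) (by simpa using hδ₁)
      rw [L.mul4_zero, map_zero, sub_zero, sub_zero, sub_zero, hcoc] at this
      refine le_trans (le_of_eq ?_) (this.trans (by gcongr))
      congr 1
      simp [N, f1, f2]
      abel
    have e1 : M.mean f1 = -(T u m - m) := by
      rw [map_neg, ← hmean u]
      congr 1
      exact M.congr_mul_right _ _ t fun s => rfl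
    have e2 : M.mean f2 = T (t * u) m - m := hmean _
    have e3 : M.mean (postcompCLM 𝕜 G (T u) (InvariantMean.sectionFst d t)) =
        T u (T t m - m) := by
      rw [← hmean t]
      exact M.comp_clm _ _ _ fun s => rfl
    have e4 : M.mean N = T u (T t m) - T (t * u) m - d (t, u) := by
      simp only [N, map_sub, e1, e2, e3, M.const]
      abel
    have e5 : T u (T t m) = Ad 𝕜 (L.exp (-d (t, u))) (T (t * u) m) := by
      simp only [T]
      rw [← Ad_mul_apply, ← Ad_mul_apply, L.exp_neg ((hd' _).trans_le l5), hexp]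
      congr 2
      group
    have e6 : ‖T u (T t m) - T (t * u) m‖ ≤ 1 / 4 * ‖d‖ := by
      have b1 := hAd (-d (t, u)) 0 (by rw [norm_neg]; exact (hd' _).trans_le l2)
        (by simpa using hδ₂)
      rw [L.exp_zero, Ad_one, sub_zero, norm_neg] at b1
      have b2 := ContinuousLinearMap.le_of_opNorm_le _ b1 (T (t * u) m)
      have b3 : ‖T (t * u) m‖ ≤ C * ε := (T (t * u)).le_of_opNorm_le_of_le (hS _) hm.le
      rw [e5]
      refine le_trans b2 ?_
      have b4 := d.norm_coe_le_norm (t, u)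
      calc _ ≤ D * ‖d‖ * (C * ε) := by gcongr
        _ ≤ _ := by nlinarith [norm_nonneg d]
    have e7 : d (t, u) = (T u (T t m) - T (t * u) m) - M.mean N := by rw [e4]; abel
    rw [e7]
    exact (norm_sub_le_of_le e6 hN).trans (by linarith)
  have : ‖d‖ ≤ 1 / 2 * ‖d‖ := (ContinuousMap.norm_le _ (by positivity)).2 fun k => key k.1 k.2
  exact norm_le_zero_iff.1 (by linarith)

end AlmostMorphism

end

/-! ### Almost morphisms, their data, and their correction to morphisms. -/

noncomputable section

namespace AlmostMorphism

set_option linter.unusedSectionVars false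

variable {𝕜 : Type*} [RCLike 𝕜] {E : Type*} [NormedAddCommGroup E] [NormedSpace 𝕜 E]
  [CompleteSpace E] [NormedSpace ℝ E] [IsScalarTower ℝ 𝕜 E]
  {U : Type*} [Group U] [TopologicalSpace U] [IsTopologicalGroup U]
  [ChartedSpace E U] [LieGroup 𝓘(𝕜, E) ω U]
  {G : Type*} [Group G] [TopologicalSpace G] [IsTopologicalGroup G] [CompactSpace G]

/-- A radius up to which the operations of the group are well-behaved in exponential coordinates,
also when applied pointwise to maps on `G`. -/
structure GoodRadius (L : LogChart 𝕜 E U) (G : Type*) [TopologicalSpace G] [CompactSpace G] where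
  /-- The radius. -/
  r : ℝ
  r_pos : 0 < r
  r_le : r ≤ L.radius
  /-- A Lipschitz constant for the adjoint action. -/
  D : ℝ
  D_pos : 0 < D
  exp_mul4 : ∀ p, ‖p‖ < r →
    L.exp (L.mul4 p) = L.exp p.1 * L.exp p.2.1 * L.exp p.2.2.1 * L.exp p.2.2.2
  norm_mul4_lt : ∀ p, ‖p‖ < r → ‖L.mul4 p‖ < L.radius
  exp_mem_source : ∀ p, ‖p‖ < r → L.exp (L.mul4 p) ∈ (chartAt E (1 : U)).source
  mul4_lipschitz : ∀ p q, ‖p‖ < r → ‖q‖ < r → ‖L.mul4 p - L.mul4 q‖ ≤ 5 * ‖p - q‖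
  Ad_lipschitz : ∀ x y, ‖x‖ < r → ‖y‖ < r →
    ‖(Ad 𝕜 (L.exp x) : E →L[𝕜] E) - Ad 𝕜 (L.exp y)‖ ≤ D * ‖x - y‖
  Ad_le : ∀ x, ‖x‖ < r → ‖(Ad 𝕜 (L.exp x) : E →L[𝕜] E)‖ ≤ 2
  superpose_mul4 : ∀ u : C(G × G, E × E × E × E), (∀ k, ‖u k‖ < r) →
    AnalyticAt 𝕜 (superpose L.mul4) u ∧ ∀ k, superpose L.mul4 u k = L.mul4 (u k)
  superpose_Ad : ∀ u : C(G, E), (∀ k, ‖u k‖ < r) →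
    AnalyticAt 𝕜 (superpose fun x => (Ad 𝕜 (L.exp x) : E →L[𝕜] E)) u ∧
      ∀ k, superpose (fun x => (Ad 𝕜 (L.exp x) : E →L[𝕜] E)) u k = Ad 𝕜 (L.exp (u k))
  superpose_chart : ∀ u : C(G, E × E × E × E), (∀ k, ‖u k‖ < r) →
    AnalyticAt 𝕜 (superpose fun p => chartAt E (1 : U) (L.exp (L.mul4 p))) u ∧
      ∀ k, superpose (fun p => chartAt E (1 : U) (L.exp (L.mul4 p))) u k =
        chartAt E (1 : U) (L.exp (L.mul4 (u k)))

theorem GoodRadius.nonempty (L : LogChart 𝕜 E U) (G : Type*) [TopologicalSpace G]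
    [CompactSpace G] : Nonempty (GoodRadius L G) := by
  obtain ⟨δ₁, hδ₁, hlip⟩ := L.eventually_mul4_lipschitz (κ := 1) (by positivity)
  obtain ⟨D, hD, δ₂, hδ₂, hAd⟩ := L.exists_lipschitz_Ad_exp
  obtain ⟨δ₃, hδ₃, hexp⟩ := L.eventually_exp_mul4 L.radius_pos
  have hsrc : ∀ᶠ x in 𝓝 (0 : E), L.exp x ∈ (chartAt E (1 : U)).source :=
    L.tendsto_exp.eventually
      ((chartAt E (1 : U)).open_source.mem_nhds (mem_chart_source E (1 : U)))
  obtain ⟨η, hη, hsrc'⟩ := Metric.eventually_nhds_iff_ball.1 hsrc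
  obtain ⟨δ₄, hδ₄, hexp'⟩ := L.eventually_exp_mul4 hη
  have hc : AnalyticAt 𝕜 (fun p => chartAt E (1 : U) (L.exp (L.mul4 p))) 0 :=
    AnalyticAt.fun_comp (g := fun x => chartAt E (1 : U) (L.exp x)) (f := L.mul4)
      (by rw [L.mul4_zero]; exact L.analyticAt_chart_exp) L.analyticAt_mul4
  obtain ⟨r₁, hr₁, -, hsup₁⟩ := exists_superpose_analyticAt (K := G × G) L.analyticAt_mul4
  obtain ⟨r₂, hr₂, -, hsup₂⟩ := exists_superpose_analyticAt (K := G) L.analyticAt_Ad_exp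
  obtain ⟨r₃, hr₃, -, hsup₃⟩ := exists_superpose_analyticAt (K := G) hc
  obtain ⟨r, hr, l0, l1, l2, l3, l4, l5, l6, l7, l8⟩ : ∃ r > 0, r ≤ L.radius ∧ r ≤ δ₁ ∧ r ≤ δ₂ ∧
      r ≤ δ₃ ∧ r ≤ δ₄ ∧ r ≤ r₁ ∧ r ≤ r₂ ∧ r ≤ r₃ ∧ r ≤ 1 / D :=
    ⟨min L.radius (min δ₁ (min δ₂ (min δ₃ (min δ₄ (min r₁ (min r₂ (min r₃ (1 / D)))))))),
      by have := L.radius_pos; positivity, by simp, by simp, by simp, by simp, by simp, by simp,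
      by simp, by simp, by simp⟩
  rw [le_div_iff₀ hD] at l8
  refine ⟨⟨r, hr, l0, D, hD, fun p hp => (hexp p (hp.trans_le l3)).1,
    fun p hp => (hexp p (hp.trans_le l3)).2,
    fun p hp => hsrc' _ (by simpa using (hexp' p (hp.trans_le l4)).2), fun p q hp hq => ?_,
    fun x y hx hy => hAd x y (hx.trans_le l2) (hy.trans_le l2), fun x hx => ?_,
    fun u hu => hsup₁ u fun k => by rw [sub_zero]; exact (hu k).trans_le l5,
    fun u hu => hsup₂ u fun k => by rw [sub_zero]; exact (hu k).trans_le l6,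
    fun u hu => hsup₃ u fun k => by rw [sub_zero]; exact (hu k).trans_le l7⟩⟩
  · have h1 := hlip p q (hp.trans_le l1) (hq.trans_le l1)
    -- For the sup norm the sum of the components is `4`-Lipschitz, and with `κ = 1` the remainder
    -- is `1`-Lipschitz: hence the constant `5`.
    have h2 : ‖LogChart.sum4 𝕜 E (p - q)‖ ≤ 4 * ‖p - q‖ := by
      rw [LogChart.sum4_apply]
      have a1 := norm_fst_le (p - q)
      have b1 := norm_snd_le (p - q)
      have a2 := norm_fst_le (p - q).2
      have b2 := norm_snd_le (p - q).2
      have a3 := norm_fst_le (p - q).2.2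
      have b3 := norm_snd_le (p - q).2.2
      refine (norm_add_le_of_le a1 (norm_add_le_of_le (a2.trans b1) (norm_add_le_of_le
        (a3.trans (b2.trans b1)) (b3.trans (b2.trans b1))))).trans ?_
      linarith
    have e : L.mul4 p - L.mul4 q = (L.mul4 p - LogChart.sum4 𝕜 E p -
        (L.mul4 q - LogChart.sum4 𝕜 E q)) + LogChart.sum4 𝕜 E (p - q) := by
      rw [map_sub]; abel
    rw [e]
    exact (norm_add_le_of_le h1 h2).trans (by linarith)
  · have h1 := hAd x 0 (hx.trans_le l2) (by simpa using hδ₂)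
    rw [L.exp_zero, Ad_one, sub_zero] at h1
    refine ContinuousLinearMap.opNorm_le_bound _ (by norm_num) fun z => ?_
    have h2 := ContinuousLinearMap.le_of_opNorm_le _ h1 z
    have h3 : ‖Ad 𝕜 (L.exp x) z - z‖ ≤ D * ‖x‖ * ‖z‖ := h2
    have h4 : D * ‖x‖ * ‖z‖ ≤ 1 * ‖z‖ := by
      gcongr
      nlinarith
    have h5 := norm_add_le_of_le (h3.trans h4) (le_refl ‖z‖)
    rw [sub_add_cancel] at h5
    linarith

/-- The elements of `U` close to `1`. -/
def nearOne (L : LogChart 𝕜 E U) (ε : ℝ) : Set U :=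
  {u | ‖L.log u‖ < ε ∧ L.exp (L.log u) = u ∧ ContinuousAt L.log u}

theorem nearOne_mem_nhds (L : LogChart 𝕜 E U) {ε : ℝ} (hε : 0 < ε) : nearOne L ε ∈ 𝓝 1 :=
  L.eventually_log_lt hε

/-- A continuous map with small coboundary and bounded adjoint action. -/
structure IsAlmost (L : LogChart 𝕜 E U) (C ε : ℝ) (ρ : C(G, U)) : Prop where
  cob : ∀ s t, coboundary ρ (s, t) ∈ nearOne L ε
  Ad_le : ∀ s, ‖(Ad 𝕜 (ρ s) : E →L[𝕜] E)‖ ≤ C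
  Ad_inv_lt : ∀ s, ‖(Ad 𝕜 (ρ s)⁻¹ : E →L[𝕜] E)‖ < C

theorem IsAlmost.mono {L : LogChart 𝕜 E U} {C ε ε' : ℝ} {ρ : C(G, U)} (h : IsAlmost L C ε ρ)
    (hε : ε ≤ ε') : IsAlmost L C ε' ρ :=
  ⟨fun s t => ⟨(h.cob s t).1.trans_le hε, (h.cob s t).2⟩, h.Ad_le, h.Ad_inv_lt⟩

open Classical in
/-- The pointwise logarithm of the coboundary. -/
def logCob (L : LogChart 𝕜 E U) (ρ : C(G, U)) : C(G × G, E) :=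
  if h : Continuous fun q => L.log (coboundary ρ q) then ⟨_, h⟩ else 0

theorem IsAlmost.logCob_apply {L : LogChart 𝕜 E U} {C ε : ℝ} {ρ : C(G, U)} (h : IsAlmost L C ε ρ)
    (q : G × G) : logCob L ρ q = L.log (coboundary ρ q) := by
  have hc : Continuous fun q => L.log (coboundary ρ q) :=
    continuous_iff_continuousAt.2 fun q =>
      ContinuousAt.comp (h.cob q.1 q.2).2.2 (coboundary ρ).continuous.continuousAt
  rw [logCob, dif_pos hc]
  rfl

/-- The adjoint action of the inverses of the values of `ρ`. -/
def adInv (L : LogChart 𝕜 E U) (ρ : C(G, U)) : C(G, E →L[𝕜] E) :=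
  ⟨fun t => Ad 𝕜 (ρ t)⁻¹, L.continuous_Ad.comp ρ.continuous.inv⟩

/-- The data attached to an almost morphism. -/
def toData (L : LogChart 𝕜 E U) (ρ : C(G, U)) : Data 𝕜 E G :=
  (bilinCLM 𝕜 (G × G) (.id 𝕜 (E →L[𝕜] E))
    (precompCLM 𝕜 (E →L[𝕜] E) ⟨fun q : G × G => q.1 * q.2, by fun_prop⟩ (adInv L ρ)) (logCob L ρ),
    adInv L ρ)

namespace IsAlmost

variable {L : LogChart 𝕜 E U} {C ε : ℝ} {ρ : C(G, U)} (h : IsAlmost L C ε ρ)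
include h

theorem toData_fst_apply (s t : G) :
    (toData L ρ).1 (s, t) = Ad 𝕜 (ρ (s * t))⁻¹ (L.log (coboundary ρ (s, t))) := by
  rw [← h.logCob_apply]
  rfl

theorem C_pos : 0 < C := (norm_nonneg _).trans_lt (h.Ad_inv_lt 1)

theorem ε_pos : 0 < ε := (norm_nonneg _).trans_lt (h.cob 1 1).1

theorem norm_toData_fst_apply_lt (q : G × G) : ‖(toData L ρ).1 q‖ < C * ε := by
  obtain ⟨s, t⟩ := q
  rw [h.toData_fst_apply]
  refine (ContinuousLinearMap.le_of_opNorm_le _ (h.Ad_inv_lt (s * t)).le _).trans_lt ?_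
  have := h.C_pos
  gcongr
  exact (h.cob s t).1

theorem norm_toData_fst_lt : ‖(toData L ρ).1‖ < C * ε :=
  (ContinuousMap.norm_lt_iff _ (mul_pos h.C_pos h.ε_pos)).2 h.norm_toData_fst_apply_lt

theorem norm_toData_snd_lt : ‖(toData L ρ).2‖ < C :=
  (ContinuousMap.norm_lt_iff _ h.C_pos).2 fun t => h.Ad_inv_lt t

theorem exp_toData_fst (hε : ε ≤ L.radius) (hCε : C * ε ≤ L.radius) (s t : G) :
    L.exp ((toData L ρ).1 (s, t)) = (ρ (s * t))⁻¹ * ρ s * ρ t := by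
  have h1 := h.norm_toData_fst_apply_lt (s, t)
  rw [h.toData_fst_apply] at h1 ⊢
  rw [L.exp_Ad _ _ ((h.cob s t).1.trans_le hε) (h1.trans_le hCε), (h.cob s t).2.1]
  simp only [coboundary, ContinuousMap.coe_mk]
  group

end IsAlmost

/-- A procedure turning almost morphisms into morphisms. -/
structure Corrector (L : LogChart 𝕜 E U) (M : InvariantMean 𝕜 G E) (C : ℝ) where
  /-- The bound on the coboundary. -/
  ε : ℝ
  ε_pos : 0 < ε
  /-- The correction as a function of the data. -/
  β : Data 𝕜 E G → C(G, E)
  norm_le : ∀ p, ‖p.1‖ < C * ε → ‖p.2‖ < C → ‖β p‖ ≤ 3 * ‖p.1‖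
  analyticAt : ∀ p, ‖p.1‖ < C * ε → ‖p.2‖ < C → AnalyticAt 𝕜 β p
  lipschitz : ∀ p p', ‖p.1‖ < C * ε → ‖p.2‖ < C → ‖p'.1‖ < C * ε → ‖p'.2‖ < C →
    ‖β p - β p'‖ ≤ 3 * ‖p.1 - p'.1‖ + 2 * ‖p.2 - p'.2‖
  map_mul : ∀ ρ : C(G, U), IsAlmost L C ε ρ → ∀ s t,
    ρ (s * t) * L.exp (β (toData L ρ) (s * t)) =
      ρ s * L.exp (β (toData L ρ) s) * (ρ t * L.exp (β (toData L ρ) t))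
  invariant : ∀ ρ : C(G, U), IsAlmost L C ε ρ → ∀ t,
    Ad 𝕜 (ρ t * L.exp (β (toData L ρ) t))⁻¹ (M.mean (β (toData L ρ))) = M.mean (β (toData L ρ))

/-- The data contain the coboundary conjugated by `ρ(st)⁻¹`, which costs a factor `C`; then `‖β‖ <
3Cε`, and one more factor `C` bounds the quadruple. The correction `σ` satisfies `‖Ad σ⁻¹‖ ≤ 2C`, so
vanishing of the defect is invoked with `2C`. Once the defect is `0`, the gauge equation becomes the
invariance of the mean of `β` under `Ad σ⁻¹`. -/
theorem Corrector.nonempty (L : LogChart 𝕜 E U) (M : InvariantMean 𝕜 G E) {C : ℝ} (hC : 1 ≤ C) :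
    Nonempty (Corrector L M C) := by
  obtain ⟨R⟩ := GoodRadius.nonempty L G
  obtain ⟨ε₁, hε₁, β, hβ⟩ := exists_correction L M hC
  obtain ⟨ε₂, hε₂, hdef⟩ := exists_defect_eq_zero L M (C := 2 * C) (by linarith)
  obtain ⟨ε₃, hε₃, hexp⟩ := L.eventually_exp_mul4 (η := ε₂ / 2) (by positivity)
  have hR := R.r_pos
  have hC0 : 0 < C := by linarith
  obtain ⟨ε, hε, l1, l2, l3, l4⟩ : ∃ ε > 0, ε ≤ ε₁ / C ∧ ε ≤ R.r / (3 * C * C) ∧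
      ε ≤ ε₃ / (3 * C * C) ∧ ε ≤ ε₂ / (3 * C * C) :=
    ⟨min (ε₁ / C) (min (R.r / (3 * C * C)) (min (ε₃ / (3 * C * C)) (ε₂ / (3 * C * C)))),
      by positivity, by simp, by simp, by simp, by simp⟩
  rw [le_div_iff₀ (by positivity)] at l1 l2 l3 l4
  have hCε : C * ε ≤ 3 * C * ε := by nlinarith [mul_pos hC0 hε]
  have hCCε : 3 * C * ε ≤ 3 * C * C * ε := by nlinarith [mul_pos hC0 hε]
  have hεC : ε ≤ C * ε := by nlinarith
  have key : ∀ ρ : C(G, U), IsAlmost L C ε ρ → (∀ s t,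
      ρ (s * t) * L.exp (β (toData L ρ) (s * t)) =
        ρ s * L.exp (β (toData L ρ) s) * (ρ t * L.exp (β (toData L ρ) t))) ∧ ∀ t,
      Ad 𝕜 (ρ t * L.exp (β (toData L ρ) t))⁻¹ (M.mean (β (toData L ρ))) =
        M.mean (β (toData L ρ)) := by
    intro ρ hρ
    set p := toData L ρ with hp
    have hp1 := hρ.norm_toData_fst_lt
    obtain ⟨b1, -, b3, b4, -⟩ := hβ p (hp1.trans_le (by linarith)) hρ.norm_toData_snd_lt
    have nb : ‖β p‖ < 3 * C * ε := by
      have : ‖p.1‖ < C * ε := hp1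
      linarith
    have nbt := fun t => ((β p).norm_coe_le_norm t).trans_lt nb
    have hq : ∀ k, ‖quad p (β p) k‖ < C * (3 * C * ε) := fun k =>
      norm_quad_apply_lt (by positivity) hC (hp1.trans_le (by linarith)) hρ.norm_toData_snd_lt nb k
    have hexpβ : ∀ t, L.exp (-β p t) = (L.exp (β p t))⁻¹ := fun t =>
      L.exp_neg ((nbt t).trans_le (by linarith [R.r_le]))
    have hAdb : ∀ s t, ‖p.2 t (β p s)‖ < R.r := fun s t => by
      have h1 := norm_fst_le (quad p (β p) (s, t)).2.2
      have h2 := norm_snd_le (quad p (β p) (s, t)).2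
      have h3 := norm_snd_le (quad p (β p) (s, t))
      have h4 := hq (s, t)
      have h5 : ‖p.2 t (β p s)‖ ≤ ‖(quad p (β p) (s, t)).2.2‖ := h1
      linarith
    have hd : ∀ s t, L.exp (defect L p (β p) (s, t)) =
        (ρ (s * t) * L.exp (β p (s * t)))⁻¹ * (ρ s * L.exp (β p s)) * (ρ t * L.exp (β p t)) := by
      intro s t
      rw [b3, (hexp _ ((hq _).trans_le (by linarith))).1]
      have e1 : L.exp (p.2 t (β p s)) = (ρ t)⁻¹ * L.exp (β p s) * (ρ t)⁻¹⁻¹ :=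
        L.exp_Ad _ _ ((nbt s).trans_le (by linarith [R.r_le])) ((hAdb s t).trans_le R.r_le)
      have e2 := hρ.exp_toData_fst (by linarith [R.r_le]) (by linarith [R.r_le]) s t
      simp only [quad_apply, hexpβ, e1]
      rw [hp, e2]
      group
    have hAd : ∀ t, (Ad 𝕜 (ρ t * L.exp (β p t))⁻¹ : E →L[𝕜] E) =
        (Ad 𝕜 (L.exp (-β p t))).comp (p.2 t) := fun t => by
      rw [mul_inv_rev, Ad_mul, hexpβ]
      rfl
    -- The gauge equation `b4` is the hypothesis that the averaged defect is the coboundary of the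
    -- mean of `β`.
    have hz := hdef (fun t => ρ t * L.exp (β p t)) (defect L p (β p)) (M.mean (β p)) ?_
      ((M.norm_le _).trans_lt (nb.trans_le (by linarith))) ?_ hd ?_
    · refine ⟨fun s t => ?_, fun t => ?_⟩
      · have := hd s t
        rw [hz, ContinuousMap.zero_apply, L.exp_zero, mul_assoc, eq_inv_mul_iff_mul_eq,
          mul_one] at this
        exact this
      · have := b4 t
        rw [hz] at this
        have e : InvariantMean.sectionFst (0 : C(G × G, E)) t = 0 := rfl
        rw [e, map_zero, eq_comm, sub_eq_zero] at this
        rw [hAd]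
        exact this
    · refine ((ContinuousMap.norm_le _ (by positivity)).2 fun k => ?_).trans_lt
        (half_lt_self hε₂)
      rw [b3]
      exact (hexp _ ((hq _).trans_le (by linarith))).2.le
    · intro t
      rw [hAd]
      refine (ContinuousLinearMap.opNorm_comp_le _ _).trans ?_
      gcongr
      · exact R.Ad_le _ (by rw [norm_neg]; exact (nbt t).trans_le (by linarith))
      · exact (hρ.Ad_inv_lt t).le
    · intro t
      rw [b4, hAd]
      rfl
  exact ⟨⟨ε, hε, β, fun p a b => (hβ p (by linarith) b).1, fun p a b => (hβ p (by linarith) b).2.1,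
    fun p p' a b c d => (hβ p (by linarith) b).2.2.2.2 p' (by linarith) d,
    fun ρ h => (key ρ h).1, fun ρ h => (key ρ h).2⟩⟩

end AlmostMorphism

end

/-! ### Dependence of the correction and of the morphism on the almost morphism. -/

noncomputable section

namespace AlmostMorphism

set_option linter.unusedSectionVars false

variable {𝕜 : Type*} [RCLike 𝕜] {E : Type*} [NormedAddCommGroup E] [NormedSpace 𝕜 E]
  [CompleteSpace E] [NormedSpace ℝ E] [IsScalarTower ℝ 𝕜 E]
  {U : Type*} [Group U] [TopologicalSpace U] [IsTopologicalGroup U]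
  [ChartedSpace E U] [LieGroup 𝓘(𝕜, E) ω U]
  {G : Type*} [Group G] [TopologicalSpace G] [IsTopologicalGroup G] [CompactSpace G]

/-- The logarithms whose product is the defect of `exp h * ρ`. -/
def shiftQuad (p : Data 𝕜 E G) (h : C(G, E)) : C(G × G, E × E × E × E) :=
  -- Expanding `ρ'(st)⁻¹ ρ'(s) ρ'(t)` for `ρ' = exp(h) ρ` gives `exp(-h(st))` and `exp(h(s))`
  -- conjugated by `ρ(st)⁻¹`, the old defect, and `exp(h(t))` conjugated by `ρ(t)⁻¹`.
  pairCLM 𝕜 (G × G) E (E × E × E)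
    (-bilinCLM 𝕜 (G × G) (.id 𝕜 (E →L[𝕜] E))
        (precompCLM 𝕜 (E →L[𝕜] E) ⟨fun q : G × G => q.1 * q.2, by fun_prop⟩ p.2)
        (precompCLM 𝕜 E ⟨fun q : G × G => q.1 * q.2, by fun_prop⟩ h),
    pairCLM 𝕜 (G × G) E (E × E)
      (bilinCLM 𝕜 (G × G) (.id 𝕜 (E →L[𝕜] E))
        (precompCLM 𝕜 (E →L[𝕜] E) ⟨fun q : G × G => q.1 * q.2, by fun_prop⟩ p.2)
        (precompCLM 𝕜 E ⟨Prod.fst, by fun_prop⟩ h),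
      pairCLM 𝕜 (G × G) E E (p.1,
      bilinCLM 𝕜 (G × G) (.id 𝕜 (E →L[𝕜] E)) (precompCLM 𝕜 (E →L[𝕜] E) ⟨Prod.snd, by fun_prop⟩ p.2)
        (precompCLM 𝕜 E ⟨Prod.snd, by fun_prop⟩ h))))

@[simp]
theorem shiftQuad_apply (p : Data 𝕜 E G) (h : C(G, E)) (s t : G) :
    shiftQuad p h (s, t) = (-p.2 (s * t) (h (s * t)), p.2 (s * t) (h s), p.1 (s, t), p.2 t (h t)) :=
  rfl

theorem analyticAt_shiftQuad (p : Data 𝕜 E G) (h : C(G, E)) :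
    AnalyticAt 𝕜 (fun h : C(G, E) => shiftQuad p h) h := by
  have h0 : AnalyticAt 𝕜 (fun h : C(G, E) => h) h := analyticAt_id
  have h1 : AnalyticAt 𝕜 (fun _ : C(G, E) => p.1) h := analyticAt_const
  have h2 : AnalyticAt 𝕜 (fun _ : C(G, E) => p.2) h := analyticAt_const
  exact analyticAt_pair (analyticAt_bilin _ (analyticAt_clm_comp _ h2)
    (analyticAt_clm_comp _ h0)).neg (analyticAt_pair (analyticAt_bilin _ (analyticAt_clm_comp _ h2)
    (analyticAt_clm_comp _ h0)) (analyticAt_pair h1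
    (analyticAt_bilin _ (analyticAt_clm_comp _ h2) (analyticAt_clm_comp _ h0))))

variable (L : LogChart 𝕜 E U)

/-- The data of `exp h * ρ` in terms of the data of `ρ`. -/
def shift (p : Data 𝕜 E G) (h : C(G, E)) : Data 𝕜 E G :=
  (superpose L.mul4 (shiftQuad p h), bilinCLM 𝕜 G (ContinuousLinearMap.compL 𝕜 E E E) p.2
    (superpose (fun x => (Ad 𝕜 (L.exp x) : E →L[𝕜] E)) (-h)))

theorem norm_shiftQuad_apply_lt {r C : ℝ} {p : Data 𝕜 E G} {h : C(G, E)}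
    (hp : ‖p.1‖ < r) (hp2 : ‖p.2‖ < C) (hh : C * ‖h‖ < r) (k : G × G) :
    ‖shiftQuad p h k‖ < r := by
  obtain ⟨s, t⟩ := k
  have hC : 0 < C := (norm_nonneg p.2).trans_lt hp2
  have key : ∀ s t, ‖p.2 s (h t)‖ < r := fun s t =>
    ((p.2 s).le_of_opNorm_le_of_le ((p.2.norm_coe_le_norm s).trans hp2.le)
      (h.norm_coe_le_norm t)).trans_lt hh
  rw [shiftQuad_apply, Prod.norm_mk, Prod.norm_mk, Prod.norm_mk, norm_neg]
  exact max_lt (key _ _) (max_lt (key _ _) (max_lt ((p.1.norm_coe_le_norm _).trans_lt hp)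
    (key _ _)))

variable {L}

theorem analyticAt_shift (R : GoodRadius L G) {C : ℝ} {p : Data 𝕜 E G} {h : C(G, E)}
    (hp : ‖p.1‖ < R.r) (hp2 : ‖p.2‖ < C) (hh : C * ‖h‖ < R.r) (hh' : ‖h‖ < R.r) :
    AnalyticAt 𝕜 (shift L p) h := by
  refine AnalyticAt.prod ?_ (analyticAt_bilin _ analyticAt_const ?_)
  · exact AnalyticAt.fun_comp (g := superpose L.mul4) (f := shiftQuad p)
      (R.superpose_mul4 _ fun k => norm_shiftQuad_apply_lt hp hp2 hh k).1 (analyticAt_shiftQuad p h)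
  · exact AnalyticAt.fun_comp (g := superpose fun x => (Ad 𝕜 (L.exp x) : E →L[𝕜] E))
      (f := fun h : C(G, E) => -h) (R.superpose_Ad _ fun k => by
        rw [ContinuousMap.neg_apply, norm_neg]
        exact (h.norm_coe_le_norm k).trans_lt hh').1 analyticAt_id.neg

/-- Both sides have the same exponential and lie within the radius where `exp` is injective. Hence
the data of an almost morphism near `ρ₀` depend on it only through its coordinate `h` in the right
translate of the exponential chart, and they do so analytically. -/
theorem toData_eq_shift (R : GoodRadius L G) {C ε : ℝ} {ρ₀ ρ : C(G, U)} (h₀ : IsAlmost L C ε ρ₀)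
    (h₁ : IsAlmost L C ε ρ) (hε : ε ≤ R.r) (hCε : C * ε ≤ R.r) {h : C(G, E)}
    (hh : C * ‖h‖ < R.r) (hh' : ‖h‖ < R.r) (hρ : ∀ t, ρ t = L.exp (h t) * ρ₀ t) :
    toData L ρ = shift L (toData L ρ₀) h := by
  have hr := R.r_le
  have hht := fun t => ((h.norm_coe_le_norm t).trans_lt hh').trans_le hr
  have hq := norm_shiftQuad_apply_lt (h₀.norm_toData_fst_lt.trans_le hCε)
    h₀.norm_toData_snd_lt hh
  have hA : ∀ s t, L.exp ((toData L ρ₀).2 s (h t)) = (ρ₀ s)⁻¹ * L.exp (h t) * (ρ₀ s)⁻¹⁻¹ :=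
    fun s t => by
    refine L.exp_Ad _ _ (hht t) ?_
    exact (((toData L ρ₀).2 s).le_of_opNorm_le_of_le (h₀.Ad_inv_lt s).le
      (h.norm_coe_le_norm t)).trans_lt (hh.trans_le hr)
  refine Prod.ext ?_ ?_
  · ext q
    obtain ⟨s, t⟩ := q
    have e1 : (shift L (toData L ρ₀) h).1 (s, t) = L.mul4 (shiftQuad (toData L ρ₀) h (s, t)) :=
      (R.superpose_mul4 _ hq).2 (s, t)
    rw [e1]
    refine L.eq_of_exp_eq ((h₁.norm_toData_fst_apply_lt _).trans_le (hCε.trans hr))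
      (R.norm_mul4_lt _ (hq _)) ?_
    rw [h₁.exp_toData_fst (hε.trans hr) (hCε.trans hr), R.exp_mul4 _ (hq _), shiftQuad_apply]
    have e2 : L.exp (-(toData L ρ₀).2 (s * t) (h (s * t))) =
        (L.exp ((toData L ρ₀).2 (s * t) (h (s * t))))⁻¹ := by
      refine L.exp_neg ?_
      exact (((toData L ρ₀).2 (s * t)).le_of_opNorm_le_of_le (h₀.Ad_inv_lt _).le
        (h.norm_coe_le_norm _)).trans_lt (hh.trans_le hr)
    simp only [e2, hA, hρ]
    rw [h₀.exp_toData_fst (hε.trans hr) (hCε.trans hr)]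
    group
  · refine ContinuousMap.ext fun t => ?_
    have e1 : (shift L (toData L ρ₀) h).2 t =
        ((toData L ρ₀).2 t).comp (Ad 𝕜 (L.exp (-h t)) : E →L[𝕜] E) := by
      have := (R.superpose_Ad (-h) fun k => by
        rw [ContinuousMap.neg_apply, norm_neg]
        exact (h.norm_coe_le_norm k).trans_lt hh').2 t
      rw [ContinuousMap.neg_apply] at this
      rw [← this]
      rfl
    rw [e1, L.exp_neg (hht t)]
    change Ad 𝕜 (ρ t)⁻¹ = (Ad 𝕜 (ρ₀ t)⁻¹).comp _
    rw [hρ, mul_inv_rev, Ad_mul]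

theorem norm_shift_fst_sub_le (R : GoodRadius L G) {C : ℝ} {p : Data 𝕜 E G} {h : C(G, E)}
    (hp : ‖p.1‖ < R.r) (hp2 : ‖p.2‖ < C) (hh : C * ‖h‖ < R.r) :
    ‖(shift L p h).1 - (shift L p 0).1‖ ≤ 5 * (C * ‖h‖) := by
  have hC : 0 < C := (norm_nonneg p.2).trans_lt hp2
  refine (ContinuousMap.norm_le _ (by positivity)).2 fun k => ?_
  have hq := norm_shiftQuad_apply_lt hp hp2 hh
  have hq0 := norm_shiftQuad_apply_lt (h := 0) hp hp2 (by simpa using R.r_pos)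
  have e1 : (shift L p h).1 k = L.mul4 (shiftQuad p h k) := (R.superpose_mul4 _ hq).2 k
  have e2 : (shift L p 0).1 k = L.mul4 (shiftQuad p 0 k) := (R.superpose_mul4 _ hq0).2 k
  rw [ContinuousMap.sub_apply, e1, e2]
  refine (R.mul4_lipschitz _ _ (hq k) (hq0 k)).trans ?_
  gcongr
  obtain ⟨s, t⟩ := k
  have key : ∀ s t, ‖p.2 s (h t)‖ ≤ C * ‖h‖ := fun s t =>
    (p.2 s).le_of_opNorm_le_of_le ((p.2.norm_coe_le_norm s).trans hp2.le) (h.norm_coe_le_norm t)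
  simp only [shiftQuad_apply, ContinuousMap.zero_apply, map_zero, neg_zero, Prod.mk_sub_mk,
    sub_zero, sub_self, Prod.norm_mk, norm_neg, norm_zero]
  exact max_le (key _ _) (max_le (key _ _) (max_le (by positivity) (key _ _)))

theorem norm_toData_snd_sub_le (R : GoodRadius L G) {C ε : ℝ} {ρ₀ ρ : C(G, U)}
    (h₀ : IsAlmost L C ε ρ₀) {h : C(G, E)} (hh' : ‖h‖ < R.r)
    (hρ : ∀ t, ρ t = L.exp (h t) * ρ₀ t) :
    ‖(toData L ρ).2 - (toData L ρ₀).2‖ ≤ C * (R.D * ‖h‖) := by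
  have hC := h₀.C_pos
  have hD := R.D_pos
  refine (ContinuousMap.norm_le _ (by positivity)).2 fun t => ?_
  have ht := (h.norm_coe_le_norm t).trans_lt hh'
  have e : (toData L ρ).2 t - (toData L ρ₀).2 t =
      (Ad 𝕜 (ρ₀ t)⁻¹ : E →L[𝕜] E).comp ((Ad 𝕜 (L.exp (-h t)) : E →L[𝕜] E) - Ad 𝕜 (L.exp 0)) := by
    change (Ad 𝕜 (ρ t)⁻¹ : E →L[𝕜] E) - Ad 𝕜 (ρ₀ t)⁻¹ = _
    rw [hρ, mul_inv_rev, Ad_mul, L.exp_neg (ht.trans_le R.r_le), ContinuousLinearMap.comp_sub,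
      L.exp_zero, Ad_one, ContinuousLinearMap.comp_id]
  rw [ContinuousMap.sub_apply, e]
  refine (ContinuousLinearMap.opNorm_comp_le _ _).trans ?_
  have := R.Ad_lipschitz (-h t) 0 (by rwa [norm_neg]) (by simpa using R.r_pos)
  rw [sub_zero, norm_neg] at this
  have h2 : ‖h t‖ ≤ ‖h‖ := h.norm_coe_le_norm t
  gcongr
  · exact (h₀.Ad_inv_lt t).le
  · exact this.trans (by gcongr)

namespace Corrector

variable {M : InvariantMean 𝕜 G E} {C : ℝ} (K : Corrector L M C)

/-- The correction attached to an almost morphism. -/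
def corr (ρ : C(G, U)) : C(G, E) := K.β (toData L ρ)

theorem norm_corr_lt {ε : ℝ} {ρ : C(G, U)} (h : IsAlmost L C ε ρ) (hε : ε ≤ K.ε) :
    ‖K.corr ρ‖ < 3 * C * ε := by
  have h1 := (h.mono hε)
  have := K.norm_le _ h1.norm_toData_fst_lt h1.norm_toData_snd_lt
  have h2 := h.norm_toData_fst_lt
  unfold corr
  linarith

open Classical in
/-- The morphism attached to an almost morphism. -/
def morphism (ρ : C(G, U)) : G →ₜ* U :=
  if h : (∀ s t, ρ (s * t) * L.exp (K.corr ρ (s * t)) =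
      ρ s * L.exp (K.corr ρ s) * (ρ t * L.exp (K.corr ρ t))) ∧
      Continuous fun t => L.exp (K.corr ρ t) then
    ⟨MonoidHom.mk' (fun t => ρ t * L.exp (K.corr ρ t)) h.1, ρ.continuous.mul h.2⟩
  else 1

theorem morphism_apply {ε : ℝ} {ρ : C(G, U)} (h : IsAlmost L C ε ρ) (hε : ε ≤ K.ε)
    (hr : 3 * C * ε ≤ L.radius) (t : G) :
    K.morphism ρ t = ρ t * L.exp (K.corr ρ t) := by
  have h1 : (∀ s t, ρ (s * t) * L.exp (K.corr ρ (s * t)) =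
      ρ s * L.exp (K.corr ρ s) * (ρ t * L.exp (K.corr ρ t))) ∧
      Continuous fun t => L.exp (K.corr ρ t) :=
    ⟨K.map_mul ρ (h.mono hε), L.continuous_exp_comp (K.corr ρ).continuous fun t =>
      (((K.corr ρ).norm_coe_le_norm t).trans_lt (K.norm_corr_lt h hε)).trans_le hr⟩
  rw [morphism, dif_pos h1]
  rfl

/-- The logarithms whose product compares the morphisms attached to `ρ₀` and `exp h * ρ₀`. -/
def compareQuad (L : LogChart 𝕜 E U) (ρ₀ : C(G, U)) (h b b₀ : C(G, E)) : C(G, E × E × E × E) :=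
  pairCLM 𝕜 G E (E × E × E) (h, pairCLM 𝕜 G E (E × E)
    (bilinCLM 𝕜 G (.id 𝕜 (E →L[𝕜] E))
      ⟨fun t => (Ad 𝕜 (ρ₀ t) : E →L[𝕜] E), L.continuous_Ad.comp ρ₀.continuous⟩ b,
    pairCLM 𝕜 G E E (-bilinCLM 𝕜 G (.id 𝕜 (E →L[𝕜] E))
      ⟨fun t => (Ad 𝕜 (ρ₀ t) : E →L[𝕜] E), L.continuous_Ad.comp ρ₀.continuous⟩ b₀, 0)))

@[simp]
theorem compareQuad_apply (ρ₀ : C(G, U)) (h b b₀ : C(G, E)) (t : G) :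
    compareQuad L ρ₀ h b b₀ t = (h t, Ad 𝕜 (ρ₀ t) (b t), -Ad 𝕜 (ρ₀ t) (b₀ t), 0) := rfl

theorem norm_Ad_lt {ε b : ℝ} {ρ₀ : C(G, U)} (h₀ : IsAlmost L C ε ρ₀) {x : E} (hx : ‖x‖ < b) (t : G) :
    ‖Ad 𝕜 (ρ₀ t) x‖ < C * b := by
  have := h₀.C_pos
  exact (ContinuousLinearMap.le_of_opNorm_le _ (h₀.Ad_le t) x).trans_lt (by gcongr)

theorem norm_compareQuad_lt {ε r : ℝ} {ρ₀ ρ : C(G, U)} (h₀ : IsAlmost L C ε ρ₀)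
    (h₁ : IsAlmost L C ε ρ) (hε : ε ≤ K.ε) (hr : C * (3 * C * ε) ≤ r) {h : C(G, E)}
    (hh' : ‖h‖ < r) (t : G) : ‖compareQuad L ρ₀ h (K.corr ρ) (K.corr ρ₀) t‖ < r := by
  have b1 := fun t => ((K.corr ρ).norm_coe_le_norm t).trans_lt (K.norm_corr_lt h₁ hε)
  have b0 := fun t => ((K.corr ρ₀).norm_coe_le_norm t).trans_lt (K.norm_corr_lt h₀ hε)
  rw [compareQuad_apply, Prod.norm_mk, Prod.norm_mk, Prod.norm_mk, norm_neg, norm_zero]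
  exact max_lt ((h.norm_coe_le_norm t).trans_lt hh') (max_lt ((norm_Ad_lt h₀ (b1 t) t).trans_le hr)
    (max_lt ((norm_Ad_lt h₀ (b0 t) t).trans_le hr) ((norm_nonneg _).trans_lt hh')))

/-- With corrections `b` and `b₀`, the quotient of the morphisms is `exp(h) ρ₀ exp(b) exp(-b₀)
ρ₀⁻¹`; the conjugations by `ρ₀` move into the exponents by `exp_Ad`. -/
theorem exp_compareQuad (R : GoodRadius L G) {ε : ℝ} {ρ₀ ρ : C(G, U)} (hC : 1 ≤ C)
    (h₀ : IsAlmost L C ε ρ₀)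
    (h₁ : IsAlmost L C ε ρ) (hε : ε ≤ K.ε) (hr : C * (3 * C * ε) ≤ R.r) {h : C(G, E)}
    (hh' : ‖h‖ < R.r) (hρ : ∀ t, ρ t = L.exp (h t) * ρ₀ t) (t : G) :
    K.morphism ρ t * (K.morphism ρ₀ t)⁻¹ =
      L.exp (L.mul4 (compareQuad L ρ₀ h (K.corr ρ) (K.corr ρ₀) t)) := by
  have b1 := fun t => ((K.corr ρ).norm_coe_le_norm t).trans_lt (K.norm_corr_lt h₁ hε)
  have b0 := fun t => ((K.corr ρ₀).norm_coe_le_norm t).trans_lt (K.norm_corr_lt h₀ hε)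
  have hrr := R.r_le
  have hr3 : 3 * C * ε ≤ L.radius := by
    have : 0 < 3 * C * ε := (norm_nonneg _).trans_lt (b1 1)
    nlinarith
  rw [R.exp_mul4 _ (K.norm_compareQuad_lt h₀ h₁ hε hr hh' t), K.morphism_apply h₀ hε hr3,
    K.morphism_apply h₁ hε hr3, compareQuad_apply]
  simp only [L.exp_zero]
  rw [L.exp_neg ((norm_Ad_lt h₀ (b0 t) t).trans_le (hr.trans hrr)),
    L.exp_Ad _ _ ((b1 t).trans_le hr3) ((norm_Ad_lt h₀ (b1 t) t).trans_le (hr.trans hrr)),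
    L.exp_Ad _ _ ((b0 t).trans_le hr3) ((norm_Ad_lt h₀ (b0 t) t).trans_le (hr.trans hrr)), hρ]
  group

/-- Lipschitz dependence of the correction and of the morphism on the almost morphism. -/
theorem norm_corr_sub_le (R : GoodRadius L G) {ε : ℝ} {ρ₀ ρ : C(G, U)}
    (hC : 1 ≤ C) (h₀ : IsAlmost L C ε ρ₀)
    (h₁ : IsAlmost L C ε ρ) (hε : ε ≤ K.ε) (hr : C * (3 * C * ε) ≤ R.r) {h : C(G, E)}
    (hh : C * ‖h‖ < R.r) (hρ : ∀ t, ρ t = L.exp (h t) * ρ₀ t) :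
    ‖K.corr ρ - K.corr ρ₀‖ ≤ (15 * C + 2 * C * R.D) * ‖h‖ := by
  have hε0 := h₀.ε_pos
  have hh' : ‖h‖ < R.r := by nlinarith [norm_nonneg h]
  have hCε : C * ε ≤ R.r := by nlinarith [mul_pos h₀.C_pos hε0]
  have hε' : ε ≤ R.r := by nlinarith
  have e1 := toData_eq_shift R h₀ h₁ hε' hCε hh hh' hρ
  have e0 := toData_eq_shift R (h := 0) h₀ h₀ hε' hCε (by simpa using R.r_pos)
    (by simpa using R.r_pos) (fun t => by simp [L.exp_zero])
  have a1 := norm_shift_fst_sub_le R (h₀.norm_toData_fst_lt.trans_le hCε) h₀.norm_toData_snd_lt hh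
  have a2 := norm_toData_snd_sub_le R h₀ hh' hρ
  rw [← e1, ← e0] at a1
  have l0 := h₀.mono hε
  have l1 := h₁.mono hε
  -- The constant is `3 · 5C` from the first datum plus `2 · C D` from the second.
  have := K.lipschitz _ _ l1.norm_toData_fst_lt l1.norm_toData_snd_lt l0.norm_toData_fst_lt
    l0.norm_toData_snd_lt
  unfold corr
  linarith

theorem norm_mul4_compareQuad_le (R : GoodRadius L G) {ε : ℝ} {ρ₀ ρ : C(G, U)}
    (hC : 1 ≤ C) (h₀ : IsAlmost L C ε ρ₀)
    (h₁ : IsAlmost L C ε ρ) (hε : ε ≤ K.ε) (hr : C * (3 * C * ε) ≤ R.r) {h : C(G, E)}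
    (hh : C * ‖h‖ < R.r) (hρ : ∀ t, ρ t = L.exp (h t) * ρ₀ t) (t : G) :
    ‖L.mul4 (compareQuad L ρ₀ h (K.corr ρ) (K.corr ρ₀) t)‖ ≤
      5 * (C * (15 * C + 2 * C * R.D)) * ‖h‖ := by
  have hh' : ‖h‖ < R.r := by nlinarith [norm_nonneg h]
  have hD := R.D_pos
  have hC0 := h₀.C_pos
  have q1 := K.norm_compareQuad_lt h₀ h₁ hε hr hh' t
  have q0 := K.norm_compareQuad_lt (h := 0) h₀ h₀ hε hr (by simpa using R.r_pos) t
  -- The reference quadruple, with `ρ = ρ₀` and `h = 0`, has product `1`, so the Lipschitz estimate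
  -- for `mul4` against it bounds the norm itself.
  have hz : L.mul4 (compareQuad L ρ₀ 0 (K.corr ρ₀) (K.corr ρ₀) t) = 0 := by
    refine L.eq_of_exp_eq (R.norm_mul4_lt _ q0) (by simpa using L.radius_pos) ?_
    rw [← K.exp_compareQuad R (h := 0) hC h₀ h₀ hε hr (by simpa using R.r_pos)
      (fun t => by simp [L.exp_zero]), L.exp_zero, mul_inv_cancel]
  have := R.mul4_lipschitz _ _ q1 q0
  rw [hz, sub_zero] at this
  refine this.trans ?_
  rw [mul_assoc]
  gcongr
  have hb := K.norm_corr_sub_le R hC h₀ h₁ hε hr hh hρ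
  have hbt : ‖K.corr ρ t - K.corr ρ₀ t‖ ≤ (15 * C + 2 * C * R.D) * ‖h‖ :=
    ((K.corr ρ - K.corr ρ₀).norm_coe_le_norm t).trans hb
  have ht := h.norm_coe_le_norm t
  have n0 := norm_nonneg h
  have hCC : C ≤ C * C := by nlinarith
  simp only [compareQuad_apply, Prod.mk_sub_mk, ContinuousMap.zero_apply, sub_zero, sub_self,
    Prod.norm_mk, norm_zero]
  refine max_le (ht.trans ?_) (max_le ?_ ?_)
  · have : 1 ≤ C * (15 * C + 2 * C * R.D) := by nlinarith [mul_pos (mul_pos hC0 hC0) hD]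
    nlinarith
  · rw [← map_sub, mul_assoc]
    exact ContinuousLinearMap.le_of_opNorm_le_of_le _ (h₀.Ad_le t) hbt
  · have : 0 ≤ C * (15 * C + 2 * C * R.D) * ‖h‖ := by positivity
    simpa using this

end Corrector

end AlmostMorphism

end

/-! ### Uniform continuity and analyticity in the continuous setting. -/

noncomputable section

namespace AlmostMorphism

set_option linter.unusedSectionVars false

section Uniformity

open scoped Uniformity

/-- For nonempty `K`, a subbasic compact-open condition at the constant map `1` only asks that `K`
be sent into an open set containing `1`; empty `K` asks nothing. So uniform smallness is sufficient.
-/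
theorem exists_forall_mem_of_mem_nhds_one {X U : Type*} [TopologicalSpace X] [Group U]
    [TopologicalSpace U] {V : Set C(X, U)} (hV : V ∈ 𝓝 1) :
    ∃ O ∈ 𝓝 (1 : U), ∀ f : C(X, U), (∀ x, f x ∈ O) → f ∈ V := by
  let l : Filter C(X, U) := (𝓝 (1 : U)).lift' fun O => {f | ∀ x, f x ∈ O}
  have hmono : Monotone fun O : Set U => {f : C(X, U) | ∀ x, f x ∈ O} :=
    fun O O' h f hf x => h (hf x)
  have h1 : Tendsto (fun f : C(X, U) => f) l (𝓝 1) := by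
    rw [ContinuousMap.tendsto_nhds_compactOpen]
    intro K _ O hO hK
    rcases K.eq_empty_or_nonempty with rfl | ⟨x, hx⟩
    · exact Eventually.of_forall fun f => Set.mapsTo_empty _ _
    · have h2 : O ∈ 𝓝 (1 : U) := hO.mem_nhds (by simpa using hK hx)
      filter_upwards [mem_lift' (f := 𝓝 (1 : U)) h2] with f hf y _
      exact hf y
  obtain ⟨O, hO, h⟩ := (mem_lift'_sets hmono).1 (h1 hV)
  exact ⟨O, hO, fun f hf => h hf⟩

theorem setOf_forall_mem_nhds_one {X U : Type*} [TopologicalSpace X] [CompactSpace X] [Group U]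
    [TopologicalSpace U] {O : Set U} (hO : O ∈ 𝓝 (1 : U)) :
    {f : C(X, U) | ∀ x, f x ∈ O} ∈ 𝓝 (1 : C(X, U)) := by
  obtain ⟨O', h1, h2, h3⟩ := mem_nhds_iff.1 hO
  have h4 := (ContinuousMap.isOpen_setOf_mapsTo (X := X) isCompact_univ h2).mem_nhds
    (x := (1 : C(X, U))) (fun x _ => h3)
  exact mem_of_superset h4 fun f hf x => h1 (hf (Set.mem_univ x))

theorem uniformContinuous_unifConv_iff {A X Y : Type*} {𝒜 : UniformSpace A} {𝒰 : UniformSpace Y}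
    {k : A → X → Y} : @UniformContinuous _ _ 𝒜 (unifConv X 𝒰) k ↔
      ∀ V ∈ 𝓤[𝒰], ∀ᶠ p in 𝓤[𝒜], ∀ x, (k p.1 x, k p.2 x) ∈ V := by
  have h := (UniformFun.hasBasis_uniformity X Y).comap
    (fun p : (X → Y) × (X → Y) => (UniformFun.ofFun p.1, UniformFun.ofFun p.2))
  change Tendsto _ _ (comap _ _) ↔ _
  exact h.tendsto_right_iff

theorem eventually_uniformity_comap {A X Y : Type*} (𝒰 : UniformSpace Y) (k : A → X → Y)
    {V : Set (Y × Y)} (hV : V ∈ 𝓤[𝒰]) :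
    ∀ᶠ p in 𝓤[(unifConv X 𝒰).comap k], ∀ x, (k p.1 x, k p.2 x) ∈ V :=
  uniformContinuous_unifConv_iff.1
    (@uniformContinuous_comap A (X → Y) k (unifConv X 𝒰)) V hV

end Uniformity

variable {𝕜 : Type*} [RCLike 𝕜] {E : Type*} [NormedAddCommGroup E] [NormedSpace 𝕜 E]
  [CompleteSpace E] [NormedSpace ℝ E] [IsScalarTower ℝ 𝕜 E]
  {U : Type*} [Group U] [TopologicalSpace U] [IsTopologicalGroup U]
  [ChartedSpace E U] [LieGroup 𝓘(𝕜, E) ω U]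
  {G : Type*} [Group G] [TopologicalSpace G] [IsTopologicalGroup G] [CompactSpace G]

/-- Conjugation by elements with bounded adjoint action is equicontinuous at `1`. -/
theorem exists_conj_mem (L : LogChart 𝕜 E U) (C : ℝ) {O : Set U} (hO : O ∈ 𝓝 (1 : U)) :
    ∃ O' ∈ 𝓝 (1 : U), ∀ u : U, ‖(Ad 𝕜 u : E →L[𝕜] E)‖ ≤ C → ∀ w ∈ O', u * w * u⁻¹ ∈ O := by
  obtain ⟨δ, hδ, hb⟩ := Metric.eventually_nhds_iff_ball.1 (L.tendsto_exp.eventually hO)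
  have hC : 0 < |C| + 1 := by positivity
  have hR := L.radius_pos
  refine ⟨nearOne L (min L.radius (min (L.radius / (|C| + 1)) (δ / (|C| + 1)))),
    nearOne_mem_nhds L (by positivity), fun u hu w hw => ?_⟩
  obtain ⟨h1, h2, -⟩ := hw
  rw [lt_min_iff, lt_min_iff, lt_div_iff₀ hC, lt_div_iff₀ hC, mul_comm] at h1
  have h3 : ‖Ad 𝕜 u (L.log w)‖ ≤ (|C| + 1) * ‖L.log w‖ :=
    ContinuousLinearMap.le_of_opNorm_le _ (hu.trans ((le_abs_self C).trans (by linarith))) _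
  rw [← h2, ← L.exp_Ad u _ h1.1 (h3.trans_lt h1.2.1)]
  refine hb _ ?_
  rw [mem_ball_zero_iff]
  linarith [h1.2.2]

/-- Maps with values in `B` after composition with `Ad` and coboundary close to `1` are almost
morphisms. -/
theorem exists_isAlmost (L : LogChart 𝕜 E U) {B : Set (E →L[𝕜] E)} (hB : Bornology.IsBounded B) :
    ∃ C, 1 ≤ C ∧ ∀ ε > 0, ∃ O ∈ 𝓝 (1 : U), ∀ ρ : C(G, U), (∀ s t, coboundary ρ (s, t) ∈ O) →
      (∀ g, Ad 𝕜 (ρ g) ∈ B) → IsAlmost L C ε ρ := by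
  obtain ⟨R⟩ := GoodRadius.nonempty L G
  obtain ⟨A, hA⟩ := hB.exists_norm_le
  refine ⟨4 * |A| + 1, by linarith [abs_nonneg A], fun ε hε => ⟨nearOne L (min ε R.r),
    nearOne_mem_nhds L (lt_min hε R.r_pos), fun ρ hc hρ => ?_⟩⟩
  have hA' : ∀ g, ‖(Ad 𝕜 (ρ g) : E →L[𝕜] E)‖ ≤ |A| := fun g => (hA _ (hρ g)).trans (le_abs_self A)
  have hc' : ∀ s t, ‖(Ad 𝕜 (coboundary ρ (s, t))⁻¹ : E →L[𝕜] E)‖ ≤ 2 := fun s t => by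
    obtain ⟨h1, h2, -⟩ := hc s t
    have h3 := h1.trans_le (min_le_right _ _)
    rw [← h2, ← L.exp_neg (h3.trans_le R.r_le)]
    exact R.Ad_le _ (by rwa [norm_neg])
  refine ⟨fun s t => ⟨(hc s t).1.trans_le (min_le_left _ _), (hc s t).2⟩, fun s =>
    (hA' s).trans (by linarith [abs_nonneg A]), fun s => ?_⟩
  -- `B` bounds `Ad (ρ s)` but not its inverse. The coboundaries at `(1, 1)` and `(s, s⁻¹)` are
  -- `ρ(1)` and `ρ(s) ρ(s⁻¹) ρ(1)⁻¹`; being near `1` they have inverses with `Ad` of norm at most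
  -- `2`, which explains the constant `4 * |A| + 1`.
  have e : (ρ s)⁻¹ = ρ s⁻¹ * ((coboundary ρ (1, 1))⁻¹ * (coboundary ρ (s, s⁻¹))⁻¹) := by
    simp only [coboundary, ContinuousMap.coe_mk, mul_one, mul_inv_cancel]
    group
  rw [e, Ad_mul, Ad_mul]
  refine (ContinuousLinearMap.opNorm_comp_le _ _).trans_lt ?_
  have h1 : ‖(Ad 𝕜 (coboundary ρ (1, 1))⁻¹ : E →L[𝕜] E).comp
      (Ad 𝕜 (coboundary ρ (s, s⁻¹))⁻¹ : E →L[𝕜] E)‖ ≤ 2 * 2 := by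
    refine (ContinuousLinearMap.opNorm_comp_le _ _).trans ?_
    gcongr <;> exact hc' _ _
  calc _ ≤ |A| * (2 * 2) := by
        gcongr
        exact hA' _
    _ < _ := by linarith

/-- The pointwise logarithm of a map close to `1`. -/
theorem exists_log_continuousMap {X : Type*} [TopologicalSpace X] (L : LogChart 𝕜 E U) {ε : ℝ}
    {f : X → U} (hf : Continuous f) (h : ∀ x, f x ∈ nearOne L ε) :
    ∃ k : C(X, E), (∀ x, ‖k x‖ < ε) ∧ ∀ x, L.exp (k x) = f x :=
  ⟨⟨fun x => L.log (f x), continuous_iff_continuousAt.2 fun x =>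
    ContinuousAt.comp (h x).2.2 hf.continuousAt⟩, fun x => (h x).1, fun x => (h x).2.1⟩

namespace Corrector

variable {L : LogChart 𝕜 E U} {M : InvariantMean 𝕜 G E} {C : ℝ} (K : Corrector L M C)
  (R : GoodRadius L G) {ε : ℝ}

theorem norm_Ad_morphism_inv_le {ρ : C(G, U)} (hC : 1 ≤ C) (hρ : IsAlmost L C ε ρ) (hε : ε ≤ K.ε)
    (hr : C * (3 * C * ε) ≤ R.r) (t : G) :
    ‖(Ad 𝕜 (K.morphism ρ t)⁻¹ : E →L[𝕜] E)‖ ≤ 2 * C := by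
  have b := (((K.corr ρ).norm_coe_le_norm t).trans_lt (K.norm_corr_lt hρ hε))
  have hr3 : 3 * C * ε ≤ R.r := by
    have : 0 < 3 * C * ε := (norm_nonneg _).trans_lt b
    nlinarith
  rw [K.morphism_apply hρ hε (hr3.trans R.r_le), mul_inv_rev, Ad_mul,
    ← L.exp_neg (b.trans_le (hr3.trans R.r_le))]
  refine (ContinuousLinearMap.opNorm_comp_le _ _).trans ?_
  gcongr
  · exact R.Ad_le _ (by rw [norm_neg]; exact b.trans_le hr3)
  · exact (hρ.Ad_inv_lt t).le

include R in
/-- Uniform continuity for the right uniformity. -/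
theorem exists_right_close (hC : 1 ≤ C) (hε : ε ≤ K.ε) (hr : C * (3 * C * ε) ≤ R.r) {O : Set U}
    (hO : O ∈ 𝓝 1) : ∃ O' ∈ 𝓝 (1 : U), ∀ ρ ρ₀ : C(G, U), IsAlmost L C ε ρ → IsAlmost L C ε ρ₀ →
      (∀ t, ρ t * (ρ₀ t)⁻¹ ∈ O') → ∀ t, K.morphism ρ t * (K.morphism ρ₀ t)⁻¹ ∈ O := by
  obtain ⟨δ, hδ, hb⟩ := Metric.eventually_nhds_iff_ball.1 (L.tendsto_exp.eventually hO)
  have hR := R.r_pos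
  have hD := R.D_pos
  have hC0 : 0 < C := by linarith
  have hA : 0 < 5 * (C * (15 * C + 2 * C * R.D)) := by positivity
  refine ⟨nearOne L (min (R.r / C) (δ / (5 * (C * (15 * C + 2 * C * R.D))))),
    nearOne_mem_nhds L (by positivity), fun ρ ρ₀ hρ hρ₀ h t => ?_⟩
  obtain ⟨k, hk, hk'⟩ := exists_log_continuousMap L (by fun_prop) h
  have hkn := (ContinuousMap.norm_lt_iff _ (by positivity)).2 hk
  rw [lt_min_iff, lt_div_iff₀ hC0, lt_div_iff₀ hA, mul_comm, mul_comm ‖k‖] at hkn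
  have hh' : ‖k‖ < R.r := by nlinarith [norm_nonneg k]
  have e : ∀ t, ρ t = L.exp (k t) * ρ₀ t := fun t => by rw [hk']; group
  rw [K.exp_compareQuad R hC hρ₀ hρ hε hr hh' e]
  refine hb _ ?_
  rw [mem_ball_zero_iff]
  exact (K.norm_mul4_compareQuad_le R hC hρ₀ hρ hε hr hkn.1 e t).trans_lt hkn.2

include R in
/-- Uniform continuity for the left uniformity. -/
theorem exists_left_close (hC : 1 ≤ C) (hε : ε ≤ K.ε) (hr : C * (3 * C * ε) ≤ R.r) {O : Set U}
    (hO : O ∈ 𝓝 1) : ∃ O' ∈ 𝓝 (1 : U), ∀ ρ ρ₀ : C(G, U), IsAlmost L C ε ρ → IsAlmost L C ε ρ₀ →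
      (∀ t, (ρ₀ t)⁻¹ * ρ t ∈ O') → ∀ t, (K.morphism ρ₀ t)⁻¹ * K.morphism ρ t ∈ O := by
  -- Conjugation by `ρ₀` turns `ρ₀⁻¹ ρ` into `ρ ρ₀⁻¹`, and conjugation by the inverse of the
  -- morphism of `ρ₀`, whose `Ad` is bounded by `2C`, brings the conclusion back from right to left.
  obtain ⟨O₁, hO₁, h1⟩ := exists_conj_mem L (2 * C) hO
  obtain ⟨O₂, hO₂, h2⟩ := K.exists_right_close R hC hε hr hO₁
  obtain ⟨O₃, hO₃, h3⟩ := exists_conj_mem L C hO₂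
  refine ⟨O₃, hO₃, fun ρ ρ₀ hρ hρ₀ h t => ?_⟩
  have h4 := h2 ρ ρ₀ hρ hρ₀ (fun t => by
    have := h3 (ρ₀ t) (hρ₀.Ad_le t) _ (h t)
    rwa [mul_inv_cancel_left] at this) t
  have := h1 (K.morphism ρ₀ t)⁻¹ (K.norm_Ad_morphism_inv_le R hC hρ₀ hε hr t) _ h4
  convert! this using 1
  group

/-- Analyticity of the morphism as a function of the almost morphism. -/
theorem exists_analyticAt_coord (hC : 1 ≤ C) (hε : ε ≤ K.ε) (hr : C * (3 * C * ε) ≤ R.r)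
    {ρ₀ : C(G, U)} (h₀ : IsAlmost L C ε ρ₀) : ∃ f : C(G, E) → C(G, E),
    AnalyticAt 𝕜 f (ContinuousMap.const G (chartAt E (1 : U) 1)) ∧
    ∀ᶠ ξ : C(G, E) in 𝓝 (ContinuousMap.const G (chartAt E (1 : U) 1)), ∀ ρ : C(G, U),
      IsAlmost L C ε ρ → IsCoord ρ₀ ρ ξ → IsCoord (K.morphism ρ₀) (K.morphism ρ) (f ξ) := by
  set φ := chartAt E (1 : U) with hφ
  have hC0 := h₀.C_pos
  have hε0 := h₀.ε_pos
  have hR := R.r_pos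
  have hCε : C * ε ≤ R.r := by nlinarith [mul_pos hC0 hε0]
  have hε' : ε ≤ R.r := by nlinarith
  obtain ⟨r₁, hr₁, -, hlog⟩ := exists_superpose_analyticAt (K := G) L.analyticAt_log_chart
  let ξ₀ : C(G, E) := ContinuousMap.const G (φ 1)
  -- `H` converts chart coordinates into exponential ones. The required map is the composite of
  -- analytic maps: `H`, the shift of the data, the correction, the comparison quadruple, and the
  -- return to the chart.
  let H : C(G, E) → C(G, E) := superpose fun y => L.log (φ.symm y)
  have hH : AnalyticAt 𝕜 H ξ₀ := (hlog ξ₀ fun k => by simpa [ξ₀, hφ] using hr₁).1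
  have hH0 : H ξ₀ = 0 := superpose_eq fun k => by
    simp only [ξ₀, ContinuousMap.const_apply, ContinuousMap.zero_apply]
    rw [φ.left_inv (mem_chart_source E (1 : U)), L.log_one]
  have hHn : Tendsto (fun ξ => ‖H ξ‖) (𝓝 ξ₀) (𝓝 0) := by
    have := hH.continuousAt.norm
    rwa [ContinuousAt, hH0, norm_zero] at this
  have l0 := h₀.mono hε
  have hs0 : shift L (toData L ρ₀) 0 = toData L ρ₀ :=
    (toData_eq_shift R (h := 0) h₀ h₀ hε' hCε (by simpa using R.r_pos)
    (by simpa using R.r_pos) (fun t => by simp [L.exp_zero])).symm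
  let b : C(G, E) → C(G, E) := fun ξ => K.β (shift L (toData L ρ₀) (H ξ))
  have hb : AnalyticAt 𝕜 b ξ₀ := by
    refine AnalyticAt.fun_comp (g := K.β) (f := fun ξ => shift L (toData L ρ₀) (H ξ)) ?_ ?_
    · rw [hH0, hs0]
      exact K.analyticAt _ l0.norm_toData_fst_lt l0.norm_toData_snd_lt
    · refine AnalyticAt.fun_comp (g := shift L (toData L ρ₀)) (f := H) ?_ hH
      rw [hH0]
      exact analyticAt_shift R (h₀.norm_toData_fst_lt.trans_le hCε) h₀.norm_toData_snd_lt
        (by simpa using hR) (by simpa using hR)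
  let q : C(G, E) → C(G, E × E × E × E) := fun ξ => compareQuad L ρ₀ (H ξ) (b ξ) (K.corr ρ₀)
  have hq : AnalyticAt 𝕜 q ξ₀ :=
    analyticAt_pair hH (analyticAt_pair (analyticAt_bilin _ analyticAt_const hb)
      (analyticAt_pair analyticAt_const analyticAt_const))
  have hb0 : b ξ₀ = K.corr ρ₀ := by
    simp only [b, hH0, hs0]
    rfl
  refine ⟨fun ξ => superpose (fun p => φ (L.exp (L.mul4 p))) (q ξ), ?_, ?_⟩
  · refine AnalyticAt.fun_comp (g := superpose fun p => φ (L.exp (L.mul4 p))) (f := q)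
      (R.superpose_chart _ fun t => ?_).1 hq
    simp only [q]
    rw [hH0, hb0]
    exact K.norm_compareQuad_lt (h := 0) h₀ h₀ hε hr (by simpa using R.r_pos) t
  · have hnear : ∀ᶠ ξ : C(G, E) in 𝓝 ξ₀, ∀ k, ‖ξ k - φ 1‖ < r₁ := by
      filter_upwards [Metric.ball_mem_nhds ξ₀ hr₁] with ξ hξ k
      rw [mem_ball_iff_norm] at hξ
      exact ((ξ - ξ₀).norm_coe_le_norm k).trans_lt hξ
    have hexp : ∀ᶠ y in 𝓝 (φ 1), L.exp (L.log (φ.symm y)) = φ.symm y := by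
      have : Tendsto φ.symm (𝓝 (φ 1)) (𝓝 1) := by
        have := φ.continuousAt_symm (mem_chart_target E (1 : U))
        rwa [ContinuousAt, φ.left_inv (mem_chart_source E (1 : U))] at this
      exact this.eventually L.exp_log
    obtain ⟨r₂, hr₂, hexp'⟩ := Metric.eventually_nhds_iff_ball.1 hexp
    have hnear2 : ∀ᶠ ξ : C(G, E) in 𝓝 ξ₀, ∀ k, L.exp (L.log (φ.symm (ξ k))) = φ.symm (ξ k) := by
      filter_upwards [Metric.ball_mem_nhds ξ₀ hr₂] with ξ hξ k
      rw [mem_ball_iff_norm] at hξ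
      refine hexp' _ ?_
      rw [mem_ball_iff_norm]
      exact ((ξ - ξ₀).norm_coe_le_norm k).trans_lt hξ
    filter_upwards [hnear, hnear2, hHn.eventually (gt_mem_nhds hR),
      hHn.eventually (gt_mem_nhds (div_pos hR hC0))] with ξ a1 a2 a3 a4 ρ hρ hcoord
    rw [lt_div_iff₀ hC0, mul_comm] at a4
    have e : ∀ t, ρ t = L.exp (H ξ t) * ρ₀ t := fun t => by
      have e1 : H ξ t = L.log (φ.symm (ξ t)) := (hlog ξ a1).2 t
      obtain ⟨h1, h2⟩ := hcoord t
      rw [e1, a2, ← h2, φ.left_inv h1]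
      group
    have e2 : b ξ = K.corr ρ := by
      simp only [b]
      rw [← toData_eq_shift R h₀ hρ hε' hCε a4 a3 e]
      rfl
    intro t
    have hqs := K.norm_compareQuad_lt h₀ hρ hε hr a3
    have e3 := K.exp_compareQuad R hC h₀ hρ hε hr a3 e t
    have e4 : superpose (fun p => φ (L.exp (L.mul4 p))) (q ξ) t = φ (L.exp (L.mul4 (q ξ t))) :=
      (R.superpose_chart (q ξ) fun t => by simp only [q]; rw [e2]; exact hqs t).2 t
    rw [e3, e4]
    refine ⟨R.exp_mem_source _ (hqs t), ?_⟩
    simp only [q, e2]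
    rfl

end Corrector

/-- The continuous setting. -/
theorem continuous_setting (B : Set (E →L[𝕜] E)) (hBbdd : Bornology.IsBounded B) :
    ∀ V ∈ 𝓝 (1 : C(G, U)), ∃ W ∈ 𝓝 (1 : C(G × G, U)),
      ∃ F : ↥(almostMorphisms 𝕜 B W : Set C(G, U)) → (G →ₜ* U),
        IsAnalytic 𝕜 (E := E) F ∧
        (∀ 𝒰 ∈ ({IsTopologicalGroup.rightUniformSpace U,
            IsTopologicalGroup.leftUniformSpace U} : Set (UniformSpace U)),
          @UniformContinuous _ _ ((unifConv G 𝒰).comap (fun ρ : ↥(almostMorphisms 𝕜 B W) => ⇑ρ.1))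
            ((unifConv G 𝒰).comap (fun π : G →ₜ* U => ⇑π)) F) ∧
        ∀ ρ, (F ρ : C(G, U)) * (ρ.1)⁻¹ ∈ V := by
  intro V hV
  obtain ⟨L⟩ := LogChart.nonempty 𝕜 E U
  obtain ⟨M⟩ := InvariantMean.nonempty 𝕜 G E
  obtain ⟨R⟩ := GoodRadius.nonempty L G
  obtain ⟨C, hC, hall⟩ := exists_isAlmost (G := G) L hBbdd
  obtain ⟨K⟩ := Corrector.nonempty L M hC
  obtain ⟨O, hO, hOV⟩ := exists_forall_mem_of_mem_nhds_one hV
  obtain ⟨δ, hδ, hb⟩ := Metric.eventually_nhds_iff_ball.1 (L.tendsto_exp.eventually hO)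
  have hR := R.r_pos
  have hC0 : 0 < C := by linarith
  obtain ⟨ε, hε, l1, l2, l3⟩ : ∃ ε > 0, ε ≤ K.ε ∧ ε ≤ R.r / (C * (3 * C)) ∧
      ε ≤ δ / (C * (3 * C)) :=
    ⟨min K.ε (min (R.r / (C * (3 * C))) (δ / (C * (3 * C)))), by have := K.ε_pos; positivity,
      by simp, by simp, by simp⟩
  rw [le_div_iff₀ (by positivity)] at l2 l3
  have hr : C * (3 * C * ε) ≤ R.r := by linarith
  obtain ⟨O', hO', hal⟩ := hall ε hε
  have hal' : ∀ ρ : ↥(almostMorphisms 𝕜 B {f : C(G × G, U) | ∀ x, f x ∈ O'}), IsAlmost L C ε ρ.1 :=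
    fun ρ => hal ρ.1 (fun s t => ρ.2.1 (s, t)) ρ.2.2
  refine ⟨{f | ∀ x, f x ∈ O'}, setOf_forall_mem_nhds_one hO', fun ρ => K.morphism ρ.1, ?_, ?_, ?_⟩
  · intro ρ₀
    obtain ⟨f, hf, hf'⟩ := K.exists_analyticAt_coord R hC l1 hr (hal' ρ₀)
    exact ⟨f, hf, hf'.mono fun ξ h ρ hρ => h ρ.1 (hal' ρ) hρ⟩
  · intro 𝒰 h𝒰
    refine @uniformContinuous_comap' _ _ _ _ _ (_) (_) ?_
    rw [uniformContinuous_unifConv_iff]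
    intro T hT
    rcases h𝒰 with rfl | rfl
    · obtain ⟨O₁, hO₁, hT'⟩ := hT
      obtain ⟨O₂, hO₂, h2⟩ := K.exists_right_close R hC l1 hr hO₁
      have := eventually_uniformity_comap (IsTopologicalGroup.rightUniformSpace U)
        (fun ρ : ↥(almostMorphisms 𝕜 B {f : C(G × G, U) | ∀ x, f x ∈ O'}) => ⇑ρ.1)
        (preimage_mem_comap hO₂)
      filter_upwards [this] with p hp x
      exact hT' (h2 p.2.1 p.1.1 (hal' _) (hal' _) hp x)
    · obtain ⟨O₁, hO₁, hT'⟩ := hT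
      obtain ⟨O₂, hO₂, h2⟩ := K.exists_left_close R hC l1 hr hO₁
      have := eventually_uniformity_comap (IsTopologicalGroup.leftUniformSpace U)
        (fun ρ : ↥(almostMorphisms 𝕜 B {f : C(G × G, U) | ∀ x, f x ∈ O'}) => ⇑ρ.1)
        (preimage_mem_comap hO₂)
      filter_upwards [this] with p hp x
      exact hT' (h2 p.2.1 p.1.1 (hal' _) (hal' _) hp x)
  · intro ρ
    refine hOV _ fun t => ?_
    have b := ((K.corr ρ.1).norm_coe_le_norm t).trans_lt (K.norm_corr_lt (hal' ρ) l1)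
    have hr3 : 3 * C * ε ≤ R.r := by
      have : 0 < 3 * C * ε := (norm_nonneg _).trans_lt b
      nlinarith
    have b2 := Corrector.norm_Ad_lt (hal' ρ) b t
    -- The exponent has norm less than `C * (3 * C * ε)`, which was chosen to be at most `δ`.
    have e : K.morphism ρ.1 t * (ρ.1 t)⁻¹ = L.exp (Ad 𝕜 (ρ.1 t) (K.corr ρ.1 t)) := by
      rw [K.morphism_apply (hal' ρ) l1 (hr3.trans R.r_le),
        L.exp_Ad _ _ (b.trans_le (hr3.trans R.r_le)) (b2.trans_le (hr.trans R.r_le))]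
    change K.morphism ρ.1 t * (ρ.1 t)⁻¹ ∈ O
    rw [e]
    refine hb _ ?_
    rw [mem_ball_zero_iff]
    linarith

end AlmostMorphism

end

/-! ### Derivatives along left-invariant fields and along exponential curves. -/

noncomputable section

namespace AlmostMorphism

set_option linter.unusedSectionVars false

section Smoothness

variable {EG : Type*} [NormedAddCommGroup EG] [NormedSpace ℝ EG] {H : Type*} [TopologicalSpace H]
  {I : ModelWithCorners ℝ EG H} {G : Type*} [Group G] [TopologicalSpace G] [ChartedSpace H G]
  [LieGroup I ω G]
  {E : Type*} [NormedAddCommGroup E] [NormedSpace ℝ E]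

/-- The derivative at `1`. -/
def derivOne {E' H' M' : Type*} [NormedAddCommGroup E'] [NormedSpace ℝ E'] [TopologicalSpace H']
    (I : ModelWithCorners ℝ EG H) (I' : ModelWithCorners ℝ E' H') [TopologicalSpace M']
    [ChartedSpace H' M'] (F : G → M') : EG →L[ℝ] E' := mfderiv I I' F 1

/-- `ContMDiffAt.mfderiv` concerns the derivative read in tangent coordinates. Here the base point
in `G` is always `1` and `hc` keeps the chart at `F g 1` fixed, so the coordinate changes are
identities and the derivative itself is smooth in `g`. -/
theorem contMDiff_derivOne {E' H' M' : Type*} [NormedAddCommGroup E'] [NormedSpace ℝ E']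
    [TopologicalSpace H'] {I' : ModelWithCorners ℝ E' H'} [TopologicalSpace M']
    [ChartedSpace H' M'] {n m : WithTop ℕ∞} [IsManifold I 1 G] [IsManifold I' 1 M']
    [IsManifold I n G] [IsManifold I' n M'] (F : G → G → M')
    (hF : ContMDiff (I.prod I) I' n (Function.uncurry F))
    (hc : ∀ g g', achart H' (F g 1) = achart H' (F g' 1)) (hmn : m + 1 ≤ n) :
    ContMDiff I 𝓘(ℝ, EG →L[ℝ] E') m
      (fun g => derivOne I I' (F g)) := by
  intro g₀
  have h := ContMDiffAt.mfderiv (I := I) (J := I) (I' := I') (x₀ := g₀) F (fun _ => (1 : G))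
    (hF (g₀, 1)) contMDiffAt_const hmn
  refine h.congr_of_eventuallyEq (Eventually.of_forall fun g => ?_)
  have hs : F g 1 ∈ (chartAt H' (F g₀ 1)).source := by
    have e := congrArg Subtype.val (hc g₀ g)
    simp only [coe_achart] at e
    rw [e]
    exact mem_chart_source _ _
  have key := inTangentCoordinates_eq (I := I) (I' := I') (fun _ : G => (1 : G)) (fun x => F x 1)
    (fun x => derivOne I I' (F x)) (x₀ := g₀) (x := g) (mem_chart_source H (1 : G)) hs
  refine Eq.trans ?_ key.symm
  rw [hc g g₀]
  ext v
  simp only [ContinuousLinearMap.comp_apply]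
  rw [(tangentBundleCore I G).coordChange_self _ _ (by simp [mem_chart_source]),
    (tangentBundleCore I' M').coordChange_self _ _ (by simpa using hs)]

theorem contMDiff_invDeriv {n m : WithTop ℕ∞} {f : G → E} (hf : ContMDiff I 𝓘(ℝ, E) n f)
    (hmn : m + 1 ≤ n) (X : EG) : ContMDiff I 𝓘(ℝ, E) m (invDeriv I X f) := by
  have hn : n ≤ ω := le_top
  have : LieGroup I n G := LieGroup.of_le hn
  have : IsManifold I 1 G := IsManifold.of_le (n := ω) le_top
  have h := contMDiff_derivOne (I := I) (I' := 𝓘(ℝ, E)) (m := m) (n := n)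
    (fun g h => f (g * h)) (hf.comp (contMDiff_mul I n)) (fun g g' => Subtype.ext (by simp only [coe_achart, chartAt_self_eq])) hmn
  exact (((ContinuousLinearMap.apply ℝ E X).contMDiff).comp h)

theorem invDerivs_cons (X : EG) (L : List EG) (f : G → E) :
    invDerivs I (X :: L) f = invDeriv I X (invDerivs I L f) := rfl

theorem contMDiff_invDerivs {n m : WithTop ℕ∞} {f : G → E} (hf : ContMDiff I 𝓘(ℝ, E) n f)
    (L : List EG) (hmn : m + (L.length : ℕ) ≤ n) : ContMDiff I 𝓘(ℝ, E) m (invDerivs I L f) := by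
  induction L generalizing m with
  | nil => exact hf.of_le (by simpa using hmn)
  | cons X L ih =>
    rw [invDerivs_cons]
    refine contMDiff_invDeriv (ih (m := m + 1) ?_) le_rfl X
    refine le_trans (le_of_eq ?_) hmn
    rw [List.length_cons]
    push_cast
    rw [add_assoc, add_comm 1]

theorem contMDiff_logDeriv {U : Type*} [Group U] [TopologicalSpace U] [ChartedSpace E U]
    [LieGroup 𝓘(ℝ, E) ω U] {n m : WithTop ℕ∞} {f : G → U} (hf : ContMDiff I 𝓘(ℝ, E) n f)
    (hmn : m + 1 ≤ n) (X : EG) : ContMDiff I 𝓘(ℝ, E) m (logDeriv I X f : G → E) := by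
  have hn : n ≤ ω := le_top
  have : LieGroup I n G := LieGroup.of_le hn
  have : LieGroup 𝓘(ℝ, E) n U := LieGroup.of_le hn
  have : IsManifold I 1 G := IsManifold.of_le (n := ω) le_top
  have : IsManifold 𝓘(ℝ, E) 1 U := IsManifold.of_le (n := ω) le_top
  have h := contMDiff_derivOne (I := I) (I' := 𝓘(ℝ, E)) (m := m) (n := n)
    (fun g h => (f g)⁻¹ * f (g * h))
    ((hf.comp contMDiff_fst).inv.mul (hf.comp (contMDiff_mul I n)))
    (fun g g' => by simp only [mul_one, inv_mul_cancel]) hmn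
  exact (((ContinuousLinearMap.apply ℝ E X).contMDiff).comp h)

end Smoothness

namespace LogChart

variable {𝕜 : Type*} [RCLike 𝕜] {E : Type*} [NormedAddCommGroup E] [NormedSpace 𝕜 E]
  [NormedSpace ℝ E] [IsScalarTower ℝ 𝕜 E]
  {U : Type*} [Group U] [TopologicalSpace U] [IsTopologicalGroup U] [ChartedSpace E U]
  (L : LogChart 𝕜 E U)

/-- The chain rule for `log (exp x) = x`, where the derivative of `exp` in the chart is already
known to be the identity. -/
theorem hasFDerivAt_log_chart : HasFDerivAt (fun y => L.log ((chartAt E (1 : U)).symm y))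
    (ContinuousLinearMap.id 𝕜 E) (chartAt E (1 : U) 1) := by
  have h1 := L.analyticAt_log_chart.differentiableAt.hasFDerivAt
  have h2 : HasFDerivAt (fun x => L.log ((chartAt E (1 : U)).symm (chartAt E (1 : U) (L.exp x))))
      (fderiv 𝕜 (fun y => L.log ((chartAt E (1 : U)).symm y)) (chartAt E (1 : U) 1) ∘L
        ContinuousLinearMap.id 𝕜 E) 0 :=
    HasFDerivAt.comp (g := fun y => L.log ((chartAt E (1 : U)).symm y))
      (f := fun x => chartAt E (1 : U) (L.exp x)) (0 : E) (by rw [L.exp_zero]; exact h1)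
      L.hasFDerivAt_chart_exp
  have h3 : HasFDerivAt (fun x => L.log ((chartAt E (1 : U)).symm (chartAt E (1 : U) (L.exp x))))
      (ContinuousLinearMap.id 𝕜 E) 0 := by
    refine (hasFDerivAt_id (0 : E)).congr_of_eventuallyEq ?_
    filter_upwards [Metric.ball_mem_nhds 0 L.radius_pos, L.tendsto_exp.eventually
      ((chartAt E (1 : U)).open_source.mem_nhds (mem_chart_source E (1 : U)))] with x hx hx'
    rw [(chartAt E (1 : U)).left_inv hx', L.log_exp x (by simpa using hx)]
    rfl
  have h4 := h2.unique h3
  rw [ContinuousLinearMap.comp_id] at h4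
  rwa [h4] at h1

theorem hasMFDerivAt_log : HasMFDerivAt 𝓘(ℝ, E) 𝓘(ℝ, E) L.log (1 : U)
    (ContinuousLinearMap.id ℝ E : E →L[ℝ] E) := by
  refine ⟨L.continuousAt_log.self_of_nhds, ?_⟩
  have h := (L.hasFDerivAt_log_chart.restrictScalars ℝ).hasFDerivWithinAt (s := Set.range 𝓘(ℝ, E))
  simp only [writtenInExtChartAt, extChartAt, mfld_simps] at h ⊢
  exact h

/-- The one-parameter curve `t ↦ exp (t X)`. -/
def curve (X : E) (t : ℝ) : U := L.exp (t • X)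

@[simp]
theorem curve_zero (X : E) : L.curve X 0 = 1 := by simp [curve, L.exp_zero]

theorem hasMFDerivAt_curve (X : E) : HasMFDerivAt 𝓘(ℝ, ℝ) 𝓘(ℝ, E) (L.curve X) 0
    (ContinuousLinearMap.toSpanSingleton ℝ X : ℝ →L[ℝ] E) := by
  have hs : HasDerivAt (fun t : ℝ => t • X) X 0 := by
    simpa using (hasDerivAt_id (0 : ℝ)).smul_const X
  have h1 : HasDerivAt (fun t : ℝ => chartAt E (1 : U) (L.exp (t • X))) X 0 := by
    have := L.hasFDerivAt_chart_exp.restrictScalars ℝ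
    rw [← zero_smul ℝ X] at this
    exact this.comp_hasDerivAt 0 hs
  refine ⟨?_, ?_⟩
  · have : Tendsto (fun t : ℝ => L.exp (t • X)) (𝓝 0) (𝓝 1) :=
      L.tendsto_exp_comp hs.continuousAt (by simp)
    rw [ContinuousAt, curve_zero]
    exact this
  · have h2 := h1.hasFDerivAt.hasFDerivWithinAt (s := Set.range 𝓘(ℝ, ℝ))
    simp only [writtenInExtChartAt, curve_zero]
    simp only [extChartAt, mfld_simps] at h2 ⊢
    exact h2

/-- Additivity of `exp` requires a vector shorter than the radius and times in `[-1, 1]`; replacing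
`X` by `X / n` and `t` by `n t` meets both for arbitrary `X` and times below `1 / n`. -/
theorem curve_add (X : E) : ∀ᶠ p in 𝓝 (0 : ℝ × ℝ),
    L.curve X (p.1 + p.2) = L.curve X p.1 * L.curve X p.2 := by
  obtain ⟨n, hn⟩ := exists_nat_gt (‖X‖ / L.radius)
  have hn' : (0 : ℝ) < n := (div_nonneg (norm_nonneg _) L.radius_pos.le).trans_lt hn
  have hX : ‖(n : ℝ)⁻¹ • X‖ < L.radius := by
    rw [norm_smul, norm_inv, Real.norm_natCast, inv_mul_lt_iff₀ hn']
    rwa [div_lt_iff₀ L.radius_pos] at hn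
  filter_upwards [Metric.ball_mem_nhds (0 : ℝ × ℝ) (inv_pos.2 hn')] with p hp
  rw [mem_ball_zero_iff, Prod.norm_def, max_lt_iff, Real.norm_eq_abs, Real.norm_eq_abs] at hp
  have hb : ∀ t : ℝ, |t| < (n : ℝ)⁻¹ → t * n ∈ Set.Icc (-1 : ℝ) 1 := fun t ht => by
    rw [Set.mem_Icc, ← abs_le, abs_mul, Nat.abs_cast]
    calc |t| * n ≤ (n : ℝ)⁻¹ * n := by gcongr
      _ = 1 := inv_mul_cancel₀ hn'.ne'
  have h1 := L.exp_add _ hX (p.1 * n) (hb _ hp.1) (p.2 * n) (hb _ hp.2)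
  have e : ∀ t : ℝ, (t * n) • (n : ℝ)⁻¹ • X = t • X := fun t => by
    rw [smul_smul, mul_assoc, mul_inv_cancel₀ hn'.ne', mul_one]
  rw [← add_mul, e, e, e] at h1
  exact h1.symm

end LogChart

section Curves

variable {EG : Type*} [NormedAddCommGroup EG] [NormedSpace ℝ EG]
  {G : Type*} [Group G] [TopologicalSpace G] [IsTopologicalGroup G] [ChartedSpace EG G]
  [LieGroup 𝓘(ℝ, EG) ω G] (LG : LogChart ℝ EG G)
  {E : Type*} [NormedAddCommGroup E] [NormedSpace ℝ E]

theorem hasMFDerivAt_curve_snd (X : EG) :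
    HasMFDerivAt 𝓘(ℝ, ℝ) (𝓘(ℝ, EG).prod 𝓘(ℝ, EG)) (fun t => ((1 : G), LG.curve X t)) 0
      (ContinuousLinearMap.toSpanSingleton ℝ ((0 : EG), X) : ℝ →L[ℝ] EG × EG) := by
  have h := (hasMFDerivAt_const (I := 𝓘(ℝ, ℝ)) (I' := 𝓘(ℝ, EG)) (1 : G) (0 : ℝ)).prodMk
    (LG.hasMFDerivAt_curve X)
  have e : (ContinuousLinearMap.toSpanSingleton ℝ ((0 : EG), X) : ℝ →L[ℝ] EG × EG) =
      (0 : ℝ →L[ℝ] EG).prod (ContinuousLinearMap.toSpanSingleton ℝ X) := by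
    ext <;> simp
  rw [e]
  exact h

/-- The exponential curve has velocity `X` at `1`. Derivatives along invariant fields thus become
ordinary derivatives in a real variable, whose uniqueness is used afterwards to identify them. -/
theorem hasDerivAt_invDeriv {f : G → E} {n : WithTop ℕ∞} (hn : 1 ≤ n)
    (hf : ContMDiff 𝓘(ℝ, EG) 𝓘(ℝ, E) n f) (X : EG) (g : G) :
    HasDerivAt (fun t => f (g * LG.curve X t)) (invDeriv 𝓘(ℝ, EG) X f g) 0 := by
  have : LieGroup 𝓘(ℝ, EG) n G := LieGroup.of_le (n := ω) le_top
  have h1 : MDifferentiableAt 𝓘(ℝ, EG) 𝓘(ℝ, E) (fun h => f (g * h)) (LG.curve X 0) :=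
    ((hf.comp (contMDiff_mul_left (I := 𝓘(ℝ, EG)) (n := n) (a := g))).mdifferentiable
      (by positivity)) _
  have h2 := HasMFDerivAt.comp (0 : ℝ) h1.hasMFDerivAt (LG.hasMFDerivAt_curve X)
  rw [hasMFDerivAt_iff_hasFDerivAt, LG.curve_zero] at h2
  have h3 : HasFDerivAt (fun t => f (g * LG.curve X t))
      ((derivOne 𝓘(ℝ, EG) 𝓘(ℝ, E) fun h => f (g * h)).comp
        (ContinuousLinearMap.toSpanSingleton ℝ X)) 0 := h2
  convert! h3.hasDerivAt using 1
  rw [ContinuousLinearMap.comp_apply, ContinuousLinearMap.toSpanSingleton_apply, one_smul]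
  rfl

theorem hasDerivAt_invDeriv_snd {f : G × G → E} {n : WithTop ℕ∞} (hn : 1 ≤ n)
    (hf : ContMDiff (𝓘(ℝ, EG).prod 𝓘(ℝ, EG)) 𝓘(ℝ, E) n f) (X : EG) (g : G × G) :
    HasDerivAt (fun t => f (g.1, g.2 * LG.curve X t))
      (invDeriv (𝓘(ℝ, EG).prod 𝓘(ℝ, EG)) (0, X) f g) 0 := by
  have : LieGroup 𝓘(ℝ, EG) n G := LieGroup.of_le (n := ω) le_top
  have h1 : MDifferentiableAt (𝓘(ℝ, EG).prod 𝓘(ℝ, EG)) 𝓘(ℝ, E) (fun h => f (g * h))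
      ((1 : G), LG.curve X 0) :=
    ((hf.comp (contMDiff_mul_left (I := 𝓘(ℝ, EG).prod 𝓘(ℝ, EG)) (n := n) (a := g))).mdifferentiable
      (by positivity)) _
  have h2 := HasMFDerivAt.comp (0 : ℝ) h1.hasMFDerivAt (hasMFDerivAt_curve_snd LG X)
  rw [hasMFDerivAt_iff_hasFDerivAt, LG.curve_zero] at h2
  have e : (fun h => f (g * h)) ∘ (fun t => ((1 : G), LG.curve X t)) =
      fun t => f (g.1, g.2 * LG.curve X t) := by
    ext t
    simp only [Function.comp_apply]
    congr 1
    ext <;> simp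
  rw [e] at h2
  have h3 : HasFDerivAt (fun t => f (g.1, g.2 * LG.curve X t))
      ((derivOne (𝓘(ℝ, EG).prod 𝓘(ℝ, EG)) 𝓘(ℝ, E) fun h => f (g * h)).comp
        (ContinuousLinearMap.toSpanSingleton ℝ ((0 : EG), X))) 0 := h2
  convert! h3.hasDerivAt using 1
  rw [ContinuousLinearMap.comp_apply, ContinuousLinearMap.toSpanSingleton_apply, one_smul]
  rfl

variable {U : Type*} [Group U] [TopologicalSpace U] [IsTopologicalGroup U] [ChartedSpace E U]
  [LieGroup 𝓘(ℝ, E) ω U] {𝕜 : Type*} [RCLike 𝕜] [NormedSpace 𝕜 E] [IsScalarTower ℝ 𝕜 E]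
  (L : LogChart 𝕜 E U)

theorem hasDerivAt_logDeriv {f : G → U} {n : WithTop ℕ∞} (hn : 1 ≤ n)
    (hf : ContMDiff 𝓘(ℝ, EG) 𝓘(ℝ, E) n f) (X : EG) (g : G) :
    HasDerivAt (fun t => L.log ((f g)⁻¹ * f (g * LG.curve X t))) (logDeriv 𝓘(ℝ, EG) X f g) 0 := by
  have : LieGroup 𝓘(ℝ, EG) n G := LieGroup.of_le (n := ω) le_top
  have : LieGroup 𝓘(ℝ, E) n U := LieGroup.of_le (n := ω) le_top
  have h1 : MDifferentiableAt 𝓘(ℝ, EG) 𝓘(ℝ, E) (fun h => (f g)⁻¹ * f (g * h)) (LG.curve X 0) :=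
    (((contMDiff_mul_left (I := 𝓘(ℝ, E)) (n := n) (a := (f g)⁻¹)).comp
      (hf.comp (contMDiff_mul_left (I := 𝓘(ℝ, EG)) (n := n) (a := g)))).mdifferentiable
      (by positivity)) _
  have h2 := HasMFDerivAt.comp (0 : ℝ) h1.hasMFDerivAt (LG.hasMFDerivAt_curve X)
  have e : ((fun h => (f g)⁻¹ * f (g * h)) ∘ LG.curve X) 0 = 1 := by simp
  have h0 := L.hasMFDerivAt_log
  rw [← e] at h0
  have h3 := HasMFDerivAt.comp (0 : ℝ) h0 h2
  rw [hasMFDerivAt_iff_hasFDerivAt, LG.curve_zero] at h3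
  have h4 : HasFDerivAt (fun t => L.log ((f g)⁻¹ * f (g * LG.curve X t)))
      ((derivOne 𝓘(ℝ, EG) 𝓘(ℝ, E) fun h => (f g)⁻¹ * f (g * h)).comp
        (ContinuousLinearMap.toSpanSingleton ℝ X)) 0 := h3
  convert! h4.hasDerivAt using 1
  rw [ContinuousLinearMap.comp_apply, ContinuousLinearMap.toSpanSingleton_apply, one_smul]
  rfl

theorem hasDerivAt_logDeriv_snd {f : G × G → U} {n : WithTop ℕ∞} (hn : 1 ≤ n)
    (hf : ContMDiff (𝓘(ℝ, EG).prod 𝓘(ℝ, EG)) 𝓘(ℝ, E) n f) (X : EG) (g : G × G) :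
    HasDerivAt (fun t => L.log ((f g)⁻¹ * f (g.1, g.2 * LG.curve X t)))
      (logDeriv (𝓘(ℝ, EG).prod 𝓘(ℝ, EG)) (0, X) f g) 0 := by
  have : LieGroup 𝓘(ℝ, EG) n G := LieGroup.of_le (n := ω) le_top
  have : LieGroup 𝓘(ℝ, E) n U := LieGroup.of_le (n := ω) le_top
  have h1 : MDifferentiableAt (𝓘(ℝ, EG).prod 𝓘(ℝ, EG)) 𝓘(ℝ, E) (fun h => (f g)⁻¹ * f (g * h))
      ((1 : G), LG.curve X 0) :=
    (((contMDiff_mul_left (I := 𝓘(ℝ, E)) (n := n) (a := (f g)⁻¹)).comp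
      (hf.comp (contMDiff_mul_left (I := 𝓘(ℝ, EG).prod 𝓘(ℝ, EG)) (n := n) (a := g)))).mdifferentiable
      (by positivity)) _
  have h2 := HasMFDerivAt.comp (0 : ℝ) h1.hasMFDerivAt (hasMFDerivAt_curve_snd LG X)
  have e0 : (fun h => (f g)⁻¹ * f (g * h)) ∘ (fun t => ((1 : G), LG.curve X t)) =
      fun t => (f g)⁻¹ * f (g.1, g.2 * LG.curve X t) := by
    ext t
    simp only [Function.comp_apply]
    congr 2
    ext <;> simp
  rw [e0] at h2
  have e : (fun t => (f g)⁻¹ * f (g.1, g.2 * LG.curve X t)) 0 = 1 := by simp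
  have h0 := L.hasMFDerivAt_log
  rw [← e] at h0
  have h3 := HasMFDerivAt.comp (0 : ℝ) h0 h2
  rw [hasMFDerivAt_iff_hasFDerivAt, LG.curve_zero] at h3
  have h4 : HasFDerivAt (fun t => L.log ((f g)⁻¹ * f (g.1, g.2 * LG.curve X t)))
      ((derivOne (𝓘(ℝ, EG).prod 𝓘(ℝ, EG)) 𝓘(ℝ, E) fun h => (f g)⁻¹ * f (g * h)).comp
        (ContinuousLinearMap.toSpanSingleton ℝ ((0 : EG), X))) 0 := h3
  convert! h4.hasDerivAt using 1
  rw [ContinuousLinearMap.comp_apply, ContinuousLinearMap.toSpanSingleton_apply, one_smul]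
  rfl

end Curves

end AlmostMorphism

end

/-! ### Analyticity of continuous morphisms. -/

noncomputable section

namespace AlmostMorphism

set_option linter.unusedSectionVars false

namespace LogChart

variable {𝕜 : Type*} [RCLike 𝕜] {E : Type*} [NormedAddCommGroup E] [NormedSpace 𝕜 E]
  [NormedSpace ℝ E] [IsScalarTower ℝ 𝕜 E] [CompleteSpace E]
  {U : Type*} [Group U] [TopologicalSpace U] [IsTopologicalGroup U] [ChartedSpace E U]
  (L : LogChart 𝕜 E U)

theorem contMDiffAt_log [IsManifold 𝓘(ℝ, E) ω U] : ContMDiffAt 𝓘(ℝ, E) 𝓘(ℝ, E) ω L.log (1 : U) := by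
  refine ⟨L.continuousAt_log.self_of_nhds.continuousWithinAt, ?_⟩
  have h := (L.analyticAt_log_chart.restrictScalars (𝕜 := ℝ)).contDiffAt (n := ω)
  simp only [ChartedSpace.LiftPropAt, ContDiffWithinAtProp, extChartAt, mfld_simps] at h ⊢
  exact h.contDiffWithinAt

theorem contMDiffAt_exp [IsManifold 𝓘(ℝ, E) ω U] :
    ContMDiffAt 𝓘(ℝ, E) 𝓘(ℝ, E) ω L.exp (0 : E) := by
  refine ⟨(L.continuousOn_exp.continuousAt (Metric.ball_mem_nhds 0 L.radius_pos)).continuousWithinAt, ?_⟩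
  have h := (L.analyticAt_chart_exp.restrictScalars (𝕜 := ℝ)).contDiffAt (n := ω)
  simp only [ContDiffWithinAtProp, extChartAt, mfld_simps] at h ⊢
  rw [L.exp_zero]
  exact h.contDiffWithinAt

/-- The derivative of the product at `0` in the direction `(x, y, 0, 0)` is `x + y`, taken along the
sequence `2⁻ᵏ`. -/
theorem tendsto_dyadic_mul (x y : E) :
    Tendsto (fun k : ℕ => (2 : ℝ) ^ k • L.log (L.exp (((2 : ℝ) ^ k)⁻¹ • x) *
      L.exp (((2 : ℝ) ^ k)⁻¹ • y))) atTop (𝓝 (x + y)) := by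
  have h := (L.hasFDerivAt_mul4.restrictScalars ℝ).lim (v := ((x, y, 0, 0) : E × E × E × E))
    (l := atTop) (c := fun k : ℕ => (2 : ℝ) ^ k) (by
      simp only [norm_pow, Real.norm_ofNat]
      exact tendsto_pow_atTop_atTop_of_one_lt one_lt_two)
  simp only [zero_add, L.mul4_zero, sub_zero, ContinuousLinearMap.coe_restrictScalars',
    sum4_apply, add_zero] at h
  refine h.congr fun k => ?_
  simp [mul4, L.exp_zero]

end LogChart

section Morphism

variable {EG : Type*} [NormedAddCommGroup EG] [NormedSpace ℝ EG] [CompleteSpace EG]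
  {G : Type*} [Group G] [TopologicalSpace G] [IsTopologicalGroup G] [ChartedSpace EG G]
  (LG : LogChart ℝ EG G)
  {𝕜 : Type*} [RCLike 𝕜] {E : Type*} [NormedAddCommGroup E] [NormedSpace 𝕜 E]
  [NormedSpace ℝ E] [IsScalarTower ℝ 𝕜 E] [CompleteSpace E]
  {U : Type*} [Group U] [TopologicalSpace U] [IsTopologicalGroup U] [ChartedSpace E U]
  (L : LogChart 𝕜 E U)

/-- A continuous morphism is linear in exponential coordinates. -/
theorem exists_tangent (π : G →ₜ* U) :
    ∃ T : EG →L[ℝ] E, ∀ᶠ x in 𝓝 (0 : EG), π (LG.exp x) = L.exp (T x) := by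
  let lam : EG → E := fun x => L.log (π (LG.exp x))
  have htend : Tendsto (fun x => π (LG.exp x)) (𝓝 0) (𝓝 1) := by
    have := (π.continuous_toFun.tendsto' 1 1 π.map_one).comp LG.tendsto_exp
    exact this
  have hlam0 : lam 0 = 0 := by simp [lam, LG.exp_zero, L.log_one]
  obtain ⟨δ, hδ, hδ'⟩ : ∃ δ > 0, ∀ x : EG, ‖x‖ < δ → L.exp (lam x) = π (LG.exp x) ∧
      ‖lam x‖ < L.radius / 2 ∧ ContinuousAt lam x ∧ ‖x‖ < LG.radius := by
    obtain ⟨δ, hδ, h⟩ := Metric.eventually_nhds_iff_ball.1 (((htend.eventually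
      (L.eventually_log_lt (half_pos L.radius_pos)))).and (Metric.ball_mem_nhds 0 LG.radius_pos))
    refine ⟨δ, hδ, fun x hx => ?_⟩
    obtain ⟨⟨h1, h2, h3⟩, h4⟩ := h x (by simpa using hx)
    refine ⟨h2, h1, ?_, by simpa using h4⟩
    have h5 : ContinuousAt (fun x => π (LG.exp x)) x :=
      π.continuous_toFun.continuousAt.comp
        (LG.continuousOn_exp.continuousAt (Metric.isOpen_ball.mem_nhds h4))
    exact ContinuousAt.comp h3 h5
  -- `π` maps squares to squares, and the bound `L.radius / 2` on `lam` keeps the doubled logarithm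
  -- in the range where `exp` is injective.
  have half : ∀ x : EG, ‖x‖ < δ → lam ((2 : ℝ)⁻¹ • x) = (2 : ℝ)⁻¹ • lam x := by
    intro x hx
    have hx2 : ‖(2 : ℝ)⁻¹ • x‖ < δ := by
      rw [norm_smul]; norm_num; linarith [norm_nonneg x]
    obtain ⟨a1, a2, -, a4⟩ := hδ' x hx
    obtain ⟨b1, b2, -, b4⟩ := hδ' _ hx2
    have e1 := LG.exp_add _ b4 1 (by norm_num) 1 (by norm_num)
    have e2 := L.exp_add _ (b2.trans (half_lt_self L.radius_pos)) 1 (by norm_num) 1 (by norm_num)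
    rw [one_smul, one_add_one_eq_two, smul_smul, mul_inv_cancel₀ two_ne_zero, one_smul] at e1
    rw [one_smul, one_add_one_eq_two, b1, ← map_mul, e1, ← a1] at e2
    have e3 := L.eq_of_exp_eq (a2.trans (half_lt_self L.radius_pos)) (by
      rw [norm_smul]; norm_num; linarith) e2
    rw [e3, smul_smul, inv_mul_cancel₀ two_ne_zero, one_smul]
  have hpow_lt : ∀ (x : EG) (k : ℕ), ‖((2 : ℝ) ^ k)⁻¹ • x‖ ≤ ‖x‖ := fun x k => by
    rw [norm_smul, norm_inv, norm_pow, Real.norm_ofNat]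
    have : ((2 : ℝ) ^ k)⁻¹ ≤ 1 := inv_le_one_of_one_le₀ (one_le_pow₀ one_le_two)
    nlinarith [norm_nonneg x]
  have dyad : ∀ (k : ℕ) (x : EG), ‖x‖ < δ →
      lam (((2 : ℝ) ^ k)⁻¹ • x) = ((2 : ℝ) ^ k)⁻¹ • lam x := by
    intro k
    induction k with
    | zero => intro x _; simp
    | succ k ih =>
      intro x hx
      have e : ((2 : ℝ) ^ (k + 1))⁻¹ = (2 : ℝ)⁻¹ * ((2 : ℝ) ^ k)⁻¹ := by rw [pow_succ, mul_inv_rev]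
      rw [e, mul_smul, half _ ((hpow_lt x k).trans_lt hx), ih x hx, smul_smul]
  have hsmall : ∀ v : EG, Tendsto (fun k : ℕ => ((2 : ℝ) ^ k)⁻¹ • v) atTop (𝓝 0) := fun v => by
    have h1 : Tendsto (fun k : ℕ => ((2 : ℝ) ^ k)⁻¹) atTop (𝓝 0) :=
      (tendsto_pow_atTop_atTop_of_one_lt one_lt_two).inv_tendsto_atTop
    simpa using h1.smul_const v
  -- With `z k = log(exp(2⁻ᵏ x) exp(2⁻ᵏ y))`, the points `2ᵏ z k` tend to `x + y`. By dyadic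
  -- homogeneity, `lam` of them is `2ᵏ log(exp(2⁻ᵏ lam x) exp(2⁻ᵏ lam y))`, which tends to `lam x +
  -- lam y`.
  have hadd : ∀ x y : EG, ‖x‖ < δ → ‖y‖ < δ → ‖x + y‖ < δ → lam (x + y) = lam x + lam y := by
    intro x y hx hy hxy
    let z : ℕ → EG := fun k => LG.log (LG.exp (((2 : ℝ) ^ k)⁻¹ • x) * LG.exp (((2 : ℝ) ^ k)⁻¹ • y))
    have hz := LG.tendsto_dyadic_mul x y
    have l1 := L.tendsto_dyadic_mul (lam x) (lam y)
    have hz2 : ∀ᶠ k in atTop, LG.exp (z k) =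
        LG.exp (((2 : ℝ) ^ k)⁻¹ • x) * LG.exp (((2 : ℝ) ^ k)⁻¹ • y) := by
      have : Tendsto (fun k : ℕ => LG.exp (((2 : ℝ) ^ k)⁻¹ • x) * LG.exp (((2 : ℝ) ^ k)⁻¹ • y))
          atTop (𝓝 (1 * 1)) :=
        (LG.tendsto_exp.comp (hsmall x)).mul (LG.tendsto_exp.comp (hsmall y))
      rw [mul_one] at this
      exact this.eventually LG.exp_log
    have hz3 : ∀ᶠ k in atTop, ‖(2 : ℝ) ^ k • z k‖ < δ := hz.norm.eventually (gt_mem_nhds hxy)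
    have l2 : Tendsto (fun k => lam ((2 : ℝ) ^ k • z k)) atTop (𝓝 (lam (x + y))) :=
      (hδ' _ hxy).2.2.1.tendsto.comp hz
    refine tendsto_nhds_unique l2 (l1.congr' ?_)
    filter_upwards [hz2, hz3] with k h2 h3
    have e1 := dyad k _ h3
    rw [smul_smul, inv_mul_cancel₀ (by positivity), one_smul] at e1
    have e2 : lam ((2 : ℝ) ^ k • z k) = (2 : ℝ) ^ k • lam (z k) := by
      rw [e1, smul_smul, mul_inv_cancel₀ (by positivity), one_smul]
    rw [e2]
    congr 1
    change _ = L.log (π (LG.exp (z k)))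
    rw [h2, map_mul, ← (hδ' _ ((hpow_lt x k).trans_lt hx)).1,
      ← (hδ' _ ((hpow_lt y k).trans_lt hy)).1, dyad k x hx, dyad k y hy]
  -- `lam` is additive only near `0`; its extension at `x` is the eventually constant value of `2ᵏ
  -- lam(2⁻ᵏ x)`. Additivity and continuity at `0` then give real linearity.
  have hT : ∀ x : EG, ∃ v : E, ∀ᶠ k : ℕ in atTop,
      lam (((2 : ℝ) ^ k)⁻¹ • x) = ((2 : ℝ) ^ k)⁻¹ • v := by
    intro x
    have h1 := (hsmall x).norm
    rw [norm_zero] at h1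
    obtain ⟨k₀, hk₀⟩ := (h1.eventually (gt_mem_nhds hδ)).exists
    refine ⟨(2 : ℝ) ^ k₀ • lam (((2 : ℝ) ^ k₀)⁻¹ • x), eventually_atTop.2 ⟨k₀, fun k hk => ?_⟩⟩
    obtain ⟨j, rfl⟩ := Nat.exists_eq_add_of_le hk
    have e : ((2 : ℝ) ^ (k₀ + j))⁻¹ = ((2 : ℝ) ^ j)⁻¹ * ((2 : ℝ) ^ k₀)⁻¹ := by
      rw [pow_add, mul_inv_rev]
    rw [e, mul_smul, dyad j _ hk₀, mul_smul]
    congr 1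
    rw [smul_smul, inv_mul_cancel₀ (by positivity), one_smul]
  choose T hT' using hT
  have hTlam : ∀ x, ‖x‖ < δ → T x = lam x := fun x hx => by
    obtain ⟨k, hk⟩ := (hT' x).exists
    rw [dyad k x hx] at hk
    have := congrArg (fun v => (2 : ℝ) ^ k • v) hk
    simp only [smul_smul, mul_inv_cancel₀ (pow_ne_zero k (two_ne_zero (α := ℝ))), one_smul] at this
    exact this.symm
  have hsm : ∀ x : EG, ∀ᶠ k : ℕ in atTop, ‖((2 : ℝ) ^ k)⁻¹ • x‖ < δ := fun x => by
    have h1 := (hsmall x).norm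
    rw [norm_zero] at h1
    exact h1.eventually (gt_mem_nhds hδ)
  have hTadd : ∀ x y, T (x + y) = T x + T y := fun x y => by
    obtain ⟨k, h1, h2, h3, h4, h5, h6⟩ := ((hT' x).and ((hT' y).and ((hT' (x + y)).and
      ((hsm x).and ((hsm y).and (hsm (x + y))))))).exists
    rw [smul_add] at h3 h6
    rw [hadd _ _ h4 h5 h6, h1, h2, ← smul_add] at h3
    have := congrArg (fun v => (2 : ℝ) ^ k • v) h3
    simp only [smul_smul, mul_inv_cancel₀ (pow_ne_zero k (two_ne_zero (α := ℝ))), one_smul] at this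
    exact this.symm
  have hev : T =ᶠ[𝓝 0] lam := by
    filter_upwards [Metric.ball_mem_nhds (0 : EG) hδ] with x hx
    exact hTlam x (by simpa using hx)
  let T' : EG →+ E := AddMonoidHom.mk' T hTadd
  have hTc : Continuous T' :=
    continuous_of_continuousAt_zero T' (((hδ' 0 (by simpa using hδ)).2.2.1).congr hev.symm)
  refine ⟨T'.toRealLinearMap hTc, ?_⟩
  filter_upwards [Metric.ball_mem_nhds (0 : EG) hδ, hev] with x hx hx'
  have e : T'.toRealLinearMap hTc x = lam x := hx'
  rw [e, (hδ' x (by simpa using hx)).1]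

variable [LieGroup 𝓘(ℝ, EG) ω G] [LieGroup 𝓘(ℝ, E) ω U]

include LG L in
/-- Continuous morphisms are analytic. -/
theorem contMDiff_morphism (π : G →ₜ* U) : ContMDiff 𝓘(ℝ, EG) 𝓘(ℝ, E) ω π := by
  obtain ⟨T, hT⟩ := exists_tangent LG L π
  have h1 : ContMDiffAt 𝓘(ℝ, EG) 𝓘(ℝ, E) ω π 1 := by
    have a1 : ContMDiffAt 𝓘(ℝ, EG) 𝓘(ℝ, EG) ω LG.log (1 : G) := LG.contMDiffAt_log
    have a2 : ContMDiffAt 𝓘(ℝ, EG) 𝓘(ℝ, E) ω (fun g => T (LG.log g)) (1 : G) :=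
      T.contMDiff.contMDiffAt.comp (1 : G) a1
    have a3 : ContMDiffAt 𝓘(ℝ, EG) 𝓘(ℝ, E) ω (fun g => L.exp (T (LG.log g))) (1 : G) := by
      refine ContMDiffAt.comp (g := L.exp) (f := fun g => T (LG.log g)) (1 : G) ?_ a2
      rw [LG.log_one, map_zero]
      exact L.contMDiffAt_exp
    refine a3.congr_of_eventuallyEq ?_
    filter_upwards [LG.exp_log, LG.tendsto_log.eventually hT] with g h2 h3
    rw [← h3, h2]
  intro g₀
  have e : (π : G → U) = fun g => π g₀ * π (g₀⁻¹ * g) := by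
    ext g
    rw [← map_mul, mul_inv_cancel_left]
  rw [e]
  have h2 : ContMDiffAt 𝓘(ℝ, EG) 𝓘(ℝ, E) ω (fun g => π (g₀⁻¹ * g)) g₀ := by
    refine ContMDiffAt.comp (g := π) (f := fun g => g₀⁻¹ * g) g₀ ?_
      (contMDiff_mul_left (I := 𝓘(ℝ, EG)) (n := ω) (a := g₀⁻¹)).contMDiffAt
    rw [inv_mul_cancel]
    exact h1
  exact (contMDiff_mul_left (I := 𝓘(ℝ, E)) (n := ω) (a := π g₀)).contMDiffAt.comp g₀ h2

/-- The logarithmic derivatives of a morphism are constant. -/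
theorem logDeriv_morphism (π : G →ₜ* U) {T : EG →L[ℝ] E}
    (hT : ∀ᶠ x in 𝓝 (0 : EG), π (LG.exp x) = L.exp (T x)) (X : EG) (g : G) :
    logDeriv 𝓘(ℝ, EG) X π g = T X := by
  have h1 := hasDerivAt_logDeriv LG L (n := ω) le_top (contMDiff_morphism LG L π) X g
  have h2 : HasDerivAt (fun t : ℝ => t • T X) (T X) 0 := by
    simpa using (hasDerivAt_id (0 : ℝ)).smul_const (T X)
  refine h1.unique (h2.congr_of_eventuallyEq ?_)
  have hs : Tendsto (fun t : ℝ => t • X) (𝓝 0) (𝓝 0) := by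
    have : Continuous fun t : ℝ => t • X := by fun_prop
    exact this.tendsto' _ _ (by simp)
  have hs2 : Tendsto (fun t : ℝ => ‖t • T X‖) (𝓝 0) (𝓝 0) := by
    have : Continuous fun t : ℝ => ‖t • T X‖ := by fun_prop
    exact this.tendsto' _ _ (by simp)
  filter_upwards [hs.eventually hT, hs2.eventually (gt_mem_nhds L.radius_pos)] with t h3 h4
  rw [map_mul, inv_mul_cancel_left, LogChart.curve, h3, map_smul, L.log_exp _ h4]

end Morphism

end AlmostMorphism

end

/-! ### Jets along families of curves. -/

noncomputable section

namespace AlmostMorphism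

set_option linter.unusedSectionVars false

section Jets

variable {A K ι : Type*}

/-- Uniform convergence to `0` along a filter. -/
def UnifSmall {Z : Type*} [NormedAddCommGroup Z] (𝓕 : Filter A) (k : A → K → Z) : Prop :=
  ∀ ε > 0, ∀ᶠ a in 𝓕, ∀ x, ‖k a x‖ < ε

/-- Uniform convergence to `0` along a filter of all derivatives up to a given order, where the
derivatives are taken along a family of curves. -/
def JetSmall {Z : Type*} [NormedAddCommGroup Z] [NormedSpace ℝ Z] (cur : ι → K → ℝ → K)
    (𝓕 : Filter A) : ℕ → (A → K → Z) → Prop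
  | 0, k => UnifSmall 𝓕 k
  | n + 1, k => UnifSmall 𝓕 k ∧ ∀ X, ∃ k' : A → K → Z, JetSmall cur 𝓕 n k' ∧
      ∀ᶠ a in 𝓕, ∀ x, HasDerivAt (fun t => k a (cur X x t)) (k' a x) 0

variable {Z Z' : Type*} [NormedAddCommGroup Z] [NormedSpace ℝ Z] [NormedAddCommGroup Z']
  [NormedSpace ℝ Z'] {cur : ι → K → ℝ → K} {𝓕 : Filter A} {n : ℕ}

theorem UnifSmall.congr {k l : A → K → Z} (h : UnifSmall 𝓕 k) (e : ∀ᶠ a in 𝓕, k a = l a) :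
    UnifSmall 𝓕 l := fun ε hε => by
  filter_upwards [h ε hε, e] with a h1 h2
  rwa [← h2]

theorem UnifSmall.prodMk {k : A → K → Z} {l : A → K → Z'} (h : UnifSmall 𝓕 k)
    (h' : UnifSmall 𝓕 l) : UnifSmall 𝓕 (fun a x => (k a x, l a x)) := fun ε hε => by
  filter_upwards [h ε hε, h' ε hε] with a h1 h2 x
  exact max_lt (h1 x) (h2 x)

theorem UnifSmall.eventually {k : A → K → Z} (h : UnifSmall 𝓕 k) {p : Z → Prop}
    (hp : ∀ᶠ z in 𝓝 0, p z) : ∀ᶠ a in 𝓕, ∀ x, p (k a x) := by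
  obtain ⟨δ, hδ, hb⟩ := Metric.eventually_nhds_iff_ball.1 hp
  filter_upwards [h δ hδ] with a ha x
  exact hb _ (by simpa using ha x)

theorem UnifSmall.comp {k : A → K → Z} (h : UnifSmall 𝓕 k) {Y : Z → Z'} (hY : ContinuousAt Y 0)
    (hY0 : Y 0 = 0) : UnifSmall 𝓕 (fun a x => Y (k a x)) := fun ε hε => by
  refine h.eventually (p := fun z => ‖Y z‖ < ε) ?_
  have := hY.norm
  rw [ContinuousAt, hY0, norm_zero] at this
  exact this.eventually (gt_mem_nhds hε)

namespace JetSmall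

theorem unifSmall {k : A → K → Z} (h : JetSmall cur 𝓕 n k) : UnifSmall 𝓕 k := by
  cases n with
  | zero => exact h
  | succ n => exact h.1

theorem of_succ {k : A → K → Z} (h : JetSmall cur 𝓕 (n + 1) k) : JetSmall cur 𝓕 n k := by
  induction n generalizing k with
  | zero => exact h.1
  | succ n ih =>
    refine ⟨h.1, fun X => ?_⟩
    obtain ⟨k', h1, h2⟩ := h.2 X
    exact ⟨k', ih h1, h2⟩

theorem congr {k l : A → K → Z} (h : JetSmall cur 𝓕 n k) (e : ∀ᶠ a in 𝓕, k a = l a) :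
    JetSmall cur 𝓕 n l := by
  cases n with
  | zero => exact UnifSmall.congr h e
  | succ n =>
    refine ⟨h.1.congr e, fun X => ?_⟩
    obtain ⟨k', h1, h2⟩ := h.2 X
    refine ⟨k', h1, ?_⟩
    filter_upwards [h2, e] with a a1 a2
    rwa [← a2]

theorem const {z : A → Z} (hz : Tendsto z 𝓕 (𝓝 0)) : JetSmall cur 𝓕 n (fun a _ => z a) := by
  have hz' : ∀ {z : A → Z}, Tendsto z 𝓕 (𝓝 0) → UnifSmall 𝓕 (fun a (_ : K) => z a) :=
    fun hz ε hε => by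
      filter_upwards [hz (Metric.ball_mem_nhds 0 hε)] with a ha x
      simpa using ha
  induction n generalizing z with
  | zero => exact hz' hz
  | succ n ih =>
    exact ⟨hz' hz, fun X => ⟨fun _ _ => 0, ih tendsto_const_nhds,
      Eventually.of_forall fun a x => hasDerivAt_const _ _⟩⟩

theorem prodMk {k : A → K → Z} {l : A → K → Z'} (h : JetSmall cur 𝓕 n k)
    (h' : JetSmall cur 𝓕 n l) : JetSmall cur 𝓕 n (fun a x => (k a x, l a x)) := by
  induction n generalizing k l with
  | zero => exact UnifSmall.prodMk h h'
  | succ n ih =>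
    refine ⟨h.1.prodMk h'.1, fun X => ?_⟩
    obtain ⟨k', h1, h2⟩ := h.2 X
    obtain ⟨l', h3, h4⟩ := h'.2 X
    refine ⟨_, ih h1 h3, ?_⟩
    filter_upwards [h2, h4] with a a1 a2 x
    exact (a1 x).prodMk (a2 x)

end JetSmall

theorem analyticAt_fderiv_apply {𝕜 Z Z' : Type*} [RCLike 𝕜] [NormedAddCommGroup Z]
    [NormedSpace 𝕜 Z] [NormedAddCommGroup Z'] [NormedSpace 𝕜 Z'] [CompleteSpace Z'] {Y : Z → Z'}
    {X : Type*} [NormedAddCommGroup X] [NormedSpace 𝕜 X] {f g : X → Z} {x : X}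
    (hY : AnalyticAt 𝕜 Y (f x)) (hf : AnalyticAt 𝕜 f x) (hg : AnalyticAt 𝕜 g x) :
    AnalyticAt 𝕜 (fun p => fderiv 𝕜 Y (f p) (g p)) x := by
  have h1 : AnalyticAt 𝕜 (fun p => fderiv 𝕜 Y (f p)) x :=
    AnalyticAt.fun_comp (g := fderiv 𝕜 Y) (f := f) hY.fderiv hf
  exact AnalyticAt.fun_comp (g := fun p : (Z →L[𝕜] Z') × Z => p.1 p.2)
    (f := fun p => (fderiv 𝕜 Y (f p), g p))
    ((ContinuousLinearMap.apply 𝕜 Z' : Z →L[𝕜] (Z →L[𝕜] Z') →L[𝕜] Z').flip.analyticAt_bilinear _)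
    (h1.prod hg)

/-- Jets of compositions with a function which is analytic at `0`. -/
theorem JetSmall.comp (hcur : ∀ X x, cur X x 0 = x) [CompleteSpace Z'] {k : A → K → Z}
    (h : JetSmall cur 𝓕 n k) {Y : Z → Z'} (hY : AnalyticAt ℝ Y 0) (hY0 : Y 0 = 0) :
    JetSmall cur 𝓕 n (fun a x => Y (k a x)) := by
  induction n generalizing Z with
  | zero => exact UnifSmall.comp h hY.continuousAt hY0
  | succ n ih =>
    refine ⟨h.1.comp hY.continuousAt hY0, fun X => ?_⟩
    obtain ⟨k', h1, h2⟩ := h.2 X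
    -- The derivative of `Y ∘ k` is an analytic function of `(k, k')` vanishing at `0`, so the
    -- induction hypothesis applies with `Z × Z` in place of `Z`.
    have hY' : AnalyticAt ℝ (fun p : Z × Z => fderiv ℝ Y p.1 p.2) 0 :=
      analyticAt_fderiv_apply hY analyticAt_fst analyticAt_snd
    refine ⟨_, ih (h.of_succ.prodMk h1) hY' (by simp), ?_⟩
    filter_upwards [h2, h.1.eventually hY.eventually_analyticAt] with a a1 a2 x
    have h3 := (a2 x).differentiableAt.hasFDerivAt
    have h4 := a1 x
    have h5 : HasFDerivAt Y (fderiv ℝ Y (k a x)) (k a (cur X x 0)) := by rwa [hcur]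
    exact h5.comp_hasDerivAt (0 : ℝ) h4

end Jets

section Translation

variable {EG : Type*} [NormedAddCommGroup EG] [NormedSpace ℝ EG]
  {G : Type*} [Group G] [TopologicalSpace G] [IsTopologicalGroup G] [ChartedSpace EG G]
  (LG : LogChart ℝ EG G)

/-- The curves `t ↦ g exp (t X)` in `G`. -/
def translate (X : EG) (g : G) (t : ℝ) : G := g * LG.curve X t

/-- The curves `t ↦ (g, h exp (t X))` in `G × G`. -/
def translateSnd (X : EG) (g : G × G) (t : ℝ) : G × G := (g.1, g.2 * LG.curve X t)

@[simp]
theorem translate_zero (X : EG) (g : G) : translate LG X g 0 = g := by simp [translate]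

@[simp]
theorem translateSnd_zero (X : EG) (g : G × G) : translateSnd LG X g 0 = g := by
  simp [translateSnd]

theorem LogChart.tendsto_curve (X : EG) : Tendsto (LG.curve X) (𝓝 0) (𝓝 1) := by
  have := LG.tendsto_exp_comp (f := fun t : ℝ => t • X) (x := 0) (by fun_prop) (by simp)
  exact this

variable [LieGroup 𝓘(ℝ, EG) ω G] {E : Type*} [NormedAddCommGroup E] [NormedSpace ℝ E]
  {A : Type*} {𝓕 : Filter A} {n : ℕ}

theorem invDerivs_append_singleton {H : Type*} [TopologicalSpace H] (I : ModelWithCorners ℝ EG H)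
    {G : Type*} [Group G] [TopologicalSpace G] [ChartedSpace H G] (L : List EG) (X : EG)
    (f : G → E) : invDerivs I (L ++ [X]) f = invDerivs I L (invDeriv I X f) := by
  simp [invDerivs]

/-- The last letter of a list is the derivation applied first, so the induction removes letters from
the end. -/
theorem jetSmall_of_invDerivs {f : A → G × G → E}
    (hf : ∀ a, ContMDiff (𝓘(ℝ, EG).prod 𝓘(ℝ, EG)) 𝓘(ℝ, E) n (f a))
    (h : ∀ L : List EG, L.length ≤ n → UnifSmall 𝓕
      (fun a => invDerivs (𝓘(ℝ, EG).prod 𝓘(ℝ, EG)) (L.map fun X => ((0 : EG), X)) (f a))) :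
    JetSmall (translateSnd LG) 𝓕 n f := by
  induction n generalizing f with
  | zero => exact h [] le_rfl
  | succ n ih =>
    refine ⟨h [] (by simp), fun X => ⟨fun a => invDeriv (𝓘(ℝ, EG).prod 𝓘(ℝ, EG)) (0, X) (f a),
      ih (fun a => contMDiff_invDeriv (hf a) (by push_cast; rfl) _) fun L hL => ?_,
      Eventually.of_forall fun a x => hasDerivAt_invDeriv_snd LG (by simp) (hf a) X x⟩⟩
    have := h (L ++ [X]) (by simpa using hL)
    rw [List.map_append] at this
    simpa only [List.map_cons, List.map_nil, invDerivs_append_singleton] using this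

theorem JetSmall.invDerivs {f : A → G → E}
    (hf : ∀ a, ContMDiff 𝓘(ℝ, EG) 𝓘(ℝ, E) n (f a)) (h : JetSmall (translate LG) 𝓕 n f)
    (L : List EG) (hL : L.length ≤ n) :
    UnifSmall 𝓕 (fun a => invDerivs 𝓘(ℝ, EG) L (f a)) := by
  induction n generalizing f L with
  | zero =>
    rw [List.eq_nil_of_length_eq_zero (Nat.le_zero.1 hL)]
    exact h
  | succ n ih =>
    rcases List.eq_nil_or_concat L with rfl | ⟨L', X, rfl⟩
    · exact h.1
    · obtain ⟨k', h1, h2⟩ := h.2 X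
      simp only [List.concat_eq_append, invDerivs_append_singleton]
      refine ih (fun a => contMDiff_invDeriv (hf a) (by push_cast; rfl) _) (h1.congr ?_) L'
        (by simpa using hL)
      filter_upwards [h2] with a ha
      ext x
      exact (ha x).unique (hasDerivAt_invDeriv LG (by simp) (hf a) X x)

variable [CompactSpace G]

/-- The sections `x ↦ f (x, x⁻¹ y)` of a map on `G × G`. -/
def diagSection {Y : Type*} [TopologicalSpace Y] (f : C(G × G, Y)) (y : G) : C(G, Y) :=
  ⟨fun x => f (x, x⁻¹ * y), by fun_prop⟩

@[simp]
theorem diagSection_apply {Y : Type*} [TopologicalSpace Y] (f : C(G × G, Y)) (x y : G) :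
    diagSection f y x = f (x, x⁻¹ * y) := rfl

/-- For fixed `x` only the second argument `x⁻¹ y` moves, along an exponential curve. Uniformity in
`x`, needed for a derivative in `C(G, E)`, comes from continuity of `f'` on compact `G` and the mean
value inequality. -/
theorem hasDerivAt_diagSection {f f' : C(G × G, E)}
    (hf : ContMDiff (𝓘(ℝ, EG).prod 𝓘(ℝ, EG)) 𝓘(ℝ, E) 1 f) (X : EG)
    (hf' : ∀ q, f' q = invDeriv (𝓘(ℝ, EG).prod 𝓘(ℝ, EG)) (0, X) f q) (y : G) :
    HasDerivAt (fun t => diagSection f (translate LG X y t)) (diagSection f' y) 0 := by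
  obtain ⟨δ, hδ, hadd⟩ := Metric.eventually_nhds_iff_ball.1 (LG.curve_add X)
  have hcurve : ∀ t : ℝ, |t| < δ → ∀ᶠ s in 𝓝 (0 : ℝ),
      LG.curve X (t + s) = LG.curve X t * LG.curve X s := fun t ht => by
    filter_upwards [Metric.ball_mem_nhds (0 : ℝ) hδ] with s hs
    refine hadd (t, s) ?_
    rw [mem_ball_zero_iff, Prod.norm_def]
    exact max_lt ht (by simpa using hs)
  have hder : ∀ x, ∀ t : ℝ, |t| < δ → HasDerivAt (fun t => f (x, x⁻¹ * (y * LG.curve X t)))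
      (f' (x, x⁻¹ * (y * LG.curve X t))) t := fun x t ht => by
    have h1 := hasDerivAt_invDeriv_snd LG le_rfl hf X (x, x⁻¹ * (y * LG.curve X t))
    rw [← hf'] at h1
    have h2 : HasDerivAt (fun s => f (x, x⁻¹ * (y * LG.curve X (t + s))))
        (f' (x, x⁻¹ * (y * LG.curve X t))) 0 := by
      refine h1.congr_of_eventuallyEq ?_
      filter_upwards [hcurve t ht] with s hs
      rw [hs]
      simp only [mul_assoc]
    have h3 : HasDerivAt (fun s => f (x, x⁻¹ * (y * LG.curve X (t + (s - t)))))
        (f' (x, x⁻¹ * (y * LG.curve X t))) t := by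
      refine HasDerivAt.comp_sub_const t t (f := fun s => f (x, x⁻¹ * (y * LG.curve X (t + s)))) ?_
      rwa [sub_self]
    simpa using h3
  rw [hasDerivAt_iff_isLittleO, Asymptotics.isLittleO_iff]
  intro ε hε
  have hunif : ∀ᶠ t in 𝓝 (0 : ℝ), ∀ x ∈ (Set.univ : Set G),
      ‖f' (x, x⁻¹ * (y * LG.curve X t)) - f' (x, x⁻¹ * y)‖ < ε := by
    refine isCompact_univ.eventually_forall_of_forall_eventually fun x _ => ?_
    have h1 : Tendsto (fun p : ℝ × G => LG.curve X p.1) (𝓝 (0, x)) (𝓝 1) :=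
      (LG.tendsto_curve X).comp (continuous_fst.tendsto' _ _ rfl)
    have h2 : Tendsto (fun p : ℝ × G => p.2) (𝓝 (0, x)) (𝓝 x) := continuous_snd.tendsto' _ _ rfl
    have h3 : Tendsto (fun p : ℝ × G => (p.2, p.2⁻¹ * (y * LG.curve X p.1))) (𝓝 (0, x))
        (𝓝 (x, x⁻¹ * (y * 1))) := h2.prodMk_nhds (h2.inv.mul (h1.const_mul y))
    have h4 : Tendsto (fun p : ℝ × G => (p.2, p.2⁻¹ * y)) (𝓝 (0, x))
        (𝓝 (x, x⁻¹ * y)) := h2.prodMk_nhds (h2.inv.mul_const y)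
    have h5 := (((f'.continuous.tendsto _).comp h3).sub ((f'.continuous.tendsto _).comp h4)).norm
    rw [mul_one, sub_self, norm_zero] at h5
    exact h5.eventually (gt_mem_nhds hε)
  obtain ⟨η, hη, hb⟩ := Metric.eventually_nhds_iff_ball.1 hunif
  filter_upwards [Metric.ball_mem_nhds (0 : ℝ) (lt_min hδ hη)] with t ht
  refine (ContinuousMap.norm_le _ (by positivity)).2 fun x => ?_
  have hφ : ∀ s ∈ Metric.ball (0 : ℝ) (min δ η), HasDerivWithinAt
      (fun s => f (x, x⁻¹ * (y * LG.curve X s)) - s • f' (x, x⁻¹ * y))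
      (f' (x, x⁻¹ * (y * LG.curve X s)) - f' (x, x⁻¹ * y)) (Metric.ball 0 (min δ η)) s :=
    fun s hs => by
      have h1 := hder x s ((by simpa using hs : |s| < δ ∧ |s| < η).1)
      have h2 := (hasDerivAt_id s).smul_const (f' (x, x⁻¹ * y))
      rw [one_smul] at h2
      exact (h1.sub h2).hasDerivWithinAt
  have := (convex_ball (0 : ℝ) (min δ η)).norm_image_sub_le_of_norm_hasDerivWithin_le hφ
    (fun s hs => (hb s (Metric.ball_subset_ball (min_le_right _ _) hs) x trivial).le)
    (Metric.mem_ball_self (lt_min hδ hη)) ht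
  refine le_trans (le_of_eq ?_) this
  simp only [translate, ContinuousMap.sub_apply, ContinuousMap.smul_apply, diagSection_apply,
    LG.curve_zero, zero_smul, sub_zero, mul_one]
  congr 1
  abel

theorem JetSmall.diagSection {f : A → C(G × G, E)}
    (hf : ∀ a, ContMDiff (𝓘(ℝ, EG).prod 𝓘(ℝ, EG)) 𝓘(ℝ, E) n (f a))
    (h : JetSmall (translateSnd LG) 𝓕 n (fun a => f a)) :
    JetSmall (translate LG) 𝓕 n (fun a => AlmostMorphism.diagSection (f a)) := by
  have key : ∀ {f : A → C(G × G, E)}, UnifSmall 𝓕 (fun a => f a) →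
      UnifSmall 𝓕 (fun a => AlmostMorphism.diagSection (f a)) := fun h ε hε => by
    filter_upwards [h ε hε] with a ha y
    exact (ContinuousMap.norm_lt_iff _ hε).2 fun x => ha _
  induction n generalizing f with
  | zero => exact key h
  | succ n ih =>
    refine ⟨key h.1, fun X => ?_⟩
    obtain ⟨k', h1, h2⟩ := h.2 X
    have hc : ∀ a, ContMDiff (𝓘(ℝ, EG).prod 𝓘(ℝ, EG)) 𝓘(ℝ, E) n
        (invDeriv (𝓘(ℝ, EG).prod 𝓘(ℝ, EG)) (0, X) (f a)) :=
      fun a => contMDiff_invDeriv (hf a) (by push_cast; rfl) _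
    refine ⟨_, ih (f := fun a => ⟨_, (hc a).continuous⟩) hc (h1.congr ?_),
      Eventually.of_forall fun a y => hasDerivAt_diagSection LG ((hf a).of_le (by simp)) X
        (fun q => rfl) y⟩
    filter_upwards [h2] with a ha
    ext x
    exact (ha x).unique (hasDerivAt_invDeriv_snd LG (by simp) (hf a) X x)

end Translation

end AlmostMorphism

end

/-! ### The averaged equation satisfied by the correction. -/

noncomputable section

namespace AlmostMorphism

set_option linter.unusedSectionVars false

variable {𝕜 : Type*} [RCLike 𝕜] {E : Type*} [NormedAddCommGroup E] [NormedSpace 𝕜 E]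
  [CompleteSpace E] [NormedSpace ℝ E] [IsScalarTower ℝ 𝕜 E]
  {U : Type*} [Group U] [TopologicalSpace U] [IsTopologicalGroup U]
  [ChartedSpace E U] [LieGroup 𝓘(𝕜, E) ω U]
  {G : Type*} [Group G] [TopologicalSpace G] [IsTopologicalGroup G] [CompactSpace G]

/-- The logarithms of `exp a`, `exp (-κ)`, `exp (-α)`. -/
def gaugeQuad (p : C(G, E) × C(G, E) × E) (a : E) : C(G, E × E × E × E) :=
  pairCLM 𝕜 G E (E × E × E) (constCLM 𝕜 G E a,
    pairCLM 𝕜 G E (E × E) (-p.1, pairCLM 𝕜 G E E (-p.2.1, 0)))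

@[simp]
theorem gaugeQuad_apply (p : C(G, E) × C(G, E) × E) (a : E) (x : G) :
    gaugeQuad (𝕜 := 𝕜) p a x = (a, -p.1 x, -p.2.1 x, 0) := rfl

/-- The equation `∫ log (exp a exp (-κ x) exp (-α x)) dx = m` has a unique small solution `a`. -/
theorem exists_gauge (L : LogChart 𝕜 E U) (M : InvariantMean 𝕜 G E) :
    ∃ Y : C(G, E) × C(G, E) × E → E, AnalyticAt 𝕜 Y 0 ∧ Y 0 = 0 ∧
      (∀ᶠ p in 𝓝 0, M.mean (superpose L.mul4 (gaugeQuad (𝕜 := 𝕜) p (Y p))) = p.2.2) ∧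
      ∀ᶠ v in 𝓝 ((0 : C(G, E) × C(G, E) × E), (0 : E)),
        M.mean (superpose L.mul4 (gaugeQuad (𝕜 := 𝕜) v.1 v.2)) = v.1.2.2 → Y v.1 = v.2 := by
  let Q : (C(G, E) × C(G, E) × E) × E → C(G, E × E × E × E) := fun v => gaugeQuad (𝕜 := 𝕜) v.1 v.2
  have hQ : AnalyticAt 𝕜 Q 0 := by
    have h1 : AnalyticAt 𝕜 (fun v : (C(G, E) × C(G, E) × E) × E => v.1) 0 := analyticAt_fst
    have h2 : AnalyticAt 𝕜 (fun v : (C(G, E) × C(G, E) × E) × E => v.1.1) 0 :=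
      AnalyticAt.fun_comp (g := Prod.fst) analyticAt_fst h1
    have h3 : AnalyticAt 𝕜 (fun v : (C(G, E) × C(G, E) × E) × E => v.1.2) 0 :=
      AnalyticAt.fun_comp (g := Prod.snd) analyticAt_snd h1
    have h4 : AnalyticAt 𝕜 (fun v : (C(G, E) × C(G, E) × E) × E => v.1.2.1) 0 :=
      AnalyticAt.fun_comp (g := Prod.fst) analyticAt_fst h3
    exact analyticAt_pair (analyticAt_clm_comp (constCLM 𝕜 G E) analyticAt_snd)
      (analyticAt_pair h2.neg (analyticAt_pair h4.neg analyticAt_const))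
  have hQ0 : Q 0 = 0 := by
    ext x <;> simp [Q]
  obtain ⟨r, hr, -, hsup⟩ := exists_superpose_analyticAt (K := G) L.analyticAt_mul4
  have hS : AnalyticAt 𝕜 (superpose L.mul4 : C(G, E × E × E × E) → C(G, E)) 0 :=
    (hsup 0 fun k => by simpa using hr).1
  let Φ : (C(G, E) × C(G, E) × E) × E → E :=
    fun v => v.2 - M.mean (superpose L.mul4 (Q v)) + v.1.2.2
  have hΦ : AnalyticAt 𝕜 Φ (0, 0) := by
    have h1 : AnalyticAt 𝕜 (fun v : (C(G, E) × C(G, E) × E) × E => v.1) 0 := analyticAt_fst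
    have h3 : AnalyticAt 𝕜 (fun v : (C(G, E) × C(G, E) × E) × E => v.1.2) 0 :=
      AnalyticAt.fun_comp (g := Prod.snd) analyticAt_snd h1
    have h5 : AnalyticAt 𝕜 (fun v : (C(G, E) × C(G, E) × E) × E => v.1.2.2) 0 :=
      AnalyticAt.fun_comp (g := Prod.snd) analyticAt_snd h3
    refine (analyticAt_snd.sub (analyticAt_clm_comp M.mean ?_)).add h5
    exact AnalyticAt.fun_comp (g := superpose L.mul4) (f := Q)
      (by change AnalyticAt 𝕜 _ (Q 0); rwa [hQ0]) hQ
  -- For the zero parameter the mean is that of the constant `a`, so `Φ (0, ·)` vanishes near `0`;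
  -- its derivative is `0` and the fixed point theorem applies.
  have hΦ0 : ∀ᶠ a in 𝓝 (0 : E), Φ (0, a) = 0 := by
    filter_upwards [Metric.ball_mem_nhds (0 : E) L.radius_pos] with a ha
    have e : superpose L.mul4 (Q (0, a)) = ContinuousMap.const G a := superpose_eq fun k => by
      simp [Q, LogChart.mul4, L.exp_zero, L.log_exp a (by simpa using ha)]
    simp only [Φ, e, M.const]
    simp
  have hd : fderiv 𝕜 Φ (0, 0) ∘L ContinuousLinearMap.inr 𝕜 (C(G, E) × C(G, E) × E) E = 0 := by
    have h1 : HasFDerivAt (fun a : E => Φ (0, a)) (fderiv 𝕜 Φ (0, 0) ∘L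
        ContinuousLinearMap.inr 𝕜 (C(G, E) × C(G, E) × E) E) 0 :=
      HasFDerivAt.comp (g := Φ) (f := fun a : E => ((0 : C(G, E) × C(G, E) × E), a)) (0 : E)
        hΦ.differentiableAt.hasFDerivAt (hasFDerivAt_prodMk_right _ _)
    exact h1.unique ((hasFDerivAt_const (0 : E) (0 : E)).congr_of_eventuallyEq hΦ0)
  obtain ⟨Y, hY, hY0, hY1, hY2⟩ := exists_analyticAt_fixedPoint hΦ hΦ0.self_of_nhds (by
    rw [hd, ContinuousLinearMap.opNorm_zero]; exact one_pos)
  refine ⟨Y, hY, hY0, ?_, ?_⟩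
  · filter_upwards [hY1] with p hp
    have : Y p - M.mean (superpose L.mul4 (gaugeQuad (𝕜 := 𝕜) p (Y p))) + p.2.2 = Y p := hp
    rw [sub_add_eq_add_sub, sub_eq_iff_eq_add] at this
    exact (add_left_cancel this).symm
  · filter_upwards [hY2] with v hv h
    refine hv ?_
    change v.2 - M.mean (superpose L.mul4 (gaugeQuad (𝕜 := 𝕜) v.1 v.2)) + v.1.2.2 = v.2
    rw [h, sub_add_cancel]

namespace Corrector

variable {L : LogChart 𝕜 E U} {M : InvariantMean 𝕜 G E} {C : ℝ} (K : Corrector L M C)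
  (R : GoodRadius L G) {ε : ℝ}

/-- The logarithm of the quotient of the morphism and of the almost morphism. -/
def leftCorr (ρ : C(G, U)) : C(G, E) :=
  bilinCLM 𝕜 G (.id 𝕜 (E →L[𝕜] E))
    ⟨fun t => (Ad 𝕜 (ρ t) : E →L[𝕜] E), L.continuous_Ad.comp ρ.continuous⟩ (K.corr ρ)

@[simp]
theorem leftCorr_apply (ρ : C(G, U)) (t : G) : K.leftCorr ρ t = Ad 𝕜 (ρ t) (K.corr ρ t) := rfl

variable {ρ : C(G, U)} (hC : 1 ≤ C) (hρ : IsAlmost L C ε ρ) (hε : ε ≤ K.ε)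
  (hr : 2 * (C * (3 * C * ε)) ≤ R.r)
include hC hρ hε

theorem norm_corr_apply_lt (t : G) : ‖K.corr ρ t‖ < 3 * C * ε :=
  ((K.corr ρ).norm_coe_le_norm t).trans_lt (K.norm_corr_lt hρ hε)

theorem norm_leftCorr_lt : ‖K.leftCorr ρ‖ < C * (3 * C * ε) := by
  have := hρ.C_pos
  have := hρ.ε_pos
  exact (ContinuousMap.norm_lt_iff _ (by positivity)).2 fun t =>
    norm_Ad_lt hρ (K.norm_corr_apply_lt hC hρ hε t) t

include hr

theorem radius_bounds : 0 < C * (3 * C * ε) ∧ C * (3 * C * ε) ≤ R.r ∧ 3 * C * ε ≤ R.r ∧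
    ε ≤ R.r := by
  have h1 := hρ.C_pos
  have h2 := hρ.ε_pos
  have h3 : 0 < 3 * C * ε := by positivity
  have h4 : 3 * C * ε ≤ C * (3 * C * ε) := by nlinarith
  have h5 : ε ≤ 3 * C * ε := by nlinarith
  refine ⟨by positivity, by linarith, by linarith, by linarith⟩

theorem exp_leftCorr (t : G) : L.exp (K.leftCorr ρ t) = K.morphism ρ t * (ρ t)⁻¹ := by
  obtain ⟨h0, h1, h2, h3⟩ := K.radius_bounds R hC hρ hε hr
  have b := K.norm_corr_apply_lt hC hρ hε t
  rw [K.morphism_apply hρ hε (h2.trans R.r_le), leftCorr_apply,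
    L.exp_Ad _ _ (b.trans_le (h2.trans R.r_le)) ((norm_Ad_lt hρ b t).trans_le (h1.trans R.r_le))]

theorem norm_Ad_morphism_le (t : G) : ‖(Ad 𝕜 (K.morphism ρ t) : E →L[𝕜] E)‖ ≤ 2 * C := by
  have := K.norm_Ad_morphism_inv_le R hC hρ hε (K.radius_bounds R hC hρ hε hr).2.1 t⁻¹
  rwa [map_inv, inv_inv] at this

theorem Ad_morphism_mean (t : G) :
    Ad 𝕜 (K.morphism ρ t) (M.mean (K.corr ρ)) = M.mean (K.corr ρ) := by
  obtain ⟨h0, h1, h2, h3⟩ := K.radius_bounds R hC hρ hε hr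
  have := K.invariant ρ (hρ.mono hε) t
  change Ad 𝕜 (ρ t * L.exp (K.corr ρ t))⁻¹ (M.mean (K.corr ρ)) = M.mean (K.corr ρ) at this
  rw [← K.morphism_apply hρ hε (h2.trans R.r_le)] at this
  nth_rewrite 1 [← this]
  rw [Ad_Ad_inv]

theorem norm_logCob_lt : ‖logCob L ρ‖ < ε :=
  (ContinuousMap.norm_lt_iff _ hρ.ε_pos).2 fun q => by
    rw [hρ.logCob_apply]
    exact (hρ.cob q.1 q.2).1

/-- The mean of the logarithms of the elements `exp (α y) c(x, x⁻¹ y)⁻¹ exp (-α x)`, where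
`exp α` is the quotient of the morphism and of the almost morphism. -/
theorem mean_superpose_gaugeQuad (y : G) :
    M.mean (superpose L.mul4 (gaugeQuad (𝕜 := 𝕜)
      (diagSection (logCob L ρ) y, K.leftCorr ρ, M.mean (K.corr ρ)) (K.leftCorr ρ y))) =
      M.mean (K.corr ρ) := by
  obtain ⟨h0, h1, h2, h3⟩ := K.radius_bounds R hC hρ hε hr
  have hrr := R.r_le
  let T : E →L[𝕜] E := Ad 𝕜 (K.morphism ρ y)
  let b : C(G, E) := ⟨fun x => K.corr ρ (x⁻¹ * y), by fun_prop⟩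
  have hTn : ∀ x, ‖T (b x)‖ < R.r := fun x => by
    refine (ContinuousLinearMap.le_of_opNorm_le _ (K.norm_Ad_morphism_le R hC hρ hε hr y)
      _).trans_lt ?_
    have hb := K.norm_corr_apply_lt hC hρ hε (x⁻¹ * y)
    have hC0 := hρ.C_pos
    calc 2 * C * ‖b x‖ < 2 * C * (3 * C * ε) := by gcongr; exact hb
      _ ≤ R.r := by linarith
  -- Since `exp α = π ρ⁻¹`, the product is `π(y) ρ(x⁻¹y)⁻¹ π(x)⁻¹`. Multiplicativity of `π` rewrites
  -- it as `π(y) exp(β(x⁻¹y)) π(y)⁻¹`, with logarithm `Ad(π(y)) β(x⁻¹y)`. The mean of the latter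
  -- over `x` is `Ad(π(y)) m`, which is `m` by invariance.
  have e : superpose L.mul4 (gaugeQuad (𝕜 := 𝕜)
      (diagSection (logCob L ρ) y, K.leftCorr ρ, M.mean (K.corr ρ)) (K.leftCorr ρ y)) =
      (⟨fun x => T (b x), by fun_prop⟩ : C(G, E)) := by
    refine superpose_eq fun x => ?_
    have na := fun t => ((K.leftCorr ρ).norm_coe_le_norm t).trans_lt
      ((K.norm_leftCorr_lt hC hρ hε).trans_le h1)
    have nl : ‖logCob L ρ (x, x⁻¹ * y)‖ < R.r :=
      ((logCob L ρ).norm_coe_le_norm _).trans_lt ((K.norm_logCob_lt R hC hρ hε hr).trans_le h3)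
    have nq : ‖gaugeQuad (𝕜 := 𝕜) (diagSection (logCob L ρ) y, K.leftCorr ρ, M.mean (K.corr ρ))
        (K.leftCorr ρ y) x‖ < R.r := by
      rw [gaugeQuad_apply, Prod.norm_mk, Prod.norm_mk, Prod.norm_mk, norm_neg, norm_neg, norm_zero]
      exact max_lt (na y) (max_lt nl (max_lt (na x) R.r_pos))
    refine L.eq_of_exp_eq (R.norm_mul4_lt _ nq) ((hTn x).trans_le hrr) ?_
    rw [R.exp_mul4 _ nq]
    simp only [gaugeQuad_apply, diagSection_apply, L.exp_zero, mul_one]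
    rw [L.exp_neg (nl.trans_le hrr), L.exp_neg ((na x).trans_le hrr),
      K.exp_leftCorr R hC hρ hε hr, K.exp_leftCorr R hC hρ hε hr, hρ.logCob_apply,
      (hρ.cob _ _).2.1]
    change _ = L.exp (Ad 𝕜 (K.morphism ρ y) (b x))
    rw [L.exp_Ad (K.morphism ρ y) (b x) ((K.norm_corr_apply_lt hC hρ hε _).trans_le (h2.trans hrr))
      ((hTn x).trans_le hrr)]
    have e1 := K.morphism_apply hρ hε (h2.trans hrr) (x⁻¹ * y)
    have e2 : L.exp (b x) = (ρ (x⁻¹ * y))⁻¹ * K.morphism ρ (x⁻¹ * y) := by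
      rw [e1, inv_mul_cancel_left]; rfl
    have e3 : K.morphism ρ (x⁻¹ * y) = (K.morphism ρ x)⁻¹ * K.morphism ρ y := by
      rw [_root_.map_mul, map_inv]
    rw [e2, e3]
    simp only [coboundary, ContinuousMap.coe_mk, mul_inv_cancel_left]
    group
  rw [e, M.comp_clm T b _ fun s => rfl, M.congr_inv_mul (K.corr ρ) b y fun s => rfl]
  exact K.Ad_morphism_mean R hC hρ hε hr y

end Corrector

end AlmostMorphism

end

/-! ### The logarithmic derivative of the quotient of the morphism and the almost morphism. -/

noncomputable section

namespace AlmostMorphism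

set_option linter.unusedSectionVars false

variable {𝕜 : Type*} [RCLike 𝕜] {E : Type*} [NormedAddCommGroup E] [NormedSpace 𝕜 E]
  [CompleteSpace E] [NormedSpace ℝ E] [IsScalarTower ℝ 𝕜 E]
  {U : Type*} [Group U] [TopologicalSpace U] [IsTopologicalGroup U]
  [ChartedSpace E U] [LieGroup 𝓘(𝕜, E) ω U]

/-- To first order the logarithm of `a b⁻¹` is the difference of the logarithms, and conjugation by
`u` acts through `Ad u`. This is the computation behind the formulas for quotients and for
coboundaries. -/
theorem LogChart.hasDerivAt_log_conj (L : LogChart 𝕜 E U) (u : U) {a b : ℝ → U} {p q : E}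
    (ha : HasDerivAt (fun t => L.log (a t)) p 0) (ha1 : Tendsto a (𝓝 0) (𝓝 1)) (ha0 : a 0 = 1)
    (hb : HasDerivAt (fun t => L.log (b t)) q 0) (hb1 : Tendsto b (𝓝 0) (𝓝 1)) (hb0 : b 0 = 1) :
    HasDerivAt (fun t => L.log (u * (a t * (b t)⁻¹) * u⁻¹)) (Ad 𝕜 u (p - q)) 0 := by
  let z : ℝ → E × E × E × E := fun t => (L.log (a t), -L.log (b t), 0, 0)
  have hz : HasDerivAt z (p, -q, 0, 0) 0 :=
    ha.prodMk (hb.fun_neg.prodMk ((hasDerivAt_const _ _).prodMk (hasDerivAt_const _ _)))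
  have hz0 : z 0 = 0 := by simp [z, ha0, hb0, L.log_one]
  have h1 : HasFDerivAt L.mul4 ((LogChart.sum4 𝕜 E).restrictScalars ℝ) (z 0) := by
    rw [hz0]
    exact L.hasFDerivAt_mul4.restrictScalars ℝ
  have h2 : HasDerivAt (fun t => Ad 𝕜 u (L.mul4 (z t))) (Ad 𝕜 u (p - q)) 0 := by
    have h3 := h1.comp_hasDerivAt (0 : ℝ) hz
    have h4 := ((Ad 𝕜 u : E →L[𝕜] E).restrictScalars ℝ).hasFDerivAt.comp_hasDerivAt (0 : ℝ) h3
    convert! h4 using 1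
    simp [LogChart.sum4_apply, sub_eq_add_neg]
  refine h2.congr_of_eventuallyEq ?_
  have hA : 0 < ‖(Ad 𝕜 u : E →L[𝕜] E)‖ + 1 := by positivity
  have hR := L.radius_pos
  obtain ⟨δ, hδ, hm⟩ := L.eventually_exp_mul4
    (η := min L.radius (L.radius / (‖(Ad 𝕜 u : E →L[𝕜] E)‖ + 1))) (by positivity)
  have hzt : Tendsto z (𝓝 0) (𝓝 0) := by
    have := hz.continuousAt.tendsto
    rwa [hz0] at this
  filter_upwards [hzt.eventually (Metric.ball_mem_nhds 0 hδ), ha1.eventually L.exp_log,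
    hb1.eventually L.exp_log, (L.tendsto_log.comp hb1).eventually
      (Metric.ball_mem_nhds 0 L.radius_pos)] with t t1 t2 t3 t4
  obtain ⟨h5, h6⟩ := hm (z t) (by simpa using t1)
  rw [lt_min_iff, lt_div_iff₀ hA] at h6
  have h7 : ‖Ad 𝕜 u (L.mul4 (z t))‖ < L.radius := by
    refine lt_of_le_of_lt ?_ h6.2
    refine (ContinuousLinearMap.le_opNorm _ _).trans ?_
    rw [mul_comm]
    gcongr
    linarith
  rw [← L.log_exp _ h7, L.exp_Ad _ _ h6.1 h7, h5]
  simp only [z, L.exp_zero, mul_one]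
  rw [L.exp_neg (by simpa using t4), t2, t3]

theorem LogChart.eventually_contMDiffAt_log (L : LogChart 𝕜 E U) [LieGroup 𝓘(ℝ, E) ω U] :
    ∀ᶠ u in 𝓝 (1 : U), ContMDiffAt 𝓘(ℝ, E) 𝓘(ℝ, E) ω L.log u :=
  (contMDiffAt_iff_contMDiffAt_nhds (by simp)).1 L.contMDiffAt_log

variable {EG : Type*} [NormedAddCommGroup EG] [NormedSpace ℝ EG] [CompleteSpace EG]
  {G : Type*} [Group G] [TopologicalSpace G] [IsTopologicalGroup G] [ChartedSpace EG G]
  [LieGroup 𝓘(ℝ, EG) ω G] (LG : LogChart ℝ EG G) [LieGroup 𝓘(ℝ, E) ω U] (L : LogChart 𝕜 E U)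

theorem tendsto_translate_quotient {f : G → U} (hf : Continuous f) (X : EG) (g : G) :
    Tendsto (fun t => (f g)⁻¹ * f (g * LG.curve X t)) (𝓝 0) (𝓝 1) := by
  have h : Continuous fun u => (f g)⁻¹ * f (g * u) := by fun_prop
  exact (h.tendsto' 1 1 (by simp)).comp (LG.tendsto_curve X)

theorem tendsto_translateSnd_quotient {f : G × G → U} (hf : Continuous f) (X : EG) (g : G × G) :
    Tendsto (fun t => (f g)⁻¹ * f (g.1, g.2 * LG.curve X t)) (𝓝 0) (𝓝 1) := by
  have h : Continuous fun u => (f g)⁻¹ * f (g.1, g.2 * u) := by fun_prop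
  exact (h.tendsto' 1 1 (by simp)).comp (LG.tendsto_curve X)

-- The left-translated increment of `f₁ f₂⁻¹` is the increment of `f₁` times the inverse increment
-- of `f₂`, conjugated by `f₂ g`.
include LG L in
theorem logDeriv_div {f₁ f₂ : G → U} {n : WithTop ℕ∞} (hn : 1 ≤ n)
    (h₁ : ContMDiff 𝓘(ℝ, EG) 𝓘(ℝ, E) n f₁)
    (h₂ : ContMDiff 𝓘(ℝ, EG) 𝓘(ℝ, E) n f₂) (X : EG) (g : G) :
    logDeriv 𝓘(ℝ, EG) X (fun x => f₁ x * (f₂ x)⁻¹) g =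
      Ad 𝕜 (f₂ g) (logDeriv 𝓘(ℝ, EG) X f₁ g - logDeriv 𝓘(ℝ, EG) X f₂ g : E) := by
  have : LieGroup 𝓘(ℝ, E) n U := LieGroup.of_le (n := ω) le_top
  have h := hasDerivAt_logDeriv LG L hn (h₁.mul h₂.inv) X g
  refine h.unique ?_
  have := L.hasDerivAt_log_conj (f₂ g) (hasDerivAt_logDeriv LG L hn h₁ X g)
    (tendsto_translate_quotient LG h₁.continuous X g) (by simp)
    (hasDerivAt_logDeriv LG L hn h₂ X g)
    (tendsto_translate_quotient LG h₂.continuous X g) (by simp)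
  convert! this using 3
  simp only [Pi.mul_apply]
  group

theorem contMDiff_coboundary {ρ : C(G, U)} {n : WithTop ℕ∞} (hρ : ContMDiff 𝓘(ℝ, EG) 𝓘(ℝ, E) n ρ) :
    ContMDiff (𝓘(ℝ, EG).prod 𝓘(ℝ, EG)) 𝓘(ℝ, E) n (coboundary ρ) := by
  have : LieGroup 𝓘(ℝ, E) n U := LieGroup.of_le (n := ω) le_top
  have : LieGroup 𝓘(ℝ, EG) n G := LieGroup.of_le (n := ω) le_top
  exact ((hρ.comp contMDiff_fst).mul (hρ.comp contMDiff_snd)).mul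
      (hρ.comp (contMDiff_mul 𝓘(ℝ, EG) n)).inv

-- Along the second variable the factor `ρ(s)` is constant and cancels in a left logarithmic
-- derivative; what remains is a quotient of increments of `ρ` at `t` and at `st`, conjugated by
-- `ρ(st)`.
include LG L in
theorem logDeriv_coboundary {ρ : C(G, U)} {n : WithTop ℕ∞} (hn : 1 ≤ n)
    (hρ : ContMDiff 𝓘(ℝ, EG) 𝓘(ℝ, E) n ρ) (X : EG) (s t : G) :
    logDeriv (𝓘(ℝ, EG).prod 𝓘(ℝ, EG)) (0, X) (coboundary ρ) (s, t) =
      Ad 𝕜 (ρ (s * t)) (logDeriv 𝓘(ℝ, EG) X ρ t - logDeriv 𝓘(ℝ, EG) X ρ (s * t) : E) := by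
  have h := hasDerivAt_logDeriv_snd LG L hn (contMDiff_coboundary hρ) X (s, t)
  refine h.unique ?_
  have := L.hasDerivAt_log_conj (ρ (s * t)) (hasDerivAt_logDeriv LG L hn hρ X t)
    (tendsto_translate_quotient LG hρ.continuous X t) (by simp)
    (hasDerivAt_logDeriv LG L hn hρ X (s * t))
    (tendsto_translate_quotient LG hρ.continuous X (s * t)) (by simp)
  convert! this using 3
  simp only [coboundary, ContinuousMap.coe_mk, mul_assoc]
  group

variable [CompactSpace G]

/-- The derivative of `log (exp p exp v)` in `v` at `0`. -/
def dlogMul (p : E × E) : E := fderiv 𝕜 L.mul4 (p.1, 0, 0, 0) (0, p.2, 0, 0)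

theorem analyticAt_mk4 {X : Type*} [NormedAddCommGroup X] [NormedSpace 𝕜 X] {f g : X → E} {x : X}
    (hf : AnalyticAt 𝕜 f x) (hg : AnalyticAt 𝕜 g x) :
    AnalyticAt 𝕜 (fun v => ((f v, g v, 0, 0) : E × E × E × E)) x :=
  hf.prod (hg.prod (analyticAt_const.prod analyticAt_const))

theorem analyticAt_dlogMul : AnalyticAt 𝕜 (dlogMul L) 0 :=
  analyticAt_fderiv_apply (by exact L.analyticAt_mul4)
    (analyticAt_mk4 analyticAt_fst analyticAt_const) (analyticAt_mk4 analyticAt_const analyticAt_snd)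

theorem dlogMul_zero : dlogMul L 0 = 0 := map_zero _

theorem exists_contMDiff_logCob : ∃ δ > 0, ∀ {C ε : ℝ} {ρ : C(G, U)} {n : WithTop ℕ∞},
    IsAlmost L C ε ρ → ε ≤ δ → ContMDiff 𝓘(ℝ, EG) 𝓘(ℝ, E) n ρ →
      ContMDiff (𝓘(ℝ, EG).prod 𝓘(ℝ, EG)) 𝓘(ℝ, E) n (logCob L ρ) := by
  obtain ⟨δ, hδ, hb⟩ := Metric.eventually_nhds_iff_ball.1
    (L.tendsto_exp.eventually L.eventually_contMDiffAt_log)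
  refine ⟨δ, hδ, fun {C ε ρ n} h hε hρ q => ?_⟩
  have e : (logCob L ρ : G × G → E) = L.log ∘ coboundary ρ := funext h.logCob_apply
  rw [e]
  have h1 := h.cob q.1 q.2
  have h2 := hb (L.log (coboundary ρ q)) (by simpa using h1.1.trans_le hε)
  rw [h1.2.1] at h2
  exact ContMDiffAt.comp q (h2.of_le le_top) (contMDiff_coboundary hρ q)

/-- The coboundary near `q` is `exp(log c(q))` times an increment starting at `1`. So the derivative
of `log c` is an analytic function of `log c` and of the logarithmic derivative, which allows an
induction on the order of derivation. -/
theorem exists_hasDerivAt_logCob : ∃ δ > 0, ∀ {C ε : ℝ} {ρ : C(G, U)} {n : WithTop ℕ∞},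
    IsAlmost L C ε ρ → ε ≤ δ → 1 ≤ n → ContMDiff 𝓘(ℝ, EG) 𝓘(ℝ, E) n ρ → ∀ (X : EG) (q : G × G),
      HasDerivAt (fun t => logCob L ρ (translateSnd LG X q t))
        (dlogMul L (logCob L ρ q,
          logDeriv (𝓘(ℝ, EG).prod 𝓘(ℝ, EG)) (0, X) (coboundary ρ) q)) 0 := by
  obtain ⟨δ, hδ, hb⟩ := Metric.eventually_nhds_iff_ball.1 L.analyticAt_mul4.eventually_analyticAt
  refine ⟨δ, hδ, fun {C ε ρ n} h hε hn hρ X q => ?_⟩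
  have h1 := h.cob q.1 q.2
  have h2 := hasDerivAt_logDeriv_snd LG L hn (contMDiff_coboundary hρ) X q
  have h3 : HasDerivAt (fun t => ((logCob L ρ q, L.log ((coboundary ρ q)⁻¹ *
      coboundary ρ (q.1, q.2 * LG.curve X t)), 0, 0) : E × E × E × E))
      (0, logDeriv (𝓘(ℝ, EG).prod 𝓘(ℝ, EG)) (0, X) (coboundary ρ) q, 0, 0) 0 :=
    (hasDerivAt_const _ _).prodMk (h2.prodMk ((hasDerivAt_const _ _).prodMk (hasDerivAt_const _ _)))
  have h4 : HasFDerivAt L.mul4 ((fderiv 𝕜 L.mul4 (logCob L ρ q, 0, 0, 0)).restrictScalars ℝ)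
      (logCob L ρ q, L.log ((coboundary ρ q)⁻¹ *
      coboundary ρ (q.1, q.2 * LG.curve X 0)), 0, 0) := by
    rw [LG.curve_zero, mul_one, inv_mul_cancel, L.log_one]
    refine ((hb _ ?_).differentiableAt.hasFDerivAt).restrictScalars ℝ
    rw [mem_ball_zero_iff, h.logCob_apply, Prod.norm_mk, Prod.norm_mk, Prod.norm_mk, norm_zero]
    have : ‖L.log (coboundary ρ q)‖ < δ := h1.1.trans_le hε
    exact max_lt this (max_lt hδ (max_lt hδ hδ))
  refine (h4.comp_hasDerivAt (0 : ℝ) h3).congr_of_eventuallyEq ?_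
  filter_upwards [(tendsto_translateSnd_quotient LG (coboundary ρ).continuous X q).eventually
    L.exp_log] with t ht
  rw [h.logCob_apply]
  simp only [Function.comp_apply, LogChart.mul4, L.exp_zero, mul_one, ht]
  rw [h.logCob_apply, h1.2.1, mul_inv_cancel_left]
  rfl

namespace Corrector

variable {L} {M : InvariantMean 𝕜 G E} {C : ℝ} (K : Corrector L M C) (R : GoodRadius L G)

include LG in
/-- The logarithmic derivative of the quotient of the morphism and of the almost morphism is an
analytic function of the coboundary, of its logarithmic derivative and of the correction. -/
theorem exists_logDeriv_quotient (hC : 1 ≤ C) :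
    ∃ H : (C(G, E) × C(G, E) × E) × C(G, E) → E, AnalyticAt 𝕜 H 0 ∧ H 0 = 0 ∧
      ∃ δ > 0, ∀ {ε : ℝ} {ρ : C(G, U)} {n : WithTop ℕ∞}, IsAlmost L C ε ρ → ε ≤ K.ε →
        2 * (C * (3 * C * ε)) ≤ R.r → C * (3 * C * ε) ≤ δ → 1 ≤ n →
        ContMDiff 𝓘(ℝ, EG) 𝓘(ℝ, E) n ρ → ∀ (X : EG) (J : C(G × G, E)),
        (∀ q, J q = logDeriv (𝓘(ℝ, EG).prod 𝓘(ℝ, EG)) (0, X) (coboundary ρ) q) → ‖J‖ < δ →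
        ∀ y, logDeriv 𝓘(ℝ, EG) X (fun x => K.morphism ρ x * (ρ x)⁻¹) y =
          H ((diagSection (logCob L ρ) y, K.leftCorr ρ, M.mean (K.corr ρ)), diagSection J y) := by
  obtain ⟨Y, hY, hY0, -, hYu⟩ := exists_gauge L M
  obtain ⟨δ₁, hδ₁, hlogC⟩ := exists_contMDiff_logCob (G := G) (EG := EG) L
  obtain ⟨δ₂, hδ₂, hlogD⟩ := exists_hasDerivAt_logCob LG L
  obtain ⟨δ₃, hδ₃, -, hsup⟩ := exists_superpose_analyticAt (K := G) (analyticAt_dlogMul L)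
  obtain ⟨δ₄, hδ₄, hu⟩ := Metric.eventually_nhds_iff_ball.1 hYu
  obtain ⟨δ₅, hδ₅, ha⟩ := Metric.eventually_nhds_iff_ball.1 hY.eventually_analyticAt
  obtain ⟨δ₆, hδ₆, hm⟩ := Metric.eventually_nhds_iff_ball.1 L.analyticAt_mul4.eventually_analyticAt
  let S : C(G, E × E) → C(G, E) := superpose (dlogMul L)
  -- Derivative in `y` of `α(y) = Y (κ_y, α, m)`, where `κ_y` is the diagonal section of `log c`.
  -- Only `κ_y` moves with `y`, and its derivative is `S` of the pair `(κ_y, J_y)`; `α` enters as a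
  -- parameter and is not differentiated on the right.
  let D : (C(G, E) × C(G, E) × E) × C(G, E) → E := fun v =>
    fderiv 𝕜 Y v.1 (S (pairCLM 𝕜 G E E (v.1.1, v.2)), 0, 0)
  have hf : AnalyticAt 𝕜 (fun v : (C(G, E) × C(G, E) × E) × C(G, E) => v.1) 0 := analyticAt_fst
  have hff : AnalyticAt 𝕜 (fun v : (C(G, E) × C(G, E) × E) × C(G, E) => v.1.1) 0 :=
    AnalyticAt.fun_comp (g := Prod.fst) analyticAt_fst hf
  have hS : AnalyticAt 𝕜 (fun v : (C(G, E) × C(G, E) × E) × C(G, E) =>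
      S (pairCLM 𝕜 G E E (v.1.1, v.2))) 0 := by
    refine AnalyticAt.fun_comp (g := S) ?_ (analyticAt_pair hff analyticAt_snd)
    exact (hsup _ fun k => by simpa using hδ₃).1
  have hD : AnalyticAt 𝕜 D 0 :=
    analyticAt_fderiv_apply (by exact hY) hf (hS.prod (analyticAt_const.prod analyticAt_const))
  have hYf : AnalyticAt 𝕜 (fun v : (C(G, E) × C(G, E) × E) × C(G, E) => Y v.1) 0 :=
    AnalyticAt.fun_comp (g := Y) (by exact hY) hf
  have hS0 : S (pairCLM 𝕜 G E E ((0 : C(G, E)), (0 : C(G, E)))) = 0 := superpose_eq fun k => by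
    simp only [pairCLM_apply, ContinuousMap.zero_apply]
    exact dlogMul_zero L
  -- The left logarithmic derivative of `exp α` at `y` is the derivative of `log(exp(-α(y))
  -- exp(α(·)))`, which converts `D` into the required quantity.
  refine ⟨fun v => fderiv 𝕜 L.mul4 (-Y v.1, Y v.1, 0, 0) (0, D v, 0, 0), ?_, ?_, ?_⟩
  · refine analyticAt_fderiv_apply ?_ (analyticAt_mk4 hYf.neg hYf)
      (analyticAt_mk4 analyticAt_const hD)
    simp only [Prod.fst_zero, hY0, neg_zero]
    exact L.analyticAt_mul4
  · have : D 0 = 0 := by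
      simp only [D, Prod.fst_zero, Prod.snd_zero, hS0]
      exact map_zero _
    simp only [this]
    exact map_zero _
  obtain ⟨δ, hδ, l1, l2, l3, l4, l5, l6⟩ : ∃ δ > 0, δ ≤ δ₁ ∧ δ ≤ δ₂ ∧ δ ≤ δ₃ ∧ δ ≤ δ₄ ∧ δ ≤ δ₅ ∧
      δ ≤ δ₆ :=
    ⟨min δ₁ (min δ₂ (min δ₃ (min δ₄ (min δ₅ δ₆)))), by positivity, by simp, by simp, by simp,
      by simp, by simp, by simp⟩
  refine ⟨δ, hδ, fun {ε ρ n} h hε hr hεδ hn hρ X J hJ hJn y => ?_⟩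
  obtain ⟨b0, b1, b2, b3⟩ := K.radius_bounds R hC h hε hr
  have hC0 := h.C_pos
  have hε0 := h.ε_pos
  have c1 : 3 * C * ε ≤ C * (3 * C * ε) := by nlinarith [mul_pos hC0 hε0]
  have c2 : ε ≤ 3 * C * ε := by nlinarith
  have nκ : ∀ y, ‖diagSection (logCob L ρ) y‖ < δ := fun y =>
    (ContinuousMap.norm_lt_iff _ hδ).2 fun x => ((logCob L ρ).norm_coe_le_norm _).trans_lt
      ((K.norm_logCob_lt R hC h hε hr).trans_le (by linarith))
  have nα : ‖K.leftCorr ρ‖ < δ := (K.norm_leftCorr_lt hC h hε).trans_le hεδ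
  have nm : ‖M.mean (K.corr ρ)‖ < δ :=
    (M.norm_le _).trans_lt ((K.norm_corr_lt h hε).trans_le (by linarith))
  have np : ∀ y, ‖(diagSection (logCob L ρ) y, K.leftCorr ρ, M.mean (K.corr ρ))‖ < δ := fun y =>
    max_lt (nκ y) (max_lt nα nm)
  -- By the averaged identity `α(y)` solves the equation defining `Y`, and small solutions are
  -- unique.
  have eY : ∀ y, Y (diagSection (logCob L ρ) y, K.leftCorr ρ, M.mean (K.corr ρ)) =
      K.leftCorr ρ y := fun y => by
    refine hu ((diagSection (logCob L ρ) y, K.leftCorr ρ, M.mean (K.corr ρ)), K.leftCorr ρ y) ?_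
      (K.mean_superpose_gaugeQuad R hC h hε hr y)
    rw [Metric.mem_ball, Prod.dist_eq, dist_zero_right, dist_zero_right]
    exact max_lt ((np y).trans_le l4)
      (((K.leftCorr ρ).norm_coe_le_norm y).trans_lt (nα.trans_le l4))
  let f' : C(G × G, E) := ⟨fun q => dlogMul L (logCob L ρ q, J q), by
    have hc := (contMDiff_invDeriv (I := 𝓘(ℝ, EG).prod 𝓘(ℝ, EG)) (n := 1) (m := 0) (hlogC h
      (by linarith) (hρ.of_le hn)) (by simp) ((0 : EG), X)).continuous
    convert! hc using 1
    ext q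
    rw [hJ]
    exact (hlogD h (by linarith) hn hρ X q).unique (hasDerivAt_invDeriv_snd LG hn
      (hlogC h (by linarith) hρ) X q)⟩
  have eS : S (pairCLM 𝕜 G E E (diagSection (logCob L ρ) y, diagSection J y)) = diagSection f' y :=
    superpose_eq fun x => rfl
  have d1 := hasDerivAt_diagSection LG (f := logCob L ρ) (f' := f')
    (hlogC h (by linarith) (hρ.of_le hn)) X (fun q => by
      change dlogMul L (logCob L ρ q, J q) = _
      rw [hJ]
      exact (hlogD h (by linarith) hn hρ X q).unique (hasDerivAt_invDeriv_snd LG hn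
        (hlogC h (by linarith) hρ) X q)) y
  have d2 : HasDerivAt (fun t => K.leftCorr ρ (translate LG X y t))
      (D ((diagSection (logCob L ρ) y, K.leftCorr ρ, M.mean (K.corr ρ)), diagSection J y)) 0 := by
    simp only [← eY]
    have d3 : HasFDerivAt Y ((fderiv 𝕜 Y (diagSection (logCob L ρ) y, K.leftCorr ρ,
        M.mean (K.corr ρ))).restrictScalars ℝ)
        (diagSection (logCob L ρ) (translate LG X y 0), K.leftCorr ρ, M.mean (K.corr ρ)) := by
      rw [translate_zero]
      refine ((ha _ ?_).differentiableAt.hasFDerivAt).restrictScalars ℝ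
      rw [mem_ball_zero_iff]
      exact (np y).trans_le l5
    have d4 := d3.comp_hasDerivAt (0 : ℝ) (d1.prodMk ((hasDerivAt_const (0 : ℝ) (K.leftCorr ρ)).prodMk
      (hasDerivAt_const (0 : ℝ) (M.mean (K.corr ρ)))))
    convert! d4 using 1
    simp only [D, eS]
    rfl
  have d5 : HasDerivAt (fun t => ((-K.leftCorr ρ y, K.leftCorr ρ (translate LG X y t), 0, 0) :
      E × E × E × E)) (0, D ((diagSection (logCob L ρ) y, K.leftCorr ρ, M.mean (K.corr ρ)),
      diagSection J y), 0, 0) 0 :=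
    (hasDerivAt_const _ _).prodMk (d2.prodMk ((hasDerivAt_const _ _).prodMk (hasDerivAt_const _ _)))
  have d6 : HasFDerivAt L.mul4 ((fderiv 𝕜 L.mul4 (-K.leftCorr ρ y, K.leftCorr ρ y,
      0, 0)).restrictScalars ℝ) (-K.leftCorr ρ y, K.leftCorr ρ (translate LG X y 0), 0, 0) := by
    rw [translate_zero]
    refine ((hm _ ?_).differentiableAt.hasFDerivAt).restrictScalars ℝ
    rw [mem_ball_zero_iff, Prod.norm_mk, Prod.norm_mk, Prod.norm_mk, norm_zero, norm_neg]
    have := ((K.leftCorr ρ).norm_coe_le_norm y).trans_lt (nα.trans_le l6)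
    exact max_lt this (max_lt this (max_lt hδ₆ hδ₆))
  have d7 := d6.comp_hasDerivAt (0 : ℝ) d5
  have hπ : ContMDiff 𝓘(ℝ, EG) 𝓘(ℝ, E) n (K.morphism ρ) :=
    (contMDiff_morphism LG L (K.morphism ρ)).of_le le_top
  have : LieGroup 𝓘(ℝ, E) n U := LieGroup.of_le (n := ω) le_top
  have d8 := hasDerivAt_logDeriv LG L hn (hπ.mul hρ.inv) X y
  simp only [eY]
  refine d8.unique (d7.congr_of_eventuallyEq (Eventually.of_forall fun t => ?_))
  simp only [Function.comp_apply, LogChart.mul4, L.exp_zero, mul_one]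
  rw [L.exp_neg (((K.leftCorr ρ).norm_coe_le_norm y).trans_lt
    ((K.norm_leftCorr_lt hC h hε).trans_le (b1.trans R.r_le))), K.exp_leftCorr R hC h hε hr,
    K.exp_leftCorr R hC h hε hr]
  rfl

end Corrector

end AlmostMorphism

end

/-! ### The `C^r` topology and convergence of the quotient to `1`. -/

noncomputable section

namespace AlmostMorphism

set_option linter.unusedSectionVars false

section Topology

open scoped Uniformity

variable {EG : Type*} [NormedAddCommGroup EG] [NormedSpace ℝ EG] {H : Type*} [TopologicalSpace H]
  {I : ModelWithCorners ℝ EG H} {G : Type*} [Group G] [TopologicalSpace G] [ChartedSpace H G]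
  {E : Type*} [NormedAddCommGroup E] [NormedSpace ℝ E]
  {U : Type*} [Group U] [TopologicalSpace U] [IsTopologicalGroup U] [ChartedSpace E U]
  {r : WithTop ℕ∞}

theorem invDeriv_const (X : EG) (e : E) : invDeriv I X (fun _ : G => e) = fun _ => 0 := by
  ext g
  simp only [invDeriv]
  rw [mfderiv_const]
  rfl

theorem invDerivs_zero (L : List EG) : invDerivs I L (fun _ : G => (0 : E)) = fun _ => 0 := by
  induction L with
  | nil => rfl
  | cons X L ih =>
    change invDeriv I X (invDerivs I L _) = _
    rw [ih, invDeriv_const]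

theorem logDeriv_one (X : EG) : (logDeriv I X (fun _ : G => (1 : U)) : G → E) = fun _ => 0 := by
  ext g
  simp only [logDeriv]
  rw [mfderiv_const]
  rfl

theorem tendsto_unifConv_iff {A X Y : Type*} {𝒰 : UniformSpace Y} {𝓕 : Filter A} {k : A → X → Y}
    {k₀ : X → Y} : Tendsto k 𝓕 (@nhds _ (unifConv X 𝒰).toTopologicalSpace k₀) ↔
      ∀ V ∈ 𝓤[𝒰], ∀ᶠ a in 𝓕, ∀ x, (k₀ x, k a x) ∈ V := by
  have h : @nhds _ (unifConv X 𝒰).toTopologicalSpace k₀ =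
      comap UniformFun.ofFun (𝓝 (UniformFun.ofFun k₀)) := nhds_induced _ _
  rw [h, tendsto_comap_iff, UniformFun.tendsto_iff_tendstoUniformly]
  rfl

theorem tendsto_nhds_inf_iff {A X : Type*} {u v : UniformSpace X} {𝓕 : Filter A} {f : A → X}
    {x : X} : Tendsto f 𝓕 (@nhds X (u ⊓ v).toTopologicalSpace x) ↔
      Tendsto f 𝓕 (@nhds X u.toTopologicalSpace x) ∧
        Tendsto f 𝓕 (@nhds X v.toTopologicalSpace x) := by
  have h : @nhds X (u ⊓ v).toTopologicalSpace x =
      @nhds X u.toTopologicalSpace x ⊓ @nhds X v.toTopologicalSpace x := by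
    rw [← @nhds_inf X u.toTopologicalSpace v.toTopologicalSpace x]
  exact (iff_of_eq (congrArg _ h)).trans tendsto_inf

theorem tendsto_nhds_comap_iff {A X Y : Type*} {u : UniformSpace Y} {𝓕 : Filter A} {f : A → X}
    {g : X → Y} {x : X} : Tendsto f 𝓕 (@nhds X (u.comap g).toTopologicalSpace x) ↔
      Tendsto (fun a => g (f a)) 𝓕 (@nhds Y u.toTopologicalSpace (g x)) := by
  have h : @nhds X (u.comap g).toTopologicalSpace x =
      comap g (@nhds Y u.toTopologicalSpace (g x)) := nhds_induced _ _
  exact (iff_of_eq (congrArg _ h)).trans tendsto_comap_iff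

theorem tendsto_nhds_iInf_iff {A X : Type*} {ι : Sort*} {u : ι → UniformSpace X} {𝓕 : Filter A}
    {f : A → X} {x : X} : Tendsto f 𝓕 (@nhds X (⨅ i, u i).toTopologicalSpace x) ↔
      ∀ i, Tendsto f 𝓕 (@nhds X (u i).toTopologicalSpace x) := by
  have h : @nhds X (⨅ i, u i).toTopologicalSpace x = ⨅ i, @nhds X (u i).toTopologicalSpace x :=
    (congrArg (fun t => @nhds X t x) UniformSpace.toTopologicalSpace_iInf).trans nhds_iInf
  exact (iff_of_eq (congrArg _ h)).trans tendsto_iInf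

theorem tendsto_nhds_one_iff {A : Type*} {𝓕 : Filter A} {f : A → C^r⟮I, G; 𝓘(ℝ, E), U⟯} :
    Tendsto f 𝓕 (𝓝 1) ↔ (∀ O ∈ 𝓝 (1 : U), ∀ᶠ a in 𝓕, ∀ x, f a x ∈ O) ∧
      ∀ (X : EG) (L : List EG), ((L.length + 1 : ℕ) : WithTop ℕ∞) ≤ r →
        UnifSmall 𝓕 (fun a => invDerivs I L (logDeriv I X (f a) : G → E)) := by
  refine tendsto_nhds_inf_iff.trans (and_congr ?_ ?_)
  · refine tendsto_nhds_comap_iff.trans (tendsto_unifConv_iff.trans ?_)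
    constructor
    · intro h O hO
      filter_upwards [h _ (preimage_mem_comap hO)] with a ha x
      simpa using ha x
    · rintro h V ⟨O, hO, hV⟩
      filter_upwards [h O hO] with a ha x
      refine hV ?_
      simpa using ha x
  · refine tendsto_nhds_iInf_iff.trans (forall_congr' fun X => tendsto_nhds_iInf_iff.trans
      (forall_congr' fun L => tendsto_nhds_iInf_iff.trans (forall_congr' fun hL =>
        tendsto_nhds_comap_iff.trans (tendsto_unifConv_iff.trans ?_))))
    have e : invDerivs I L (logDeriv I X (1 : C^r⟮I, G; 𝓘(ℝ, E), U⟯) : G → E) = fun _ => 0 := by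
      have : (logDeriv I X (1 : C^r⟮I, G; 𝓘(ℝ, E), U⟯) : G → E) = fun _ => 0 := logDeriv_one X
      rw [this, invDerivs_zero]
    simp only [e]
    constructor
    · intro h ε hε
      filter_upwards [h _ (Metric.dist_mem_uniformity hε)] with a ha x
      simpa using ha x
    · intro h V hV
      obtain ⟨ε, hε, hV'⟩ := Metric.mem_uniformity_dist.1 hV
      filter_upwards [h ε hε] with a ha x
      exact hV' (by simpa using ha x)

/-- The continuous map underlying a `C^r` map. -/
def crToC (ρ : C^r⟮I, G; 𝓘(ℝ, E), U⟯) : C(G, U) := ⟨ρ, ρ.contMDiff.continuous⟩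

end Topology

theorem JetSmall.mono {A K ι Z : Type*} [NormedAddCommGroup Z] [NormedSpace ℝ Z]
    {cur : ι → K → ℝ → K} {𝓕 : Filter A} {m n : ℕ} {k : A → K → Z} (h : JetSmall cur 𝓕 n k)
    (hmn : m ≤ n) : JetSmall cur 𝓕 m k := by
  induction n, hmn using Nat.le_induction with
  | base => exact h
  | succ n _ ih => exact ih h.of_succ

variable {𝕜 : Type*} [RCLike 𝕜] {E : Type*} [NormedAddCommGroup E] [NormedSpace 𝕜 E]
  [CompleteSpace E] [NormedSpace ℝ E] [IsScalarTower ℝ 𝕜 E]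
  {U : Type*} [Group U] [TopologicalSpace U] [IsTopologicalGroup U]
  [ChartedSpace E U] [LieGroup 𝓘(𝕜, E) ω U]
  {EG : Type*} [NormedAddCommGroup EG] [NormedSpace ℝ EG] [CompleteSpace EG]
  {G : Type*} [Group G] [TopologicalSpace G] [IsTopologicalGroup G] [ChartedSpace EG G]
  [LieGroup 𝓘(ℝ, EG) ω G] (LG : LogChart ℝ EG G) [LieGroup 𝓘(ℝ, E) ω U]
  [CompactSpace G]

namespace Corrector

variable {L : LogChart 𝕜 E U} {M : InvariantMean 𝕜 G E} {C : ℝ} (K : Corrector L M C)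
  (R : GoodRadius L G) {r : WithTop ℕ∞}

include LG L in
/-- The morphism attached to a `C^r` almost morphism, as a `C^r` map. -/
def crMorphism (ρ : C^r⟮𝓘(ℝ, EG), G; 𝓘(ℝ, E), U⟯) :
    ↥(crMorphisms 𝓘(ℝ, EG) r : Set C^r⟮𝓘(ℝ, EG), G; 𝓘(ℝ, E), U⟯) :=
  ⟨⟨K.morphism (crToC ρ), (contMDiff_morphism LG L _).of_le le_top⟩,
    _root_.map_mul (K.morphism (crToC ρ))⟩

@[simp]
theorem crMorphism_apply (ρ : C^r⟮𝓘(ℝ, EG), G; 𝓘(ℝ, E), U⟯) (g : G) :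
    (K.crMorphism LG ρ).1 g = K.morphism (crToC ρ) g := rfl

include R in
/-- The quotient of the morphism and of the almost morphism tends to `1` with the coboundary. -/
theorem exists_tendsto_crDiv (hC : 1 ≤ C) : ∃ ε₀ > 0, ∀ {A : Type*} {𝓕 : Filter A}
    {ρ : A → C^r⟮𝓘(ℝ, EG), G; 𝓘(ℝ, E), U⟯}, (∀ a, IsAlmost L C ε₀ (crToC (ρ a))) →
    Tendsto (fun a => crCoboundary 𝓘(ℝ, EG) r 𝕜 (ρ a)) 𝓕 (𝓝 1) →
    Tendsto (fun a => crDiv 𝓘(ℝ, EG) r 𝕜 (K.crMorphism LG (ρ a)).1 (ρ a)) 𝓕 (𝓝 1) := by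
  obtain ⟨H, hH, hH0, δ, hδ, hlog⟩ := K.exists_logDeriv_quotient LG R hC
  obtain ⟨δ₁, hδ₁, hlogC⟩ := exists_contMDiff_logCob (G := G) (EG := EG) L
  obtain ⟨δ₂, hδ₂, hlogD⟩ := exists_hasDerivAt_logCob LG L
  have hC0 : 0 < C := by linarith
  have hR := R.r_pos
  obtain ⟨ε₀, hε₀, l1, l2, l3, l4, l5⟩ : ∃ ε > 0, ε ≤ K.ε ∧ ε ≤ R.r / (2 * (C * (3 * C))) ∧
      ε ≤ δ / (C * (3 * C)) ∧ ε ≤ δ₁ ∧ ε ≤ δ₂ :=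
    ⟨min K.ε (min (R.r / (2 * (C * (3 * C)))) (min (δ / (C * (3 * C))) (min δ₁ δ₂))),
      by have := K.ε_pos; positivity, by simp, by simp, by simp, by simp, by simp⟩
  rw [le_div_iff₀ (by positivity)] at l2 l3
  have hr : 2 * (C * (3 * C * ε₀)) ≤ R.r := by linarith
  have hrδ : C * (3 * C * ε₀) ≤ δ := by linarith
  refine ⟨ε₀, hε₀, fun {A 𝓕 ρ} hal hco => ?_⟩
  rw [tendsto_nhds_one_iff] at hco
  obtain ⟨hco1, hco2⟩ := hco
  -- Only the bound on the coboundary improves along the filter; the bounds on `Ad` are those given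
  -- from the start.
  have hsm : ∀ ε > 0, ∀ᶠ a in 𝓕, IsAlmost L C ε (crToC (ρ a)) := fun ε hε => by
    filter_upwards [hco1 _ (nearOne_mem_nhds L hε)] with a ha
    exact ⟨fun s t => ha (s, t), (hal a).Ad_le, (hal a).Ad_inv_lt⟩
  have hα : Tendsto (fun a => K.leftCorr (crToC (ρ a))) 𝓕 (𝓝 0) := by
    rw [Metric.tendsto_nhds]
    intro η hη
    filter_upwards [hsm (η / (C * (3 * C))) (by positivity)] with a ha
    rw [dist_zero_right]
    have h1 : IsAlmost L C (min (η / (C * (3 * C))) ε₀) (crToC (ρ a)) :=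
      ⟨fun s t => ⟨lt_min (ha.cob s t).1 ((hal a).cob s t).1, (ha.cob s t).2⟩, ha.Ad_le,
        ha.Ad_inv_lt⟩
    refine (K.norm_leftCorr_lt hC h1 ((min_le_right _ _).trans l1)).trans_le ?_
    calc C * (3 * C * min (η / (C * (3 * C))) ε₀) ≤ C * (3 * C * (η / (C * (3 * C)))) := by
          gcongr; exact min_le_left _ _
      _ = η := by field_simp
  have hm : Tendsto (fun a => M.mean (K.corr (crToC (ρ a)))) 𝓕 (𝓝 0) := by
    rw [Metric.tendsto_nhds]
    intro η hη
    filter_upwards [hsm (η / (3 * C)) (by positivity)] with a ha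
    rw [dist_zero_right]
    have h1 : IsAlmost L C (min (η / (3 * C)) ε₀) (crToC (ρ a)) :=
      ⟨fun s t => ⟨lt_min (ha.cob s t).1 ((hal a).cob s t).1, (ha.cob s t).2⟩, ha.Ad_le,
        ha.Ad_inv_lt⟩
    refine (M.norm_le _).trans_lt
      ((K.norm_corr_lt h1 ((min_le_right _ _).trans l1)).trans_le ?_)
    calc 3 * C * min (η / (3 * C)) ε₀ ≤ 3 * C * (η / (3 * C)) := by
          gcongr; exact min_le_left _ _
      _ = η := by field_simp
  refine tendsto_nhds_one_iff.2 ⟨fun O hO => ?_, fun X l hl => ?_⟩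
  · obtain ⟨η, hη, hb⟩ := Metric.eventually_nhds_iff_ball.1 (L.tendsto_exp.eventually hO)
    filter_upwards [hα.eventually (Metric.ball_mem_nhds 0 hη)] with a ha x
    have e : crDiv 𝓘(ℝ, EG) r 𝕜 (K.crMorphism LG (ρ a)).1 (ρ a) x =
        L.exp (K.leftCorr (crToC (ρ a)) x) := by
      rw [K.exp_leftCorr R hC (hal a) l1 hr]
      rfl
    rw [e]
    refine hb _ ?_
    rw [mem_ball_zero_iff]
    rw [dist_zero_right] at ha
    exact ((K.leftCorr (crToC (ρ a))).norm_coe_le_norm x).trans_lt ha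
  · set n := l.length with hn
    have hn1 : ((n : ℕ) : WithTop ℕ∞) + 1 ≤ r := by
      refine le_trans (le_of_eq ?_) hl
      push_cast
      rfl
    have h1r : 1 ≤ r := le_trans (by simp) hn1
    have hnr : ((n : ℕ) : WithTop ℕ∞) ≤ r := le_trans (by simp) hn1
    have hρc : ∀ a, ContMDiff 𝓘(ℝ, EG) 𝓘(ℝ, E) r (crToC (ρ a)) := fun a => (ρ a).contMDiff
    have hjc : ∀ (X : EG) (a : A), ContMDiff (𝓘(ℝ, EG).prod 𝓘(ℝ, EG)) 𝓘(ℝ, E) n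
        (logDeriv (𝓘(ℝ, EG).prod 𝓘(ℝ, EG)) (0, X) (coboundary (crToC (ρ a))) : G × G → E) :=
      fun X a => contMDiff_logDeriv (contMDiff_coboundary (hρc a)) hn1 _
    have hj : ∀ X : EG, JetSmall (translateSnd LG) 𝓕 n (fun a =>
        (logDeriv (𝓘(ℝ, EG).prod 𝓘(ℝ, EG)) (0, X) (coboundary (crToC (ρ a))) : G × G → E)) :=
      fun X => jetSmall_of_invDerivs LG (hjc X) fun l' hl' => hco2 (0, X) _ (by
        rw [List.length_map]
        refine le_trans ?_ hl
        exact_mod_cast Nat.succ_le_succ hl')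
    -- One order at a time: the derivative of `log c` is `dlogMul` of `log c` and its logarithmic
    -- derivative, so smallness of their `m`-jets gives smallness of the `(m + 1)`-jet of `log c`.
    have hℓ : ∀ m ≤ n, JetSmall (translateSnd LG) 𝓕 m (fun a => ⇑(logCob L (crToC (ρ a)))) := by
      have h0 : UnifSmall 𝓕 (fun a => ⇑(logCob L (crToC (ρ a)))) := fun ε hε => by
        filter_upwards [hsm ε hε] with a ha q
        rw [ha.logCob_apply]
        exact (ha.cob q.1 q.2).1
      intro m
      induction m with
      | zero => exact fun _ => h0
      | succ m ih =>
        intro hm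
        refine ⟨h0, fun X => ⟨_, ((ih (by omega)).prodMk ((hj X).mono (by omega))).comp
          (translateSnd_zero LG) ((analyticAt_dlogMul L).restrictScalars (𝕜 := ℝ)) (dlogMul_zero L),
          Eventually.of_forall fun a q => hlogD (hal a) l5 h1r (hρc a) X q⟩⟩
    have hκ := JetSmall.diagSection LG (fun a => (hlogC (hal a) l4 (hρc a)).of_le hnr) (hℓ n le_rfl)
    have hJ := JetSmall.diagSection LG (f := fun a => ⟨_, (hjc X a).continuous⟩) (hjc X) (hj X)
    -- The arguments of `H` are jets in `y` coming from the coboundary, together with `α` and `m`,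
    -- which do not depend on `y` and tend to `0`.
    have hall := ((hκ.prodMk ((JetSmall.const hα).prodMk (JetSmall.const hm))).prodMk hJ).comp
      (translate_zero LG) (hH.restrictScalars (𝕜 := ℝ)) hH0
    have hq : JetSmall (translate LG) 𝓕 n (fun a => (logDeriv 𝓘(ℝ, EG) X
        (crDiv 𝓘(ℝ, EG) r 𝕜 (K.crMorphism LG (ρ a)).1 (ρ a)) : G → E)) := by
      refine hall.congr ?_
      filter_upwards [(hj X).unifSmall δ hδ] with a ha
      ext y
      exact (hlog (hal a) l1 hr hrδ h1r (hρc a) X ⟨_, (hjc X a).continuous⟩ (fun q => rfl)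
        ((ContinuousMap.norm_lt_iff _ hδ).2 ha) y).symm
    exact JetSmall.invDerivs LG (fun a => contMDiff_logDeriv (ContMDiffMap.contMDiff _) hn1 X) hq l
      le_rfl

end Corrector

end AlmostMorphism

end

/-! ### Uniform dependence of the tangent map of the morphism. -/

noncomputable section

namespace AlmostMorphism

set_option linter.unusedSectionVars false

variable {𝕜 : Type*} [RCLike 𝕜] {E : Type*} [NormedAddCommGroup E] [NormedSpace 𝕜 E]
  [CompleteSpace E] [NormedSpace ℝ E] [IsScalarTower ℝ 𝕜 E]
  {U : Type*} [Group U] [TopologicalSpace U] [IsTopologicalGroup U]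
  [ChartedSpace E U] [LieGroup 𝓘(𝕜, E) ω U]
  {G : Type*} [Group G] [TopologicalSpace G] [IsTopologicalGroup G] [CompactSpace G]
  {L : LogChart 𝕜 E U} (R : GoodRadius L G)

theorem GoodRadius.norm_Ad_exp_sub_le {x : E} (hx : ‖x‖ < R.r) (v : E) :
    ‖Ad 𝕜 (L.exp x) v - v‖ ≤ R.D * ‖x‖ * ‖v‖ := by
  have h1 := R.Ad_lipschitz x 0 hx (by simpa using R.r_pos)
  rw [L.exp_zero, Ad_one, sub_zero] at h1
  exact ContinuousLinearMap.le_of_opNorm_le _ h1 v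

/-- The coboundary of `exp(h) ρ₀` at `(s, t)` is `exp(h(s))`, times `ρ₀(s) exp(h(t)) ρ₀(s)⁻¹`, times
the coboundary of `ρ₀`, times `exp(-h(st))`; compare with the quadruple for `h = 0`. -/
theorem norm_logCob_sub_le {C ε : ℝ} {ρ₀ ρ : C(G, U)} (hC : 1 ≤ C) (h₀ : IsAlmost L C ε ρ₀)
    (h₁ : IsAlmost L C ε ρ) (hr : ε ≤ R.r) {h : C(G, E)} (hh : C * ‖h‖ < R.r)
    (hρ : ∀ t, ρ t = L.exp (h t) * ρ₀ t) (q : G × G) :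
    ‖logCob L ρ q - logCob L ρ₀ q‖ ≤ 5 * (C * ‖h‖) := by
  obtain ⟨s, t⟩ := q
  have hC0 := h₀.C_pos
  have hhC : ‖h‖ ≤ C * ‖h‖ := by nlinarith [norm_nonneg h]
  have nh : ∀ t, ‖h t‖ ≤ C * ‖h‖ := fun t => (h.norm_coe_le_norm t).trans hhC
  have nA : ‖Ad 𝕜 (ρ₀ s) (h t)‖ ≤ C * ‖h‖ :=
    ContinuousLinearMap.le_of_opNorm_le_of_le _ (h₀.Ad_le s) (h.norm_coe_le_norm t)
  have nl : ‖logCob L ρ₀ (s, t)‖ < R.r := by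
    rw [h₀.logCob_apply]
    exact (h₀.cob s t).1.trans_le hr
  have nl₁ : ‖logCob L ρ (s, t)‖ < R.r := by
    rw [h₁.logCob_apply]
    exact (h₁.cob s t).1.trans_le hr
  have hrr := R.r_le
  have nq : ‖((h s, Ad 𝕜 (ρ₀ s) (h t), logCob L ρ₀ (s, t), -h (s * t)) : E × E × E × E)‖ < R.r := by
    rw [Prod.norm_mk, Prod.norm_mk, Prod.norm_mk, norm_neg]
    exact max_lt ((nh s).trans_lt hh) (max_lt (nA.trans_lt hh) (max_lt nl ((nh _).trans_lt hh)))
  have nq₀ : ‖((0, 0, logCob L ρ₀ (s, t), 0) : E × E × E × E)‖ < R.r := by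
    rw [Prod.norm_mk, Prod.norm_mk, Prod.norm_mk, norm_zero]
    exact max_lt R.r_pos (max_lt R.r_pos (max_lt nl R.r_pos))
  have e₀ : L.mul4 (0, 0, logCob L ρ₀ (s, t), 0) = logCob L ρ₀ (s, t) := by
    simp [LogChart.mul4, L.exp_zero, L.log_exp _ (nl.trans_le hrr)]
  have e₁ : L.mul4 (h s, Ad 𝕜 (ρ₀ s) (h t), logCob L ρ₀ (s, t), -h (s * t)) =
      logCob L ρ (s, t) := by
    refine L.eq_of_exp_eq (R.norm_mul4_lt _ nq) (nl₁.trans_le hrr) ?_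
    rw [R.exp_mul4 _ nq]
    simp only
    rw [L.exp_Ad _ _ (((nh t).trans_lt hh).trans_le hrr) ((nA.trans_lt hh).trans_le hrr),
      L.exp_neg (((nh _).trans_lt hh).trans_le hrr), h₀.logCob_apply, h₁.logCob_apply,
      (h₀.cob s t).2.1, (h₁.cob s t).2.1]
    simp only [coboundary, ContinuousMap.coe_mk, hρ]
    group
  have := R.mul4_lipschitz _ _ nq nq₀
  rw [e₀, e₁] at this
  refine this.trans ?_
  gcongr
  simp only [Prod.mk_sub_mk, sub_zero, sub_self, Prod.norm_mk, norm_neg, norm_zero]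
  exact max_le (nh s) (max_le nA (max_le (by positivity) (nh _)))

variable {EG : Type*} [NormedAddCommGroup EG] [NormedSpace ℝ EG] [CompleteSpace EG]
  [ChartedSpace EG G] [LieGroup 𝓘(ℝ, EG) ω G] (LG : LogChart ℝ EG G) [LieGroup 𝓘(ℝ, E) ω U]

namespace Corrector

variable {M : InvariantMean 𝕜 G E} {C : ℝ} (K : Corrector L M C)

/-- The difference is `Ad(ρ)` of the variation of the correction plus `(Ad(exp h) - 1) α₀`, where
`α₀` is the `leftCorr` of `ρ₀`; the second term is Lipschitz in `h` because `α₀` is bounded by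
`R.r`. -/
theorem norm_leftCorr_sub_le {ε : ℝ} {ρ₀ ρ : C(G, U)} (hC : 1 ≤ C) (h₀ : IsAlmost L C ε ρ₀)
    (h₁ : IsAlmost L C ε ρ) (hε : ε ≤ K.ε) (hr : C * (3 * C * ε) ≤ R.r) {h : C(G, E)}
    (hh : C * ‖h‖ < R.r) (hρ : ∀ t, ρ t = L.exp (h t) * ρ₀ t) :
    ‖K.leftCorr ρ - K.leftCorr ρ₀‖ ≤ (C * (15 * C + 2 * C * R.D) + R.D * R.r) * ‖h‖ := by
  have hC0 := h₀.C_pos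
  have hD := R.D_pos
  have hR := R.r_pos
  have hb := K.norm_corr_sub_le R hC h₀ h₁ hε hr hh hρ
  have hh' : ‖h‖ < R.r := by nlinarith [norm_nonneg h]
  refine (ContinuousMap.norm_le _ (by positivity)).2 fun t => ?_
  have ht : ‖h t‖ ≤ ‖h‖ := h.norm_coe_le_norm t
  have e : (K.leftCorr ρ - K.leftCorr ρ₀) t = Ad 𝕜 (ρ t) ((K.corr ρ - K.corr ρ₀) t) +
      (Ad 𝕜 (L.exp (h t)) (K.leftCorr ρ₀ t) - K.leftCorr ρ₀ t) := by
    simp only [ContinuousMap.sub_apply, leftCorr_apply, map_sub]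
    rw [← Ad_mul_apply, ← hρ]
    abel
  rw [e]
  have a1 : ‖Ad 𝕜 (ρ t) ((K.corr ρ - K.corr ρ₀) t)‖ ≤ C * ((15 * C + 2 * C * R.D) * ‖h‖) :=
    ContinuousLinearMap.le_of_opNorm_le_of_le _ (h₁.Ad_le t)
      (((K.corr ρ - K.corr ρ₀).norm_coe_le_norm t).trans hb)
  have a2 := R.norm_Ad_exp_sub_le (ht.trans_lt hh') (K.leftCorr ρ₀ t)
  have a3 : ‖K.leftCorr ρ₀ t‖ ≤ R.r := ((K.leftCorr ρ₀).norm_coe_le_norm t).trans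
    ((K.norm_leftCorr_lt hC h₀ hε).le.trans hr)
  have a4 : R.D * ‖h t‖ * ‖K.leftCorr ρ₀ t‖ ≤ R.D * ‖h‖ * R.r := by gcongr
  calc _ ≤ C * ((15 * C + 2 * C * R.D) * ‖h‖) + R.D * ‖h‖ * R.r :=
        norm_add_le_of_le a1 (a2.trans a4)
    _ = _ := by ring

include R LG in
/-- The tangent map of the morphism depends uniformly continuously on the almost morphism. -/
theorem exists_logDeriv_close (hC : 1 ≤ C) : ∃ ε₀ > 0, ∀ (X : EG), ∀ η > 0,
    ∃ O ∈ 𝓝 (1 : U), ∃ θ > 0, ∀ {n : WithTop ℕ∞} {ρ ρ₀ : C(G, U)}, 1 ≤ n →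
      ContMDiff 𝓘(ℝ, EG) 𝓘(ℝ, E) n ρ → ContMDiff 𝓘(ℝ, EG) 𝓘(ℝ, E) n ρ₀ →
      IsAlmost L C ε₀ ρ → IsAlmost L C ε₀ ρ₀ →
      (∀ q, ‖(logDeriv (𝓘(ℝ, EG).prod 𝓘(ℝ, EG)) (0, X) (coboundary ρ) q : E)‖ < ε₀) →
      (∀ q, ‖(logDeriv (𝓘(ℝ, EG).prod 𝓘(ℝ, EG)) (0, X) (coboundary ρ₀) q : E)‖ < ε₀) →
      (∀ t, ρ t * (ρ₀ t)⁻¹ ∈ O) →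
      (∀ t, ‖(logDeriv 𝓘(ℝ, EG) X ρ t - logDeriv 𝓘(ℝ, EG) X ρ₀ t : E)‖ < θ) →
      ‖(logDeriv 𝓘(ℝ, EG) X (K.morphism ρ) 1 - logDeriv 𝓘(ℝ, EG) X (K.morphism ρ₀) 1 : E)‖ < η := by
  obtain ⟨H, hH, hH0, δ, hδ, hlog⟩ := K.exists_logDeriv_quotient LG R hC
  obtain ⟨Λ, s, hs, hlip⟩ := hH.hasStrictFDerivAt.exists_lipschitzOnWith
  obtain ⟨δ₁, hδ₁, hball⟩ := Metric.mem_nhds_iff.1 hs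
  have hlip' : ∀ v w, ‖v‖ < δ₁ → ‖w‖ < δ₁ → ‖H v - H w‖ ≤ Λ * ‖v - w‖ := fun v w hv hw =>
    hlip.norm_sub_le (hball (by simpa using hv)) (hball (by simpa using hw))
  have hC0 : 0 < C := by linarith
  have hR := R.r_pos
  have hD := R.D_pos
  obtain ⟨ε₀, hε₀, l1, l2, l3, l4, l5, l6⟩ : ∃ ε > 0, ε ≤ K.ε ∧ ε ≤ R.r / (2 * (C * (3 * C))) ∧
      ε ≤ δ / (C * (3 * C)) ∧ ε ≤ δ ∧ ε ≤ δ₁ ∧ ε ≤ δ₁ / (C * (3 * C)) :=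
    ⟨min K.ε (min (R.r / (2 * (C * (3 * C)))) (min (δ / (C * (3 * C))) (min δ
      (min δ₁ (δ₁ / (C * (3 * C))))))),
      by have := K.ε_pos; positivity, by simp, by simp, by simp, by simp, by simp, by simp⟩
  rw [le_div_iff₀ (by positivity)] at l2 l3 l6
  have hr : 2 * (C * (3 * C * ε₀)) ≤ R.r := by linarith
  have hrδ : C * (3 * C * ε₀) ≤ δ := by linarith
  have hrδ₁ : C * (3 * C * ε₀) ≤ δ₁ := by linarith
  have c1 : 3 * C * ε₀ ≤ C * (3 * C * ε₀) := by nlinarith [mul_pos hC0 hε₀]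
  have c2 : ε₀ ≤ 3 * C * ε₀ := by nlinarith
  refine ⟨ε₀, hε₀, fun X η hη => ?_⟩
  obtain ⟨P, hP, p1, p2, p3, p4⟩ : ∃ P > 0, 5 * C ≤ P ∧
      C * (15 * C + 2 * C * R.D) + R.D * R.r ≤ P ∧ 15 * C + 2 * C * R.D ≤ P ∧
      2 * C + R.D * ε₀ ≤ P :=
    ⟨max (5 * C) (max (C * (15 * C + 2 * C * R.D) + R.D * R.r) (max (15 * C + 2 * C * R.D)
      (2 * C + R.D * ε₀))), by positivity, by simp, by simp, by simp, by simp⟩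
  have hΛ : (0 : ℝ) ≤ Λ := Λ.2
  set Q : ℝ := 1 + C * (Λ * P) + C * (R.D * (Λ * δ₁)) with hQ
  have hQ0 : 0 < Q := by positivity
  refine ⟨nearOne L (min (R.r / C) (η / (2 * Q))), nearOne_mem_nhds L (by positivity),
    η / (2 * Q), by positivity, fun {n ρ ρ₀} hn hs hs₀ h₁ h₀ hj hj₀ hO hθ => ?_⟩
  obtain ⟨h, hk, hk'⟩ := exists_log_continuousMap L (by fun_prop) hO
  have hkn := (ContinuousMap.norm_lt_iff _ (by positivity)).2 hk
  obtain ⟨hk1, hk2⟩ := lt_min_iff.1 hkn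
  rw [lt_div_iff₀ hC0, mul_comm] at hk1
  have hh' : ‖h‖ < R.r := by nlinarith [norm_nonneg h]
  have e : ∀ t, ρ t = L.exp (h t) * ρ₀ t := fun t => by rw [hk']; group
  obtain ⟨b0, b1, b2, b3⟩ := K.radius_bounds R hC h₀ l1 hr
  set θ := η / (2 * Q) with hθdef
  have hθ0 : 0 < θ := by positivity
  have hjc : ∀ {ρ : C(G, U)}, ContMDiff 𝓘(ℝ, EG) 𝓘(ℝ, E) n ρ → Continuous
      (logDeriv (𝓘(ℝ, EG).prod 𝓘(ℝ, EG)) (0, X) (coboundary ρ) : G × G → E) := fun hρ =>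
    (contMDiff_logDeriv (m := 0) (contMDiff_coboundary hρ) (by simpa using hn) _).continuous
  let J : C(G × G, E) := ⟨_, hjc hs⟩
  let J₀ : C(G × G, E) := ⟨_, hjc hs₀⟩
  have nJ : ‖J‖ < ε₀ := (ContinuousMap.norm_lt_iff _ hε₀).2 hj
  have nJ₀ : ‖J₀‖ < ε₀ := (ContinuousMap.norm_lt_iff _ hε₀).2 hj₀
  have q₁ := hlog h₁ l1 hr hrδ hn hs X J (fun q => rfl) (nJ.trans_le l4) 1
  have q₀ := hlog h₀ l1 hr hrδ hn hs₀ X J₀ (fun q => rfl) (nJ₀.trans_le l4) 1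
  have nv : ∀ {ρ : C(G, U)} {J : C(G × G, E)}, IsAlmost L C ε₀ ρ → ‖J‖ < ε₀ →
      ‖((diagSection (logCob L ρ) 1, K.leftCorr ρ, M.mean (K.corr ρ)), diagSection J 1)‖ < δ₁ :=
    fun {ρ J} hρ hJ => by
      refine max_lt (max_lt ?_ (max_lt ?_ ?_)) ?_
      · exact (ContinuousMap.norm_lt_iff _ hδ₁).2 fun x => ((logCob L ρ).norm_coe_le_norm _).trans_lt
          ((K.norm_logCob_lt R hC hρ l1 hr).trans_le l5)
      · exact (K.norm_leftCorr_lt hC hρ l1).trans_le hrδ₁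
      · exact (M.norm_le _).trans_lt ((K.norm_corr_lt hρ l1).trans_le (by linarith))
      · exact (ContinuousMap.norm_lt_iff _ hδ₁).2 fun x =>
          (J.norm_coe_le_norm _).trans_lt (hJ.trans_le l5)
  have hdiff : ‖((diagSection (logCob L ρ) 1, K.leftCorr ρ, M.mean (K.corr ρ)), diagSection J 1) -
      ((diagSection (logCob L ρ₀) 1, K.leftCorr ρ₀, M.mean (K.corr ρ₀)), diagSection J₀ 1)‖ ≤
      P * θ := by
    have hhP : ∀ {c : ℝ}, 0 ≤ c → c ≤ P → c * ‖h‖ ≤ P * θ := fun h0 hc => by gcongr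
    refine max_le (max_le ?_ (max_le ?_ ?_)) ?_
    · refine (ContinuousMap.norm_le _ (by positivity)).2 fun x => ?_
      refine (norm_logCob_sub_le R hC h₀ h₁ b3 hk1 e (x, x⁻¹ * 1)).trans ?_
      rw [← mul_assoc]
      exact hhP (by positivity) p1
    · exact (K.norm_leftCorr_sub_le R hC h₀ h₁ l1 b1 hk1 e).trans (hhP (by positivity) p2)
    · change ‖M.mean (K.corr ρ) - M.mean (K.corr ρ₀)‖ ≤ _
      rw [← map_sub]
      exact (M.norm_le _).trans ((K.norm_corr_sub_le R hC h₀ h₁ l1 b1 hk1 e).trans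
        (hhP (by positivity) p3))
    · refine (ContinuousMap.norm_le _ (by positivity)).2 fun x => ?_
      change ‖(logDeriv (𝓘(ℝ, EG).prod 𝓘(ℝ, EG)) (0, X) (coboundary ρ) (x, x⁻¹ * 1) : E) -
        logDeriv (𝓘(ℝ, EG).prod 𝓘(ℝ, EG)) (0, X) (coboundary ρ₀) (x, x⁻¹ * 1)‖ ≤ P * θ
      have hj0 := hj₀ (x, x⁻¹ * 1)
      rw [logDeriv_coboundary LG L hn hs₀] at hj0
      rw [logDeriv_coboundary LG L hn hs, logDeriv_coboundary LG L hn hs₀]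
      -- At `y = 1` the arguments `x` and `x⁻¹` have product `1`, so only `Ad` of values at `1`
      -- occurs. No bound is available for `a₀` and `b₀` separately, but `hj0` bounds `Ad(ρ₀(1)) (a₀
      -- - b₀)` by `ε₀`, and this is the only combination needed.
      rw [mul_one, mul_inv_cancel] at hj0 ⊢
      set a : E := logDeriv 𝓘(ℝ, EG) X ρ x⁻¹
      set b : E := logDeriv 𝓘(ℝ, EG) X ρ 1
      set a₀ : E := logDeriv 𝓘(ℝ, EG) X ρ₀ x⁻¹ with ha₀
      set b₀ : E := logDeriv 𝓘(ℝ, EG) X ρ₀ 1 with hb₀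
      have e2 : Ad 𝕜 (ρ 1) (a - b) - Ad 𝕜 (ρ₀ 1) (a₀ - b₀) = Ad 𝕜 (ρ 1) ((a - a₀) - (b - b₀)) +
          (Ad 𝕜 (L.exp (h 1)) (Ad 𝕜 (ρ₀ 1) (a₀ - b₀)) - Ad 𝕜 (ρ₀ 1) (a₀ - b₀)) := by
        rw [← Ad_mul_apply, ← e]
        simp only [map_sub]
        abel
      rw [e2]
      have ht : ‖h 1‖ ≤ ‖h‖ := h.norm_coe_le_norm 1
      have a1 : ‖Ad 𝕜 (ρ 1) ((a - a₀) - (b - b₀))‖ ≤ C * (θ + θ) :=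
        ContinuousLinearMap.le_of_opNorm_le_of_le _ (h₁.Ad_le 1)
          (norm_sub_le_of_le (hθ x⁻¹).le (hθ 1).le)
      have a2 := R.norm_Ad_exp_sub_le (ht.trans_lt hh') (Ad 𝕜 (ρ₀ 1) (a₀ - b₀))
      have a4 : R.D * ‖h 1‖ * ‖Ad 𝕜 (ρ₀ 1) (a₀ - b₀)‖ ≤ R.D * θ * ε₀ := by
        gcongr
        exact ht.trans hk2.le
      calc _ ≤ C * (θ + θ) + R.D * θ * ε₀ := norm_add_le_of_le a1 (a2.trans a4)
        _ = (2 * C + R.D * ε₀) * θ := by ring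
        _ ≤ P * θ := by gcongr
  have hπ : ∀ ρ : C(G, U), ContMDiff 𝓘(ℝ, EG) 𝓘(ℝ, E) n (K.morphism ρ) := fun ρ =>
    (contMDiff_morphism LG L (K.morphism ρ)).of_le le_top
  have hq : ‖H ((diagSection (logCob L ρ) 1, K.leftCorr ρ, M.mean (K.corr ρ)), diagSection J 1) -
      H ((diagSection (logCob L ρ₀) 1, K.leftCorr ρ₀, M.mean (K.corr ρ₀)), diagSection J₀ 1)‖ ≤
      Λ * (P * θ) := (hlip' _ _ (nv h₁ nJ) (nv h₀ nJ₀)).trans (by gcongr)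
  have hq0 : ‖H ((diagSection (logCob L ρ₀) 1, K.leftCorr ρ₀, M.mean (K.corr ρ₀)),
      diagSection J₀ 1)‖ ≤ Λ * δ₁ := by
    have := hlip' _ 0 (nv h₀ nJ₀) (by simpa using hδ₁)
    rw [hH0, sub_zero, sub_zero] at this
    exact this.trans (by gcongr; exact (nv h₀ nJ₀).le)
  rw [← q₁, ← q₀] at hq
  rw [← q₀] at hq0
  have m₁ := logDeriv_div LG L hn (hπ ρ) hs X 1
  have m₀ := logDeriv_div LG L hn (hπ ρ₀) hs₀ X 1
  set μ₁ : E := logDeriv 𝓘(ℝ, EG) X (K.morphism ρ) 1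
  set μ₀ : E := logDeriv 𝓘(ℝ, EG) X (K.morphism ρ₀) 1
  set w₁ : E := logDeriv 𝓘(ℝ, EG) X (fun x => K.morphism ρ x * (ρ x)⁻¹) 1
  set w₀ : E := logDeriv 𝓘(ℝ, EG) X (fun x => K.morphism ρ₀ x * (ρ₀ x)⁻¹) 1
  have hθ1 := hθ 1
  set b : E := logDeriv 𝓘(ℝ, EG) X ρ 1
  set b₀ : E := logDeriv 𝓘(ℝ, EG) X ρ₀ 1
  -- The formula for quotients solved for the logarithmic derivative of the morphism. The unbounded
  -- term `b` enters alone, so only `b - b₀` has to be small.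
  have n₁ : μ₁ = b + Ad 𝕜 (ρ 1)⁻¹ w₁ := by rw [m₁, Ad_inv_Ad]; abel
  have n₀ : μ₀ = b₀ + Ad 𝕜 (ρ₀ 1)⁻¹ w₀ := by rw [m₀, Ad_inv_Ad]; abel
  have ht : ‖h 1‖ ≤ ‖h‖ := h.norm_coe_le_norm 1
  have hinv : (ρ 1)⁻¹ = (ρ₀ 1)⁻¹ * L.exp (-h 1) := by
    rw [e, mul_inv_rev, L.exp_neg ((ht.trans_lt hh').trans_le R.r_le)]
  have e3 : μ₁ - μ₀ = (b - b₀) + Ad 𝕜 (ρ 1)⁻¹ (w₁ - w₀) +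
      Ad 𝕜 (ρ₀ 1)⁻¹ (Ad 𝕜 (L.exp (-h 1)) w₀ - w₀) := by
    rw [n₁, n₀, map_sub, map_sub, ← Ad_mul_apply _ (ρ₀ 1)⁻¹ (L.exp (-h 1)), ← hinv]
    abel
  rw [e3]
  have a1 : ‖Ad 𝕜 (ρ 1)⁻¹ (w₁ - w₀)‖ ≤ C * (Λ * (P * θ)) :=
    ContinuousLinearMap.le_of_opNorm_le_of_le _ (h₁.Ad_inv_lt 1).le hq
  have a2 : ‖Ad 𝕜 (L.exp (-h 1)) w₀ - w₀‖ ≤ R.D * θ * (Λ * δ₁) := by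
    refine (R.norm_Ad_exp_sub_le (by rw [norm_neg]; exact ht.trans_lt hh') w₀).trans ?_
    rw [norm_neg]
    gcongr
    exact ht.trans hk2.le
  have a3 : ‖Ad 𝕜 (ρ₀ 1)⁻¹ (Ad 𝕜 (L.exp (-h 1)) w₀ - w₀)‖ ≤ C * (R.D * θ * (Λ * δ₁)) :=
    ContinuousLinearMap.le_of_opNorm_le_of_le _ (h₀.Ad_inv_lt 1).le a2
  calc _ ≤ θ + C * (Λ * (P * θ)) + C * (R.D * θ * (Λ * δ₁)) :=
        norm_add_le_of_le (norm_add_le_of_le hθ1.le a1) a3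
    _ = Q * θ := by rw [hQ]; ring
    _ = η / 2 := by rw [hθdef]; field_simp
    _ < η := half_lt_self hη

end Corrector

end AlmostMorphism

end

/-! ### Conjugacy of nearby morphisms. -/

noncomputable section

namespace AlmostMorphism

set_option linter.unusedSectionVars false

variable {𝕜 : Type*} [RCLike 𝕜] {E : Type*} [NormedAddCommGroup E] [NormedSpace 𝕜 E]
  [CompleteSpace E] [NormedSpace ℝ E] [IsScalarTower ℝ 𝕜 E]
  {U : Type*} [Group U] [TopologicalSpace U] [IsTopologicalGroup U]
  [ChartedSpace E U] [LieGroup 𝓘(𝕜, E) ω U]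
  {G : Type*} [Group G] [TopologicalSpace G] [IsTopologicalGroup G] [CompactSpace G]

theorem InvariantMean.congr_mul_left (M : InvariantMean 𝕜 G E) (f g : C(G, E)) (z : G)
    (h : ∀ s, g s = f (z⁻¹ * s)) : M.mean g = M.mean f := by
  let f' : C(G, E) := ⟨fun s => f s⁻¹, by fun_prop⟩
  have h1 : M.mean f' = M.mean f := M.congr_inv f f' fun s => rfl
  rw [← h1]
  exact M.congr_inv_mul f' g z fun s => by simp [f', h]

/-- Two morphisms which are close to each other are conjugate. -/
theorem exists_conjugator (L : LogChart 𝕜 E U) (M : InvariantMean 𝕜 G E) (R : GoodRadius L G)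
    {C : ℝ} (hC : 1 ≤ C) : ∃ a : C(G, E) → E, AnalyticAt 𝕜 a 0 ∧ a 0 = 0 ∧
      ∀ᶠ κ in 𝓝 0, ∀ π π₀ : G →ₜ* U, (∀ s, ‖(Ad 𝕜 (π s) : E →L[𝕜] E)‖ ≤ C) →
        (∀ s, ‖(Ad 𝕜 (π₀ s) : E →L[𝕜] E)‖ ≤ C) → (∀ s, π s = L.exp (κ s) * π₀ s) →
        ∀ s, π s = L.exp (a κ) * π₀ s * (L.exp (a κ))⁻¹ := by
  obtain ⟨Y, hY, hY0, hYe, hYu⟩ := exists_gauge L M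
  have hC0 : 0 < C := by linarith
  have hR := R.r_pos
  have hrr := R.r_le
  obtain ⟨δ, hδ, hu⟩ := Metric.eventually_nhds_iff_ball.1 hYu
  let ι : C(G, E) →L[𝕜] C(G, E) × C(G, E) × E := -ContinuousLinearMap.inl 𝕜 C(G, E) (C(G, E) × E)
  have hι : ∀ κ, ι κ = (-κ, 0, 0) := fun κ => by
    change -((κ, (0 : C(G, E) × E)) : C(G, E) × C(G, E) × E) = _
    simp
    rfl
  have ha : AnalyticAt 𝕜 (fun κ => -Y (ι κ)) 0 :=
    (AnalyticAt.fun_comp (g := Y) (f := ι) (by rwa [map_zero]) (ι.analyticAt 0)).neg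
  have ha0 : -Y (ι 0) = 0 := by rw [map_zero, hY0, neg_zero]
  -- `5` is the Lipschitz constant of `mul4` and `C` bounds the adjoint action.
  obtain ⟨η, hη, e1, e2, e3⟩ : ∃ η > 0, η ≤ δ / (5 * C) ∧ η ≤ R.r / (5 * C) ∧ η ≤ δ :=
    ⟨min (δ / (5 * C)) (min (R.r / (5 * C)) δ), by positivity, by simp, by simp, by simp⟩
  rw [le_div_iff₀ (by positivity)] at e1 e2
  have hηr : η ≤ R.r := by nlinarith
  have hηC : η ≤ C * η := by nlinarith
  have hat : Tendsto (fun κ => ‖-Y (ι κ)‖) (𝓝 0) (𝓝 0) := by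
    have := ha.continuousAt.norm
    rwa [ContinuousAt, ha0, norm_zero] at this
  have hιt : Tendsto ι (𝓝 0) (𝓝 0) := by
    have := ι.continuous.tendsto 0
    rwa [map_zero] at this
  refine ⟨fun κ => -Y (ι κ), ha, ha0, ?_⟩
  filter_upwards [hat.eventually (gt_mem_nhds hη), hιt.eventually hYe,
    Metric.ball_mem_nhds (0 : C(G, E)) hη] with κ k1 k2 k3 π π₀ hπ hπ₀ h z
  rw [mem_ball_zero_iff] at k3
  have nκ : ∀ x, ‖κ x‖ < η := fun x => (κ.norm_coe_le_norm x).trans_lt k3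
  set y : E := -Y (ι κ) with hy
  have hYy : Y (ι κ) = -y := by rw [hy, neg_neg]
  have hq0 : L.mul4 0 = 0 := L.mul4_zero
  have n4 : ∀ {b : ℝ} (p q : E), b ≤ R.r → ‖p‖ < b → ‖q‖ < b →
      ‖((p, q, 0, 0) : E × E × E × E)‖ < R.r ∧ ‖L.mul4 (p, q, 0, 0)‖ ≤ 5 * b := by
    intro b p q hb hp hq
    have hb0 : 0 < b := (norm_nonneg _).trans_lt hp
    have h1 : ‖((p, q, 0, 0) : E × E × E × E)‖ < b := by
      rw [Prod.norm_mk, Prod.norm_mk, Prod.norm_mk, norm_zero]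
      exact max_lt hp (max_lt hq (max_lt hb0 hb0))
    have h2 := R.mul4_lipschitz _ 0 (h1.trans_le hb) (by simpa using hR)
    rw [hq0, sub_zero, sub_zero] at h2
    exact ⟨h1.trans_le hb, h2.trans (by linarith)⟩
  have hw := fun x => n4 (-y) (κ x) hηr (by rwa [norm_neg]) (nκ x)
  have hexpw : ∀ x, L.exp (L.mul4 (-y, κ x, 0, 0)) = (L.exp y)⁻¹ * L.exp (κ x) := fun x => by
    rw [R.exp_mul4 _ (hw x).1]
    simp only [L.exp_zero, mul_one]
    rw [L.exp_neg (k1.trans_le (hηr.trans hrr))]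
  have nA : ‖Ad 𝕜 (π z) y‖ < C * η :=
    (ContinuousLinearMap.le_of_opNorm_le _ (hπ z) y).trans_lt (by gcongr)
  have hCη : C * η ≤ R.r := by nlinarith [mul_pos hC0 hη]
  obtain ⟨m1, m2⟩ := n4 (Ad 𝕜 (π z) y) (κ z) hCη nA ((nκ z).trans_le hηC)
  -- `y` was chosen so that `log(exp(-y) exp(κ(x)))` has mean `0`, and `exp y' = π(z) exp(y)
  -- π₀(z)⁻¹`. Then `exp(-y') exp(κ(x))` is the conjugate by `π₀(z)` of `exp(-y) exp(κ(z⁻¹x))`, so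
  -- by left invariance of the mean `y'` solves the same equation. Uniqueness gives `y' = y`, that
  -- is, `π(z) exp(y) = exp(y) π₀(z)`.
  set y' : E := L.mul4 (Ad 𝕜 (π z) y, κ z, 0, 0) with hy'
  have ny' : ‖y'‖ < L.radius := R.norm_mul4_lt _ m1
  have hexpy' : L.exp y' = π z * L.exp y * (π₀ z)⁻¹ := by
    rw [hy', R.exp_mul4 _ m1]
    simp only [L.exp_zero, mul_one]
    rw [L.exp_Ad _ _ (k1.trans_le (hηr.trans hrr)) (nA.trans_le (hCη.trans hrr))]
    have := h z
    rw [← mul_inv_eq_iff_eq_mul] at this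
    rw [← this]
    group
  let w : C(G, E) := superpose L.mul4 (gaugeQuad (𝕜 := 𝕜) (ι κ) (-y))
  have hwapply : ∀ x, w x = L.mul4 (-y, κ x, 0, 0) := fun x => by
    have hc : Continuous fun x => L.mul4 (gaugeQuad (𝕜 := 𝕜) (ι κ) (-y) x) := by
      have e : (fun x => L.mul4 (gaugeQuad (𝕜 := 𝕜) (ι κ) (-y) x)) =
          fun x => L.mul4 (-y, κ x, 0, 0) := by
        ext x
        rw [gaugeQuad_apply, hι]
        simp
      rw [e]
      refine continuous_iff_continuousAt.2 fun x => ?_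
      have hlip : LipschitzOnWith 5 L.mul4 (Metric.ball 0 R.r) :=
        LipschitzOnWith.of_dist_le_mul fun p hp q hq => by
          rw [dist_eq_norm, dist_eq_norm]
          exact_mod_cast R.mul4_lipschitz p q (by simpa using hp) (by simpa using hq)
      exact ContinuousAt.comp (f := fun x => ((-y, κ x, 0, 0) : E × E × E × E))
        (hlip.continuousOn.continuousAt (Metric.isOpen_ball.mem_nhds (by simpa using (hw x).1)))
        (by fun_prop)
    rw [superpose_apply hc, gaugeQuad_apply, hι]
    simp
  have hmw : M.mean w = 0 := by
    have := k2
    rw [hYy] at this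
    rw [this, hι]
  let T : E →L[𝕜] E := Ad 𝕜 (π₀ z)
  let b : C(G, E) := ⟨fun x => w (z⁻¹ * x), by fun_prop⟩
  have nT : ∀ x, ‖T (b x)‖ < L.radius := fun x => by
    have h1 : ‖b x‖ ≤ 5 * η := by
      change ‖w (z⁻¹ * x)‖ ≤ _
      rw [hwapply]
      exact (hw _).2
    have h2 : ‖T (b x)‖ ≤ C * (5 * η) :=
      ContinuousLinearMap.le_of_opNorm_le_of_le _ (hπ₀ z) h1
    have h3 : 0 < L.radius := L.radius_pos
    by_cases h4 : ‖T (b x)‖ < R.r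
    · exact h4.trans_le hrr
    · have hbx := R.norm_mul4_lt _ (hw (z⁻¹ * x)).1
      exfalso
      have h5 : ‖b x‖ < 5 * η := by
        change ‖w (z⁻¹ * x)‖ < _
        rw [hwapply]
        have h6 := R.mul4_lipschitz _ 0 (hw (z⁻¹ * x)).1 (by simpa using hR)
        rw [hq0, sub_zero, sub_zero] at h6
        refine h6.trans_lt ?_
        gcongr
        rw [Prod.norm_mk, Prod.norm_mk, Prod.norm_mk, norm_zero, norm_neg]
        exact max_lt k1 (max_lt (nκ _) (max_lt hη hη))
      have h7 : ‖T (b x)‖ ≤ C * ‖b x‖ := ContinuousLinearMap.le_of_opNorm_le _ (hπ₀ z) _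
      have h8 : C * ‖b x‖ < C * (5 * η) := by gcongr
      linarith
  have hsup : superpose L.mul4 (gaugeQuad (𝕜 := 𝕜) (ι κ) (-y')) =
      (⟨fun x => T (b x), by fun_prop⟩ : C(G, E)) := by
    refine superpose_eq fun x => ?_
    have e0 : gaugeQuad (𝕜 := 𝕜) (ι κ) (-y') x = (-y', κ x, 0, 0) := by
      rw [gaugeQuad_apply, hι]
      simp
    rw [e0]
    change L.mul4 (-y', κ x, 0, 0) = T (b x)
    have e4 : L.exp (-y') * L.exp (κ x) * L.exp 0 * L.exp 0 = L.exp (T (b x)) := by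
      rw [L.exp_neg ny', hexpy', L.exp_zero, mul_one, mul_one]
      have e5 : L.exp (T (b x)) = π₀ z * L.exp (b x) * (π₀ z)⁻¹ :=
        L.exp_Ad _ _ (by
          change ‖w (z⁻¹ * x)‖ < _
          rw [hwapply]
          exact R.norm_mul4_lt _ (hw _).1) (nT x)
      have e6 : L.exp (b x) = (L.exp y)⁻¹ * L.exp (κ (z⁻¹ * x)) := by
        change L.exp (w (z⁻¹ * x)) = _
        rw [hwapply, hexpw]
      have e7 : ∀ x, L.exp (κ x) = π x * (π₀ x)⁻¹ := fun x => by rw [h x, mul_inv_cancel_right]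
      rw [e5, e6, e7, e7, map_mul, map_mul, map_inv, map_inv]
      group
    rw [LogChart.mul4]
    simp only
    rw [e4, L.log_exp _ (nT x)]
  have hm' : M.mean (superpose L.mul4 (gaugeQuad (𝕜 := 𝕜) (ι κ) (-y'))) = (ι κ).2.2 := by
    rw [hsup, M.comp_clm T b _ fun s => rfl, M.congr_mul_left w b z fun s => rfl, hmw, map_zero, hι]
  have ny'δ : ‖y'‖ < δ := by
    have h6 := R.mul4_lipschitz _ 0 m1 (by simpa using hR)
    rw [hq0, sub_zero, sub_zero] at h6
    refine h6.trans_lt ?_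
    have : ‖((Ad 𝕜 (π z) y, κ z, 0, 0) : E × E × E × E)‖ < C * η := by
      rw [Prod.norm_mk, Prod.norm_mk, Prod.norm_mk, norm_zero]
      exact max_lt nA (max_lt ((nκ z).trans_le hηC) (max_lt (by positivity) (by positivity)))
    linarith
  have huniq := hu (ι κ, -y') (by
    rw [Metric.mem_ball, Prod.dist_eq, dist_zero_right, dist_zero_right, norm_neg]
    refine max_lt ?_ ny'δ
    rw [hι]
    refine max_lt (by rw [norm_neg]; linarith) (max_lt ?_ ?_) <;> simpa using hδ) hm'
  simp only at huniq
  rw [hYy, neg_inj] at huniq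
  rw [← huniq] at hexpy'
  nth_rewrite 1 [hexpy']
  group

variable {EG : Type*} [NormedAddCommGroup EG] [NormedSpace ℝ EG] [CompleteSpace EG]
  [ChartedSpace EG G] [LieGroup 𝓘(ℝ, EG) ω G] (LG : LogChart ℝ EG G) [LieGroup 𝓘(ℝ, E) ω U]
  (L : LogChart 𝕜 E U)

include LG L in
/-- The adjoint action of a morphism is analytic, and its derivative is determined by a linear
map. -/
theorem exists_Ad_morphism (π : G →ₜ* U) :
    (∀ v : E, ContMDiff 𝓘(ℝ, EG) 𝓘(ℝ, E) ω (fun s => Ad 𝕜 (π s) v)) ∧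
    ∃ N : EG → E →L[𝕜] E, ∀ (X : EG) (s : G) (v : E),
      HasDerivAt (fun t => Ad 𝕜 (π (translate LG X s t)) v) (Ad 𝕜 (π s) (N X v)) 0 := by
  obtain ⟨T, hT⟩ := exists_tangent LG L π
  have hA : AnalyticAt 𝕜 (fun x => (Ad 𝕜 (L.exp x) : E →L[𝕜] E)) 0 := L.analyticAt_Ad_exp
  have hAv : ∀ v : E, AnalyticAt 𝕜 (fun x => Ad 𝕜 (L.exp x) v) 0 := fun v =>
    analyticAt_clm_comp (ContinuousLinearMap.apply 𝕜 E v) hA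
  refine ⟨fun v g₀ => ?_, fun X => fderiv 𝕜 (fun x => (Ad 𝕜 (L.exp x) : E →L[𝕜] E)) 0 (T X),
    fun X s v => ?_⟩
  · have h1 : ContMDiffAt 𝓘(ℝ, EG) 𝓘(ℝ, E) ω (fun s => Ad 𝕜 (π s) v) 1 := by
      have a1 : ContMDiffAt 𝓘(ℝ, EG) 𝓘(ℝ, EG) ω LG.log (1 : G) := LG.contMDiffAt_log
      have a2 : ContMDiffAt 𝓘(ℝ, EG) 𝓘(ℝ, E) ω (fun g => T (LG.log g)) (1 : G) :=
        T.contMDiff.contMDiffAt.comp (1 : G) a1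
      have a3 : ContMDiffAt 𝓘(ℝ, EG) 𝓘(ℝ, E) ω (fun g => Ad 𝕜 (L.exp (T (LG.log g))) v) (1 : G) := by
        refine ContMDiffAt.comp (g := fun x => Ad 𝕜 (L.exp x) v) (f := fun g => T (LG.log g))
          (1 : G) ?_ a2
        rw [LG.log_one, map_zero]
        exact (((hAv v).restrictScalars (𝕜 := ℝ)).contDiffAt (n := ω)).contMDiffAt
      refine a3.congr_of_eventuallyEq ?_
      filter_upwards [LG.exp_log, LG.tendsto_log.eventually hT] with g h2 h3
      rw [← h3, h2]
    have e : (fun s => Ad 𝕜 (π s) v) = fun g => Ad 𝕜 (π g₀) (Ad 𝕜 (π (g₀⁻¹ * g)) v) := by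
      ext g
      rw [← Ad_mul_apply, ← map_mul, mul_inv_cancel_left]
    rw [e]
    have h2 : ContMDiffAt 𝓘(ℝ, EG) 𝓘(ℝ, E) ω (fun g => Ad 𝕜 (π (g₀⁻¹ * g)) v) g₀ := by
      refine ContMDiffAt.comp (g := fun s => Ad 𝕜 (π s) v) (f := fun g => g₀⁻¹ * g) g₀ ?_
        (contMDiff_mul_left (I := 𝓘(ℝ, EG)) (n := ω) (a := g₀⁻¹)).contMDiffAt
      rw [inv_mul_cancel]
      exact h1
    exact (((Ad 𝕜 (π g₀) : E →L[𝕜] E).restrictScalars ℝ).contMDiff).contMDiffAt.comp g₀ h2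
  · have hs : HasDerivAt (fun t : ℝ => t • T X) (T X) 0 := by
      simpa using (hasDerivAt_id (0 : ℝ)).smul_const (T X)
    have h1 : HasFDerivAt (fun x => (Ad 𝕜 (L.exp x) : E →L[𝕜] E))
        ((fderiv 𝕜 (fun x => (Ad 𝕜 (L.exp x) : E →L[𝕜] E)) 0).restrictScalars ℝ)
        ((0 : ℝ) • T X) := by
      rw [zero_smul]
      exact hA.differentiableAt.hasFDerivAt.restrictScalars ℝ
    have h2 := h1.comp_hasDerivAt (0 : ℝ) hs
    have h3 := (((Ad 𝕜 (π s) : E →L[𝕜] E).comp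
      (ContinuousLinearMap.apply 𝕜 E v : (E →L[𝕜] E) →L[𝕜] E)).restrictScalars
      ℝ).hasFDerivAt.comp_hasDerivAt (0 : ℝ) h2
    refine h3.congr_of_eventuallyEq ?_
    have hs2 : Tendsto (fun t : ℝ => t • X) (𝓝 0) (𝓝 0) := by
      have : Continuous fun t : ℝ => t • X := by fun_prop
      exact this.tendsto' _ _ (by simp)
    filter_upwards [hs2.eventually hT] with t ht
    change Ad 𝕜 (π (s * LG.exp (t • X))) v = Ad 𝕜 (π s) (Ad 𝕜 (L.exp (t • T X)) v)
    rw [map_mul, Ad_mul_apply, ht, map_smul]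

end AlmostMorphism

end

/-! ### Power series along an analytic action, with all invariant derivatives. -/

noncomputable section

namespace AlmostMorphism

set_option linter.unusedSectionVars false

section InvDerivs

variable {EG : Type*} [NormedAddCommGroup EG] [NormedSpace ℝ EG]
  {G : Type*} [Group G] [TopologicalSpace G] [IsTopologicalGroup G] [ChartedSpace EG G]
  [LieGroup 𝓘(ℝ, EG) ω G] (LG : LogChart ℝ EG G)
  {E : Type*} [NormedAddCommGroup E] [NormedSpace ℝ E]

/-- A derivative along the curves `t ↦ g exp (t X)` at `0`, for every `g`, is one at all small `t`,
uniformly. -/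
theorem exists_hasDerivAt_translate (X : EG) : ∃ δ > 0, ∀ {f f' : G → E},
    (∀ g, HasDerivAt (fun t => f (translate LG X g t)) (f' g) 0) → ∀ g, ∀ t ∈ Metric.ball (0 : ℝ) δ,
      HasDerivAt (fun t => f (translate LG X g t)) (f' (translate LG X g t)) t := by
  obtain ⟨δ, hδ, hadd⟩ := Metric.eventually_nhds_iff_ball.1 (LG.curve_add X)
  refine ⟨δ, hδ, fun {f f'} h g t ht => ?_⟩
  rw [mem_ball_zero_iff] at ht
  have h1 := h (translate LG X g t)
  have hs : HasDerivAt (fun s : ℝ => s - t) 1 t := (hasDerivAt_id t).sub_const t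
  have h2 : HasDerivAt (fun s => f (translate LG X (translate LG X g t) (s - t)))
      (f' (translate LG X g t)) t := by
    have h3 : HasDerivAt (fun t' => f (translate LG X (translate LG X g t) t'))
        (f' (translate LG X g t)) (t - t) := by rwa [sub_self]
    exact HasDerivAt.comp_sub_const t t h3
  refine h2.congr_of_eventuallyEq ?_
  have : ∀ᶠ s in 𝓝 t, s - t ∈ Metric.ball (0 : ℝ) δ :=
    hs.continuousAt.eventually_mem (by simpa using Metric.ball_mem_nhds (0 : ℝ) hδ)
  filter_upwards [this] with s h4
  have h5 := hadd (t, s - t) (by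
    rw [mem_ball_zero_iff] at h4
    rw [mem_ball_zero_iff, Prod.norm_def]
    exact max_lt ht h4)
  simp only [add_sub_cancel] at h5
  rw [translate, translate, translate, h5, mul_assoc]

include LG in
theorem invDerivs_add {f g : G → E} {n : WithTop ℕ∞} (hf : ContMDiff 𝓘(ℝ, EG) 𝓘(ℝ, E) n f)
    (hg : ContMDiff 𝓘(ℝ, EG) 𝓘(ℝ, E) n g) (L : List EG)
    (hL : ((L.length : ℕ) : WithTop ℕ∞) ≤ n) :
    invDerivs 𝓘(ℝ, EG) L (f + g) = invDerivs 𝓘(ℝ, EG) L f + invDerivs 𝓘(ℝ, EG) L g := by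
  induction L with
  | nil => rfl
  | cons X L ih =>
    ext s
    have hL' : 1 + ((L.length : ℕ) : WithTop ℕ∞) ≤ n := by
      rw [List.length_cons] at hL
      push_cast at hL
      rwa [add_comm]
    have h1 := contMDiff_invDerivs (m := 1) hf L hL'
    have h2 := contMDiff_invDerivs (m := 1) hg L hL'
    rw [invDerivs_cons, ih (le_add_self.trans hL')]
    exact (hasDerivAt_invDeriv LG le_rfl (h1.add h2) X s).unique
      ((hasDerivAt_invDeriv LG le_rfl h1 X s).add (hasDerivAt_invDeriv LG le_rfl h2 X s))

include LG in
theorem invDerivs_clm {E' : Type*} [NormedAddCommGroup E'] [NormedSpace ℝ E'] (T : E →L[ℝ] E')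
    {f : G → E} (hf : ContMDiff 𝓘(ℝ, EG) 𝓘(ℝ, E) ω f) (L : List EG) :
    invDerivs 𝓘(ℝ, EG) L (fun g => T (f g)) = fun g => T (invDerivs 𝓘(ℝ, EG) L f g) := by
  induction L with
  | nil => rfl
  | cons X L ih =>
    ext s
    have h1 := contMDiff_invDerivs (m := 1) hf L le_top
    rw [invDerivs_cons, ih]
    exact (hasDerivAt_invDeriv LG le_rfl (T.contMDiff.comp h1) X s).unique
      (T.hasFDerivAt.comp_hasDerivAt (0 : ℝ) (hasDerivAt_invDeriv LG le_rfl h1 X s))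

end InvDerivs

section Words

variable {𝕜 : Type*} [RCLike 𝕜] {EG Z E : Type*} [NormedAddCommGroup Z] [NormedSpace 𝕜 Z]
  [NormedAddCommGroup E] [NormedSpace 𝕜 E] {k : ℕ}

/-- The action of an endomorphism on multilinear maps, as a derivation. -/
def lieAct (N : Z →L[𝕜] Z) (q : Z [×k]→L[𝕜] E) : Z [×k]→L[𝕜] E :=
  ∑ i, q.compContinuousLinearMap fun j => if j = i then N else ContinuousLinearMap.id 𝕜 Z

theorem lieAct_apply (N : Z →L[𝕜] Z) (q : Z [×k]→L[𝕜] E) (v : Fin k → Z) :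
    lieAct N q v = ∑ i, q (Function.update v i (N (v i))) := by
  rw [lieAct, sum_apply]
  refine Finset.sum_congr rfl fun i _ => ?_
  rw [ContinuousMultilinearMap.compContinuousLinearMap_apply]
  congr 1
  ext j
  by_cases h : j = i
  · subst h
    simp
  · simp [h]

theorem norm_lieAct_le {N : Z →L[𝕜] Z} {n : ℝ} (hN : ‖N‖ ≤ n) (q : Z [×k]→L[𝕜] E) :
    ‖lieAct N q‖ ≤ k * n * ‖q‖ := by
  have h : ∀ i ∈ Finset.univ, ‖q.compContinuousLinearMap fun j =>
      if j = i then N else ContinuousLinearMap.id 𝕜 Z‖ ≤ n * ‖q‖ := fun i _ => by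
    refine (q.norm_compContinuousLinearMap_le _).trans ?_
    rw [mul_comm]
    gcongr
    calc ∏ j, ‖if j = i then N else ContinuousLinearMap.id 𝕜 Z‖
        ≤ ∏ j, (if j = i then n else 1) := by
          refine Finset.prod_le_prod (fun _ _ => norm_nonneg _) fun j _ => ?_
          split_ifs
          · exact hN
          · exact ContinuousLinearMap.norm_id_le
      _ = n := by simp
  refine (norm_sum_le_of_le _ h).trans (le_of_eq ?_)
  simp [mul_assoc]

/-- The action of words in a family of endomorphisms on multilinear maps. -/
def wordAct (N : EG → Z →L[𝕜] Z) (L : List EG) (q : Z [×k]→L[𝕜] E) : Z [×k]→L[𝕜] E :=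
  L.foldl (fun q X => lieAct (N X) q) q

theorem wordAct_cons (N : EG → Z →L[𝕜] Z) (X : EG) (L : List EG) (q : Z [×k]→L[𝕜] E) :
    wordAct N (X :: L) q = wordAct N L (lieAct (N X) q) := rfl

/-- The weight of a word in a family of endomorphisms. -/
def wordWeight (N : EG → Z →L[𝕜] Z) (L : List EG) : ℝ :=
  (L.map fun X => ‖N X‖ + 1).prod * L.length.factorial

theorem wordWeight_pos (N : EG → Z →L[𝕜] Z) (L : List EG) : 0 < wordWeight N L := by
  have : 0 < (L.map fun X => ‖N X‖ + 1).prod := by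
    refine List.prod_pos ?_
    simp only [List.mem_map]
    rintro _ ⟨X, _, rfl⟩
    positivity
  unfold wordWeight
  positivity

@[simp]
theorem wordWeight_nil (N : EG → Z →L[𝕜] Z) : wordWeight N [] = 1 := by simp [wordWeight]

/-- Each letter costs a factor `k (‖N X‖ + 1)`. The inequality `kˡ ≤ l! eᵏ` separates the length `l`
of the word, absorbed by the weight, from the degree `k`, which retains only a geometric factor and
merely shrinks the radius of convergence. -/
theorem norm_wordAct_le (N : EG → Z →L[𝕜] Z) (L : List EG) (q : Z [×k]→L[𝕜] E) :
    ‖wordAct N L q‖ ≤ wordWeight N L * (Real.exp k * ‖q‖) := by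
  have h1 : ‖wordAct N L q‖ ≤ (L.map fun X => ‖N X‖ + 1).prod * (k : ℝ) ^ L.length * ‖q‖ := by
    induction L generalizing q with
    | nil => simp [wordAct]
    | cons X L ih =>
      rw [wordAct_cons]
      refine (ih _).trans ?_
      have h2 := norm_lieAct_le (N := N X) (n := ‖N X‖ + 1) (by linarith) q
      have h3 : 0 ≤ (L.map fun X => ‖N X‖ + 1).prod := by
        refine List.prod_nonneg ?_
        simp only [List.mem_map]
        rintro _ ⟨X, _, rfl⟩
        positivity
      calc _ ≤ (L.map fun X => ‖N X‖ + 1).prod * (k : ℝ) ^ L.length * (k * (‖N X‖ + 1) * ‖q‖) := by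
            gcongr
        _ = _ := by
          simp only [List.map_cons, List.prod_cons, List.length_cons]
          ring
  refine h1.trans ?_
  have h4 := Real.pow_div_factorial_le_exp (k : ℝ) (by positivity) L.length
  rw [div_le_iff₀ (by positivity)] at h4
  have h5 : 0 < (L.map fun X => ‖N X‖ + 1).prod := by
    have := wordWeight_pos N L
    unfold wordWeight at this
    exact pos_of_mul_pos_left this (by positivity)
  calc _ ≤ (L.map fun X => ‖N X‖ + 1).prod * (Real.exp k * L.length.factorial) * ‖q‖ := by gcongr
    _ = _ := by
      unfold wordWeight
      ring

theorem hasDerivAt_wordAct [NormedSpace ℝ E] [IsScalarTower ℝ 𝕜 E] (N : EG → Z →L[𝕜] Z)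
    (L : List EG) {q : ℝ → Z [×k]→L[𝕜] E} {q' : Z [×k]→L[𝕜] E} {t : ℝ}
    (h : ∀ v, HasDerivAt (fun t => q t v) (q' v) t) (v : Fin k → Z) :
    HasDerivAt (fun t => wordAct N L (q t) v) (wordAct N L q' v) t := by
  induction L generalizing q q' with
  | nil => exact h v
  | cons X L ih =>
    simp only [wordAct_cons]
    refine ih fun v => ?_
    simp only [lieAct_apply]
    exact HasDerivAt.fun_sum fun i _ => h _

end Words

section Series

variable {𝕜 : Type*} [RCLike 𝕜] {E : Type*} [NormedAddCommGroup E] [NormedSpace 𝕜 E]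
  [NormedSpace ℝ E] [IsScalarTower ℝ 𝕜 E]
  {Z : Type*} [NormedAddCommGroup Z] [NormedSpace 𝕜 Z] [NormedSpace ℝ Z] [IsScalarTower ℝ 𝕜 Z]
  {EG : Type*} [NormedAddCommGroup EG] [NormedSpace ℝ EG]
  {G : Type*} [Group G] [TopologicalSpace G] [IsTopologicalGroup G] [ChartedSpace EG G]
  [LieGroup 𝓘(ℝ, EG) ω G] (LG : LogChart ℝ EG G)

/-- A bounded analytic action of `G` on a Banach space, with its derivative. -/
structure AnalyticAction (𝕜 : Type*) [RCLike 𝕜] (Z : Type*) [NormedAddCommGroup Z]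
    [NormedSpace 𝕜 Z] [NormedSpace ℝ Z] [IsScalarTower ℝ 𝕜 Z] (LG : LogChart ℝ EG G) where
  /-- The action. -/
  act : G → Z →L[𝕜] Z
  /-- A bound for the action. -/
  bound : ℝ
  one_le_bound : 1 ≤ bound
  norm_act_le : ∀ s, ‖act s‖ ≤ bound
  contMDiff_act : ∀ w, ContMDiff 𝓘(ℝ, EG) 𝓘(ℝ, Z) ω fun s => act s w
  /-- The derivative of the action. -/
  der : EG → Z →L[𝕜] Z
  hasDerivAt_act : ∀ X s w, HasDerivAt (fun t => act (translate LG X s t) w) (act s (der X w)) 0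

namespace AnalyticAction

variable {LG} (T : AnalyticAction 𝕜 Z LG) {k : ℕ}

/-- The translates of a multilinear map under an action. -/
def pull (q : Z [×k]→L[𝕜] E) (s : G) : Z [×k]→L[𝕜] E :=
  q.compContinuousLinearMap fun _ => T.act s

theorem pull_apply (q : Z [×k]→L[𝕜] E) (s : G) (v : Fin k → Z) :
    T.pull q s v = q fun i => T.act s (v i) := rfl

theorem norm_pull_le (q : Z [×k]→L[𝕜] E) (s : G) : ‖T.pull q s‖ ≤ T.bound ^ k * ‖q‖ := by
  refine (q.norm_compContinuousLinearMap_le _).trans ?_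
  rw [mul_comm]
  gcongr
  calc ∏ _i : Fin k, ‖T.act s‖ ≤ ∏ _i : Fin k, T.bound :=
        Finset.prod_le_prod (fun _ _ => norm_nonneg _) fun i _ => T.norm_act_le s
    _ = _ := by simp

theorem hasDerivAt_pull (q : Z [×k]→L[𝕜] E) (X : EG) (s : G) (v : Fin k → Z) :
    HasDerivAt (fun t => T.pull q (translate LG X s t) v) (lieAct (T.der X) (T.pull q s) v) 0 := by
  have h := HasFDerivAt.multilinear_comp (f := q.restrictScalars ℝ)
    (g := fun i t => T.act (translate LG X s t) (v i)) (x := (0 : ℝ))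
    fun i => (T.hasDerivAt_act X s (v i)).hasFDerivAt
  have h2 := h.hasDerivAt
  convert! h2 using 1
  rw [lieAct_apply, sum_apply]
  refine Finset.sum_congr rfl fun i _ => ?_
  rw [pull_apply]
  simp only [translate_zero, ContinuousLinearMap.comp_apply,
    ContinuousLinearMap.toSpanSingleton_apply, one_smul]
  rw [ContinuousMultilinearMap.toContinuousLinearMap_apply]
  change q _ = q _
  congr 1
  ext j
  by_cases h : j = i
  · subst h
    simp
  · simp [h]

theorem hasDerivAt_wordAct_pull (q : Z [×k]→L[𝕜] E) (L : List EG) (X : EG) (s : G)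
    (v : Fin k → Z) : HasDerivAt (fun t => wordAct T.der L (T.pull q (translate LG X s t)) v)
      (wordAct T.der (X :: L) (T.pull q s) v) 0 :=
  hasDerivAt_wordAct T.der L (T.hasDerivAt_pull q X s) v

theorem contMDiff_pull (q : Z [×k]→L[𝕜] E) (v : Fin k → Z) :
    ContMDiff 𝓘(ℝ, EG) 𝓘(ℝ, E) ω fun s => T.pull q s v := by
  have h1 : ContMDiff 𝓘(ℝ, EG) 𝓘(ℝ, Fin k → Z) ω fun s => (fun i => T.act s (v i)) :=
    contMDiff_pi_space.2 fun i => T.contMDiff_act (v i)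
  exact ((q.restrictScalars ℝ).contDiff (n := ω)).contMDiff.comp h1

/-- Differentiation passes through the outer word and acts on the pulled-back map inside, so the
newest letter is innermost; this is why words act by a left fold. -/
theorem invDerivs_pull (q : Z [×k]→L[𝕜] E) (v : Fin k → Z) (L : List EG) :
    invDerivs 𝓘(ℝ, EG) L (fun s => T.pull q s v) = fun s => wordAct T.der L (T.pull q s) v := by
  induction L with
  | nil => rfl
  | cons X L ih =>
    ext s
    have h1 := contMDiff_invDerivs (m := 1) (T.contMDiff_pull q v) L le_top
    have h2 := hasDerivAt_invDeriv LG le_rfl h1 X s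
    rw [ih] at h2
    rw [invDerivs_cons, ih]
    exact h2.unique (T.hasDerivAt_wordAct_pull q L X s v)

end AnalyticAction

variable (E G EG) in
/-- Families of vectors indexed by words and points. -/
abbrev JetSpace : Type _ := lp (fun _ : List EG × G => E) ⊤

/-- The families consisting of the derivatives of an analytic map, divided by weights. -/
def jetSubmodule (wt : List EG → ℝ) : Submodule 𝕜 (JetSpace E EG G) where
  carrier := {F | ∃ f : G → E, ContMDiff 𝓘(ℝ, EG) 𝓘(ℝ, E) ω f ∧
    ∀ L g, invDerivs 𝓘(ℝ, EG) L f g = wt L • F (L, g)}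
  add_mem' := by
    rintro F F' ⟨f, hf, h⟩ ⟨f', hf', h'⟩
    refine ⟨f + f', hf.add hf', fun L g => ?_⟩
    rw [invDerivs_add LG hf hf' L le_top, Pi.add_apply, h, h', ← smul_add]
    rfl
  zero_mem' := ⟨0, contMDiff_const, fun L g => by
    change invDerivs 𝓘(ℝ, EG) L (fun _ => (0 : E)) g = wt L • (0 : E)
    rw [invDerivs_zero, smul_zero]⟩
  smul_mem' := by
    rintro c F ⟨f, hf, h⟩
    let T : E →L[ℝ] E := (c • ContinuousLinearMap.id 𝕜 E).restrictScalars ℝ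
    refine ⟨fun g => T (f g), T.contMDiff.comp hf, fun L g => ?_⟩
    rw [invDerivs_clm LG T hf]
    change c • invDerivs 𝓘(ℝ, EG) L f g = wt L • c • F (L, g)
    rw [h, smul_comm]

namespace AnalyticAction

variable {LG} (T : AnalyticAction 𝕜 Z LG) {k : ℕ}

theorem norm_wordAct_pull_le (q : Z [×k]→L[𝕜] E) (L : List EG) (s : G) (v : Fin k → Z) :
    ‖wordAct T.der L (T.pull q s) v‖ ≤
      wordWeight T.der L * ((Real.exp 1 * T.bound) ^ k * ‖q‖ * ∏ i, ‖v i‖) := by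
  have h0 := wordWeight_pos T.der L
  refine (ContinuousMultilinearMap.le_opNorm _ _).trans ?_
  calc _ ≤ wordWeight T.der L * (Real.exp k * (T.bound ^ k * ‖q‖)) * ∏ i, ‖v i‖ := by
        gcongr
        refine (norm_wordAct_le T.der L _).trans ?_
        gcongr
        exact T.norm_pull_le q s
    _ = _ := by
      rw [mul_pow, ← Real.exp_nat_mul, mul_one]
      ring

/-- The multilinear map whose values are the families of derivatives, divided by weights, of a
multilinear map along an action. -/
def jet (q : Z [×k]→L[𝕜] E) : Z [×k]→L[𝕜] JetSpace E EG G :=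
  MultilinearMap.mkContinuous
    { toFun := fun v => ⟨fun x => (wordWeight T.der x.1)⁻¹ • wordAct T.der x.1 (T.pull q x.2) v,
        memℓp_infty ⟨(Real.exp 1 * T.bound) ^ k * ‖q‖ * ∏ i, ‖v i‖, by
          rintro _ ⟨x, rfl⟩
          have h0 := wordWeight_pos T.der x.1
          simp only [norm_smul, norm_inv, Real.norm_of_nonneg h0.le]
          rw [inv_mul_le_iff₀ h0]
          exact T.norm_wordAct_pull_le q x.1 x.2 v⟩⟩
      map_update_add' := by
        intro _ v i x y
        ext z
        have h := (wordAct T.der z.1 (T.pull q z.2)).map_update_add v i x y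
        refine Eq.trans ?_ (smul_add (wordWeight T.der z.1)⁻¹ _ _)
        rw [← h]
      map_update_smul' := by
        intro _ v i c x
        ext z
        have h := (wordAct T.der z.1 (T.pull q z.2)).map_update_smul v i c x
        refine Eq.trans ?_ (smul_comm c (wordWeight T.der z.1)⁻¹ _).symm
        rw [← h] }
    ((Real.exp 1 * T.bound) ^ k * ‖q‖) fun v => by
      have hb := T.one_le_bound
      refine lp.norm_le_of_forall_le (by positivity) fun x => ?_
      have h0 := wordWeight_pos T.der x.1
      change ‖_ • _‖ ≤ _
      rw [norm_smul, norm_inv, Real.norm_of_nonneg h0.le, inv_mul_le_iff₀ h0]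
      exact T.norm_wordAct_pull_le q x.1 x.2 v

theorem jet_apply (q : Z [×k]→L[𝕜] E) (v : Fin k → Z) (L : List EG) (s : G) :
    T.jet q v (L, s) = (wordWeight T.der L)⁻¹ • wordAct T.der L (T.pull q s) v := rfl

theorem norm_jet_le (q : Z [×k]→L[𝕜] E) : ‖T.jet q‖ ≤ (Real.exp 1 * T.bound) ^ k * ‖q‖ := by
  have hb := T.one_le_bound
  exact MultilinearMap.mkContinuous_norm_le _ (by positivity) _

theorem jet_mem (q : Z [×k]→L[𝕜] E) (v : Fin k → Z) :
    T.jet q v ∈ jetSubmodule (𝕜 := 𝕜) (E := E) LG (wordWeight T.der) := by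
  refine ⟨fun s => T.pull q s v, T.contMDiff_pull q v, fun L g => ?_⟩
  rw [invDerivs_pull, jet_apply, smul_inv_smul₀ (wordWeight_pos _ _).ne']

variable [CompleteSpace E]

/-- Superposition with an analytic map along an action is analytic, with all derivatives. -/
theorem exists_jet_series {Q : Z → E} (hQ : AnalyticAt 𝕜 Q 0) :
    ∃ (Θ : Z → JetSpace E EG G) (p : FormalMultilinearSeries 𝕜 Z (JetSpace E EG G)),
      HasFPowerSeriesAt Θ p 0 ∧
      (∀ k v, p k v ∈ jetSubmodule (𝕜 := 𝕜) (E := E) LG (wordWeight T.der)) ∧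
      ∀ᶠ w in 𝓝 0, Θ w ∈ jetSubmodule (𝕜 := 𝕜) (E := E) LG (wordWeight T.der) ∧
        ∀ s, Θ w ([], s) = Q (T.act s w) := by
  obtain ⟨q, R, hq⟩ := hQ
  have hb : 0 < T.bound := by linarith [T.one_le_bound]
  obtain ⟨C, r, hC, hr, hqr⟩ := q.le_mul_pow_of_radius_pos (hq.r_pos.trans_le hq.r_le)
  let p : FormalMultilinearSeries 𝕜 Z (JetSpace E EG G) := fun k => T.jet (q k)
  -- The geometric rate of the coefficients: `r` from the original series, the bound of the action,
  -- and `e` from the weights.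
  let B : ℝ := Real.exp 1 * T.bound * r
  have hB : 0 < B := by positivity
  have hp : ∀ k, ‖p k‖ ≤ C * B ^ k := fun k => by
    refine (T.norm_jet_le (q k)).trans ?_
    calc _ ≤ (Real.exp 1 * T.bound) ^ k * (C * r ^ k) := by
          gcongr
          exact hqr k
      _ = _ := by
        simp only [B]
        ring
  have hrad : 0 < p.radius := by
    refine lt_of_lt_of_le ?_ (p.le_radius_of_bound (r := ⟨B⁻¹, by positivity⟩) C fun k => ?_)
    · exact ENNReal.coe_pos.2 (inv_pos.2 hB)
    · calc ‖p k‖ * (B⁻¹) ^ k ≤ C * B ^ k * (B⁻¹) ^ k := by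
            gcongr
            exact hp k
        _ = C := by rw [mul_assoc, ← mul_pow, mul_inv_cancel₀ hB.ne', one_pow, mul_one]
  have hΘ := p.hasFPowerSeriesOnBall hrad
  refine ⟨p.sum, p, hΘ.hasFPowerSeriesAt, fun k v => T.jet_mem _ _, ?_⟩
  have hact : ∀ᶠ w in 𝓝 (0 : Z), ∀ s, T.act s w ∈ Metric.eball (0 : Z) R := by
    obtain ⟨ε, hε, hεR⟩ := Metric.mem_nhds_iff.1 (Metric.eball_mem_nhds (0 : Z) hq.r_pos)
    filter_upwards [Metric.ball_mem_nhds (0 : Z) (div_pos hε hb)] with w hw s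
    rw [mem_ball_zero_iff, lt_div_iff₀ hb] at hw
    refine hεR ?_
    rw [mem_ball_zero_iff]
    calc ‖T.act s w‖ ≤ T.bound * ‖w‖ := ContinuousLinearMap.le_of_opNorm_le _ (T.norm_act_le s) _
      _ < ε := by linarith
  filter_upwards [hact, Metric.ball_mem_nhds (0 : Z) (inv_pos.2 hB), Metric.eball_mem_nhds (0 : Z) hrad]
    with w hw hwB hwp
  rw [mem_ball_zero_iff] at hwB
  have hsum : HasSum (fun k => p k fun _ => w) (p.sum w) := by
    have := hΘ.hasSum hwp
    rwa [zero_add] at this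
  have hval : ∀ L s, HasSum (fun k => wordAct T.der L (T.pull (q k) s) fun _ => w)
      (wordWeight T.der L • p.sum w (L, s)) := fun L s => by
    have h1 : HasSum (fun k => (p k fun _ => w) (L, s)) (p.sum w (L, s)) :=
      hsum.map (lp.evalCLM 𝕜 (fun _ : List EG × G => E) ⊤ (L, s))
        (lp.evalCLM 𝕜 (fun _ : List EG × G => E) ⊤ (L, s)).continuous
    have h2 := h1.const_smul (wordWeight T.der L)
    refine h2.congr_fun fun k => ?_
    change _ = _ • T.jet (q k) _ (L, s)
    rw [jet_apply, smul_inv_smul₀ (wordWeight_pos _ _).ne']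
  have hnil : ∀ s, p.sum w ([], s) = Q (T.act s w) := fun s => by
    have h1 := hval [] s
    rw [wordWeight_nil, one_smul] at h1
    have h2 := hq.hasSum (hw s)
    rw [zero_add] at h2
    exact h1.unique h2
  have hf : ContMDiff 𝓘(ℝ, EG) 𝓘(ℝ, E) ω fun s => Q (T.act s w) := fun s => by
    have h1 : AnalyticAt 𝕜 Q (T.act s w) := hq.analyticAt_of_mem (hw s)
    exact (((h1.restrictScalars (𝕜 := ℝ)).contDiffAt (n := ω)).contMDiffAt).comp s
      (T.contMDiff_act w s)
  -- Closedness of the space of jets is not used: that the sum of the series is a jet is proved by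
  -- induction on the word.
  refine ⟨⟨_, hf, fun L => ?_⟩, hnil⟩
  induction L with
  | nil =>
    intro g
    rw [hnil, wordWeight_nil, one_smul]
    rfl
  | cons X L ih =>
    intro g
    have e : invDerivs 𝓘(ℝ, EG) L (fun s => Q (T.act s w)) =
        fun s => ∑' k, wordAct T.der L (T.pull (q k) s) fun _ => w := by
      ext s
      rw [ih, (hval L s).tsum_eq]
    have h1 := contMDiff_invDerivs (m := 1) hf L le_top
    have h2 := hasDerivAt_invDeriv LG le_rfl h1 X g
    obtain ⟨δ, hδ, hd⟩ := exists_hasDerivAt_translate (E := E) LG X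
    -- Termwise differentiation on a whole interval around `0`; for a fixed word the differentiated
    -- terms are dominated by a geometric series since `‖w‖ < B⁻¹`.
    have h3 : HasDerivAt (fun t => ∑' k, wordAct T.der L (T.pull (q k) (translate LG X g t))
        fun _ => w) (∑' k, wordAct T.der (X :: L) (T.pull (q k) (translate LG X g 0)) fun _ => w)
        0 := by
      have hu : Summable fun k : ℕ => wordWeight T.der (X :: L) * (C * (B * ‖w‖) ^ k) := by
        refine ((summable_geometric_of_lt_one (by positivity) ?_).mul_left C).mul_left _
        rwa [← lt_inv_mul_iff₀ hB, mul_one]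
      refine hasDerivAt_tsum_of_isPreconnected
        (g := fun k t => wordAct T.der L (T.pull (q k) (translate LG X g t)) fun _ => w)
        (g' := fun k t => wordAct T.der (X :: L) (T.pull (q k) (translate LG X g t)) fun _ => w)
        (t := Metric.ball (0 : ℝ) δ) (y₀ := 0) (y := 0) hu Metric.isOpen_ball
        (convex_ball _ _).isPreconnected (fun k t ht => ?_) (fun k t _ => ?_)
        (Metric.mem_ball_self hδ) (hval L _).summable (Metric.mem_ball_self hδ)
      · exact hd (f := fun s => wordAct T.der L (T.pull (q k) s) fun _ => w)
          (f' := fun s => wordAct T.der (X :: L) (T.pull (q k) s) fun _ => w)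
          (fun s => T.hasDerivAt_wordAct_pull (q k) L X s _) g t ht
      · refine (T.norm_wordAct_pull_le (q k) _ _ _).trans ?_
        have := wordWeight_pos T.der (X :: L)
        rw [Finset.prod_const, Finset.card_univ, Fintype.card_fin]
        refine mul_le_mul_of_nonneg_left ?_ this.le
        calc _ ≤ (Real.exp 1 * T.bound) ^ k * (C * r ^ k) * ‖w‖ ^ k := by
              gcongr
              exact hqr k
          _ = _ := by
            simp only [B]
            ring
    rw [translate_zero, (hval (X :: L) g).tsum_eq] at h3
    rw [e] at h2
    rw [invDerivs_cons, e]
    exact h2.unique h3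

end AnalyticAction

end Series

end AlmostMorphism

end

/-! ### Analytic maps into the space of `C^r` maps. -/

noncomputable section

namespace AlmostMorphism

set_option linter.unusedSectionVars false

section CrVec

variable {𝕜 : Type*} [RCLike 𝕜] {E : Type*} [NormedAddCommGroup E] [NormedSpace 𝕜 E]
  [NormedSpace ℝ E] [IsScalarTower ℝ 𝕜 E]
  {EG : Type*} [NormedAddCommGroup EG] [NormedSpace ℝ EG]
  {G : Type*} [Group G] [TopologicalSpace G] [IsTopologicalGroup G] [ChartedSpace EG G]
  [LieGroup 𝓘(ℝ, EG) ω G] {LG : LogChart ℝ EG G} {r : WithTop ℕ∞}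

theorem tendsto_crVec_iff {A : Type*} {𝓕 : Filter A} {k : A → CrVec 𝓘(ℝ, EG) G E r 𝕜}
    {k₀ : CrVec 𝓘(ℝ, EG) G E r 𝕜} : Tendsto k 𝓕 (𝓝 k₀) ↔
      ∀ L : List EG, ((L.length : ℕ) : WithTop ℕ∞) ≤ r → ∀ ε > 0, ∀ᶠ a in 𝓕, ∀ x,
        ‖invDerivs 𝓘(ℝ, EG) L k₀ x - invDerivs 𝓘(ℝ, EG) L (k a) x‖ < ε := by
  refine tendsto_nhds_iInf_iff.trans (forall_congr' fun L => tendsto_nhds_iInf_iff.trans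
    (forall_congr' fun hL => tendsto_nhds_comap_iff.trans (tendsto_unifConv_iff.trans ?_)))
  constructor
  · intro h ε hε
    filter_upwards [h _ (Metric.dist_mem_uniformity hε)] with a ha x
    rw [← dist_eq_norm]
    exact ha x
  · intro h V hV
    obtain ⟨ε, hε, hV'⟩ := Metric.mem_uniformity_dist.1 hV
    filter_upwards [h ε hε] with a ha x
    refine hV' ?_
    rw [dist_eq_norm]
    exact ha x

include LG in
theorem tendsto_crVec_add (x₀ : CrVec 𝓘(ℝ, EG) G E r 𝕜) :
    Tendsto (fun h => x₀ + h) (𝓝 0) (𝓝 x₀) := by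
  refine tendsto_crVec_iff.2 fun L hL ε hε => ?_
  filter_upwards [tendsto_crVec_iff.1 (tendsto_id (x := 𝓝 (0 : CrVec 𝓘(ℝ, EG) G E r 𝕜))) L hL ε hε]
    with h hh x
  have h1 : invDerivs 𝓘(ℝ, EG) L (0 : CrVec 𝓘(ℝ, EG) G E r 𝕜) x = 0 :=
    congrFun (invDerivs_zero (I := 𝓘(ℝ, EG)) (G := G) (E := E) L) x
  have h2 : invDerivs 𝓘(ℝ, EG) L (x₀ + h : CrVec 𝓘(ℝ, EG) G E r 𝕜) x =
      invDerivs 𝓘(ℝ, EG) L x₀ x + invDerivs 𝓘(ℝ, EG) L h x :=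
    congrFun (invDerivs_add LG x₀.2 h.2 L hL) x
  have h3 := hh x
  rw [h1, zero_sub, id] at h3
  rwa [h2, sub_add_cancel_left]

variable (𝕜 E EG G r) in
/-- The inclusion of `C^r(G, E)` in `C(G, E)`. -/
def crRes [CompactSpace G] : CrVec 𝓘(ℝ, EG) G E r 𝕜 →L[𝕜] C(G, E) where
  toFun f := ⟨f.1, ContMDiff.continuous f.2⟩
  map_add' _ _ := rfl
  map_smul' _ _ := rfl
  cont := by
    refine continuous_iff_continuousAt.2 fun f => Metric.tendsto_nhds.2 fun ε hε => ?_
    have h := tendsto_crVec_iff.1 (tendsto_id (x := 𝓝 f)) [] (by simp) (ε / 2) (by positivity)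
    filter_upwards [h] with f' hf'
    rw [dist_comm, dist_eq_norm]
    refine ((ContinuousMap.norm_le _ (by positivity)).2 fun x => (hf' x).le).trans_lt ?_
    linarith

variable (LG) in
/-- The map underlying a family of derivatives. -/
def jetToCr (wt : List EG → ℝ) : jetSubmodule (𝕜 := 𝕜) (E := E) LG wt →L[𝕜]
    CrVec 𝓘(ℝ, EG) G E r 𝕜 := by
  have key : ∀ F : jetSubmodule (𝕜 := 𝕜) (E := E) LG wt,
      ContMDiff 𝓘(ℝ, EG) 𝓘(ℝ, E) ω (fun g => wt [] • F.1 ([], g)) ∧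
      ∀ L g, invDerivs 𝓘(ℝ, EG) L (fun g => wt [] • F.1 ([], g)) g = wt L • F.1 (L, g) := by
    rintro ⟨F, f, hf, h⟩
    have e : f = fun g => wt [] • F ([], g) := funext fun g => h [] g
    rw [← e]
    exact ⟨hf, h⟩
  refine
    { toFun := fun F => ⟨fun g => wt [] • F.1 ([], g), (key F).1.of_le le_top⟩
      map_add' := fun F F' => Subtype.ext (funext fun g => smul_add _ _ _)
      map_smul' := fun c F => Subtype.ext (funext fun g => smul_comm _ _ _)
      cont := ?_ }
  refine continuous_iff_continuousAt.2 fun F => tendsto_crVec_iff.2 fun L _ ε hε => ?_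
  have hpos : 0 < ε / (|wt L| + 1) := by positivity
  filter_upwards [Metric.ball_mem_nhds F hpos] with F' hF' g
  refine (congrArg norm (congrArg₂ (· - ·) ((key F).2 L g) ((key F').2 L g))).trans_lt ?_
  rw [← smul_sub, norm_smul, Real.norm_eq_abs]
  have h1 : ‖F.1 (L, g) - F'.1 (L, g)‖ < ε / (|wt L| + 1) := by
    refine (lp.norm_apply_le_norm ENNReal.top_ne_zero (F.1 - F'.1) (L, g)).trans_lt ?_
    rw [mem_ball_iff_norm'] at hF'
    exact hF'
  rw [lt_div_iff₀ (by positivity)] at h1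
  nlinarith [norm_nonneg (F.1 (L, g) - F'.1 (L, g)), abs_nonneg (wt L)]

/-- The `C^r` spaces need not be normable, so the map is factored through Banach spaces: the source
is first sent to `C(G, E)`, and the values are produced in the space of weighted jets, which maps
continuously to the `C^r` maps. An ordinary power series between Banach spaces is then transported
by continuous linear maps on both sides. -/
theorem AnalyticAction.exists_analyticNear {Z : Type*} [NormedAddCommGroup Z] [NormedSpace 𝕜 Z]
    [NormedSpace ℝ Z] [IsScalarTower ℝ 𝕜 Z] [CompactSpace G] [CompleteSpace E]
    (T : AnalyticAction 𝕜 Z LG) {Q : Z → E} (hQ : AnalyticAt 𝕜 Q 0) {b : C(G, E) → Z}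
    (x₀ : CrVec 𝓘(ℝ, EG) G E r 𝕜) (hb : AnalyticAt 𝕜 b (crRes 𝕜 E EG G r x₀))
    (hb0 : b (crRes 𝕜 E EG G r x₀) = 0) :
    ∃ f : CrVec 𝓘(ℝ, EG) G E r 𝕜 → CrVec 𝓘(ℝ, EG) G E r 𝕜, AnalyticNear 𝕜 f x₀ ∧
      ∀ᶠ ξ in 𝓝 x₀, ∀ s, f ξ s = Q (T.act s (b (crRes 𝕜 E EG G r ξ))) := by
  obtain ⟨Θ, p, hΘ, hp, hmem⟩ := T.exists_jet_series hQ
  set S := jetSubmodule (𝕜 := 𝕜) (E := E) LG (wordWeight T.der)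
  obtain ⟨a, ha⟩ := hb
  have hres : Tendsto (crRes 𝕜 E EG G r) (𝓝 x₀) (𝓝 (crRes 𝕜 E EG G r x₀)) :=
    (crRes 𝕜 E EG G r).continuous.tendsto _
  have hbt : Tendsto (fun ξ => b (crRes 𝕜 E EG G r ξ)) (𝓝 x₀) (𝓝 0) := by
    have := ha.analyticAt.continuousAt.tendsto.comp hres
    rwa [hb0] at this
  have hcomp : HasFPowerSeriesAt (Θ ∘ b) (p.comp a) (crRes 𝕜 E EG G r x₀) :=
    HasFPowerSeriesAt.comp (by rwa [hb0]) ha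
  -- Each coefficient of the composite is a finite sum of values of `p`, so it stays in the subspace
  -- of jets.
  have hcmem : ∀ k v, p.comp a k v ∈ S := fun k v => by
    change (∑ c : Composition k, p.compAlongComposition a c) v ∈ S
    rw [sum_apply]
    exact Submodule.sum_mem _ fun c _ => hp _ _
  classical
  let g : CrVec 𝓘(ℝ, EG) G E r 𝕜 → S := fun ξ =>
    if h : Θ (b (crRes 𝕜 E EG G r ξ)) ∈ S then ⟨_, h⟩ else 0
  have hg : ∀ᶠ ξ in 𝓝 x₀, (g ξ).1 = Θ (b (crRes 𝕜 E EG G r ξ)) := by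
    filter_upwards [hbt.eventually hmem] with ξ h
    simp only [g]
    rw [dif_pos h.1]
  let ι : S →L[𝕜] CrVec 𝓘(ℝ, EG) G E r 𝕜 := jetToCr LG (wordWeight T.der)
  refine ⟨fun ξ => ι (g ξ), ⟨?_, fun k => ι.compContinuousMultilinearMap
    (((p.comp a k).compContinuousLinearMap fun _ => crRes 𝕜 E EG G r).codRestrict S
      fun v => hcmem _ _), ?_⟩, ?_⟩
  · have h1 : ∀ᶠ ξ in 𝓝 x₀, ContinuousAt (fun ξ => Θ (b (crRes 𝕜 E EG G r ξ))) ξ := by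
      filter_upwards [hres.eventually hcomp.analyticAt.eventually_analyticAt] with ξ h
      exact ContinuousAt.comp (g := Θ ∘ b) (f := crRes 𝕜 E EG G r) h.continuousAt
        (crRes 𝕜 E EG G r).continuous.continuousAt
    filter_upwards [h1, hg.eventually_nhds] with ξ h2 h3
    refine ContinuousAt.comp (g := ι) (f := g) ι.continuous.continuousAt ?_
    rw [Topology.IsInducing.subtypeVal.continuousAt_iff]
    exact h2.congr_of_eventuallyEq h3
  · have hadd : Tendsto (fun h => crRes 𝕜 E EG G r h) (𝓝 0) (𝓝 0) := by
      have := (crRes 𝕜 E EG G r).continuous.tendsto 0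
      rwa [map_zero] at this
    filter_upwards [hadd.eventually hcomp.eventually_hasSum,
      (tendsto_crVec_add (LG := LG) x₀).eventually hg] with h h1 h2
    have h3 : HasSum (fun k => ((p.comp a k).compContinuousLinearMap
        fun _ => crRes 𝕜 E EG G r).codRestrict S (fun v => hcmem _ _) fun _ => h) (g (x₀ + h)) := by
      rw [← Topology.IsInducing.subtypeVal.hasSum_iff (g := S.subtype)]
      have h4 : S.subtype (g (x₀ + h)) =
          (Θ ∘ b) (crRes 𝕜 E EG G r x₀ + crRes 𝕜 E EG G r h) := by
        rw [← map_add]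
        exact h2
      rw [h4]
      exact h1
    exact h3.map ι ι.continuous
  · filter_upwards [hbt.eventually hmem, hg] with ξ h1 h2 s
    change wordWeight T.der [] • (g ξ).1 ([], s) = _
    rw [wordWeight_nil, one_smul, h2, h1.2]

end CrVec

end AlmostMorphism

end

/-! ### Analyticity of the morphism in `C^r` coordinates. -/

noncomputable section

namespace AlmostMorphism

set_option linter.unusedSectionVars false

variable {𝕜 : Type*} [RCLike 𝕜] {E : Type*} [NormedAddCommGroup E] [NormedSpace 𝕜 E]
  [CompleteSpace E] [NormedSpace ℝ E] [IsScalarTower ℝ 𝕜 E]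
  {U : Type*} [Group U] [TopologicalSpace U] [IsTopologicalGroup U]
  [ChartedSpace E U] [LieGroup 𝓘(𝕜, E) ω U]
  {EG : Type*} [NormedAddCommGroup EG] [NormedSpace ℝ EG] [CompleteSpace EG]
  {G : Type*} [Group G] [TopologicalSpace G] [IsTopologicalGroup G] [ChartedSpace EG G]
  [LieGroup 𝓘(ℝ, EG) ω G] (LG : LogChart ℝ EG G) [LieGroup 𝓘(ℝ, E) ω U]
  [CompactSpace G]

/-- The action of `G` on `E × E` through the adjoint representation in the second component. -/
theorem exists_Ad_action (L : LogChart 𝕜 E U) {C : ℝ} (hC : 1 ≤ C) (π : G →ₜ* U)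
    (hπ : ∀ s, ‖(Ad 𝕜 (π s) : E →L[𝕜] E)‖ ≤ C) :
    ∃ T : AnalyticAction 𝕜 (E × E) LG, ∀ s w, T.act s w = (w.1, Ad 𝕜 (π s) w.2) := by
  obtain ⟨h1, N, hN⟩ := exists_Ad_morphism LG L π
  refine ⟨
    { act := fun s => (ContinuousLinearMap.fst 𝕜 E E).prod
        ((Ad 𝕜 (π s) : E →L[𝕜] E).comp (ContinuousLinearMap.snd 𝕜 E E))
      bound := C
      one_le_bound := hC
      norm_act_le := fun s => ContinuousLinearMap.opNorm_le_bound _ (by linarith) fun w => ?_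
      contMDiff_act := fun w => contMDiff_const.prodMk_space (h1 w.2)
      der := fun X => (0 : E × E →L[𝕜] E).prod ((N X).comp (ContinuousLinearMap.snd 𝕜 E E))
      hasDerivAt_act := fun X s w => (hasDerivAt_const _ _).prodMk (hN X s w.2) },
    fun s w => rfl⟩
  refine max_le ((norm_fst_le w).trans ?_) ?_
  · exact le_mul_of_one_le_left (norm_nonneg _) hC
  · exact (ContinuousLinearMap.le_of_opNorm_le _ (hπ s) _).trans (by gcongr; exact norm_snd_le w)

namespace Corrector

variable {L : LogChart 𝕜 E U} {M : InvariantMean 𝕜 G E} {C ε : ℝ} (K : Corrector L M C)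
  (R : GoodRadius L G) {r : WithTop ℕ∞}

include R in
/-- Analyticity of the morphism as a function of the almost morphism. -/
theorem exists_analyticNear_coord (hC : 1 ≤ C) (hε : ε ≤ K.ε) (hr : 2 * (C * (3 * C * ε)) ≤ R.r)
    {ρ₀ : C^r⟮𝓘(ℝ, EG), G; 𝓘(ℝ, E), U⟯} (h₀ : IsAlmost L C ε (crToC ρ₀)) :
    ∃ f : CrVec 𝓘(ℝ, EG) G E r 𝕜 → CrVec 𝓘(ℝ, EG) G E r 𝕜,
      AnalyticNear 𝕜 f (crConst 𝓘(ℝ, EG) G r 𝕜 (chartAt E (1 : U) 1)) ∧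
      ∀ᶠ ξ : CrVec 𝓘(ℝ, EG) G E r 𝕜 in 𝓝 (crConst 𝓘(ℝ, EG) G r 𝕜 (chartAt E (1 : U) 1)),
        ∀ ρ : C^r⟮𝓘(ℝ, EG), G; 𝓘(ℝ, E), U⟯, IsAlmost L C ε (crToC ρ) →
          IsCoord (E := E) ρ₀ ρ ξ →
          IsCoord (E := E) (K.crMorphism LG ρ₀).1 (K.crMorphism LG ρ).1 (f ξ) := by
  set φ := chartAt E (1 : U) with hφ
  have hC0 := h₀.C_pos
  have hε0 := h₀.ε_pos
  have hR := R.r_pos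
  have hr' : C * (3 * C * ε) ≤ R.r := by
    have : 0 < C * (3 * C * ε) := by positivity
    linarith
  let ξ₀ : C(G, E) := ContinuousMap.const G (φ 1)
  obtain ⟨f₀, hf₀, hf₀'⟩ := K.exists_analyticAt_coord R hC hε hr' h₀
  have hf₀0 : f₀ ξ₀ = ξ₀ := by
    have h1 := hf₀'.self_of_nhds (crToC ρ₀) h₀ fun t => by
      rw [mul_inv_cancel]
      exact ⟨mem_chart_source E (1 : U), rfl⟩
    ext t
    rw [← (h1 t).2, mul_inv_cancel]
    rfl
  obtain ⟨r₁, hr₁, -, hlog⟩ := exists_superpose_analyticAt (K := G) L.analyticAt_log_chart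
  let H : C(G, E) → C(G, E) := superpose fun y => L.log (φ.symm y)
  have hH : AnalyticAt 𝕜 H ξ₀ := (hlog ξ₀ fun k => by simpa [ξ₀, hφ] using hr₁).1
  have hH0 : H ξ₀ = 0 := superpose_eq fun k => by
    simp only [ξ₀, ContinuousMap.const_apply, ContinuousMap.zero_apply]
    rw [φ.left_inv (mem_chart_source E (1 : U)), L.log_one]
  obtain ⟨a, ha, ha0, ha'⟩ := exists_conjugator L M R (C := 2 * C) (by linarith)
  have hκ : AnalyticAt 𝕜 (fun ξ => H (f₀ ξ)) ξ₀ :=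
    AnalyticAt.fun_comp (g := H) (f := f₀) (by rwa [hf₀0]) hf₀
  have hy : AnalyticAt 𝕜 (fun ξ => a (H (f₀ ξ))) ξ₀ :=
    AnalyticAt.fun_comp (g := a) (f := fun ξ => H (f₀ ξ)) (by rwa [hf₀0, hH0]) hκ
  have hy0 : a (H (f₀ ξ₀)) = 0 := by rw [hf₀0, hH0, ha0]
  have hAd := K.norm_Ad_morphism_le R hC h₀ hε hr
  obtain ⟨T, hT⟩ := exists_Ad_action LG L (C := 2 * C) (by linarith) (K.morphism (crToC ρ₀)) hAd
  -- With the conjugator `exp y`, the quotient is `π(s) π₀(s)⁻¹ = exp(y) exp(-Ad(π₀(s)) y)`. It is a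
  -- fixed analytic function of the orbit of `(y, y)` under the action that is trivial on the first
  -- component and `Ad π₀` on the second.
  let j : E × E →L[𝕜] E × E × E × E := (ContinuousLinearMap.fst 𝕜 E E).prod
    ((-ContinuousLinearMap.snd 𝕜 E E).prod 0)
  have hQ : AnalyticAt 𝕜 (fun p : E × E => φ (L.exp (L.mul4 (j p)))) 0 := by
    refine AnalyticAt.fun_comp (g := fun x => φ (L.exp x)) (f := fun p => L.mul4 (j p)) ?_
      (AnalyticAt.fun_comp (g := L.mul4) (f := j) (by rw [map_zero]; exact L.analyticAt_mul4)
        (j.analyticAt 0))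
    rw [map_zero, L.mul4_zero]
    exact L.analyticAt_chart_exp
  have hres : Tendsto (crRes 𝕜 E EG G r) (𝓝 (crConst 𝓘(ℝ, EG) G r 𝕜 (φ 1))) (𝓝 ξ₀) :=
    (crRes 𝕜 E EG G r).continuous.tendsto _
  obtain ⟨f, hf, hf'⟩ := T.exists_analyticNear hQ (b := fun ξ => (a (H (f₀ ξ)), a (H (f₀ ξ))))
    (crConst 𝓘(ℝ, EG) G r 𝕜 (φ 1)) (hy.prod hy) (by
      change (a (H (f₀ ξ₀)), a (H (f₀ ξ₀))) = 0
      rw [hy0]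
      rfl)
  refine ⟨f, hf, ?_⟩
  have hκt : Tendsto (fun ξ => H (f₀ ξ)) (𝓝 ξ₀) (𝓝 0) := by
    have := hκ.continuousAt
    rwa [ContinuousAt, hf₀0, hH0] at this
  have hyt : Tendsto (fun ξ => ‖a (H (f₀ ξ))‖) (𝓝 ξ₀) (𝓝 0) := by
    have := hy.continuousAt.norm
    rwa [ContinuousAt, hy0, norm_zero] at this
  have hf₀t : Tendsto f₀ (𝓝 ξ₀) (𝓝 ξ₀) := by
    have := hf₀.continuousAt
    rwa [ContinuousAt, hf₀0] at this
  have hexp : ∀ᶠ y in 𝓝 (φ 1), L.exp (L.log (φ.symm y)) = φ.symm y := by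
    have : Tendsto φ.symm (𝓝 (φ 1)) (𝓝 1) := by
      have := φ.continuousAt_symm (mem_chart_target E (1 : U))
      rwa [ContinuousAt, φ.left_inv (mem_chart_source E (1 : U))] at this
    exact this.eventually L.exp_log
  obtain ⟨r₂, hr₂, hexp'⟩ := Metric.eventually_nhds_iff_ball.1 hexp
  have hnear : ∀ᶠ ζ : C(G, E) in 𝓝 ξ₀, ∀ k, ‖ζ k - φ 1‖ < min r₁ r₂ := by
    filter_upwards [Metric.ball_mem_nhds ξ₀ (lt_min hr₁ hr₂)] with ζ hζ k
    rw [mem_ball_iff_norm] at hζ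
    exact ((ζ - ξ₀).norm_coe_le_norm k).trans_lt hζ
  have hpos : 0 < R.r / (2 * C) := by positivity
  filter_upwards [hf', hres.eventually hf₀', hres.eventually (hκt.eventually ha'),
    hres.eventually (hf₀t.eventually hnear), hres.eventually (hyt.eventually (gt_mem_nhds hpos))]
    with ξ k1 k2 k3 k4 k5 ρ hρ hcoord
  set ζ := f₀ (crRes 𝕜 E EG G r ξ)
  have hc := k2 (crToC ρ) hρ hcoord
  have e1 : ∀ s, K.morphism (crToC ρ) s = L.exp (H ζ s) * K.morphism (crToC ρ₀) s := fun s => by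
    have e2 : H ζ s = L.log (φ.symm (ζ s)) :=
      (hlog ζ fun k => (k4 k).trans_le (min_le_left _ _)).2 s
    obtain ⟨h1, h2⟩ := hc s
    rw [e2, hexp' _ (by
      rw [mem_ball_iff_norm]
      exact (k4 s).trans_le (min_le_right _ _)), ← h2, φ.left_inv h1, inv_mul_cancel_right]
  have e2 := k3 _ _ (K.norm_Ad_morphism_le R hC hρ hε hr) hAd e1
  intro s
  set y := a (H ζ)
  have hb : ‖(Ad 𝕜 (K.morphism (crToC ρ₀) s) : E →L[𝕜] E) y‖ < R.r := by
    refine (ContinuousLinearMap.le_of_opNorm_le _ (hAd s) y).trans_lt ?_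
    rwa [lt_div_iff₀ (by positivity), mul_comm] at k5
  have hyR : ‖y‖ < R.r := by
    refine k5.trans_le (div_le_self hR.le (by linarith))
  have hj : ‖j (T.act s (y, y))‖ < R.r := by
    rw [hT]
    change ‖(y, -(Ad 𝕜 (K.morphism (crToC ρ₀) s) : E →L[𝕜] E) y, (0 : E), (0 : E))‖ < R.r
    rw [Prod.norm_mk, Prod.norm_mk, Prod.norm_mk, norm_neg, norm_zero]
    exact max_lt hyR (max_lt hb (max_lt hR hR))
  have e3 : L.exp (L.mul4 (j (T.act s (y, y)))) =
      K.morphism (crToC ρ) s * (K.morphism (crToC ρ₀) s)⁻¹ := by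
    rw [R.exp_mul4 _ hj, hT]
    change L.exp y * L.exp (-(Ad 𝕜 (K.morphism (crToC ρ₀) s) : E →L[𝕜] E) y) * L.exp 0 * L.exp 0 = _
    rw [L.exp_zero, mul_one, mul_one, L.exp_neg (hb.trans_le R.r_le),
      L.exp_Ad _ _ (hyR.trans_le R.r_le) (hb.trans_le R.r_le), e2 s]
    group
  rw [crMorphism_apply, crMorphism_apply, ← e3]
  exact ⟨R.exp_mem_source _ hj, (k1 s).symm⟩

end Corrector

end AlmostMorphism

end

/-! ### Uniform continuity for the `C^r` uniformities, and conclusion. -/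

noncomputable section

namespace AlmostMorphism

set_option linter.unusedSectionVars false

section CrUniformity

open scoped Uniformity

variable {EG : Type*} [NormedAddCommGroup EG] [NormedSpace ℝ EG] {H : Type*} [TopologicalSpace H]
  {I : ModelWithCorners ℝ EG H} {G : Type*} [Group G] [TopologicalSpace G] [ChartedSpace H G]
  {E : Type*} [NormedAddCommGroup E] [NormedSpace ℝ E]
  {U : Type*} [Group U] [TopologicalSpace U] [ChartedSpace E U] {r : WithTop ℕ∞}
  {A : Type*} (k : A → C^r⟮I, G; 𝓘(ℝ, E), U⟯)

theorem uniformContinuous_cr_iff {𝒜 : UniformSpace A} {𝒰 : UniformSpace U} :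
    @UniformContinuous _ _ 𝒜 (crUniformSpace I r 𝒰) k ↔
      (∀ V ∈ 𝓤[𝒰], ∀ᶠ p in 𝓤[𝒜], ∀ x, (k p.1 x, k p.2 x) ∈ V) ∧
      ∀ (X : EG) (L : List EG), ((L.length + 1 : ℕ) : WithTop ℕ∞) ≤ r → ∀ ε > 0,
        ∀ᶠ p in 𝓤[𝒜], ∀ x, ‖(invDerivs I L (logDeriv I X (k p.1)) x -
          invDerivs I L (logDeriv I X (k p.2)) x : E)‖ < ε := by
  refine (tendsto_inf (f := fun p : A × A => (k p.1, k p.2))).trans (and_congr ?_ ?_)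
  · exact (tendsto_comap_iff (f := fun p : A × A => (k p.1, k p.2))).trans
      (uniformContinuous_unifConv_iff (k := fun a => ⇑(k a)))
  · refine uniformContinuous_iInf_rng.trans (forall_congr' fun X => uniformContinuous_iInf_rng.trans
      (forall_congr' fun L => uniformContinuous_iInf_rng.trans (forall_congr' fun hL =>
        (tendsto_comap_iff (f := fun p : A × A => (k p.1, k p.2))).trans
        ((uniformContinuous_unifConv_iff
          (k := fun a => invDerivs I L (logDeriv I X (k a) : G → E))).trans ?_))))
    constructor
    · intro h ε hε
      filter_upwards [h _ (Metric.dist_mem_uniformity hε)] with a ha x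
      rw [← dist_eq_norm]
      exact ha x
    · intro h V hV
      obtain ⟨ε, hε, hV'⟩ := Metric.mem_uniformity_dist.1 hV
      filter_upwards [h ε hε] with a ha x
      refine hV' ?_
      rw [dist_eq_norm]
      exact ha x

theorem eventually_crUniformity (𝒰 : UniformSpace U) {V : Set (U × U)} (hV : V ∈ 𝓤[𝒰]) :
    ∀ᶠ p in 𝓤[(crUniformSpace I r 𝒰).comap k], ∀ x, (k p.1 x, k p.2 x) ∈ V :=
  ((uniformContinuous_cr_iff k).1
    (@uniformContinuous_comap _ _ k (crUniformSpace I r 𝒰))).1 V hV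

theorem eventually_crUniformity_logDeriv (hr : 1 ≤ r) (𝒰 : UniformSpace U) (X : EG) {θ : ℝ}
    (hθ : 0 < θ) : ∀ᶠ p in 𝓤[(crUniformSpace I r 𝒰).comap k], ∀ x,
      ‖(logDeriv I X (k p.1) x - logDeriv I X (k p.2) x : E)‖ < θ :=
  ((uniformContinuous_cr_iff k).1
    (@uniformContinuous_comap _ _ k (crUniformSpace I r 𝒰))).2 X [] (by simpa using hr) θ hθ

theorem invDerivs_const (c : E) {L : List EG} (hL : L ≠ []) :
    invDerivs I L (fun _ : G => c) = fun _ => 0 := by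
  rcases List.eq_nil_or_concat L with rfl | ⟨L', X, rfl⟩
  · exact absurd rfl hL
  · rw [List.concat_eq_append, invDerivs_append_singleton, invDeriv_const, invDerivs_zero]

end CrUniformity

variable {𝕜 : Type*} [RCLike 𝕜] {E : Type*} [NormedAddCommGroup E] [NormedSpace 𝕜 E]
  [CompleteSpace E] [NormedSpace ℝ E] [IsScalarTower ℝ 𝕜 E]
  {U : Type*} [Group U] [TopologicalSpace U] [IsTopologicalGroup U]
  [ChartedSpace E U] [LieGroup 𝓘(𝕜, E) ω U]
  {EG : Type*} [NormedAddCommGroup EG] [NormedSpace ℝ EG] [FiniteDimensional ℝ EG]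
  {G : Type*} [Group G] [TopologicalSpace G] [IsTopologicalGroup G] [ChartedSpace EG G]
  [LieGroup 𝓘(ℝ, EG) ω G] [CompactSpace G] {r : WithTop ℕ∞}

section Uniform

variable [CompleteSpace EG] [LieGroup 𝓘(ℝ, E) ω U] (LG : LogChart ℝ EG G)
  {L : LogChart 𝕜 E U} {M : InvariantMean 𝕜 G E} {C : ℝ} (K : Corrector L M C)
  (R : GoodRadius L G)

open scoped Uniformity

include R in
/-- The morphism depends uniformly continuously on the almost morphism. -/
theorem Corrector.exists_uniformContinuous (hC : 1 ≤ C) (hr1 : 1 ≤ r) : ∃ ε₀ > 0,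
    ∀ {A : Type*} (k : A → C^r⟮𝓘(ℝ, EG), G; 𝓘(ℝ, E), U⟯),
    (∀ a, IsAlmost L C ε₀ (crToC (k a))) →
    (∀ a i q, ‖(logDeriv (𝓘(ℝ, EG).prod 𝓘(ℝ, EG)) (0, Module.finBasis ℝ EG i)
      (coboundary (crToC (k a))) q : E)‖ < ε₀) →
    ∀ 𝒰 ∈ ({IsTopologicalGroup.rightUniformSpace U,
      IsTopologicalGroup.leftUniformSpace U} : Set (UniformSpace U)),
    @UniformContinuous _ _ ((crUniformSpace 𝓘(ℝ, EG) r 𝒰).comap k) (crUniformSpace 𝓘(ℝ, EG) r 𝒰)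
      (fun a => (K.crMorphism LG (k a)).1) := by
  obtain ⟨ε₁, hε₁, hclose⟩ := K.exists_logDeriv_close R LG hC
  have hC0 : 0 < C := by linarith
  have hR := R.r_pos
  obtain ⟨ε, hε, l1, l2, l3⟩ : ∃ ε > 0, ε ≤ K.ε ∧ ε ≤ R.r / (C * (3 * C)) ∧ ε ≤ ε₁ :=
    ⟨min K.ε (min (R.r / (C * (3 * C))) ε₁), by have := K.ε_pos; positivity, by simp, by simp,
      by simp⟩
  rw [le_div_iff₀ (by positivity)] at l2
  have hr : C * (3 * C * ε) ≤ R.r := by linarith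
  refine ⟨ε, hε, fun {A} k hal hder 𝒰 h𝒰 => ?_⟩
  have hright : ∀ O ∈ 𝓝 (1 : U), ∀ᶠ p in 𝓤[(crUniformSpace 𝓘(ℝ, EG) r 𝒰).comap k], ∀ t,
      crToC (k p.2) t * (crToC (k p.1) t)⁻¹ ∈ O := fun O hO => by
    rcases h𝒰 with rfl | rfl
    · exact eventually_crUniformity k (IsTopologicalGroup.rightUniformSpace U)
        (preimage_mem_comap hO)
    · obtain ⟨O', hO', h⟩ := exists_conj_mem L C hO
      filter_upwards [eventually_crUniformity k (IsTopologicalGroup.leftUniformSpace U)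
        (preimage_mem_comap hO')] with p hp t
      have := h (k p.1 t) ((hal p.1).Ad_le t) _ (hp t)
      rwa [mul_inv_cancel_left] at this
  choose T hT using fun a => exists_tangent LG L (K.morphism (crToC (k a)))
  -- Logarithmic derivatives of morphisms are constant, so their further derivatives vanish, and
  -- beyond the maps themselves only the tangent maps `T a` have to be compared.
  have hlog : ∀ a X, (logDeriv 𝓘(ℝ, EG) X (K.crMorphism LG (k a)).1 : G → E) = fun _ => T a X :=
    fun a X => funext fun g => logDeriv_morphism LG L _ (hT a) X g
  have hbasis : ∀ i, ∀ η > 0, ∀ᶠ p in 𝓤[(crUniformSpace 𝓘(ℝ, EG) r 𝒰).comap k],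
      ‖T p.1 (Module.finBasis ℝ EG i) - T p.2 (Module.finBasis ℝ EG i)‖ < η := fun i η hη => by
    obtain ⟨O, hO, θ, hθ, h⟩ := hclose (Module.finBasis ℝ EG i) η hη
    filter_upwards [hright O hO, eventually_crUniformity_logDeriv k hr1 𝒰
      (Module.finBasis ℝ EG i) hθ] with p h1 h2
    have := h (ρ := crToC (k p.2)) (ρ₀ := crToC (k p.1)) hr1 (k p.2).contMDiff (k p.1).contMDiff
      ((hal _).mono l3) ((hal _).mono l3) (fun q => (hder p.2 i q).trans_le l3)
      (fun q => (hder p.1 i q).trans_le l3) h1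
      (fun t => by
        rw [norm_sub_rev]
        exact h2 t)
    rwa [logDeriv_morphism LG L _ (hT p.2), logDeriv_morphism LG L _ (hT p.1), norm_sub_rev] at this
  -- The estimate for a direction requires a bound on the derivative of the coboundary in that
  -- direction, and a neighbourhood `W` can impose such bounds for finitely many directions only;
  -- linearity of `T a` extends it from a basis.
  have hall : ∀ X : EG, ∀ η > 0, ∀ᶠ p in 𝓤[(crUniformSpace 𝓘(ℝ, EG) r 𝒰).comap k],
      ‖T p.1 X - T p.2 X‖ < η := fun X η hη => by
    set c : ℝ := ∑ i, |(Module.finBasis ℝ EG).repr X i| with hc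
    have hc0 : 0 ≤ c := Finset.sum_nonneg fun i _ => abs_nonneg _
    have hη' : 0 < η / (c + 1) := by positivity
    filter_upwards [eventually_all.2 fun i => hbasis i _ hη'] with p hp
    have e : T p.1 X - T p.2 X = ∑ i, (Module.finBasis ℝ EG).repr X i •
        (T p.1 (Module.finBasis ℝ EG i) - T p.2 (Module.finBasis ℝ EG i)) := by
      conv_lhs => rw [← (Module.finBasis ℝ EG).sum_repr X]
      simp only [map_sum, map_smul, smul_sub, Finset.sum_sub_distrib]
    rw [e]
    calc _ ≤ ∑ i, |(Module.finBasis ℝ EG).repr X i| * (η / (c + 1)) := by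
          refine norm_sum_le_of_le _ fun i _ => ?_
          rw [norm_smul, Real.norm_eq_abs]
          gcongr
          exact (hp i).le
      _ = c * (η / (c + 1)) := by rw [← Finset.sum_mul]
      _ < η := by
        rw [← mul_div_assoc, div_lt_iff₀ (by positivity)]
        nlinarith
  refine (uniformContinuous_cr_iff _).2 ⟨?_, fun X L' hL' η hη => ?_⟩
  · rcases h𝒰 with rfl | rfl
    · rintro V ⟨O₁, hO₁, hV⟩
      obtain ⟨O₂, hO₂, h2⟩ := K.exists_right_close R hC l1 hr hO₁
      filter_upwards [eventually_crUniformity k (IsTopologicalGroup.rightUniformSpace U)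
        (preimage_mem_comap hO₂)] with p hp x
      exact hV (h2 _ _ (hal _) (hal _) hp x)
    · rintro V ⟨O₁, hO₁, hV⟩
      obtain ⟨O₂, hO₂, h2⟩ := K.exists_left_close R hC l1 hr hO₁
      filter_upwards [eventually_crUniformity k (IsTopologicalGroup.leftUniformSpace U)
        (preimage_mem_comap hO₂)] with p hp x
      exact hV (h2 _ _ (hal _) (hal _) hp x)
  · simp only [hlog]
    by_cases h : L' = []
    · subst h
      filter_upwards [hall X η hη] with p hp x
      exact hp
    · simp only [invDerivs_const _ h, sub_self, norm_zero]
      exact Eventually.of_forall fun _ _ => hη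

end Uniform

/-- The `C^r` setting. -/
theorem cr_setting (B : Set (E →L[𝕜] E)) (hBbdd : Bornology.IsBounded B) (hr1 : 1 ≤ r)
    {V : Set C^r⟮𝓘(ℝ, EG), G; 𝓘(ℝ, E), U⟯} (hV : V ∈ 𝓝 1) :
    ∃ W ∈ 𝓝 (1 : C^r⟮𝓘(ℝ, EG).prod 𝓘(ℝ, EG), G × G; 𝓘(ℝ, E), U⟯),
      ∃ F : ↥(crAlmostMorphisms 𝓘(ℝ, EG) r 𝕜 B W : Set C^r⟮𝓘(ℝ, EG), G; 𝓘(ℝ, E), U⟯) →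
          ↥(crMorphisms 𝓘(ℝ, EG) r : Set C^r⟮𝓘(ℝ, EG), G; 𝓘(ℝ, E), U⟯),
        CrIsAnalytic 𝓘(ℝ, EG) r 𝕜 F ∧
        (∀ 𝒰 ∈ ({IsTopologicalGroup.rightUniformSpace U,
            IsTopologicalGroup.leftUniformSpace U} : Set (UniformSpace U)),
          @UniformContinuous _ _ ((crUniformSpace 𝓘(ℝ, EG) r 𝒰).comap Subtype.val)
            ((crUniformSpace 𝓘(ℝ, EG) r 𝒰).comap Subtype.val) F) ∧
        ∀ ρ, crDiv 𝓘(ℝ, EG) r 𝕜 (F ρ).1 ρ.1 ∈ V := by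
  have : CompleteSpace EG := FiniteDimensional.complete ℝ EG
  have : LieGroup 𝓘(ℝ, E) ω U := lieGroup_real 𝕜
  obtain ⟨LG⟩ := LogChart.nonempty ℝ EG G
  obtain ⟨L⟩ := LogChart.nonempty 𝕜 E U
  obtain ⟨M⟩ := InvariantMean.nonempty 𝕜 G E
  obtain ⟨R⟩ := GoodRadius.nonempty L G
  obtain ⟨C, hC, hall⟩ := exists_isAlmost (G := G) L hBbdd
  obtain ⟨K⟩ := Corrector.nonempty L M hC
  obtain ⟨ε₁, hε₁, hdiv⟩ := K.exists_tendsto_crDiv LG R (r := r) hC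
  obtain ⟨ε₂, hε₂, huc⟩ := K.exists_uniformContinuous LG R hC hr1
  have hR := R.r_pos
  have hC0 : 0 < C := by linarith
  obtain ⟨ε, hε, l1, l2, l3, l4⟩ : ∃ ε > 0, ε ≤ K.ε ∧ ε ≤ R.r / (2 * (C * (3 * C))) ∧
      ε ≤ ε₁ ∧ ε ≤ ε₂ :=
    ⟨min K.ε (min (R.r / (2 * (C * (3 * C)))) (min ε₁ ε₂)), by have := K.ε_pos; positivity,
      by simp, by simp, by simp, by simp⟩
  rw [le_div_iff₀ (by positivity)] at l2
  have hr : 2 * (C * (3 * C * ε)) ≤ R.r := by linarith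
  obtain ⟨O, hO, hal⟩ := hall ε hε
  let A := {ρ : C^r⟮𝓘(ℝ, EG), G; 𝓘(ℝ, E), U⟯ // IsAlmost L C ε (crToC ρ)}
  -- The limit statement is applied to the tautological family of all almost morphisms, along the
  -- pullback of `𝓝 1` by the coboundary; unfolding this filter yields the neighbourhood `N`.
  have h1 := hdiv (A := A) (𝓕 := comap (fun ρ => crCoboundary 𝓘(ℝ, EG) r 𝕜 ρ.1) (𝓝 1))
    (ρ := Subtype.val) (fun ρ => ρ.2.mono l3) tendsto_comap
  obtain ⟨N, hN, hNV⟩ := mem_comap.1 (h1 hV)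
  change ∀ᶠ c in 𝓝 1, c ∈ N at hN
  have h2 := tendsto_nhds_one_iff.1
    (tendsto_id (x := 𝓝 (1 : C^r⟮𝓘(ℝ, EG).prod 𝓘(ℝ, EG), G × G; 𝓘(ℝ, E), U⟯)))
  have h3 : ∀ᶠ c : C^r⟮𝓘(ℝ, EG).prod 𝓘(ℝ, EG), G × G; 𝓘(ℝ, E), U⟯ in 𝓝 1, ∀ i q,
      ‖(logDeriv (𝓘(ℝ, EG).prod 𝓘(ℝ, EG)) (0, Module.finBasis ℝ EG i) c q : E)‖ < ε₂ :=
    eventually_all.2 fun i => h2.2 (0, Module.finBasis ℝ EG i) [] (by simpa using hr1) ε₂ hε₂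
  obtain ⟨W, hW, hWN⟩ := (hN.and ((h2.1 O hO).and h3)).exists_mem
  have hal' : ∀ ρ : ↥(crAlmostMorphisms 𝓘(ℝ, EG) r 𝕜 B W : Set C^r⟮𝓘(ℝ, EG), G; 𝓘(ℝ, E), U⟯),
      IsAlmost L C ε (crToC ρ.1) := fun ρ =>
    hal (crToC ρ.1) (fun s t => (hWN _ ρ.2.1).2.1 (s, t)) ρ.2.2
  refine ⟨W, hW, fun ρ => K.crMorphism LG ρ.1, ?_, ?_, ?_⟩
  · intro ρ₀
    obtain ⟨f, hf, hf'⟩ := K.exists_analyticNear_coord LG R hC l1 hr (hal' ρ₀)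
    exact ⟨f, hf, hf'.mono fun ξ h ρ hρ => h ρ.1 (hal' ρ) hρ⟩
  · intro 𝒰 h𝒰
    refine @uniformContinuous_comap' _ _ _ _ _ (_) (_) ?_
    exact huc Subtype.val (fun ρ => (hal' ρ).mono l4) (fun ρ => (hWN _ ρ.2.1).2.2) 𝒰 h𝒰
  · intro ρ
    exact @hNV ⟨ρ.1, hal' ρ⟩ (hWN _ ρ.2.1).1

end AlmostMorphism

end

theorem mainTheorem2
    {𝕜 : Type*} [RCLike 𝕜]
    {E : Type*} [NormedAddCommGroup E] [NormedSpace 𝕜 E] [CompleteSpace E]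
    [NormedSpace ℝ E] [IsScalarTower ℝ 𝕜 E]
    {U : Type*} [Group U] [TopologicalSpace U] [IsTopologicalGroup U]
    [ChartedSpace E U] [LieGroup 𝓘(𝕜, E) ω U]
    {G : Type*} [Group G] [TopologicalSpace G] [IsTopologicalGroup G]
    [CompactSpace G] [T2Space G]
    (B : Set (E →L[𝕜] E)) (hBGL : ∀ b ∈ B, IsUnit b) (hBopen : IsOpen B)
    (hBbdd : Bornology.IsBounded B) :
    -- the continuous setting
    (∀ V ∈ 𝓝 (1 : C(G, U)), ∃ W ∈ 𝓝 (1 : C(G × G, U)),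
      ∃ F : ↥(almostMorphisms 𝕜 B W : Set C(G, U)) → (G →ₜ* U),
        IsAnalytic 𝕜 (E := E) F ∧
        (∀ 𝒰 ∈ ({IsTopologicalGroup.rightUniformSpace U,
            IsTopologicalGroup.leftUniformSpace U} : Set (UniformSpace U)),
          @UniformContinuous _ _ ((unifConv G 𝒰).comap (fun ρ : ↥(almostMorphisms 𝕜 B W) => ⇑ρ.1))
            ((unifConv G 𝒰).comap (fun π : G →ₜ* U => ⇑π)) F) ∧
        ∀ ρ, (F ρ : C(G, U)) * (ρ.1)⁻¹ ∈ V) ∧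
    -- the `C^r` setting, when `G` is a Lie group
    (∀ (EG : Type*) [NormedAddCommGroup EG] [NormedSpace ℝ EG] [FiniteDimensional ℝ EG]
      [ChartedSpace EG G] [LieGroup 𝓘(ℝ, EG) ω G] (r : WithTop ℕ∞), 1 ≤ r →
      ∀ V ∈ 𝓝 (1 : C^r⟮𝓘(ℝ, EG), G; 𝓘(ℝ, E), U⟯),
      ∃ W ∈ 𝓝 (1 : C^r⟮𝓘(ℝ, EG).prod 𝓘(ℝ, EG), G × G; 𝓘(ℝ, E), U⟯),
      ∃ F : ↥(crAlmostMorphisms 𝓘(ℝ, EG) r 𝕜 B W : Set C^r⟮𝓘(ℝ, EG), G; 𝓘(ℝ, E), U⟯) →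
          ↥(crMorphisms 𝓘(ℝ, EG) r : Set C^r⟮𝓘(ℝ, EG), G; 𝓘(ℝ, E), U⟯),
        CrIsAnalytic 𝓘(ℝ, EG) r 𝕜 F ∧
        (∀ 𝒰 ∈ ({IsTopologicalGroup.rightUniformSpace U,
            IsTopologicalGroup.leftUniformSpace U} : Set (UniformSpace U)),
          @UniformContinuous _ _ ((crUniformSpace 𝓘(ℝ, EG) r 𝒰).comap Subtype.val)
            ((crUniformSpace 𝓘(ℝ, EG) r 𝒰).comap Subtype.val) F) ∧
        ∀ ρ, crDiv 𝓘(ℝ, EG) r 𝕜 (F ρ).1 ρ.1 ∈ V) := by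
  exact ⟨continuous_setting B hBbdd, fun EG _ _ _ _ _ r hr V hV => cr_setting B hBbdd hr hV⟩
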